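/- Let $(X,\mathcal B,\mu)$ be a Lebesgue probability space, that is, a standard Borel space with a probability measure, and let $T$ be an automorphism of it, that is, an invertible bimeasurable $\mu$-preserving map. **Definitions.** A self-joining of order $n$ of $T$ is a probability measure $\nu$ on $X^n$ that is invariant under $T\times\dots\times T$ and whose projection to each coordinate is $\mu$. For $p\in\mathbb Z$ let $\Delta_{T^p}$ be the image of $\mu$ under $x\mapsto(x,T^px)$. We write $T\in MSJ(n)$ ($T$ has minimal self-joinings of order $n$) if every ergodic self-joining $\nu\ne\mu^{\otimes n}$ of order $n$ has at least one two-dimensional projection (to coordinates $i<j$) equal to $\Delta_{T^p}$ for some $p\in\mathbb Z$. The automorphism $T$ is mixing of multiplicity $k$ if $$\mu(A_0\cap T^{n_1}A_1\cap\dots\cap T^{n_1+\dots+n_k}A_k)\to\mu(A_0)\mu(A_1)\cdots\mu(A_k)$$ for all measurable $A_0,\dots,A_k$ and all sequences $n_1,\dots,n_k\to\infty$ of natural numbers; $T$ is mixing if it is mixing of multiplicity $1$, and mixing of all orders if it is mixing of multiplicity $k$ for every $k$. The automorphism $T$ has the multiple recurrence property if for every measurable $A$ with $\mu(A)>0$ and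 every sequence $k(m)$ of natural numbers with $k(m)\to\infty$ and $|k(m)-m|\to\infty$ one has $$\mu(T^{-k(m)}A\cap T^{-m}A\cap A)>0\quad\text{for all sufficiently large } m.$$ **Theorem.** 1. If $T$ is mixing, $T\in MSJ(2)$ and $T$ has the multiple recurrence property, then $T\in MSJ(3)$; consequently $T\in MSJ(n)$ for all $n$, and $T$ is mixing of all orders. 2. In particular, if $T\in MSJ(2)$ and $T$ is mixing of multiplicity $2$, then $T\in MSJ(n)$ for all $n$, and $T$ is mixing of all orders. 3. For $\mathbb Z$-actions the question whether $MSJ(2)=MSJ(3)$ is equivalent to Rokhlin's problem in the class $MSJ(2)$. That is, the following are equivalent: (a) the classes $MSJ(2)$ and $MSJ(3)$ of automorphisms of Lebesgue probability spaces coincide; (b) every mixing $T\in MSJ(2)$ is mixing of multiplicity $2$; (c) every mixing $T\in MSJ(2)$ is mixing of all orders. -/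

import Mathlib

open MeasureTheory Filter Topology

universe u

namespace SelfJoining

variable {X : Type u} [MeasurableSpace X]

/-- The diagonal action `T × ⋯ × T` on the cube `X ^ n`. -/
def diagMap (n : ℕ) (T : X ≃ᵐ X) : (Fin n → X) → (Fin n → X) :=
  fun x i => T (x i)

/-- The shifted diagonal measure `Δ_{T ^ p}` on `X × X`: the image of `μ` under
`x ↦ (x, T ^ p x)`, for an integer `p`. -/
noncomputable def offDiagonal (μ : Measure X) (T : X ≃ᵐ X) (p : ℤ) : Measure (X × X) :=
  μ.map (fun x => (x, (T.toEquiv ^ p : Equiv.Perm X) x))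

/-- `ν` is a self-joining of order `n` of `T`: a probability measure on `X ^ n`, invariant
under `T × ⋯ × T`, all of whose one-dimensional marginals are `μ`. -/
structure IsSelfJoining (n : ℕ) (μ : Measure X) (T : X ≃ᵐ X)
    (ν : Measure (Fin n → X)) : Prop where
  isProbabilityMeasure : IsProbabilityMeasure ν
  invariant : MeasurePreserving (diagMap n T) ν ν
  marginal : ∀ i : Fin n, ν.map (fun x => x i) = μ

/-- `T ∈ MSJ(n)`: every ergodic self-joining of order `n` other than the product measure
`μ ⊗ ⋯ ⊗ μ` has some two-dimensional marginal equal to some `Δ_{T ^ p}`. -/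
def MSJ (n : ℕ) (μ : Measure X) (T : X ≃ᵐ X) : Prop :=
  ∀ ν : Measure (Fin n → X), IsSelfJoining n μ T ν → Ergodic (diagMap n T) ν →
    ν ≠ Measure.pi (fun _ => μ) →
    ∃ i j : Fin n, i < j ∧ ∃ p : ℤ, ν.map (fun x => (x i, x j)) = offDiagonal μ T p

/-- Mixing of multiplicity `k`: for all measurable `A₀, …, A_k` and all sequences
`n₁, …, n_k → ∞`,
`μ (A₀ ∩ T ^ n₁ A₁ ∩ ⋯ ∩ T ^ (n₁ + ⋯ + n_k) A_k) → μ A₀ * ⋯ * μ A_k`.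
The sequence `n_{j+1}` is `s j` below, with `j : Fin k`. -/
def IsMixingOfMultiplicity (k : ℕ) (μ : Measure X) (T : X ≃ᵐ X) : Prop :=
  ∀ A : Fin (k + 1) → Set X, (∀ i, MeasurableSet (A i)) →
    ∀ s : Fin k → ℕ → ℕ, (∀ j, Tendsto (s j) atTop atTop) →
      Tendsto
        (fun t : ℕ => μ (⋂ i : Fin (k + 1),
          (⇑T)^[∑ j : Fin k with j.castSucc < i, s j t] '' A i))
        atTop (𝓝 (∏ i, μ (A i)))

/-- Mixing is mixing of multiplicity one. -/
def IsMixing (μ : Measure X) (T : X ≃ᵐ X) : Prop :=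
  IsMixingOfMultiplicity 1 μ T

/-- Multiple mixing of all orders. -/
def IsMixingOfAllOrders (μ : Measure X) (T : X ≃ᵐ X) : Prop :=
  ∀ k : ℕ, IsMixingOfMultiplicity k μ T

/-- The multiple recurrence property: for every set `A` of positive measure and every sequence
`k(m) → ∞` with `|k(m) - m| → ∞`, for all large `m`,
`μ (T ^ (-k(m)) A ∩ T ^ (-m) A ∩ A) > 0`. -/
def IsMultiplyRecurrent (μ : Measure X) (T : X ≃ᵐ X) : Prop :=
  ∀ A : Set X, MeasurableSet A → 0 < μ A →
    ∀ k : ℕ → ℕ, Tendsto k atTop atTop →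
      Tendsto (fun m : ℕ => |(k m : ℤ) - (m : ℤ)|) atTop atTop →
      ∀ᶠ m in atTop, 0 < μ ((⇑T)^[k m] ⁻¹' A ∩ (⇑T)^[m] ⁻¹' A ∩ A)

end SelfJoining

/-! The core is that a pairwise independent ergodic joining ν of three copies of T must be the
product when T is mixing, multiply recurrent and in `MSJ(2)`. Suppose ν is not the product. Three
mechanisms act against it.

Rigidity: ν is not invariant under any nontrivial `T ^ a × T ^ b × T ^ c` that fixes a coordinate,
because ergodicity of `T × T` forces averages along two coordinates to decouple
(`IsTripleJoining.eq_prod_of_map_shift`).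

Finite fibres: given two coordinates, the third takes finitely many values
(`HasMinimalPairs.exists_hasFiniteFibres`). Take two copies of the third coordinate, conditionally
independent over the first two. On ergodic components the copies are independent or differ by a
power of T. If the conditional laws had no atoms, rigidity would leave only independence; the
conditional probabilities would then have variance zero and ν would be the product. Hence a variable
linked to earlier ones by ν is dominated, up to a constant factor, by its relatively independent
version (`HasFiniteFibres.map_le`).

Counting: distinct ergodic measures are mutually singular, so a finite measure dominates only
finitely many ergodic probability measures (`finite_ergodic_le`). An infinite family of linked
ergodic measures under one common bound therefore repeats, and a repetition makes ν equal to a shift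
of itself, against rigidity.

The objects counted are configurations `(x, z₁, y₁, z₂, y)` in which `(x, y₁, z₁)`, `(T ^ m x, y₁,
z₂)` and `(T ^ k x, y, z₁)` all have law ν. If, for every large m, only finitely many k allowed some
`(T ^ p x, y, z₂)` to have law ν as well, then conditional expectations given `(y, z₂)` would be
orthogonal to functions of x. Letting k and then m tend to infinity, mixing would make every mean
zero function of one coordinate have zero conditional expectation given the other two, so ν would be
the product. Thus completions occur for arbitrarily large m and infinitely many k
(`IsTripleJoining.exists_infinite_config`). Counting lets k, |p| and |p - k| grow while the law ξ of
`(x, z₁, z₂)` stays fixed. Multiple recurrence returns x, `T ^ k x` and `T ^ p x` to a set on which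
the fibre measures hardly vary, and so bounds ξ by a multiple of a measure that does not involve m
(`le_relSquare`). Counting over m then gives a contradiction.

From order three to order n one groups the middle coordinates into a single system and repeats the
second moment argument with mixing (`eq_prod_of_pairs`). Mixing of all orders follows because limits
of orbit laws are self-joinings with independent pairs, and so are almost all of their ergodic
components.

For the equivalence with Rokhlin's problem, a system in `MSJ(2)` that is not mixing is handled
separately: a limit of far off-diagonals with an off-diagonal component already forces ν to be the
product (`IsTripleJoining.eq_prod_of_limit`). That `MSJ(3)` implies `MSJ(2)` is seen by adjoining an
independent third coordinate (`MSJ.hasMinimalPairs`). -/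

open ProbabilityTheory

namespace SelfJoining

/-! ### Ergodic theory: mean ergodic theorem, ergodic decomposition, mutual singularity. -/

section Tools

variable {Y : Type*} [MeasurableSpace Y]

/-- A countably generated σ-algebra is generated by a countable π-system containing the whole
space. -/
theorem exists_countable_piSystem (Y : Type*) [MeasurableSpace Y]
    [MeasurableSpace.CountablyGenerated Y] :
    ∃ C : Set (Set Y), C.Countable ∧ IsPiSystem C ∧ (∀ s ∈ C, MeasurableSet s) ∧
      Set.univ ∈ C ∧ ‹MeasurableSpace Y› = MeasurableSpace.generateFrom C := by
  have hA := isSetAlgebra_generateSetAlgebra (𝒜 := MeasurableSpace.countableGeneratingSet Y)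
  have hgen : ‹MeasurableSpace Y› = MeasurableSpace.generateFrom
      (generateSetAlgebra (MeasurableSpace.countableGeneratingSet Y)) := by
    rw [generateFrom_generateSetAlgebra_eq, MeasurableSpace.generateFrom_countableGeneratingSet]
  refine ⟨generateSetAlgebra (MeasurableSpace.countableGeneratingSet Y), ?_, ?_, ?_, ?_, hgen⟩
  · exact countable_generateSetAlgebra (MeasurableSpace.countable_countableGeneratingSet)
  · exact fun s hs t ht _ => hA.isSetRing.inter_mem hs ht
  · intro s hs
    rw [hgen]
    exact MeasurableSpace.measurableSet_generateFrom hs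
  · exact hA.univ_mem

/-- A function that is almost everywhere invariant agrees almost everywhere with a strictly
invariant measurable function. -/
theorem exists_invariant_ae_eq {S : Y → Y} {Ω : Measure Y} (hS : MeasurePreserving S Ω Ω)
    {g : Y → ℝ} (hg : Measurable g) (hgS : g ∘ S =ᵐ[Ω] g) :
    ∃ g' : Y → ℝ, Measurable g' ∧ g' ∘ S = g' ∧ g' =ᵐ[Ω] g := by
  -- The limsup along an orbit is unchanged by dropping one term, so its invariance is exact. Taking
  -- it in `EReal` gives it a value at every point.
  refine ⟨fun y => (limsup (fun n : ℕ => ((g (S^[n] y) : ℝ) : EReal)) atTop).toReal, ?_, ?_, ?_⟩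
  · refine Measurable.ereal_toReal (Measurable.limsup fun n => ?_)
    exact (hg.comp (hS.measurable.iterate n)).coe_real_ereal
  · funext y
    have := Filter.limsup_nat_add (fun n : ℕ => ((g (S^[n] y) : ℝ) : EReal)) 1
    simpa [Function.iterate_succ_apply] using congrArg EReal.toReal this
  · have h : ∀ n : ℕ, ∀ᵐ y ∂Ω, g (S^[n] y) = g y := by
      intro n
      induction n with
      | zero => simp
      | succ n ih =>
        filter_upwards [ih, (hS.iterate n).quasiMeasurePreserving.ae hgS] with y h1 h2
        rw [Function.iterate_succ_apply']
        exact h2.trans h1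
    filter_upwards [ae_all_iff.2 h] with y hy
    simp [hy]

/-- The mean ergodic theorem in `L¹`, for a bounded function; the limit is strictly invariant. -/
theorem exists_tendsto_birkhoffAverage {S : Y → Y} {Ω : Measure Y} [IsProbabilityMeasure Ω]
    (hS : MeasurePreserving S Ω Ω) {f : Y → ℝ} (hf : Measurable f) {C : ℝ}
    (hC : ∀ y, |f y| ≤ C) :
    ∃ g : Y → ℝ, Measurable g ∧ g ∘ S = g ∧
      Tendsto (fun N : ℕ => ∫⁻ y, ‖birkhoffAverage ℝ S f N y - g y‖ₑ ∂Ω) atTop (𝓝 0) := by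
  have hfm : MemLp f 2 Ω := MemLp.of_bound hf.aestronglyMeasurable C (ae_of_all _ hC)
  -- Composition with S is an isometry of L², so its averages converge to the projection onto its
  -- fixed vectors; the limit is then replaced by a strictly invariant version.
  set U : Lp ℝ 2 Ω →L[ℝ] Lp ℝ 2 Ω :=
    (Lp.compMeasurePreservingₗᵢ ℝ S hS).toContinuousLinearMap with hU
  have hU1 : ‖U‖ ≤ 1 := LinearIsometry.norm_toContinuousLinearMap_le _
  have hconv := ContinuousLinearMap.tendsto_birkhoffAverage_orthogonalProjection U hU1 (hfm.toLp f)
  set g0 : Lp ℝ 2 Ω := ((U.eqLocus (1 : Lp ℝ 2 Ω →L[ℝ] Lp ℝ 2 Ω)).orthogonalProjectionOnto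
    (hfm.toLp f) : Lp ℝ 2 Ω) with hg0
  have hfix : U g0 = g0 := by
    have := ((U.eqLocus (1 : Lp ℝ 2 Ω →L[ℝ] Lp ℝ 2 Ω)).orthogonalProjectionOnto
      (hfm.toLp f)).2
    exact this
  have hUcoe : ∀ h : Lp ℝ 2 Ω, U h =ᵐ[Ω] h ∘ S := fun h => Lp.coeFn_compMeasurePreserving h hS
  have hg0m : Measurable g0 := (Lp.stronglyMeasurable g0).measurable
  obtain ⟨g, hg, hgS, hgg⟩ := exists_invariant_ae_eq hS hg0m
    ((hUcoe g0).symm.trans (by rw [hfix]))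
  refine ⟨g, hg, hgS, ?_⟩
  have hiter : ∀ n : ℕ, (U^[n] (hfm.toLp f) : Lp ℝ 2 Ω) =ᵐ[Ω] fun y => f (S^[n] y) := by
    intro n
    induction n with
    | zero => simpa using hfm.coeFn_toLp
    | succ n ih =>
      rw [Function.iterate_succ_apply']
      refine (hUcoe _).trans ?_
      have := hS.quasiMeasurePreserving.ae_eq_comp ih
      refine this.trans (ae_of_all _ fun y => ?_)
      simp [Function.iterate_succ_apply]
  have havg : ∀ N : ℕ, (birkhoffAverage ℝ U _root_.id N (hfm.toLp f) : Lp ℝ 2 Ω)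
      =ᵐ[Ω] birkhoffAverage ℝ S f N := by
    intro N
    have hsum : ((∑ k ∈ Finset.range N, (U^[k] (hfm.toLp f)) : Lp ℝ 2 Ω) : Y → ℝ) =ᵐ[Ω]
        fun y => ∑ k ∈ Finset.range N, f (S^[k] y) := by
      have h1 := Lp.coeFn_finsetSum (Finset.range N) (fun k => (U^[k] (hfm.toLp f)))
      refine h1.trans ?_
      filter_upwards [ae_all_iff.2 hiter] with y hy
      simp [hy]
    simp only [birkhoffAverage, birkhoffSum, id]
    refine (Lp.coeFn_smul _ _).trans ?_
    filter_upwards [hsum] with y hy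
    rw [Pi.smul_apply, hy]
    rfl
  have hL2 : Tendsto (fun N => eLpNorm (fun y => birkhoffAverage ℝ S f N y - g y) 2 Ω)
      atTop (𝓝 0) := by
    have h1 := (Lp.tendsto_Lp_iff_tendsto_eLpNorm' _ _).1 hconv
    refine h1.congr fun N => eLpNorm_congr_ae ?_
    filter_upwards [havg N, hgg] with y h1 h2
    simp [h1, h2, hg0]
  have hmeas : ∀ N, Measurable (birkhoffAverage ℝ S f N) := by
    intro N
    unfold birkhoffAverage birkhoffSum
    have : Measurable fun y => ∑ k ∈ Finset.range N, f (S^[k] y) :=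
      Finset.measurable_fun_sum _ fun k _ => hf.comp (hS.measurable.iterate k)
    exact this.const_smul ((N : ℝ)⁻¹)
  refine tendsto_of_tendsto_of_tendsto_of_le_of_le tendsto_const_nhds hL2
    (fun _ => bot_le) fun N => ?_
  have := eLpNorm_le_eLpNorm_of_exponent_le (μ := Ω) (p := 1) (q := 2) (by norm_num)
    (((hmeas N).sub hg).aestronglyMeasurable)
  rw [eLpNorm_one_eq_lintegral_enorm] at this
  exact this

/-- Along a subsequence with integrals at most `2⁻¹ ^ j` the sum of the functions is integrable,
hence finite almost everywhere. -/
theorem exists_seq_ae_tendsto_zero {Ω : Measure Y} {h : ℕ → Y → ENNReal}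
    (hm : ∀ n, Measurable (h n)) (h0 : Tendsto (fun n => ∫⁻ y, h n y ∂Ω) atTop (𝓝 0)) :
    ∃ s : ℕ → ℕ, Tendsto s atTop atTop ∧
      ∀ᵐ y ∂Ω, Tendsto (fun j => h (s j) y) atTop (𝓝 0) := by
  have hex : ∀ j : ℕ, ∃ n ≥ j, ∫⁻ y, h n y ∂Ω ≤ (2⁻¹ : ENNReal) ^ j := by
    intro j
    have := (ENNReal.tendsto_nhds_zero.1 h0 ((2⁻¹ : ENNReal) ^ j)
      (ENNReal.pow_pos (by simp) j)).and (eventually_ge_atTop j)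
    obtain ⟨n, hn1, hn2⟩ := this.exists
    exact ⟨n, hn2, hn1⟩
  choose s hs1 hs2 using hex
  refine ⟨s, tendsto_atTop_mono hs1 tendsto_id, ?_⟩
  have hfin : ∫⁻ y, ∑' j, h (s j) y ∂Ω ≠ ⊤ := by
    rw [lintegral_tsum fun j => (hm _).aemeasurable]
    refine ne_top_of_le_ne_top ?_ (ENNReal.tsum_le_tsum hs2)
    rw [ENNReal.tsum_geometric]
    simp
  filter_upwards [ae_lt_top (Measurable.tsum fun j => hm _) hfin] with y hy
  exact ENNReal.tendsto_atTop_zero_of_tsum_ne_top hy.ne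

theorem birkhoffAverage_indicator_integral {S : Y → Y} {P : Measure Y} [IsFiniteMeasure P]
    (hS : MeasurePreserving S P P) {A B : Set Y} (hA : MeasurableSet A) (hB : MeasurableSet B)
    (hSB : S ⁻¹' B = B) {N : ℕ} (hN : N ≠ 0) :
    ∫ y in B, birkhoffAverage ℝ S (A.indicator fun _ => (1 : ℝ)) N y ∂P = P.real (A ∩ B) := by
  have hi : ∀ k : ℕ, ∫ y in B, A.indicator (fun _ => (1 : ℝ)) (S^[k] y) ∂P = P.real (A ∩ B) := by
    intro k
    have hSB' : (S^[k]) ⁻¹' B = B := by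
      rw [Set.preimage_iterate_eq]
      exact Function.iterate_fixed hSB k
    have h1 : (fun y => A.indicator (fun _ => (1 : ℝ)) (S^[k] y))
        = ((S^[k]) ⁻¹' A).indicator fun _ => (1 : ℝ) := by
      rfl
    rw [h1, integral_indicator_const _ ((hS.measurable.iterate k) hA), smul_eq_mul, mul_one,
      measureReal_restrict_apply ((hS.measurable.iterate k) hA)]
    conv_lhs => rw [← hSB', ← Set.preimage_inter]
    exact (hS.iterate k).measureReal_preimage (hA.inter hB).nullMeasurableSet
  have hint : ∀ k : ℕ, Integrable (fun y => A.indicator (fun _ => (1 : ℝ)) (S^[k] y))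
      (P.restrict B) := by
    intro k
    refine Integrable.of_bound (C := 1) ?_ (ae_of_all _ fun y => ?_)
    · exact ((measurable_const.indicator hA).comp
        (hS.measurable.iterate k)).aestronglyMeasurable
    · by_cases h : S^[k] y ∈ A <;> simp [h]
  simp only [birkhoffAverage, birkhoffSum, smul_eq_mul]
  rw [integral_const_mul, integral_finsetSum _ fun k _ => hint k]
  simp only [hi, Finset.sum_const, Finset.card_range, nsmul_eq_mul]
  have : (N : ℝ) ≠ 0 := by exact_mod_cast hN
  field_simp

theorem measurable_birkhoffAverage {S : Y → Y} (hS : Measurable S) {f : Y → ℝ}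
    (hf : Measurable f) (N : ℕ) : Measurable (birkhoffAverage ℝ S f N) := by
  have : Measurable fun y => ∑ k ∈ Finset.range N, f (S^[k] y) :=
    Finset.measurable_fun_sum _ fun k _ => hf.comp (hS.iterate k)
  exact this.const_smul ((N : ℝ)⁻¹)

/-- If the ergodic averages of a set tend to a constant, that set is independent of all invariant
sets: the averages integrate over an invariant set to the measure of the intersection. This is the
form in which ergodicity is passed to components and to factors. -/
theorem measureReal_inter_eq_of_tendsto {S : Y → Y} {P : Measure Y} [IsProbabilityMeasure P]
    (hS : MeasurePreserving S P P) {A D : Set Y} (hA : MeasurableSet A) {s : ℕ → ℕ}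
    (hs : Tendsto s atTop atTop) {c : ℝ}
    (hc : Tendsto (fun j => ∫⁻ y, ‖birkhoffAverage ℝ S (A.indicator fun _ => (1 : ℝ)) (s j) y
      - c‖ₑ ∂P) atTop (𝓝 0)) (hD : MeasurableSet D) (hSD : S ⁻¹' D = D) :
    P.real (A ∩ D) = c * P.real D := by
  have h1 : Tendsto (fun j => ∫ y in D,
      birkhoffAverage ℝ S (A.indicator fun _ => (1 : ℝ)) (s j) y ∂P) atTop
      (𝓝 (∫ _ in D, c ∂P)) := by
    refine tendsto_integral_of_L1 _ (integrable_const c).aestronglyMeasurable ?_ ?_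
    · refine Eventually.of_forall fun j => ?_
      have : Measurable fun y => ∑ k ∈ Finset.range (s j),
          A.indicator (fun _ => (1 : ℝ)) (S^[k] y) :=
        Finset.measurable_fun_sum _ fun k _ =>
          (measurable_const.indicator hA).comp (hS.measurable.iterate k)
      have hint : Integrable (fun y => ∑ k ∈ Finset.range (s j),
          A.indicator (fun _ => (1 : ℝ)) (S^[k] y)) (P.restrict D) := by
        refine integrable_finsetSum _ fun k _ => ?_
        refine Integrable.of_bound (C := 1) ?_ (ae_of_all _ fun y => ?_)
        · exact ((measurable_const.indicator hA).comp
            (hS.measurable.iterate k)).aestronglyMeasurable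
        · by_cases h : S^[k] y ∈ A <;> simp [h]
      exact hint.const_mul ((s j : ℝ)⁻¹)
    · refine tendsto_of_tendsto_of_tendsto_of_le_of_le tendsto_const_nhds hc
        (fun _ => bot_le) fun j => ?_
      exact lintegral_mono' Measure.restrict_le_self le_rfl
  have h2 : Tendsto (fun j => ∫ y in D,
      birkhoffAverage ℝ S (A.indicator fun _ => (1 : ℝ)) (s j) y ∂P) atTop
      (𝓝 (P.real (A ∩ D))) := by
    refine tendsto_const_nhds.congr' ?_
    filter_upwards [hs.eventually_gt_atTop 0] with j hj
    exact (birkhoffAverage_indicator_integral hS hA hD hSD hj.ne').symm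
  have := tendsto_nhds_unique h2 h1
  rw [this]
  simp [mul_comm]

/-- The kernel `κ` disintegrates `Ω` into ergodic `S`-invariant probability measures. -/
structure IsErgodicDecomposition (S : Y → Y) (Ω : Measure Y) (κ : Kernel Y Y) : Prop where
  isMarkovKernel : IsMarkovKernel κ
  lintegral_eq : ∀ E, MeasurableSet E → ∫⁻ ω, κ ω E ∂Ω = Ω E
  ergodic : ∀ᵐ ω ∂Ω, Ergodic S (κ ω)

/-- **Ergodic decomposition.** -/
theorem exists_ergodic_decomposition [StandardBorelSpace Y] {S : Y → Y} {Ω : Measure Y}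
    [IsProbabilityMeasure Ω] (hS : MeasurePreserving S Ω Ω) :
    ∃ κ : Kernel Y Y, IsErgodicDecomposition S Ω κ := by
  have hI : MeasurableSpace.invariants S ≤ ‹MeasurableSpace Y› := MeasurableSpace.invariants_le S
  set κ0 := condExpKernel Ω (MeasurableSpace.invariants S) with hκ0
  -- The conditional kernel is measurable for the smaller invariant σ-algebra; it is read as a
  -- kernel on the whole space.
  let κ : Kernel Y Y := κ0.comap id (measurable_id'' hI)
  have hκ : ∀ ω, κ ω = κ0 ω := fun ω => rfl
  have hMk : IsMarkovKernel κ := by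
    have : IsMarkovKernel κ0 := by infer_instance
    exact ⟨fun ω => by rw [hκ]; infer_instance⟩
  have hbind : ∀ f : Y → ENNReal, Measurable f → ∫⁻ ω, ∫⁻ y, f y ∂κ ω ∂Ω = ∫⁻ y, f y ∂Ω := by
    intro f hf
    conv_rhs => rw [← condExpKernel_comp_trim (μ := Ω) hI]
    rw [Measure.lintegral_bind κ0.measurable.aemeasurable hf.aemeasurable, lintegral_trim hI]
    · rfl
    · exact Measurable.lintegral_kernel hf
  -- For an invariant function, the conditional probability of `{g < r}` is its own indicator;
  -- rational r suffice to show that g is constant on almost every component.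
  have hconst : ∀ g : Y → ℝ, Measurable g → g ∘ S = g → ∀ᵐ ω ∂Ω, ∀ᵐ y ∂κ ω, g y = g ω := by
    intro g hg hgS
    have hgI : Measurable[MeasurableSpace.invariants S] g := by
      rw [MeasurableSpace.measurable_invariants_dom]
      exact ⟨hg, fun s _ => by rw [hgS]⟩
    have hset : ∀ r : ℚ, ∀ᵐ ω ∂Ω, (κ ω).real {y | g y < r} = if g ω < r then 1 else 0 := by
      intro r
      have hB : MeasurableSet[MeasurableSpace.invariants S] {y | g y < r} := hgI measurableSet_Iio
      have h1 := condExpKernel_ae_eq_condExp (μ := Ω) hI (hI _ hB)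
      have h2 : Ω⟦{y | g y < r}|MeasurableSpace.invariants S⟧ = {y | g y < r}.indicator fun _ => (1 : ℝ) :=
        condExp_of_stronglyMeasurable hI (stronglyMeasurable_const.indicator hB)
          ((integrable_const _).indicator (hI _ hB))
      filter_upwards [h1] with ω hω
      rw [h2] at hω
      exact hω.trans (by simp [Set.indicator])
    filter_upwards [ae_all_iff.2 hset] with ω hω
    have h3 : ∀ r : ℚ, ∀ᵐ y ∂κ ω, (g y < r ↔ g ω < r) := by
      intro r
      have hm : MeasurableSet {y | g y < r} := hg measurableSet_Iio
      have := hω r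
      split_ifs at this with h
      · have h4 : {y | g y < r} ∈ ae (κ ω) := by
          rw [mem_ae_iff_prob_eq_one hm]
          rw [Measure.real, ENNReal.toReal_eq_one_iff] at this
          exact this
        filter_upwards [h4] with y hy
        exact ⟨fun _ => h, fun _ => hy⟩
      · rw [measureReal_eq_zero_iff] at this
        filter_upwards [measure_eq_zero_iff_ae_notMem.1 this] with y hy
        exact ⟨fun h' => absurd h' hy, fun h' => absurd h' h⟩
    filter_upwards [ae_all_iff.2 h3] with y hy
    refine le_antisymm ?_ ?_
    · by_contra! hlt
      obtain ⟨r, hr1, hr2⟩ := exists_rat_btwn hlt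
      exact absurd ((hy r).2 hr1) (not_lt.2 hr2.le)
    · by_contra! hlt
      obtain ⟨r, hr1, hr2⟩ := exists_rat_btwn hlt
      exact absurd ((hy r).1 hr1) (not_lt.2 hr2.le)
  obtain ⟨C, hCc, hCpi, hCm, hCu, hCgen⟩ := exists_countable_piSystem Y
  have : Countable C := hCc.to_subtype
  have hinv : ∀ᵐ ω ∂Ω, MeasurePreserving S (κ ω) (κ ω) := by
    have h1 : ∀ A : C, ∀ᵐ ω ∂Ω, κ ω (S ⁻¹' A) = κ ω A := by
      intro A
      have hA := hCm A A.2
      have hSA := hS.measurable hA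
      have h2 : Ω⟦S ⁻¹' (A : Set Y)|MeasurableSpace.invariants S⟧ =ᵐ[Ω] Ω⟦(A : Set Y)|MeasurableSpace.invariants S⟧ := by
        refine ae_eq_condExp_of_forall_setIntegral_eq hI ((integrable_const _).indicator hA)
          (fun _ _ _ => integrable_condExp.integrableOn) ?_
          stronglyMeasurable_condExp.aestronglyMeasurable
        intro B hB _
        have hB' := MeasurableSpace.measurableSet_invariants.1 hB
        rw [setIntegral_condExp hI ((integrable_const _).indicator hSA) hB,
          integral_indicator_const _ hSA, integral_indicator_const _ hA,
          measureReal_restrict_apply hSA, measureReal_restrict_apply hA]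
        congr 1
        conv_lhs => rw [← hB'.2, ← Set.preimage_inter]
        exact hS.measureReal_preimage (hA.inter hB'.1).nullMeasurableSet
      filter_upwards [condExpKernel_ae_eq_condExp (μ := Ω) hI hSA,
        condExpKernel_ae_eq_condExp (μ := Ω) hI hA, h2] with ω h3 h4 h5
      have h6 : (κ ω).real (S ⁻¹' A) = (κ ω).real A := h3.trans (h5.trans h4.symm)
      exact (measureReal_eq_measureReal_iff).1 h6
    filter_upwards [ae_all_iff.2 h1] with ω hω
    refine ⟨hS.measurable, ?_⟩
    have : IsProbabilityMeasure ((κ ω).map S) :=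
      Measure.isProbabilityMeasure_map hS.measurable.aemeasurable
    refine ext_of_generate_finite C hCgen hCpi (fun A hA => ?_) (by simp)
    rw [Measure.map_apply hS.measurable (hCm A hA)]
    exact hω ⟨A, hA⟩
  refine ⟨κ, hMk, fun E hE => ?_, ?_⟩
  · have := hbind (E.indicator 1) (measurable_one.indicator hE)
    simpa [lintegral_indicator_one hE] using this
  -- The exceptional null set must be fixed before the invariant set to be tested. Convergence of
  -- averages to constants is therefore recorded for the countably many sets of the π-system only.
  have hfac : ∀ A : C, ∀ᵐ ω ∂Ω, ∃ s : ℕ → ℕ, Tendsto s atTop atTop ∧ ∃ c : ℝ,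
      Tendsto (fun j => ∫⁻ y, ‖birkhoffAverage ℝ S ((A : Set Y).indicator fun _ => (1 : ℝ))
        (s j) y - c‖ₑ ∂κ ω) atTop (𝓝 0) := by
    intro A
    have hA := hCm A A.2
    have hfm : Measurable ((A : Set Y).indicator fun _ => (1 : ℝ)) := measurable_const.indicator hA
    obtain ⟨g, hg, hgS, hlim⟩ := exists_tendsto_birkhoffAverage hS hfm (C := 1)
      (fun y => by by_cases h : y ∈ (A : Set Y) <;> simp [h])
    have hmeas : ∀ N, Measurable fun y =>
        ‖birkhoffAverage ℝ S ((A : Set Y).indicator fun _ => (1 : ℝ)) N y - g y‖ₑ := by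
      intro N
      refine Measurable.enorm (Measurable.sub ?_ hg)
      have : Measurable fun y => ∑ k ∈ Finset.range N,
          (A : Set Y).indicator (fun _ => (1 : ℝ)) (S^[k] y) :=
        Finset.measurable_fun_sum _ fun k _ => hfm.comp (hS.measurable.iterate k)
      exact this.const_smul ((N : ℝ)⁻¹)
    obtain ⟨s, hs, hae⟩ := exists_seq_ae_tendsto_zero (Ω := Ω)
      (h := fun N ω => ∫⁻ y, ‖birkhoffAverage ℝ S ((A : Set Y).indicator fun _ => (1 : ℝ)) N y
        - g y‖ₑ ∂κ ω) (fun N => Measurable.lintegral_kernel (hmeas N))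
      (by simpa only [hbind _ (hmeas _)] using hlim)
    filter_upwards [hae, hconst g hg hgS] with ω h1 h2
    refine ⟨s, hs, g ω, h1.congr fun j => lintegral_congr_ae ?_⟩
    filter_upwards [h2] with y hy
    rw [hy]
  filter_upwards [hinv, ae_all_iff.2 hfac] with ω hω1 hω2
  refine ⟨hω1, ⟨fun B hB hSB => ?_⟩⟩
  have hind : ∀ A ∈ C, κ ω (A ∩ B) = κ ω A * κ ω B := by
    intro A hAC
    have hA := hCm A hAC
    obtain ⟨s, hs, c, hc⟩ := hω2 ⟨A, hAC⟩
    have hlim : ∀ D, MeasurableSet D → S ⁻¹' D = D →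
        (κ ω).real (A ∩ D) = c * (κ ω).real D := fun D hD hSD =>
      measureReal_inter_eq_of_tendsto hω1 hA hs hc hD hSD
    have h1 := hlim Set.univ MeasurableSet.univ rfl
    have h2 := hlim B hB hSB
    simp only [Set.inter_univ, probReal_univ, mul_one] at h1
    rw [← h1] at h2
    rw [← ENNReal.toReal_eq_toReal_iff' (by finiteness) (by finiteness), ENNReal.toReal_mul]
    exact h2
  -- Independence of B from a generating π-system extends to all sets, and B is then independent of
  -- itself.
  have hext : (κ ω).restrict B = κ ω B • κ ω := by
    refine ext_of_generate_finite C hCgen hCpi (fun A hA => ?_) (by simp)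
    rw [Measure.restrict_apply (hCm A hA), hind A hA]
    simp [mul_comm]
  have hsq : κ ω B = κ ω B * κ ω B := by
    have := congrArg (fun P : Measure Y => P B) hext
    simpa using this
  rw [eventuallyConst_set]
  have hne : κ ω B ≠ ⊤ := by finiteness
  rcases eq_or_ne (κ ω B) 0 with h0 | h0
  · right
    exact measure_eq_zero_iff_ae_notMem.1 h0
  · left
    have : κ ω B = 1 := by
      have := (ENNReal.mul_left_inj h0 hne).1 ((one_mul (κ ω B)).trans hsq)
      exact this.symm
    exact (mem_ae_iff_prob_eq_one hB).2 this

namespace IsErgodicDecomposition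

variable {S : Y → Y} {Ω : Measure Y} {κ : Kernel Y Y}

theorem lintegral_lintegral (h : IsErgodicDecomposition S Ω κ) {f : Y → ENNReal}
    (hf : Measurable f) : ∫⁻ ω, ∫⁻ y, f y ∂κ ω ∂Ω = ∫⁻ y, f y ∂Ω := by
  have hb : Ω.bind κ = Ω := by
    ext E hE
    rw [Measure.bind_apply hE κ.measurable.aemeasurable, h.lintegral_eq E hE]
  conv_rhs => rw [← hb]
  rw [Measure.lintegral_bind κ.measurable.aemeasurable hf.aemeasurable]

theorem ae_ae (h : IsErgodicDecomposition S Ω κ) {p : Y → Prop} (hp : ∀ᵐ y ∂Ω, p y) :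
    ∀ᵐ ω ∂Ω, ∀ᵐ y ∂κ ω, p y := by
  obtain ⟨E, hE, hEm, hE0⟩ := exists_measurable_superset_of_null (ae_iff.1 hp)
  have h0 : ∫⁻ ω, κ ω E ∂Ω = 0 := by rw [h.lintegral_eq E hEm, hE0]
  rw [lintegral_eq_zero_iff (κ.measurable_coe hEm)] at h0
  filter_upwards [h0] with ω hω
  exact ae_iff.2 (measure_mono_null hE hω)

/-- A set with the same measure for almost every ergodic component has that measure. -/
theorem measure_eq [IsProbabilityMeasure Ω] (h : IsErgodicDecomposition S Ω κ) {E : Set Y}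
    (hE : MeasurableSet E) {c : ENNReal} (hc : ∀ᵐ ω ∂Ω, κ ω E = c) : Ω E = c := by
  rw [← h.lintegral_eq E hE, lintegral_congr_ae hc]
  simp

/-- Almost every ergodic component has the same image as `Ω` in an ergodic factor. -/
theorem ae_map_eq [IsProbabilityMeasure Ω] (h : IsErgodicDecomposition S Ω κ) {Z : Type*}
    [MeasurableSpace Z] [MeasurableSpace.CountablyGenerated Z] {π : Y → Z} (hπ : Measurable π)
    {R : Z → Z} (hR : π ∘ S = R ∘ π) (hm : Ergodic R (Ω.map π)) :
    ∀ᵐ ω ∂Ω, (κ ω).map π = Ω.map π := by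
  have := h.isMarkovKernel
  have hpm : IsProbabilityMeasure (Ω.map π) :=
    Measure.isProbabilityMeasure_map hπ.aemeasurable
  have hpk : ∀ ω, IsProbabilityMeasure ((κ ω).map π) := fun ω =>
    Measure.isProbabilityMeasure_map hπ.aemeasurable
  obtain ⟨C, hCc, hCpi, hCm, hCu, hCgen⟩ := exists_countable_piSystem Z
  have : Countable C := hCc.to_subtype
  have hinv : ∀ᵐ ω ∂Ω, MeasurePreserving R ((κ ω).map π) ((κ ω).map π) := by
    filter_upwards [h.ergodic] with ω hω
    refine ⟨hm.measurable, ?_⟩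
    rw [Measure.map_map hm.measurable hπ, ← hR,
      ← Measure.map_map hπ hω.measurable, hω.map_eq]
  -- In the ergodic factor the averages of A tend to a constant c. They do so under almost every
  -- component too, along a subsequence, and c is then the mass of A under both images.
  have key : ∀ A : C, ∀ᵐ ω ∂Ω, (κ ω).map π A = Ω.map π A := by
    intro A
    have hA := hCm A A.2
    have hfm : Measurable ((A : Set Z).indicator fun _ => (1 : ℝ)) := measurable_const.indicator hA
    obtain ⟨g, hg, hgS, hlim⟩ := exists_tendsto_birkhoffAverage hm.toMeasurePreserving hfm (C := 1)
      (fun y => by by_cases h : y ∈ (A : Set Z) <;> simp [h])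
    obtain ⟨c, hc⟩ := hm.ae_eq_const_of_ae_eq_comp_ae hg.aestronglyMeasurable
      (ae_of_all _ fun z => congrFun hgS z)
    have hlimc : Tendsto (fun N => ∫⁻ y, ‖birkhoffAverage ℝ R
        ((A : Set Z).indicator fun _ => (1 : ℝ)) N y - c‖ₑ ∂(Ω.map π)) atTop (𝓝 0) := by
      refine hlim.congr fun N => lintegral_congr_ae ?_
      filter_upwards [hc] with z hz
      rw [hz]; rfl
    have hmeas : ∀ N, Measurable fun y =>
        ‖birkhoffAverage ℝ R ((A : Set Z).indicator fun _ => (1 : ℝ)) N y - c‖ₑ := fun N =>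
      ((measurable_birkhoffAverage hm.measurable hfm N).sub_const c).enorm
    have hΩ := measureReal_inter_eq_of_tendsto hm.toMeasurePreserving hA tendsto_id hlimc
      MeasurableSet.univ rfl
    obtain ⟨s, hs, hae⟩ := exists_seq_ae_tendsto_zero (Ω := Ω)
      (h := fun N ω => ∫⁻ y, ‖birkhoffAverage ℝ R ((A : Set Z).indicator fun _ => (1 : ℝ)) N (π y)
        - c‖ₑ ∂κ ω) (fun N => Measurable.lintegral_kernel ((hmeas N).comp hπ))
      (by
        refine hlimc.congr fun N => ?_
        rw [lintegral_map (hmeas N) hπ]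
        exact (h.lintegral_lintegral ((hmeas N).comp hπ)).symm)
    filter_upwards [hae, hinv] with ω h1 h2
    have h3 := measureReal_inter_eq_of_tendsto h2 hA hs (c := c)
      (by
        refine h1.congr fun N => ?_
        rw [lintegral_map (hmeas _) hπ])
      MeasurableSet.univ rfl
    simp only [Set.inter_univ, probReal_univ, mul_one] at h3 hΩ
    exact (measureReal_eq_measureReal_iff).1 (h3.trans hΩ.symm)
  filter_upwards [ae_all_iff.2 key] with ω hω
  exact ext_of_generate_finite C hCgen hCpi (fun A hA => hω ⟨A, hA⟩) (by simp)

end IsErgodicDecomposition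

/-- Distinct ergodic probability measures are mutually singular. -/
theorem mutuallySingular_of_ergodic {S : Y → Y} {P Q : Measure Y} [IsProbabilityMeasure P]
    [IsProbabilityMeasure Q] (hP : Ergodic S P) (hQ : Ergodic S Q) (hne : P ≠ Q) :
    P ⟂ₘ Q := by
  -- The part of P absolutely continuous with respect to Q is invariant and absolutely continuous
  -- with respect to both measures, so it is a multiple of each. A nonzero multiple would force the
  -- two measures to agree.
  have hw := hP.toMeasurePreserving.withDensity_rnDeriv hQ.toMeasurePreserving
  obtain ⟨c, hc⟩ := hQ.eq_smul_of_absolutelyContinuous hw (withDensity_absolutelyContinuous _ _)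
  obtain ⟨d, hd⟩ := hP.eq_smul_of_absolutelyContinuous hw
    (Measure.absolutelyContinuous_of_le (Measure.withDensity_rnDeriv_le P Q))
  have hcd : c = d := by
    have h1 := congrArg (fun m : Measure Y => m Set.univ) (hc.symm.trans hd)
    simpa using h1
  rcases eq_or_ne c 0 with h0 | h0
  · have : Q.withDensity (P.rnDeriv Q) = 0 := by rw [hc, h0, zero_smul]
    rw [← Measure.rnDeriv_eq_zero]
    rwa [withDensity_eq_zero_iff (Measure.measurable_rnDeriv P Q).aemeasurable] at this
  · refine absurd ?_ hne
    have h1 : d • P = d • Q := by rw [← hd, hc, hcd]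
    ext E hE
    have h2 := congrArg (fun m : Measure Y => m E) h1
    simp only [Measure.smul_apply, smul_eq_mul] at h2
    have htop : d ≠ ⊤ := by
      intro h
      have h3 := congrArg (fun m : Measure Y => m Set.univ) hd
      simp only [Measure.smul_apply, smul_eq_mul, measure_univ, mul_one] at h3
      exact (measure_ne_top _ _) (h3.trans h)
    exact (ENNReal.mul_right_inj (hcd ▸ h0) htop).1 h2

/-- Distinct ergodic measures live on disjoint sets, so domination of each one adds up to domination
of the sum. Comparing total masses then bounds the number of summands. -/
theorem finset_sum_le_of_ergodic {S : Y → Y} {θ : Measure Y} (F : Finset (Measure Y))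
    (hF : ∀ P ∈ F, IsProbabilityMeasure P ∧ Ergodic S P ∧ P ≤ θ) : ∑ P ∈ F, P ≤ θ := by
  classical
  induction F using Finset.induction_on with
  | empty => simpa using Measure.zero_le θ
  | insert P F hPF ih =>
    rw [Finset.sum_insert hPF]
    have ih' := ih fun Q hQ => hF Q (Finset.mem_insert_of_mem hQ)
    obtain ⟨hP1, hP2, hP3⟩ := hF P (Finset.mem_insert_self _ _)
    have hsing : P ⟂ₘ ∑ Q ∈ F, Q := by
      rw [← Measure.sum_coe_finset, Measure.MutuallySingular.sum_right]
      rintro ⟨Q, hQ⟩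
      obtain ⟨hQ1, hQ2, -⟩ := hF Q (Finset.mem_insert_of_mem hQ)
      exact mutuallySingular_of_ergodic hP2 hQ2 fun h => hPF (h ▸ hQ)
    obtain ⟨E, hE, h1, h2⟩ := hsing
    refine Measure.le_iff.2 fun A hA => ?_
    have hPA : P A ≤ θ (A \ E) := by
      refine le_trans ?_ (hP3 _)
      rw [← measure_inter_add_sdiff A hE]
      simp [measure_mono_null Set.inter_subset_right h1]
    have hQA : (∑ Q ∈ F, Q) A ≤ θ (A ∩ E) := by
      refine le_trans ?_ (ih' _)
      rw [← measure_inter_add_sdiff A hE]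
      have : (∑ Q ∈ F, Q) (A \ E) = 0 :=
        measure_mono_null (fun x hx => hx.2) h2
      simp [this]
    calc (P + ∑ Q ∈ F, Q) A = P A + (∑ Q ∈ F, Q) A := rfl
      _ ≤ θ (A \ E) + θ (A ∩ E) := add_le_add hPA hQA
      _ = θ A := by rw [add_comm, measure_inter_add_sdiff A hE]

/-- A finite measure dominates only finitely many ergodic probability measures. -/
theorem finite_ergodic_le {S : Y → Y} (θ : Measure Y) [IsFiniteMeasure θ] :
    {P : Measure Y | IsProbabilityMeasure P ∧ Ergodic S P ∧ P ≤ θ}.Finite := by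
  by_contra hinf
  obtain ⟨n, hn⟩ := ENNReal.exists_nat_gt (measure_ne_top θ Set.univ)
  obtain ⟨F, hF, hcard⟩ := Set.Infinite.exists_subset_card_eq hinf n
  have h1 := finset_sum_le_of_ergodic F (fun P hP => hF hP) Set.univ
  have h2 : (∑ P ∈ F, P) Set.univ = n := by
    rw [Measure.finsetSum_apply]
    rw [Finset.sum_congr rfl fun P hP => (hF hP).1.measure_univ]
    simp [hcard]
  rw [h2] at h1
  exact absurd hn (not_lt.2 h1)

end Tools

end SelfJoining

namespace SelfJoining

/-! ### Relatively independent extensions and finite fibres. -/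

section Extension

variable {Y B D Z : Type*} [MeasurableSpace Y] [MeasurableSpace B] [MeasurableSpace D]
  [MeasurableSpace Z]

theorem compProd_mono_left {Γ Γ' : Measure Y} [SFinite Γ] [SFinite Γ'] (h : Γ ≤ Γ')
    (κ : Kernel Y Z) [IsSFiniteKernel κ] : Γ ⊗ₘ κ ≤ Γ' ⊗ₘ κ := by
  refine Measure.le_iff.2 fun E hE => ?_
  rw [Measure.compProd_apply hE, Measure.compProd_apply hE]
  exact lintegral_mono' h le_rfl

variable [StandardBorelSpace Z] [Nonempty Z]

/-- The conditional measures of an invariant measure are equivariant. -/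
theorem condKernel_equivariant {β : B ≃ᵐ B} {τ : Z ≃ᵐ Z} {ρ : Measure (B × Z)}
    [IsProbabilityMeasure ρ] (hρ : MeasurePreserving (Prod.map β τ) ρ ρ) :
    ∀ᵐ b ∂ρ.fst, (ρ.condKernel b).map τ = ρ.condKernel (β b) := by
  have hfst : MeasurePreserving β ρ.fst ρ.fst := by
    refine ⟨β.measurable, ?_⟩
    conv_rhs => rw [← hρ.map_eq]
    rw [Measure.fst, Measure.fst, Measure.map_map β.measurable measurable_fst,
      Measure.map_map measurable_fst hρ.measurable]
    rfl
  -- Transporting the conditional measures by the inverse dynamics gives another disintegration of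
  -- the same invariant measure; uniqueness identifies the two.
  let κ' : Kernel B Z := (ρ.condKernel.comap β β.measurable).map τ.symm
  have hκ' : ∀ b, κ' b = (ρ.condKernel (β b)).map τ.symm := fun b => by
    rw [Kernel.map_apply _ τ.symm.measurable, Kernel.comap_apply]
  have hM : IsMarkovKernel κ' := Kernel.IsMarkovKernel.map _ τ.symm.measurable
  have hinv : ρ.map (Prod.map β.symm τ.symm) = ρ := by
    conv_lhs => rw [← hρ.map_eq]
    rw [Measure.map_map (β.symm.measurable.prodMap τ.symm.measurable) hρ.measurable]
    convert Measure.map_id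
    ext p <;> simp
  have hρ' : ρ = ρ.fst ⊗ₘ κ' := by
    ext E hE
    rw [Measure.compProd_apply hE]
    conv_lhs => rw [← hinv]
    have hm : Measurable (Prod.map β.symm τ.symm) :=
      β.symm.measurable.prodMap τ.symm.measurable
    rw [Measure.map_apply hm hE]
    conv_lhs => rw [← ρ.disintegrate ρ.condKernel]
    rw [Measure.compProd_apply (hm hE), ← hfst.lintegral_comp]
    · refine lintegral_congr fun b => ?_
      rw [hκ', Measure.map_apply τ.symm.measurable (measurable_prodMk_left hE)]
      congr 1
      ext z
      simp
    · exact Kernel.measurable_kernel_prodMk_left (hm hE)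
  filter_upwards [eq_condKernel_of_measure_eq_compProd κ' hρ'] with b hb
  rw [← hb, hκ', Measure.map_map τ.measurable τ.symm.measurable]
  simp

/-- The relatively independent extension of `Γ` by `ρ` over the common factor given by `π`. -/
theorem measurePreserving_compProd_condKernel {S : Y → Y} {β : B ≃ᵐ B} {τ : Z ≃ᵐ Z}
    {Γ : Measure Y} [IsProbabilityMeasure Γ] (hS : MeasurePreserving S Γ Γ) {π : Y → B}
    (hπ : Measurable π) (hπS : ∀ y, π (S y) = β (π y)) {ρ : Measure (B × Z)}
    [IsProbabilityMeasure ρ] (hρ : MeasurePreserving (Prod.map β τ) ρ ρ)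
    (hfst : Γ.map π = ρ.fst) :
    MeasurePreserving (Prod.map S τ) (Γ ⊗ₘ ρ.condKernel.comap π hπ)
      (Γ ⊗ₘ ρ.condKernel.comap π hπ) := by
  have hm : Measurable (Prod.map S τ) := hS.measurable.prodMap τ.measurable
  refine ⟨hm, ?_⟩
  ext E hE
  rw [Measure.map_apply hm hE, Measure.compProd_apply (hm hE), Measure.compProd_apply hE,
    ← hS.lintegral_comp (Kernel.measurable_kernel_prodMk_left hE)]
  have h1 : ∀ᵐ y ∂Γ, (ρ.condKernel (π y)).map τ = ρ.condKernel (β (π y)) := by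
    refine ae_of_ae_map (p := fun b => (ρ.condKernel b).map τ = ρ.condKernel (β b))
      hπ.aemeasurable ?_
    rw [hfst]
    exact condKernel_equivariant hρ
  refine lintegral_congr_ae ?_
  filter_upwards [h1] with y hy
  rw [Kernel.comap_apply, Kernel.comap_apply, hπS, ← hy,
    Measure.map_apply τ.measurable (measurable_prodMk_left hE)]
  rfl

theorem map_compProd_condKernel {Γ : Measure Y} [IsProbabilityMeasure Γ] {π : Y → B}
    (hπ : Measurable π) {ρ : Measure (B × Z)} [IsProbabilityMeasure ρ]
    (hfst : Γ.map π = ρ.fst) :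
    (Γ ⊗ₘ ρ.condKernel.comap π hπ).map (fun w => (π w.1, w.2)) = ρ := by
  have hm : Measurable (fun w : Y × Z => (π w.1, w.2)) :=
    (hπ.comp measurable_fst).prodMk measurable_snd
  ext E hE
  rw [Measure.map_apply hm hE, Measure.compProd_apply (hm hE)]
  conv_rhs => rw [← ρ.disintegrate ρ.condKernel]
  rw [Measure.compProd_apply hE, ← hfst,
    lintegral_map (Kernel.measurable_kernel_prodMk_left hE) hπ]
  rfl

/-- The conditional measures of `ρ` are purely atomic, with almost every atom of mass at
least `c⁻¹`. -/
def HasFiniteFibres (ρ : Measure (B × Z)) [IsFiniteMeasure ρ] (c : ENNReal) : Prop :=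
  ∀ᵐ p ∂ρ, 1 ≤ c * ρ.condKernel p.1 {p.2}

/-- A joining with finite fibres is dominated by its relatively independent version. -/
theorem HasFiniteFibres.map_le {ρ : Measure (B × Z)} [IsFiniteMeasure ρ] {c : ENNReal}
    (h : HasFiniteFibres ρ c) {Ω : Measure Y} [IsProbabilityMeasure Ω] {d : Y → D} {π : D → B}
    {z : Y → Z} (hd : Measurable d) (hπ : Measurable π) (hz : Measurable z)
    (hmap : Ω.map (fun w => (π (d w), z w)) = ρ) :
    Ω.map (fun w => (d w, z w)) ≤ c • (Ω.map d) ⊗ₘ ρ.condKernel.comap π hπ := by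
  set Γ := Ω.map (fun w => (d w, z w)) with hΓ
  have hdz : Measurable fun w => (d w, z w) := hd.prodMk hz
  have hΓp : IsProbabilityMeasure Γ := Measure.isProbabilityMeasure_map hdz.aemeasurable
  have hm : Measurable (fun w : D × Z => (π w.1, w.2)) :=
    (hπ.comp measurable_fst).prodMk measurable_snd
  have hΓρ : Γ.map (fun w : D × Z => (π w.1, w.2)) = ρ := by
    rw [hΓ, Measure.map_map hm hdz, ← hmap]
    rfl
  have hfst : Γ.fst = Ω.map d := by
    rw [hΓ, Measure.fst, Measure.map_map measurable_fst hdz]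
    rfl
  have hgood : ∀ᵐ w ∂Γ, 1 ≤ c * ρ.condKernel (π w.1) {w.2} := by
    refine ae_of_ae_map (f := fun w : D × Z => (π w.1, w.2)) hm.aemeasurable
      (p := fun p => 1 ≤ c * ρ.condKernel p.1 {p.2}) ?_
    rw [hΓρ]
    exact h
  rw [← hfst]
  conv_lhs => rw [← Γ.disintegrate Γ.condKernel]
  have hgood' : ∀ᵐ e ∂Γ.fst, ∀ᵐ x ∂Γ.condKernel e, 1 ≤ c * ρ.condKernel (π e) {x} := by
    refine Measure.ae_ae_of_ae_compProd (p := fun w : D × Z =>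
      1 ≤ c * ρ.condKernel (π w.1) {w.2}) ?_
    rw [Γ.disintegrate Γ.condKernel]
    exact hgood
  refine Measure.le_iff.2 fun E hE => ?_
  rw [Measure.smul_apply, Measure.compProd_apply hE, Measure.compProd_apply hE, smul_eq_mul,
    ← lintegral_const_mul _ (Kernel.measurable_kernel_prodMk_left hE)]
  refine lintegral_mono_ae ?_
  filter_upwards [hgood'] with e he
  -- Almost all of the fibre law sits on points whose mass times c is at least 1. A slice containing
  -- such a point has right side at least 1, and a slice without one is null on the left.
  by_cases hex : ∃ x, x ∈ Prod.mk e ⁻¹' E ∧ 1 ≤ c * ρ.condKernel (π e) {x}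
  · obtain ⟨x, hx, hx1⟩ := hex
    have h1 : ρ.condKernel (π e) {x} ≤ ρ.condKernel (π e) (Prod.mk e ⁻¹' E) :=
      measure_mono (Set.singleton_subset_iff.2 hx)
    exact prob_le_one.trans (hx1.trans (mul_le_mul_right h1 c))
  · push Not at hex
    have h0 : ∀ᵐ x ∂Γ.condKernel e, x ∉ Prod.mk e ⁻¹' E := by
      filter_upwards [he] with x hx1 hx
      exact absurd hx1 (not_le.2 (hex x hx))
    have : Γ.condKernel e (Prod.mk e ⁻¹' E) = 0 := measure_eq_zero_iff_ae_notMem.2 h0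
    rw [this]
    exact bot_le

end Extension

/-! ### Integer powers of an automorphism. -/

section Powers

variable {X : Type u} [MeasurableSpace X]

/-- Integer powers of an automorphism. -/
def ipow (T : X ≃ᵐ X) (p : ℤ) : X ≃ᵐ X where
  toEquiv := (T.toEquiv ^ p : Equiv.Perm X)
  measurable_toFun := by
    have hn : ∀ (S : X ≃ᵐ X) (n : ℕ), Measurable ⇑(S.toEquiv ^ n : Equiv.Perm X) := by
      intro S n
      rw [Equiv.Perm.coe_pow]
      exact S.measurable.iterate n
    cases p with
    | ofNat n => exact hn T n
    | negSucc n =>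
      have : (T.toEquiv ^ (Int.negSucc n) : Equiv.Perm X) = T.symm.toEquiv ^ (n + 1) := by
        rw [zpow_negSucc, ← inv_pow]
        rfl
      simpa [this] using hn T.symm (n + 1)
  measurable_invFun := by
    have hn : ∀ (S : X ≃ᵐ X) (n : ℕ), Measurable ⇑(S.toEquiv ^ n : Equiv.Perm X) := by
      intro S n
      rw [Equiv.Perm.coe_pow]
      exact S.measurable.iterate n
    cases p with
    | ofNat n =>
      have : (T.toEquiv ^ (Int.ofNat n) : Equiv.Perm X).symm = T.symm.toEquiv ^ n := by
        change ((T.toEquiv : Equiv.Perm X) ^ (Int.ofNat n))⁻¹ = _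
        rw [Int.ofNat_eq_natCast, zpow_natCast, ← inv_pow]
        rfl
      change Measurable ⇑((T.toEquiv ^ (Int.ofNat n) : Equiv.Perm X).symm)
      rw [this]
      exact hn T.symm n
    | negSucc n =>
      have : (T.toEquiv ^ (Int.negSucc n) : Equiv.Perm X).symm = T.toEquiv ^ (n + 1) := by
        change ((T.toEquiv : Equiv.Perm X) ^ (Int.negSucc n))⁻¹ = _
        rw [zpow_negSucc, inv_inv]
      change Measurable ⇑((T.toEquiv ^ (Int.negSucc n) : Equiv.Perm X).symm)
      rw [this]
      exact hn T (n + 1)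

variable (T : X ≃ᵐ X)

theorem coe_ipow (p : ℤ) : ⇑(ipow T p) = ⇑(T.toEquiv ^ p : Equiv.Perm X) := rfl

@[simp] theorem ipow_zero (x : X) : ipow T 0 x = x := rfl

theorem ipow_add (p q : ℤ) (x : X) : ipow T (p + q) x = ipow T p (ipow T q x) := by
  simp only [coe_ipow, zpow_add]
  rfl

theorem ipow_natCast (n : ℕ) (x : X) : ipow T n x = T^[n] x := by
  rw [coe_ipow, zpow_natCast, Equiv.Perm.coe_pow]
  rfl

@[simp] theorem ipow_one (x : X) : ipow T 1 x = T x := by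
  simpa using ipow_natCast T 1 x

theorem ipow_apply_comm (p : ℤ) (x : X) : ipow T p (T x) = T (ipow T p x) := by
  rw [← ipow_one T x, ← ipow_add, ← ipow_one T (ipow T p x), ← ipow_add, add_comm]

@[simp] theorem ipow_neg_ipow (p : ℤ) (x : X) : ipow T (-p) (ipow T p x) = x := by
  rw [← ipow_add]; simp

@[simp] theorem ipow_ipow_neg (p : ℤ) (x : X) : ipow T p (ipow T (-p) x) = x := by
  rw [← ipow_add]; simp

theorem ipow_natCast_mul (n : ℕ) (p : ℤ) (x : X) : ipow T (n * p) x = (ipow T p)^[n] x := by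
  induction n generalizing x with
  | zero => simp
  | succ n ih =>
    rw [Function.iterate_succ_apply, ← ih, ← ipow_add]
    congr 2
    push_cast; ring

variable {T} {μ : Measure X}

theorem measurePreserving_ipow (hT : MeasurePreserving T μ μ) (p : ℤ) :
    MeasurePreserving (ipow T p) μ μ := by
  have hpos : ∀ n : ℕ, MeasurePreserving (ipow T n) μ μ := by
    intro n
    have := hT.iterate n
    convert this using 1
    funext x
    exact ipow_natCast T n x
  obtain ⟨n, rfl | rfl⟩ := Int.eq_nat_or_neg p
  · exact hpos n
  · have h1 := (hpos n).symm (ipow T n)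
    convert h1 using 1
    funext x
    rw [eq_comm, MeasurableEquiv.symm_apply_eq, ipow_ipow_neg]

theorem offDiagonal_eq_map (μ : Measure X) (T : X ≃ᵐ X) (p : ℤ) :
    offDiagonal μ T p = μ.map (fun x => (x, ipow T p x)) := rfl

end Powers

end SelfJoining

namespace SelfJoining

/-! ### Vanishing on rectangles and integrals of bounded functions. -/

section Rectangles

variable {α β : Type*} [MeasurableSpace α] [MeasurableSpace β]

theorem ae_eq_zero_of_forall_setIntegral_prod_eq_zero {ρ : Measure (α × β)} {g : α × β → ℝ}
    (hg : Integrable g ρ)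
    (h : ∀ E F, MeasurableSet E → MeasurableSet F → ∫ p in E ×ˢ F, g p ∂ρ = 0) : g =ᵐ[ρ] 0 := by
  refine hg.ae_eq_zero_of_forall_setIntegral_eq_zero fun s hs h' => ?_
  clear h'
  have huniv : ∫ p, g p ∂ρ = 0 := by
    have := h Set.univ Set.univ .univ .univ
    rwa [Set.univ_prod_univ, setIntegral_univ] at this
  induction s, hs using MeasurableSpace.induction_on_inter generateFrom_prod.symm
    isPiSystem_prod with
  | empty => simp
  | basic t ht =>
    obtain ⟨E, hE, F, hF, rfl⟩ := ht
    exact h E F hE hF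
  | compl t ht ih => rw [setIntegral_compl ht hg, ih, huniv, sub_zero]
  | iUnion f hd hf ih =>
    rw [integral_iUnion hf hd hg.integrableOn]
    simp only [ih, tsum_zero]

theorem abs_indicator_one_le {γ : Type*} (A : Set γ) (y : γ) :
    |A.indicator (fun _ => (1 : ℝ)) y| ≤ 1 := by
  by_cases h : y ∈ A <;> simp [h]

theorem integrable_of_abs_le {ρ : Measure α} [IsFiniteMeasure ρ] {f : α → ℝ} (hf : Measurable f)
    {C : ℝ} (hC : ∀ y, |f y| ≤ C) : Integrable f ρ :=
  Integrable.of_bound hf.aestronglyMeasurable C (ae_of_all _ hC)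

theorem tendsto_integral_mul_of_lintegral {ρ : Measure α} [IsFiniteMeasure ρ] {F : ℕ → α → ℝ}
    {g v : α → ℝ} {C : ℝ} (hg : Measurable g) (hF : ∀ n, Integrable (F n) ρ)
    (hv : Measurable v) (hvC : ∀ y, |v y| ≤ C)
    (h : Tendsto (fun n => ∫⁻ y, ‖F n y - g y‖ₑ ∂ρ) atTop (𝓝 0)) :
    Tendsto (fun n => ∫ y, F n y * v y ∂ρ) atTop (𝓝 (∫ y, g y * v y ∂ρ)) := by
  refine tendsto_integral_of_L1 _ (hg.mul hv).aestronglyMeasurable (Eventually.of_forall fun n =>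
    (hF n).mul_bdd hv.aestronglyMeasurable (ae_of_all _ hvC)) ?_
  have h2 : Tendsto (fun n => (∫⁻ y, ‖F n y - g y‖ₑ ∂ρ) * ENNReal.ofReal C) atTop (𝓝 0) := by
    simpa using ENNReal.Tendsto.mul_const h (Or.inr ENNReal.ofReal_ne_top)
  refine tendsto_of_tendsto_of_tendsto_of_le_of_le tendsto_const_nhds h2
    (fun _ => bot_le) fun n => ?_
  change ∫⁻ y, ‖F n y * v y - g y * v y‖ₑ ∂ρ ≤ _
  rw [← lintegral_mul_const' _ _ ENNReal.ofReal_ne_top]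
  refine lintegral_mono fun y => ?_
  rw [← sub_mul, enorm_mul]
  gcongr
  rw [Real.enorm_eq_ofReal_abs]
  exact ENNReal.ofReal_le_ofReal (hvC y)

end Rectangles

/-! ### Decoupling of averages when `T × T` is ergodic. -/

section WeakMixing

variable {X : Type u} [MeasurableSpace X] {μ : Measure X} [IsProbabilityMeasure μ] {T : X ≃ᵐ X}

theorem abs_birkhoffAverage_le {Y : Type*} {S : Y → Y} {f : Y → ℝ} {C : ℝ}
    (hC : ∀ y, |f y| ≤ C) (N : ℕ) (y : Y) : |birkhoffAverage ℝ S f N y| ≤ C := by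
  have hC0 : 0 ≤ C := (abs_nonneg _).trans (hC y)
  simp only [birkhoffAverage, birkhoffSum, smul_eq_mul]
  rw [abs_mul, abs_of_nonneg (by positivity)]
  rcases eq_or_ne N 0 with rfl | hN
  · simpa
  have h1 : |∑ k ∈ Finset.range N, f (S^[k] y)| ≤ N * C := by
    refine (Finset.abs_sum_le_sum_abs _ _).trans ?_
    refine (Finset.sum_le_sum fun k _ => hC _).trans ?_
    simp
  have : (0 : ℝ) < N := by positivity
  calc (N : ℝ)⁻¹ * _ ≤ (N : ℝ)⁻¹ * (N * C) := by gcongr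
    _ = C := by field_simp

theorem integral_birkhoffAverage_mul {Y : Type*} [MeasurableSpace Y] {P : Measure Y}
    [IsFiniteMeasure P] {S : Y → Y} (hS : Measurable S) {f v : Y → ℝ} (hf : Measurable f)
    (hv : Measurable v) {C D : ℝ} (hC : ∀ y, |f y| ≤ C) (hD : ∀ y, |v y| ≤ D) (N : ℕ) :
    ∫ y, birkhoffAverage ℝ S f N y * v y ∂P
      = (N : ℝ)⁻¹ * ∑ j ∈ Finset.range N, ∫ y, f (S^[j] y) * v y ∂P := by
  have hint : ∀ k, Integrable (fun y => f (S^[k] y) * v y) P := fun k =>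
    (integrable_of_abs_le (hf.comp (hS.iterate k)) fun y => hC _).mul_bdd
      hv.aestronglyMeasurable (ae_of_all _ hD)
  simp only [birkhoffAverage, birkhoffSum, smul_eq_mul, mul_assoc, Finset.sum_mul]
  rw [integral_const_mul, integral_finsetSum _ fun k _ => hint k]

/-- If `T × T` is ergodic, correlations tend to zero in square mean. -/
theorem tendsto_average_sq_correlation (hT : MeasurePreserving T μ μ)
    (hTT : Ergodic (Prod.map T T) (μ.prod μ)) {u v : X → ℝ} (hu : Measurable u)
    (hv : Measurable v) {C D : ℝ} (hC : ∀ x, |u x| ≤ C) (hD : ∀ x, |v x| ≤ D)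
    (hu0 : ∫ x, u x ∂μ = 0) :
    Tendsto (fun N : ℕ => (N : ℝ)⁻¹ * ∑ n ∈ Finset.range N, (∫ x, u (T^[n] x) * v x ∂μ) ^ 2)
      atTop (𝓝 0) := by
  set f : X × X → ℝ := fun p => u p.1 * u p.2 with hf
  set w : X × X → ℝ := fun p => v p.1 * v p.2 with hw
  have hfm : Measurable f := (hu.comp measurable_fst).mul (hu.comp measurable_snd)
  have hwm : Measurable w := (hv.comp measurable_fst).mul (hv.comp measurable_snd)
  have hfC : ∀ p, |f p| ≤ C * C := fun p => by
    rw [hf, abs_mul]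
    exact mul_le_mul (hC _) (hC _) (abs_nonneg _) ((abs_nonneg _).trans (hC p.1))
  have hwD : ∀ p, |w p| ≤ D * D := fun p => by
    rw [hw, abs_mul]
    exact mul_le_mul (hD _) (hD _) (abs_nonneg _) ((abs_nonneg _).trans (hD p.1))
  obtain ⟨g, hg, hgS, hlim⟩ := exists_tendsto_birkhoffAverage hTT.toMeasurePreserving hfm hfC
  obtain ⟨c, hc⟩ := hTT.ae_eq_const_of_ae_eq_comp_ae hg.aestronglyMeasurable
    (ae_of_all _ fun z => congrFun hgS z)
  have hint : ∀ N, Integrable (birkhoffAverage ℝ (Prod.map T T) f N) (μ.prod μ) := fun N =>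
    integrable_of_abs_le (measurable_birkhoffAverage hTT.measurable hfm N)
      (abs_birkhoffAverage_le hfC N)
  -- Pairing the averages of `u ⊗ u` under `T × T` with `v' ⊗ v'` produces the averages of squared
  -- correlations; by ergodicity the limit function is the constant c.
  have key : ∀ v' : X → ℝ, Measurable v' → ∀ D', (∀ x, |v' x| ≤ D') → Tendsto
      (fun N : ℕ => (N : ℝ)⁻¹ * ∑ n ∈ Finset.range N, (∫ x, u (T^[n] x) * v' x ∂μ) ^ 2)
      atTop (𝓝 (∫ p, c * (v' p.1 * v' p.2) ∂μ.prod μ)) := by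
    intro v' hv' D' hD'
    have hwm' : Measurable fun p : X × X => v' p.1 * v' p.2 :=
      (hv'.comp measurable_fst).mul (hv'.comp measurable_snd)
    have hwD' : ∀ p : X × X, |v' p.1 * v' p.2| ≤ D' * D' := fun p => by
      rw [abs_mul]
      exact mul_le_mul (hD' _) (hD' _) (abs_nonneg _) ((abs_nonneg _).trans (hD' p.1))
    have h1 := tendsto_integral_mul_of_lintegral hg hint hwm' hwD' hlim
    have h2 : ∫ p, g p * (v' p.1 * v' p.2) ∂μ.prod μ
        = ∫ p, c * (v' p.1 * v' p.2) ∂μ.prod μ := by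
      refine integral_congr_ae ?_
      filter_upwards [hc] with p hp
      rw [hp]; rfl
    rw [h2] at h1
    refine h1.congr fun N => ?_
    rw [integral_birkhoffAverage_mul hTT.measurable hfm hwm' hfC hwD']
    congr 1
    refine Finset.sum_congr rfl fun n _ => ?_
    rw [sq, ← integral_prod_mul]
    refine integral_congr_ae (ae_of_all _ fun p => ?_)
    simp only [hf, Prod.map_iterate, Prod.map_fst, Prod.map_snd]
    ring
  -- Testing against the constant 1 identifies c: a mean zero function has zero correlation with it
  -- at every time.
  have h0 := key (fun _ => 1) measurable_const 1 (by simp)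
  have hc0 : c = 0 := by
    have h1 : ∀ n : ℕ, ∫ x, u (T^[n] x) * 1 ∂μ = 0 := by
      intro n
      simp only [mul_one]
      rw [← hu0]
      exact (hT.iterate n).integral_comp' (f := ⟨⟨T^[n], T.symm^[n],
        fun x => by simpa using (Function.LeftInverse.iterate T.symm_apply_apply n) x,
        fun x => by simpa using (Function.LeftInverse.iterate T.apply_symm_apply n) x⟩,
        T.measurable.iterate n, T.symm.measurable.iterate n⟩) u
    simp only [h1] at h0
    have h2 := tendsto_nhds_unique h0 (b := (0 : ℝ)) (by simp)
    simpa using h2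
  have := key v hv D hD
  simpa [hc0] using this

omit [IsProbabilityMeasure μ] in
theorem integral_comp_ipow (hT : MeasurePreserving T μ μ) (p : ℤ) (u : X → ℝ) :
    ∫ x, u (ipow T p x) ∂μ = ∫ x, u x ∂μ :=
  (measurePreserving_ipow hT p).integral_comp' u

/-- For `a = b > 0` the times `n * b` with `n < N` lie among the first `N * b` integers, so the
average grows by a factor b at most. For negative a, invariance moves the power to v, which may be
centred because u has mean zero. -/
theorem tendsto_average_sq_correlation_ipow (hT : MeasurePreserving T μ μ)
    (hTT : Ergodic (Prod.map T T) (μ.prod μ)) {u v : X → ℝ} (hu : Measurable u)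
    (hv : Measurable v) {C D : ℝ} (hC : ∀ x, |u x| ≤ C) (hD : ∀ x, |v x| ≤ D)
    (hu0 : ∫ x, u x ∂μ = 0) {a : ℤ} (ha : a ≠ 0) :
    Tendsto (fun N : ℕ => (N : ℝ)⁻¹ * ∑ n ∈ Finset.range N,
      (∫ x, u (ipow T (n * a) x) * v x ∂μ) ^ 2) atTop (𝓝 0) := by
  have main : ∀ (u v : X → ℝ), Measurable u → Measurable v → ∀ C D : ℝ, (∀ x, |u x| ≤ C) →
      (∀ x, |v x| ≤ D) → ∫ x, u x ∂μ = 0 → ∀ b : ℕ, b ≠ 0 →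
      Tendsto (fun N : ℕ => (N : ℝ)⁻¹ * ∑ n ∈ Finset.range N,
        (∫ x, u (ipow T (n * b) x) * v x ∂μ) ^ 2) atTop (𝓝 0) := by
    intro u v hu hv C D hC hD hu0 b hb
    have h1 := tendsto_average_sq_correlation hT hTT hu hv hC hD hu0
    have h2 : Tendsto (fun N : ℕ => N * b) atTop atTop :=
      tendsto_atTop_mono (fun N => Nat.le_mul_of_pos_right N (Nat.pos_of_ne_zero hb)) tendsto_id
    have h3 := (h1.comp h2).const_mul (b : ℝ)
    rw [mul_zero] at h3
    refine squeeze_zero (fun N => by positivity) (fun N => ?_) h3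
    simp only [Function.comp_apply]
    have hsub : ∑ n ∈ Finset.range N, (∫ x, u (ipow T (n * b) x) * v x ∂μ) ^ 2
        ≤ ∑ n ∈ Finset.range (N * b), (∫ x, u (T^[n] x) * v x ∂μ) ^ 2 := by
      have hinj : Set.InjOn (fun n : ℕ => n * b) (Finset.range N) := fun x _ y _ h =>
        Nat.eq_of_mul_eq_mul_right (Nat.pos_of_ne_zero hb) h
      have : ∑ n ∈ Finset.range N, (∫ x, u (ipow T (n * b) x) * v x ∂μ) ^ 2
          = ∑ n ∈ (Finset.range N).image (fun n => n * b),
            (∫ x, u (T^[n] x) * v x ∂μ) ^ 2 := by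
        rw [Finset.sum_image hinj]
        refine Finset.sum_congr rfl fun n _ => ?_
        simp only [← ipow_natCast, Nat.cast_mul]
      rw [this]
      refine Finset.sum_le_sum_of_subset_of_nonneg ?_ fun _ _ _ => by positivity
      intro n hn
      simp only [Finset.mem_image, Finset.mem_range] at hn ⊢
      obtain ⟨k, hk, rfl⟩ := hn
      exact Nat.mul_lt_mul_of_pos_right hk (Nat.pos_of_ne_zero hb)
    have hb' : (b : ℝ) ≠ 0 := by exact_mod_cast hb
    calc _ ≤ (N : ℝ)⁻¹ * ∑ n ∈ Finset.range (N * b), (∫ x, u (T^[n] x) * v x ∂μ) ^ 2 := by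
          gcongr
      _ = _ := by
          push_cast
          rw [mul_inv, ← mul_assoc]
          congr 1
          field_simp
  obtain ⟨b, rfl | rfl⟩ := Int.eq_nat_or_neg a
  · exact main u v hu hv C D hC hD hu0 b (by simpa using ha)
  · set e := ∫ x, v x ∂μ with he
    have hvi : Integrable v μ := integrable_of_abs_le hv hD
    have hui : Integrable u μ := integrable_of_abs_le hu hC
    have h1 := main (fun x => v x - e) u (hv.sub_const e) hu (D + |e|) C
      (fun x => (abs_sub _ _).trans (by gcongr; exact hD x)) hC
      (by rw [integral_sub hvi (integrable_const _)]; simp [he]) b (by simpa using ha)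
    refine h1.congr fun N => ?_
    congr 1
    refine Finset.sum_congr rfl fun n _ => ?_
    congr 1
    have h2 : ∫ x, u (ipow T (n * -(b : ℤ)) x) * v x ∂μ
        = ∫ x, u x * v (ipow T (n * b) x) ∂μ := by
      rw [← integral_comp_ipow hT (n * b)]
      refine integral_congr_ae (ae_of_all _ fun x => ?_)
      simp only [mul_neg, ipow_neg_ipow]
    rw [h2]
    have h3 : Integrable (fun x => v (ipow T (n * b) x) * u x) μ :=
      (integrable_of_abs_le (hv.comp (ipow T (n * b)).measurable) fun x => hD _).mul_bdd
        hu.aestronglyMeasurable (ae_of_all _ hC)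
    simp only [sub_mul]
    rw [integral_sub h3 (hui.const_mul e), integral_const_mul, hu0, mul_zero, sub_zero]
    simp only [mul_comm]

/-- The averages of `u(x) v(y)` along `T ^ a × T ^ c` tend to zero in mean, for `a ≠ 0`. -/
theorem tendsto_birkhoffAverage_ipow_prod (hT : MeasurePreserving T μ μ)
    (hTT : Ergodic (Prod.map T T) (μ.prod μ)) {u v : X → ℝ} (hu : Measurable u)
    (hv : Measurable v) {C D : ℝ} (hC : ∀ x, |u x| ≤ C) (hD : ∀ x, |v x| ≤ D)
    (hu0 : ∫ x, u x ∂μ = 0) {a : ℤ} (ha : a ≠ 0) (c : ℤ) :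
    Tendsto (fun N : ℕ => ∫⁻ p, ‖birkhoffAverage ℝ (Prod.map (ipow T a) (ipow T c))
      (fun p => u p.1 * v p.2) N p‖ₑ ∂μ.prod μ) atTop (𝓝 0) := by
  have hS : MeasurePreserving (Prod.map (ipow T a) (ipow T c)) (μ.prod μ) (μ.prod μ) :=
    (measurePreserving_ipow hT a).prod (measurePreserving_ipow hT c)
  set f : X × X → ℝ := fun p => u p.1 * v p.2 with hf
  have hfm : Measurable f := (hu.comp measurable_fst).mul (hv.comp measurable_snd)
  have hfC : ∀ p, |f p| ≤ C * D := fun p => by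
    rw [hf, abs_mul]
    exact mul_le_mul (hC _) (hD _) (abs_nonneg _) ((abs_nonneg _).trans (hC p.1))
  obtain ⟨g, hg, hgS, hlim⟩ := exists_tendsto_birkhoffAverage hS hfm hfC
  have hint : ∀ N, Integrable (birkhoffAverage ℝ (Prod.map (ipow T a) (ipow T c)) f N)
      (μ.prod μ) := fun N =>
    integrable_of_abs_le (measurable_birkhoffAverage hS.measurable hfm N)
      (abs_birkhoffAverage_le hfC N)
  have hgi : Integrable g (μ.prod μ) := by
    obtain ⟨N, hN⟩ := (hlim.eventually (gt_mem_nhds zero_lt_one)).exists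
    have h1 : Integrable (fun p => birkhoffAverage ℝ (Prod.map (ipow T a) (ipow T c)) f N p
        - g p) (μ.prod μ) :=
      ⟨((hint N).1.sub hg.aestronglyMeasurable), hN.trans ENNReal.one_lt_top⟩
    have := (hint N).sub h1
    refine this.congr (ae_of_all _ fun p => ?_)
    simp
  have hg0 : g =ᵐ[μ.prod μ] 0 := by
    refine ae_eq_zero_of_forall_setIntegral_prod_eq_zero hgi fun E F hE hF => ?_
    set e : X → ℝ := E.indicator fun _ => 1 with he
    set φ : X → ℝ := F.indicator fun _ => 1 with hφ
    have hem : Measurable e := measurable_const.indicator hE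
    have hφm : Measurable φ := measurable_const.indicator hF
    have hwm : Measurable fun p : X × X => e p.1 * φ p.2 :=
      (hem.comp measurable_fst).mul (hφm.comp measurable_snd)
    have hwD : ∀ p : X × X, |e p.1 * φ p.2| ≤ 1 := fun p => by
      rw [abs_mul]
      exact mul_le_one₀ (abs_indicator_one_le _ _) (abs_nonneg _) (abs_indicator_one_le _ _)
    have h1 := tendsto_integral_mul_of_lintegral hg hint hwm hwD hlim
    have h2 : ∫ p, g p * (e p.1 * φ p.2) ∂μ.prod μ = ∫ p in E ×ˢ F, g p ∂μ.prod μ := by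
      rw [← integral_indicator (hE.prod hF)]
      refine integral_congr_ae (ae_of_all _ fun p => ?_)
      by_cases h1 : p.1 ∈ E <;> by_cases h2 : p.2 ∈ F <;> simp [he, hφ, h1, h2, Set.indicator]
    rw [h2] at h1
    refine tendsto_nhds_unique h1 ?_
    set A : ℕ → ℝ := fun n => ∫ x, u (ipow T (n * a) x) * e x ∂μ with hA
    set B : ℕ → ℝ := fun n => ∫ x, v (ipow T (n * c) x) * φ x ∂μ with hB
    have hBD : ∀ n, |B n| ≤ D := fun n => by
      have : ∀ x, ‖v (ipow T (n * c) x) * φ x‖ ≤ D := fun x => by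
        rw [norm_mul]
        exact (mul_le_of_le_one_right (norm_nonneg _) (abs_indicator_one_le _ _)).trans (hD _)
      simpa using norm_integral_le_of_norm_le_const (μ := μ) (ae_of_all _ this)
    have h3 : ∀ N : ℕ, ∫ p, birkhoffAverage ℝ (Prod.map (ipow T a) (ipow T c)) f N p
        * (e p.1 * φ p.2) ∂μ.prod μ = (N : ℝ)⁻¹ * ∑ n ∈ Finset.range N, A n * B n := by
      intro N
      rw [integral_birkhoffAverage_mul hS.measurable hfm hwm hfC hwD]
      congr 1
      refine Finset.sum_congr rfl fun n _ => ?_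
      rw [hA, hB, ← integral_prod_mul]
      refine integral_congr_ae (ae_of_all _ fun p => ?_)
      simp only [hf, Prod.map_iterate, Prod.map_fst, Prod.map_snd, ipow_natCast_mul]
      ring
    simp only [h3]
    have h4 := tendsto_average_sq_correlation_ipow hT hTT hu hem hC
      (fun x => abs_indicator_one_le E x) hu0 ha
    rw [tendsto_zero_iff_norm_tendsto_zero]
    -- Cauchy–Schwarz: the first factor tends to zero in square mean and the second is bounded by D.
    -- No condition on c is needed, since only the first correlation has to decay.
    have h5 : Tendsto (fun N : ℕ => √(D ^ 2 * ((N : ℝ)⁻¹ * ∑ n ∈ Finset.range N, A n ^ 2)))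
        atTop (𝓝 0) := by
      have := (h4.const_mul (D ^ 2)).sqrt
      simpa using this
    refine squeeze_zero (fun _ => norm_nonneg _) (fun N => ?_) h5
    rw [Real.norm_eq_abs]
    refine Real.abs_le_sqrt ?_
    rcases eq_or_ne N 0 with rfl | hN
    · simp
    have hN' : (0 : ℝ) < N := by positivity
    have h6 := Finset.sum_mul_sq_le_sq_mul_sq (Finset.range N) A B
    have h7 : ∑ n ∈ Finset.range N, B n ^ 2 ≤ N * D ^ 2 := by
      refine (Finset.sum_le_sum fun n _ => sq_le_sq' (abs_le.1 (hBD n)).1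
        (abs_le.1 (hBD n)).2).trans ?_
      simp
    have h8 : (∑ n ∈ Finset.range N, A n * B n) ^ 2
        ≤ (∑ n ∈ Finset.range N, A n ^ 2) * (N * D ^ 2) :=
      h6.trans (mul_le_mul_of_nonneg_left h7 (by positivity))
    rw [mul_pow]
    calc ((N : ℝ)⁻¹) ^ 2 * (∑ n ∈ Finset.range N, A n * B n) ^ 2
        ≤ ((N : ℝ)⁻¹) ^ 2 * ((∑ n ∈ Finset.range N, A n ^ 2) * (N * D ^ 2)) := by gcongr
      _ = _ := by field_simp
  refine hlim.congr fun N => lintegral_congr_ae ?_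
  filter_upwards [hg0] with p hp
  rw [hp]; simp

/-- A measure on `X × R × X` whose outer coordinates are independent and which is invariant under
`T ^ a × id × T ^ c` with `a ≠ 0` has its first coordinate independent of the others. -/
theorem eq_prod_of_invariant (hT : MeasurePreserving T μ μ)
    (hTT : Ergodic (Prod.map T T) (μ.prod μ)) {R : Type*} [MeasurableSpace R]
    {ν : Measure (X × R × X)} (h13 : ν.map (fun p => (p.1, p.2.2)) = μ.prod μ) {a c : ℤ}
    (ha : a ≠ 0) (hinv : ν.map (fun p => (ipow T a p.1, p.2.1, ipow T c p.2.2)) = ν) :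
    ν = μ.prod (ν.map Prod.snd) := by
  have hm13 : Measurable fun p : X × R × X => (p.1, p.2.2) :=
    measurable_fst.prodMk (measurable_snd.comp measurable_snd)
  have hν : IsProbabilityMeasure ν := by
    have h1 : IsProbabilityMeasure (ν.map (fun p => (p.1, p.2.2))) := by rw [h13]; infer_instance
    exact Measure.isProbabilityMeasure_of_map (fun p : X × R × X => (p.1, p.2.2))
  have hν2 : IsProbabilityMeasure (ν.map Prod.snd) :=
    Measure.isProbabilityMeasure_map measurable_snd.aemeasurable
  set G : X × R × X → X × R × X := fun p => (ipow T a p.1, p.2.1, ipow T c p.2.2) with hG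
  have hGm : Measurable G := by
    refine ((ipow T a).measurable.comp measurable_fst).prodMk ?_
    exact (measurable_fst.comp measurable_snd).prodMk
      ((ipow T c).measurable.comp (measurable_snd.comp measurable_snd))
  have hGp : MeasurePreserving G ν ν := ⟨hGm, hinv⟩
  refine Measure.ext_prod₃ fun {A Q B} hA hQ hB => ?_
  set u : X → ℝ := fun x => A.indicator (fun _ => 1) x - μ.real A with hu
  set v : X → ℝ := B.indicator fun _ => 1 with hv
  set q : R → ℝ := Q.indicator fun _ => 1 with hq
  have hum : Measurable u := (measurable_const.indicator hA).sub_const _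
  have hvm : Measurable v := measurable_const.indicator hB
  have hqm : Measurable q := measurable_const.indicator hQ
  have huC : ∀ x, |u x| ≤ 1 + |μ.real A| := fun x =>
    (abs_sub _ _).trans (by gcongr; exact abs_indicator_one_le A x)
  have hvC : ∀ x, |v x| ≤ 1 := abs_indicator_one_le B
  have hqC : ∀ x, |q x| ≤ 1 := abs_indicator_one_le Q
  have hu0 : ∫ x, u x ∂μ = 0 := by
    rw [hu, integral_sub ((integrable_const _).indicator hA) (integrable_const _),
      integral_indicator_const _ hA]
    simp
  have hlim := tendsto_birkhoffAverage_ipow_prod hT hTT hum hvm huC hvC hu0 ha c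
  set f : X × X → ℝ := fun p => u p.1 * v p.2 with hf
  have hfm : Measurable f := (hum.comp measurable_fst).mul (hvm.comp measurable_snd)
  have hfC : ∀ p, |f p| ≤ (1 + |μ.real A|) * 1 := fun p => by
    rw [hf, abs_mul]
    exact mul_le_mul (huC _) (hvC _) (abs_nonneg _) (by positivity)
  set S := Prod.map (ipow T a) (ipow T c) with hS
  have hSm : Measurable S := (ipow T a).measurable.prodMap (ipow T c).measurable
  have hGiter : ∀ n : ℕ, ∀ p, (G^[n] p).2.1 = p.2.1 ∧
      ((G^[n] p).1, (G^[n] p).2.2) = S^[n] (p.1, p.2.2) := by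
    intro n
    induction n with
    | zero => intro p; exact ⟨rfl, rfl⟩
    | succ n ih =>
      intro p
      rw [Function.iterate_succ_apply', Function.iterate_succ_apply', ← (ih p).2]
      exact ⟨(ih p).1, rfl⟩
  have hqm' : Measurable fun p : X × R × X => q p.2.1 :=
    hqm.comp (measurable_fst.comp measurable_snd)
  -- The map fixes the middle coordinate, so q is unchanged along orbits and replacing f by its
  -- average does not alter the integral. The average tends to zero because the outer coordinates
  -- have law `μ.prod μ`.
  have hconst : ∀ N : ℕ, N ≠ 0 → ∫ p, birkhoffAverage ℝ S f N (p.1, p.2.2) * q p.2.1 ∂ν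
      = ∫ p, f (p.1, p.2.2) * q p.2.1 ∂ν := by
    intro N hN
    have hav : ∀ p : X × R × X, birkhoffAverage ℝ S f N (p.1, p.2.2)
        = birkhoffAverage ℝ G (fun p => f (p.1, p.2.2)) N p := by
      intro p
      simp only [birkhoffAverage, birkhoffSum, (hGiter _ p).2]
    simp only [hav]
    rw [integral_birkhoffAverage_mul (f := fun p : X × R × X => f (p.1, p.2.2)) hGm
      (hfm.comp hm13) hqm' (fun p => hfC _) (fun p => hqC _)]
    have : ∀ n : ℕ, ∫ p, f ((G^[n] p).1, (G^[n] p).2.2) * q p.2.1 ∂ν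
        = ∫ p, f (p.1, p.2.2) * q p.2.1 ∂ν := by
      intro n
      have h1 : ∫ p, f ((G^[n] p).1, (G^[n] p).2.2) * q (G^[n] p).2.1 ∂ν
          = ∫ p, f (p.1, p.2.2) * q p.2.1 ∂ν := by
        have hm : Measurable fun p : X × R × X => f (p.1, p.2.2) * q p.2.1 :=
          (hfm.comp hm13).mul hqm'
        conv_rhs => rw [← (hGp.iterate n).map_eq]
        rw [integral_map (hGm.iterate n).aemeasurable hm.aestronglyMeasurable]
      rw [← h1]
      simp only [(hGiter n _).1]
    simp only [this]
    have hN' : (N : ℝ) ≠ 0 := by exact_mod_cast hN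
    simp
    field_simp
  have hzero : ∫ p, f (p.1, p.2.2) * q p.2.1 ∂ν = 0 := by
    have h1 : Tendsto (fun N : ℕ => ∫ p, birkhoffAverage ℝ S f N (p.1, p.2.2) * q p.2.1 ∂ν)
        atTop (𝓝 (∫ p : X × R × X, (0 : ℝ) * q p.2.1 ∂ν)) := by
      refine tendsto_integral_mul_of_lintegral measurable_const (fun N => ?_) hqm'
        (fun p => hqC _) ?_
      · exact integrable_of_abs_le ((measurable_birkhoffAverage hSm hfm N).comp hm13)
          fun p => abs_birkhoffAverage_le hfC N _
      · refine hlim.congr fun N => ?_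
        rw [← h13, lintegral_map (measurable_birkhoffAverage hSm hfm N).enorm hm13]
        simp
    have h2 := h1.congr' (f₂ := fun _ : ℕ => ∫ p, f (p.1, p.2.2) * q p.2.1 ∂ν) (by
      filter_upwards [eventually_ne_atTop 0] with N hN using hconst N hN)
    simpa using tendsto_nhds_unique tendsto_const_nhds h2
  have hsplit : ∫ p, f (p.1, p.2.2) * q p.2.1 ∂ν
      = ν.real (A ×ˢ Q ×ˢ B) - μ.real A * ν.real (Prod.snd ⁻¹' (Q ×ˢ B)) := by
    have hE := hA.prod (hQ.prod hB)
    have hF : MeasurableSet (Prod.snd ⁻¹' (Q ×ˢ B) : Set (X × R × X)) :=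
      measurable_snd (hQ.prod hB)
    have : ∀ p : X × R × X, f (p.1, p.2.2) * q p.2.1
        = (A ×ˢ Q ×ˢ B).indicator (fun _ => (1 : ℝ)) p
          - μ.real A * (Prod.snd ⁻¹' (Q ×ˢ B)).indicator (fun _ => (1 : ℝ)) p := by
      intro p
      by_cases h1 : p.1 ∈ A <;> by_cases h2 : p.2.1 ∈ Q <;> by_cases h3 : p.2.2 ∈ B <;>
        simp [hf, hu, hv, hq, h1, h2, h3, Set.indicator]
    simp only [this]
    rw [integral_sub ((integrable_const _).indicator hE)
      (((integrable_const _).indicator hF).const_mul _), integral_const_mul,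
      integral_indicator_const _ hE, integral_indicator_const _ hF]
    simp
  have hfin : ν.real (A ×ˢ Q ×ˢ B) = μ.real A * ν.real (Prod.snd ⁻¹' (Q ×ˢ B)) := by
    linarith
  rw [Measure.prod_prod, Measure.map_apply measurable_snd (hQ.prod hB),
    ← ENNReal.toReal_eq_toReal_iff' (by finiteness) (by finiteness), ENNReal.toReal_mul]
  exact hfin

end WeakMixing

end SelfJoining

namespace SelfJoining

theorem Ergodic.map_of_semiconj {Y Z : Type*} [MeasurableSpace Y] [MeasurableSpace Z]
    {S : Y → Y} {Ω : Measure Y} (h : Ergodic S Ω) {R : Z → Z} (hR : Measurable R) {f : Y → Z}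
    (hf : Measurable f) (hfS : ∀ y, f (S y) = R (f y)) : Ergodic R (Ω.map f) :=
  (MeasurePreserving.mk hf rfl).ergodic_of_ergodic_semiconj h hR hfS

/-! ### Pairwise independent triple joinings and their rigidity under shifts. -/

section TripleJoinings

variable {X : Type u} [MeasurableSpace X]

/-- `ν` is an ergodic self-joining of order three with independent pairs of coordinates. -/
structure IsTripleJoining (μ : Measure X) (T : X ≃ᵐ X) (ν : Measure (X × X × X)) : Prop where
  ergodic : Ergodic (Prod.map T (Prod.map T T)) ν
  map12 : ν.map (fun p => (p.1, p.2.1)) = μ.prod μ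
  map13 : ν.map (fun p => (p.1, p.2.2)) = μ.prod μ
  map23 : ν.map (fun p => (p.2.1, p.2.2)) = μ.prod μ

/-- Ergodic self-joinings of order two are the product or a shifted diagonal measure. -/
def HasMinimalPairs (μ : Measure X) (T : X ≃ᵐ X) : Prop :=
  ∀ ρ : Measure (X × X), Ergodic (Prod.map T T) ρ → ρ.map Prod.fst = μ → ρ.map Prod.snd = μ →
    ρ = μ.prod μ ∨ ∃ p : ℤ, ρ = offDiagonal μ T p

/-- Ergodic self-joinings of order three with independent pairs of coordinates are products. -/
def HasProductTriples (μ : Measure X) (T : X ≃ᵐ X) : Prop :=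
  ∀ ν : Measure (X × X × X), IsTripleJoining μ T ν → ν = μ.prod (μ.prod μ)

/-- The map `T ^ a × T ^ b × T ^ c`. -/
def shift (T : X ≃ᵐ X) (a b c : ℤ) (p : X × X × X) : X × X × X :=
  (ipow T a p.1, ipow T b p.2.1, ipow T c p.2.2)

theorem measurable_shift (T : X ≃ᵐ X) (a b c : ℤ) : Measurable (shift T a b c) := by
  unfold shift
  fun_prop

theorem shift_shift (T : X ≃ᵐ X) (a b c a' b' c' : ℤ) (p : X × X × X) :
    shift T a b c (shift T a' b' c' p) = shift T (a + a') (b + b') (c + c') p := by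
  simp [shift, ipow_add]

theorem map_shift_map_shift (T : X ≃ᵐ X) (ν : Measure (X × X × X)) (a b c a' b' c' : ℤ) :
    (ν.map (shift T a b c)).map (shift T a' b' c')
      = ν.map (shift T (a' + a) (b' + b) (c' + c)) := by
  rw [Measure.map_map (measurable_shift ..) (measurable_shift ..)]
  congr 1
  funext p
  exact shift_shift ..

theorem map_shift_zero (T : X ≃ᵐ X) (ν : Measure (X × X × X)) : ν.map (shift T 0 0 0) = ν :=
  Measure.map_id

theorem map_shift_sub_eq {T : X ≃ᵐ X} {ν : Measure (X × X × X)} {a b c a' b' c' : ℤ}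
    (h : ν.map (shift T a b c) = ν.map (shift T a' b' c')) :
    ν.map (shift T (a - a') (b - b') (c - c')) = ν := by
  have h1 := congrArg (fun m => m.map (shift T (-a') (-b') (-c'))) h
  simp only [map_shift_map_shift, neg_add_cancel, map_shift_zero] at h1
  rw [← h1]
  congr 2 <;> ring

variable {μ : Measure X} [IsProbabilityMeasure μ] {T : X ≃ᵐ X}

theorem map_swap12_prod :
    (μ.prod (μ.prod μ)).map (fun p => (p.2.1, p.1, p.2.2)) = μ.prod (μ.prod μ) := by
  have hm : Measurable fun p : X × X × X => (p.2.1, p.1, p.2.2) := by fun_prop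
  refine Measure.ext_prod₃ fun {A B C} hA hB hC => ?_
  rw [Measure.map_apply hm (hA.prod (hB.prod hC))]
  have : (fun p : X × X × X => (p.2.1, p.1, p.2.2)) ⁻¹' A ×ˢ B ×ˢ C = B ×ˢ A ×ˢ C := by
    ext p; simp; tauto
  rw [this]
  simp only [Measure.prod_prod]
  ring

theorem map_swap23_prod :
    (μ.prod (μ.prod μ)).map (fun p => (p.1, p.2.2, p.2.1)) = μ.prod (μ.prod μ) := by
  have hm : Measurable fun p : X × X × X => (p.1, p.2.2, p.2.1) := by fun_prop
  refine Measure.ext_prod₃ fun {A B C} hA hB hC => ?_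
  rw [Measure.map_apply hm (hA.prod (hB.prod hC))]
  have : (fun p : X × X × X => (p.1, p.2.2, p.2.1)) ⁻¹' A ×ˢ B ×ˢ C = A ×ˢ C ×ˢ B := by
    ext p; simp; tauto
  rw [this]
  simp only [Measure.prod_prod]
  ring

namespace IsTripleJoining

variable {ν : Measure (X × X × X)}

theorem isProbabilityMeasure (h : IsTripleJoining μ T ν) : IsProbabilityMeasure ν := by
  have h1 : IsProbabilityMeasure (ν.map (fun p => (p.1, p.2.1))) := by
    rw [h.map12]; infer_instance
  exact Measure.isProbabilityMeasure_of_map (fun p : X × X × X => (p.1, p.2.1))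

theorem map1 (h : IsTripleJoining μ T ν) : ν.map (fun p => p.1) = μ := by
  have h1 : (ν.map (fun p => (p.1, p.2.1))).map Prod.fst = μ := by
    rw [h.map12, Measure.map_fst_prod]; simp
  rwa [Measure.map_map (by fun_prop) (by fun_prop)] at h1

theorem map2 (h : IsTripleJoining μ T ν) : ν.map (fun p => p.2.1) = μ := by
  have h1 : (ν.map (fun p => (p.1, p.2.1))).map Prod.snd = μ := by
    rw [h.map12, Measure.map_snd_prod]; simp
  rwa [Measure.map_map (by fun_prop) (by fun_prop)] at h1

theorem map3 (h : IsTripleJoining μ T ν) : ν.map (fun p => p.2.2) = μ := by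
  have h1 : (ν.map (fun p => (p.1, p.2.2))).map Prod.snd = μ := by
    rw [h.map13, Measure.map_snd_prod]; simp
  rwa [Measure.map_map (by fun_prop) (by fun_prop)] at h1

theorem measurePreserving (h : IsTripleJoining μ T ν) : MeasurePreserving T μ μ := by
  have := Ergodic.map_of_semiconj h.ergodic T.measurable (f := fun p : X × X × X => p.1)
    (by fun_prop) (fun _ => rfl)
  rw [h.map1] at this
  exact this.toMeasurePreserving

omit [IsProbabilityMeasure μ] in
theorem ergodic_prod (h : IsTripleJoining μ T ν) : Ergodic (Prod.map T T) (μ.prod μ) := by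
  have := Ergodic.map_of_semiconj h.ergodic (T.measurable.prodMap T.measurable)
    (f := fun p : X × X × X => (p.1, p.2.1)) (by fun_prop) (fun _ => rfl)
  rwa [h.map12] at this

theorem swap12 (h : IsTripleJoining μ T ν) :
    IsTripleJoining μ T (ν.map (fun p => (p.2.1, p.1, p.2.2))) := by
  have hsw : (μ.prod μ).map (fun p => (p.2, p.1)) = μ.prod μ := Measure.prod_swap
  refine ⟨Ergodic.map_of_semiconj h.ergodic (by fun_prop) (by fun_prop) (fun _ => rfl), ?_, ?_, ?_⟩
  · rw [Measure.map_map (by fun_prop) (by fun_prop), ← hsw, ← h.map12,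
      Measure.map_map (by fun_prop) (by fun_prop)]
    rfl
  · rw [Measure.map_map (by fun_prop) (by fun_prop)]
    exact h.map23
  · rw [Measure.map_map (by fun_prop) (by fun_prop)]
    exact h.map13

theorem swap23 (h : IsTripleJoining μ T ν) :
    IsTripleJoining μ T (ν.map (fun p => (p.1, p.2.2, p.2.1))) := by
  have hsw : (μ.prod μ).map (fun p => (p.2, p.1)) = μ.prod μ := Measure.prod_swap
  refine ⟨Ergodic.map_of_semiconj h.ergodic (by fun_prop) (by fun_prop) (fun _ => rfl), ?_, ?_, ?_⟩
  · rw [Measure.map_map (by fun_prop) (by fun_prop)]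
    exact h.map13
  · rw [Measure.map_map (by fun_prop) (by fun_prop)]
    exact h.map12
  · rw [Measure.map_map (by fun_prop) (by fun_prop), ← hsw, ← h.map23,
      Measure.map_map (by fun_prop) (by fun_prop)]
    rfl

theorem map_shift_swap12 {a b c : ℤ} (hs : ν.map (shift T a b c) = ν) :
    (ν.map (fun p => (p.2.1, p.1, p.2.2))).map (shift T b a c)
      = ν.map (fun p => (p.2.1, p.1, p.2.2)) := by
  conv_rhs => rw [← hs]
  rw [Measure.map_map (measurable_shift ..) (by fun_prop),
    Measure.map_map (by fun_prop) (measurable_shift ..)]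
  rfl

theorem map_shift_swap23 {a b c : ℤ} (hs : ν.map (shift T a b c) = ν) :
    (ν.map (fun p => (p.1, p.2.2, p.2.1))).map (shift T a c b)
      = ν.map (fun p => (p.1, p.2.2, p.2.1)) := by
  conv_rhs => rw [← hs]
  rw [Measure.map_map (measurable_shift ..) (by fun_prop),
    Measure.map_map (by fun_prop) (measurable_shift ..)]
  rfl

theorem eq_prod_of_swap12 (h : ν.map (fun p => (p.2.1, p.1, p.2.2)) = μ.prod (μ.prod μ)) :
    ν = μ.prod (μ.prod μ) := by
  have h1 := congrArg (fun m => m.map (fun p : X × X × X => (p.2.1, p.1, p.2.2))) h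
  simp only [map_swap12_prod] at h1
  rw [Measure.map_map (by fun_prop) (by fun_prop)] at h1
  rw [← h1]
  exact Measure.map_id.symm

theorem eq_prod_of_swap23 (h : ν.map (fun p => (p.1, p.2.2, p.2.1)) = μ.prod (μ.prod μ)) :
    ν = μ.prod (μ.prod μ) := by
  have h1 := congrArg (fun m => m.map (fun p : X × X × X => (p.1, p.2.2, p.2.1))) h
  simp only [map_swap23_prod] at h1
  rw [Measure.map_map (by fun_prop) (by fun_prop)] at h1
  rw [← h1]
  exact Measure.map_id.symm

theorem eq_prod_of_map_shift_aux (h : IsTripleJoining μ T ν) {a c : ℤ} (ha : a ≠ 0)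
    (hs : ν.map (shift T a 0 c) = ν) : ν = μ.prod (μ.prod μ) := by
  have := eq_prod_of_invariant h.measurePreserving h.ergodic_prod h.map13 ha (c := c) hs
  rw [this]
  congr 1
  exact h.map23

/-- A triple joining invariant under a nontrivial shift that fixes some coordinate is the
product. -/
theorem eq_prod_of_map_shift (h : IsTripleJoining μ T ν) {a b c : ℤ}
    (h0 : a = 0 ∨ b = 0 ∨ c = 0) (h1 : a ≠ 0 ∨ b ≠ 0 ∨ c ≠ 0)
    (hs : ν.map (shift T a b c) = ν) : ν = μ.prod (μ.prod μ) := by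
  have hb0 : ∀ {ν : Measure (X × X × X)}, IsTripleJoining μ T ν → ∀ {a c : ℤ},
      (a ≠ 0 ∨ c ≠ 0) → ν.map (shift T a 0 c) = ν → ν = μ.prod (μ.prod μ) := by
    intro ν h a c hac hs
    rcases hac with ha | hc
    · exact h.eq_prod_of_map_shift_aux ha hs
    -- Three adjacent transpositions exchange the outer coordinates and keep the middle one in
    -- place.
    · refine eq_prod_of_swap12 (eq_prod_of_swap23 (eq_prod_of_swap12 ?_))
      exact h.swap12.swap23.swap12.eq_prod_of_map_shift_aux hc
        (map_shift_swap12 (map_shift_swap23 (map_shift_swap12 hs)))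
  rcases h0 with rfl | rfl | rfl
  · exact eq_prod_of_swap12 (hb0 h.swap12 (by tauto) (map_shift_swap12 hs))
  · exact hb0 h (by tauto) hs
  · exact eq_prod_of_swap23 (hb0 h.swap23 (by tauto) (map_shift_swap23 hs))

end IsTripleJoining

/-! ### Minimal pairs and the finiteness of fibres. -/

section Pairs

variable [StandardBorelSpace X] {Y : Type*} [MeasurableSpace Y]

theorem measurableSet_graph_ipow (T : X ≃ᵐ X) (p : ℤ) :
    MeasurableSet {q : X × X | q.2 = ipow T p q.1} :=
  measurableSet_eq_fun measurable_snd ((ipow T p).measurable.comp measurable_fst)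

omit [IsProbabilityMeasure μ] in
-- The form in which minimality is applied throughout: two equivariant factor maps of one ergodic
-- system onto the base system are independent or differ by a power of T.
theorem HasMinimalPairs.map_eq_or (h : HasMinimalPairs μ T) {S : Y → Y} {Ω : Measure Y}
    (hΩ : Ergodic S Ω) {f g : Y → X} (hf : Measurable f) (hg : Measurable g)
    (hfS : ∀ y, f (S y) = T (f y)) (hgS : ∀ y, g (S y) = T (g y)) (hfμ : Ω.map f = μ)
    (hgμ : Ω.map g = μ) :
    Ω.map (fun y => (f y, g y)) = μ.prod μ ∨ ∃ p : ℤ, ∀ᵐ y ∂Ω, g y = ipow T p (f y) := by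
  have hfg : Measurable fun y => (f y, g y) := hf.prodMk hg
  have herg : Ergodic (Prod.map T T) (Ω.map fun y => (f y, g y)) :=
    Ergodic.map_of_semiconj hΩ (T.measurable.prodMap T.measurable) hfg
      (fun y => by simp [hfS, hgS])
  rcases h _ herg (by rw [Measure.map_map measurable_fst hfg]; exact hfμ)
    (by rw [Measure.map_map measurable_snd hfg]; exact hgμ) with h1 | ⟨p, hp⟩
  · exact Or.inl h1
  · refine Or.inr ⟨p, ?_⟩
    refine ae_of_ae_map (p := fun q : X × X => q.2 = ipow T p q.1) hfg.aemeasurable ?_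
    rw [hp, offDiagonal_eq_map, ae_map_iff (by fun_prop) (measurableSet_graph_ipow T p)]
    exact ae_of_all _ fun x => rfl

theorem measurable_condKernel_atom {B : Type*} [MeasurableSpace B] [Nonempty X]
    (ρ : Measure (B × X)) [IsFiniteMeasure ρ] :
    Measurable fun p : B × X => ρ.condKernel p.1 {p.2} := by
  have hE : MeasurableSet {q : (B × X) × X | q.2 = q.1.2} :=
    measurableSet_eq_fun measurable_snd (measurable_snd.comp measurable_fst)
  exact Kernel.measurable_kernel_prodMk_left
    (κ := ρ.condKernel.comap (Prod.fst : B × X → B) measurable_fst) hE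

/-- An ergodic joining of a system with minimal pairs is either the product or has finite
fibres, unless it is invariant under a power of `T` acting on the second coordinate alone. -/
theorem HasMinimalPairs.exists_hasFiniteFibres (h : HasMinimalPairs μ T) {B : Type*}
    [MeasurableSpace B] [StandardBorelSpace B] [Nonempty X] {β : B ≃ᵐ B} {ρ : Measure (B × X)}
    [IsProbabilityMeasure ρ] (hρ : Ergodic (Prod.map β T) ρ) (hsnd : ρ.map Prod.snd = μ)
    (hs : ∀ s : ℤ, s ≠ 0 → ρ.map (fun p => (p.1, ipow T s p.2)) ≠ ρ)
    (hne : ρ ≠ ρ.fst.prod μ) : ∃ c : ENNReal, c ≠ ⊤ ∧ HasFiniteFibres ρ c := by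
  have hqm := measurable_condKernel_atom ρ
  set q : B × X → ENNReal := fun p => ρ.condKernel p.1 {p.2} with hq
  -- The mass of the atom of a fibre at its own point is an invariant function, hence a constant c.
  -- If c is positive the fibres are finite; the rest excludes `c = 0`.
  have hqinv : q ∘ Prod.map β T =ᵐ[ρ] q := by
    have h1 := condKernel_equivariant hρ.toMeasurePreserving
    have h2 : ∀ᵐ p ∂ρ, (ρ.condKernel p.1).map T = ρ.condKernel (β p.1) :=
      ae_of_ae_map (f := Prod.fst) (p := fun b => (ρ.condKernel b).map T = ρ.condKernel (β b))
        measurable_fst.aemeasurable h1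
    filter_upwards [h2] with p hp
    simp only [hq, Function.comp_apply, Prod.map_fst, Prod.map_snd]
    rw [← hp, T.map_apply]
    congr 1
    ext z
    simp
  obtain ⟨c, hc⟩ := hρ.quasiErgodic.ae_eq_const_of_ae_eq_comp_ae hqm.aestronglyMeasurable hqinv
  rcases eq_or_ne c 0 with hc0 | hc0
  swap
  · refine ⟨c⁻¹, ENNReal.inv_ne_top.2 hc0, ?_⟩
    filter_upwards [hc] with p hp
    have hp' : ρ.condKernel p.1 {p.2} = c := hp
    have hc1 : c ≠ ⊤ := hp' ▸ measure_ne_top _ _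
    rw [hp', ENNReal.inv_mul_cancel hc0 hc1]
  exfalso
  refine hne ?_
  -- Two copies of the second variable, conditionally independent over B. When `c = 0` they almost
  -- surely differ.
  set Γ := ρ ⊗ₘ ρ.condKernel.comap (Prod.fst : B × X → B) measurable_fst with hΓ
  have hΓp : MeasurePreserving (Prod.map (Prod.map β T) T) Γ Γ :=
    measurePreserving_compProd_condKernel hρ.toMeasurePreserving measurable_fst (fun _ => rfl)
      hρ.toMeasurePreserving rfl
  have hΓfst : Γ.map Prod.fst = ρ := Measure.fst_compProd ρ _
  have hΓ2 : Γ.map (fun w => (w.1.1, w.2)) = ρ := map_compProd_condKernel measurable_fst rfl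
  have hdiag : ∀ᵐ w ∂Γ, w.2 ≠ w.1.2 := by
    have hE : MeasurableSet {w : (B × X) × X | w.2 = w.1.2} :=
      measurableSet_eq_fun measurable_snd (measurable_snd.comp measurable_fst)
    have : Γ {w : (B × X) × X | w.2 = w.1.2} = 0 := by
      rw [hΓ, Measure.compProd_apply hE]
      have h1 : ∫⁻ p, q p ∂ρ = 0 := by
        rw [lintegral_congr_ae hc]
        simp [hc0]
      exact h1
    exact measure_eq_zero_iff_ae_notMem.1 this
  obtain ⟨κ, hκ⟩ := exists_ergodic_decomposition hΓp
  have hcomp : ∀ᵐ ω ∂Γ, (κ ω).map (fun w => (w.1.2, w.2)) = μ.prod μ := by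
    have e1 := hκ.ae_map_eq (π := Prod.fst) measurable_fst (R := Prod.map β T) rfl
      (by rw [hΓfst]; exact hρ)
    have e2 := hκ.ae_map_eq (π := fun w : (B × X) × X => (w.1.1, w.2)) (by fun_prop)
      (R := Prod.map β T) rfl (by rw [hΓ2]; exact hρ)
    filter_upwards [e1, e2, hκ.ergodic, hκ.ae_ae hdiag] with ω h1 h2 h3 h4
    rw [hΓfst] at h1
    rw [hΓ2] at h2
    have hpr := hκ.isMarkovKernel.isProbabilityMeasure ω
    have m1 : (κ ω).map (fun w => w.1.2) = μ := by
      rw [← hsnd, ← h1, Measure.map_map (by fun_prop) (by fun_prop)]; rfl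
    have m2 : (κ ω).map (fun w => w.2) = μ := by
      rw [← hsnd, ← h2, Measure.map_map (by fun_prop) (by fun_prop)]; rfl
    rcases h.map_eq_or h3 (f := fun w => w.1.2) (g := fun w => w.2) (by fun_prop) (by fun_prop)
      (fun _ => rfl) (fun _ => rfl) m1 m2 with h5 | ⟨s, h5⟩
    · exact h5
    exfalso
    rcases eq_or_ne s 0 with rfl | hs0
    · obtain ⟨w, hw1, hw2⟩ := (h4.and h5).exists
      exact hw1 hw2
    -- Both copies have law ρ together with the base variable, so a relation by `T ^ s` makes ρ
    -- invariant under that power on the fibre.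
    · refine hs s hs0 ?_
      conv_lhs => rw [← h1]
      conv_rhs => rw [← h2]
      rw [Measure.map_map (by fun_prop) (by fun_prop)]
      refine Measure.map_congr ?_
      filter_upwards [h5] with w hw
      simp [hw]
  -- The two copies are now independent, so the second moment of the conditional probability of A is
  -- the square of its mean. Its variance is zero.
  have hvar : ∀ A : Set X, MeasurableSet A → ∀ᵐ b ∂ρ.fst, ρ.condKernel b A = μ A := by
    intro A hA
    set k : B → ℝ := fun b => (ρ.condKernel b).real A with hk
    have hkm' : Measurable fun b => ρ.condKernel b A := Kernel.measurable_coe _ hA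
    have hkm : Measurable k := hkm'.ennreal_toReal
    have hkC : ∀ b, |k b| ≤ 1 := fun b => by
      rw [hk, abs_of_nonneg measureReal_nonneg]; exact measureReal_le_one
    have hk1 : ∫ b, k b ∂ρ.fst = μ.real A := by
      have h1 : ∫⁻ b, ρ.condKernel b A ∂ρ.fst = μ A := by
        rw [← hsnd, Measure.map_apply measurable_snd hA]
        conv_rhs => rw [← ρ.disintegrate ρ.condKernel]
        rw [Measure.compProd_apply (measurable_snd hA)]
        rfl
      rw [hk]
      simp only [Measure.real]
      rw [integral_toReal hkm'.aemeasurable (ae_of_all _ fun b => measure_lt_top _ _), h1]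
    have hk2 : ∫ b, k b * k b ∂ρ.fst = μ.real A * μ.real A := by
      have hE : MeasurableSet ((fun w : (B × X) × X => (w.1.2, w.2)) ⁻¹' A ×ˢ A) :=
        (by fun_prop : Measurable fun w : (B × X) × X => (w.1.2, w.2)) (hA.prod hA)
      have h1 : Γ ((fun w : (B × X) × X => (w.1.2, w.2)) ⁻¹' A ×ˢ A) = μ A * μ A := by
        refine hκ.measure_eq hE ?_
        filter_upwards [hcomp] with ω hω
        rw [← Measure.map_apply (by fun_prop) (hA.prod hA), hω, Measure.prod_prod]
      have h2 : Γ ((fun w : (B × X) × X => (w.1.2, w.2)) ⁻¹' A ×ˢ A)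
          = ∫⁻ b, ρ.condKernel b A * ρ.condKernel b A ∂ρ.fst := by
        rw [hΓ, Measure.compProd_apply hE]
        have h3 : ∀ p : B × X, (ρ.condKernel.comap (Prod.fst : B × X → B) measurable_fst :
            Kernel (B × X) X) p
            (Prod.mk p ⁻¹' ((fun w : (B × X) × X => (w.1.2, w.2)) ⁻¹' A ×ˢ A))
            = A.indicator (fun _ => ρ.condKernel p.1 A) p.2 := by
          intro p
          rw [Kernel.comap_apply]
          by_cases hp : p.2 ∈ A
          · rw [Set.indicator_of_mem hp]
            congr 1
            ext z; simp [hp]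
          · rw [Set.indicator_of_notMem hp]
            convert measure_empty (μ := ρ.condKernel p.1)
            ext z; simp [hp]
        simp only [h3]
        rw [← Measure.lintegral_condKernel]
        · refine lintegral_congr fun b => ?_
          exact lintegral_indicator_const (μ := ρ.condKernel b) hA (ρ.condKernel b A)
        · have : (fun p : B × X => A.indicator (fun _ => ρ.condKernel p.1 A) p.2)
              = (Prod.snd ⁻¹' A).indicator fun p => ρ.condKernel p.1 A := rfl
          rw [this]
          exact (hkm'.comp measurable_fst).indicator (measurable_snd hA)
      have h3 : ∀ b, k b * k b = (ρ.condKernel b A * ρ.condKernel b A).toReal := fun b => by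
        rw [ENNReal.toReal_mul]; rfl
      simp only [h3]
      rw [integral_toReal (f := fun b => ρ.condKernel b A * ρ.condKernel b A)
        (hkm'.mul hkm').aemeasurable
        (ae_of_all _ fun b => ENNReal.mul_lt_top (measure_lt_top _ _) (measure_lt_top _ _)),
        ← h2, h1, ENNReal.toReal_mul]
      rfl
    have hki : Integrable k ρ.fst := integrable_of_abs_le hkm hkC
    have hkki : Integrable (fun b => k b * k b) ρ.fst :=
      hki.mul_bdd hkm.aestronglyMeasurable (ae_of_all _ hkC)
    have hsq : ∫ b, (k b - μ.real A) ^ 2 ∂ρ.fst = 0 := by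
      have : ∀ b, (k b - μ.real A) ^ 2 = (k b * k b - 2 * μ.real A * k b) + μ.real A * μ.real A :=
        fun b => by ring
      simp only [this]
      rw [integral_add (f := fun b => k b * k b - 2 * μ.real A * k b)
        (hkki.sub (hki.const_mul _)) (integrable_const _),
        integral_sub hkki (hki.const_mul _), integral_const_mul, hk1, hk2]
      simp
      ring
    have hint : Integrable (fun b => (k b - μ.real A) ^ 2) ρ.fst := by
      refine integrable_of_abs_le ((hkm.sub_const _).pow_const 2) (C := 1) fun b => ?_
      have h1 : 0 ≤ k b := measureReal_nonneg
      have h2 : k b ≤ 1 := measureReal_le_one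
      have h3 : 0 ≤ μ.real A := measureReal_nonneg
      have h4 : μ.real A ≤ 1 := measureReal_le_one
      rw [abs_of_nonneg (sq_nonneg _)]
      nlinarith
    rw [integral_eq_zero_iff_of_nonneg (fun b => sq_nonneg _) hint] at hsq
    filter_upwards [hsq] with b hb
    have hb' : k b = μ.real A := by
      have : (k b - μ.real A) ^ 2 = 0 := hb
      nlinarith [pow_eq_zero_iff (two_ne_zero) |>.1 this]
    exact (measureReal_eq_measureReal_iff).1 hb'
  refine Measure.ext_prod fun {E A} hE hA => ?_
  rw [Measure.prod_prod]
  conv_lhs => rw [← ρ.disintegrate ρ.condKernel]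
  rw [Measure.compProd_apply_prod hE hA,
    setLIntegral_congr_fun_ae hE (g := fun _ => μ A) ((hvar A hA).mono fun b hb _ => hb)]
  simp [mul_comm]

end Pairs

end TripleJoinings

end SelfJoining

namespace SelfJoining

/-! ### Finite fibres of a triple joining in the three directions. -/

section Fibres

variable {X : Type u} [MeasurableSpace X]

/-- The joining `ν`, regrouped as a measure whose fibre variable is the third coordinate. -/
noncomputable def over12 (ν : Measure (X × X × X)) : Measure ((X × X) × X) :=
  ν.map fun p => ((p.1, p.2.1), p.2.2)

/-- The joining `ν`, regrouped as a measure whose fibre variable is the second coordinate. -/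
noncomputable def over13 (ν : Measure (X × X × X)) : Measure ((X × X) × X) :=
  ν.map fun p => ((p.1, p.2.2), p.2.1)

/-- The joining `ν`, regrouped as a measure whose fibre variable is the first coordinate. -/
noncomputable def over23 (ν : Measure (X × X × X)) : Measure ((X × X) × X) :=
  ν.map fun p => ((p.2.1, p.2.2), p.1)

instance (ν : Measure (X × X × X)) [IsProbabilityMeasure ν] : IsProbabilityMeasure (over12 ν) :=
  Measure.isProbabilityMeasure_map (by fun_prop)

instance (ν : Measure (X × X × X)) [IsProbabilityMeasure ν] : IsProbabilityMeasure (over13 ν) :=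
  Measure.isProbabilityMeasure_map (by fun_prop)

instance (ν : Measure (X × X × X)) [IsProbabilityMeasure ν] : IsProbabilityMeasure (over23 ν) :=
  Measure.isProbabilityMeasure_map (by fun_prop)

theorem over13_eq (ν : Measure (X × X × X)) :
    over13 ν = over12 (ν.map fun p => (p.1, p.2.2, p.2.1)) := by
  rw [over12, Measure.map_map (by fun_prop) (by fun_prop)]
  rfl

theorem over23_eq (ν : Measure (X × X × X)) :
    over23 ν = over12 ((ν.map fun p => (p.2.1, p.1, p.2.2)).map fun p => (p.1, p.2.2, p.2.1)) := by
  rw [over12, Measure.map_map (by fun_prop) (by fun_prop),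
    Measure.map_map (by fun_prop) (by fun_prop)]
  rfl

variable {μ : Measure X} {T : X ≃ᵐ X} {ν : Measure (X × X × X)}

namespace IsTripleJoining

theorem over12_fst (h : IsTripleJoining μ T ν) : (over12 ν).fst = μ.prod μ := by
  rw [← h.map12, over12, Measure.fst, Measure.map_map (by fun_prop) (by fun_prop)]
  rfl

theorem over13_fst (h : IsTripleJoining μ T ν) : (over13 ν).fst = μ.prod μ := by
  rw [← h.map13, over13, Measure.fst, Measure.map_map (by fun_prop) (by fun_prop)]
  rfl

theorem over23_fst (h : IsTripleJoining μ T ν) : (over23 ν).fst = μ.prod μ := by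
  rw [← h.map23, over23, Measure.fst, Measure.map_map (by fun_prop) (by fun_prop)]
  rfl

theorem ergodic_over12 (h : IsTripleJoining μ T ν) :
    Ergodic (Prod.map (T.prodCongr T) T) (over12 ν) :=
  Ergodic.map_of_semiconj h.ergodic (by fun_prop) (by fun_prop) (fun _ => rfl)

theorem ergodic_over13 (h : IsTripleJoining μ T ν) :
    Ergodic (Prod.map (T.prodCongr T) T) (over13 ν) :=
  Ergodic.map_of_semiconj h.ergodic (by fun_prop) (by fun_prop) (fun _ => rfl)

theorem ergodic_over23 (h : IsTripleJoining μ T ν) :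
    Ergodic (Prod.map (T.prodCongr T) T) (over23 ν) :=
  Ergodic.map_of_semiconj h.ergodic (by fun_prop) (by fun_prop) (fun _ => rfl)

end IsTripleJoining

variable [StandardBorelSpace X] [Nonempty X] [IsProbabilityMeasure μ]

theorem HasFiniteFibres.mono {B : Type*} [MeasurableSpace B] {ρ : Measure (B × X)}
    [IsFiniteMeasure ρ] {c d : ENNReal} (h : HasFiniteFibres ρ c) (hcd : c ≤ d) :
    HasFiniteFibres ρ d := by
  filter_upwards [h] with p hp
  exact hp.trans (by gcongr)

/-- Both exceptions in the general statement make ν the product: invariance under a power of the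
third coordinate alone is a shift fixing the other two, and independence from the base combines with
the independent first pair. -/
theorem HasMinimalPairs.exists_hasFiniteFibres_over12 (hM : HasMinimalPairs μ T)
    [IsProbabilityMeasure ν] (h : IsTripleJoining μ T ν) (hne : ν ≠ μ.prod (μ.prod μ)) :
    ∃ c : ENNReal, c ≠ ⊤ ∧ HasFiniteFibres (over12 ν) c := by
  have hback : ∀ ν' : Measure (X × X × X),
      (over12 ν').map (fun q => (q.1.1, q.1.2, q.2)) = ν' := fun ν' => by
    rw [over12, Measure.map_map (by fun_prop) (by fun_prop)]
    exact Measure.map_id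
  refine hM.exists_hasFiniteFibres h.ergodic_over12 ?_ (fun s hs heq => hne ?_) (fun heq => hne ?_)
  · rw [over12, Measure.map_map (by fun_prop) (by fun_prop)]
    exact h.map3
  · refine h.eq_prod_of_map_shift (a := 0) (b := 0) (c := s) (by simp) (by simp [hs]) ?_
    conv_rhs => rw [← hback ν, ← heq]
    rw [over12, Measure.map_map (by fun_prop) (by fun_prop),
      Measure.map_map (by fun_prop) (by fun_prop)]
    rfl
  · rw [h.over12_fst] at heq
    rw [← hback ν, heq]
    refine Measure.ext_prod₃ fun {A B C} hA hB hC => ?_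
    rw [Measure.map_apply (by fun_prop) (hA.prod (hB.prod hC))]
    have : (fun q : (X × X) × X => (q.1.1, q.1.2, q.2)) ⁻¹' A ×ˢ B ×ˢ C = (A ×ˢ B) ×ˢ C := by
      ext p; simp; tauto
    rw [this]
    simp only [Measure.prod_prod, mul_assoc]

/-- A triple joining of a system with minimal pairs other than the product has finite fibres in
all three directions. -/
theorem HasMinimalPairs.exists_hasFiniteFibres_over (hM : HasMinimalPairs μ T)
    [IsProbabilityMeasure ν] (h : IsTripleJoining μ T ν) (hne : ν ≠ μ.prod (μ.prod μ)) :
    ∃ c : ENNReal, c ≠ ⊤ ∧ HasFiniteFibres (over12 ν) c ∧ HasFiniteFibres (over13 ν) c ∧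
      HasFiniteFibres (over23 ν) c := by
  have h13 := h.swap23
  have h23 := h.swap12.swap23
  have i13 := h13.isProbabilityMeasure
  have i12 := h.swap12.isProbabilityMeasure
  have i23 := h23.isProbabilityMeasure
  obtain ⟨c1, hc1, f1⟩ := hM.exists_hasFiniteFibres_over12 h hne
  obtain ⟨c2, hc2, f2⟩ := hM.exists_hasFiniteFibres_over12 h13
    fun h' => hne (IsTripleJoining.eq_prod_of_swap23 h')
  obtain ⟨c3, hc3, f3⟩ := hM.exists_hasFiniteFibres_over12 h23
    fun h' => hne (IsTripleJoining.eq_prod_of_swap12 (IsTripleJoining.eq_prod_of_swap23 h'))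
  refine ⟨max c1 (max c2 c3), by simp [hc1, hc2, hc3], f1.mono (by simp), ?_, ?_⟩
  · have := f2.mono (d := max c1 (max c2 c3)) (by simp)
    simpa only [← over13_eq] using this
  · have := f3.mono (d := max c1 (max c2 c3)) (by simp)
    simpa only [← over23_eq] using this

end Fibres

/-! ### Configurations linked by a triple joining, and counting them. -/

section Configurations

variable {X : Type u} [MeasurableSpace X]

/-- An ergodic measure on the variables `(x, z₁, y₁, z₂, y)` linked by `ν`:
`(T ^ k x, y, z₁)`, `(x, y₁, z₁)` and `(T ^ m x, y₁, z₂)` all have law `ν`. -/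
structure IsConfig (T : X ≃ᵐ X) (ν : Measure (X × X × X)) (m k : ℤ)
    (Ω : Measure (X × X × X × X × X)) : Prop where
  ergodic : Ergodic (Prod.map T (Prod.map T (Prod.map T (Prod.map T T)))) Ω
  law1 : Ω.map (fun w => (ipow T k w.1, w.2.2.2.2, w.2.1)) = ν
  law2 : Ω.map (fun w => (w.1, w.2.2.1, w.2.1)) = ν
  law3 : Ω.map (fun w => (ipow T m w.1, w.2.2.1, w.2.2.2.1)) = ν

attribute [fun_prop] measurable_shift

theorem eq_map_shift_of_map_shift_eq {T : X ≃ᵐ X} {ν ξ : Measure (X × X × X)} {a b c : ℤ}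
    (h : ξ.map (shift T a b c) = ν) : ξ = ν.map (shift T (-a) (-b) (-c)) := by
  rw [← h, map_shift_map_shift]
  simp [map_shift_zero]

variable {μ : Measure X} [IsProbabilityMeasure μ] {T : X ≃ᵐ X} {ν : Measure (X × X × X)}
  {m k : ℤ} {Ω : Measure (X × X × X × X × X)}

namespace IsConfig

theorem isProbabilityMeasure [IsProbabilityMeasure ν] (h : IsConfig T ν m k Ω) :
    IsProbabilityMeasure Ω := by
  have h1 : IsProbabilityMeasure (Ω.map (fun w => (w.1, w.2.2.1, w.2.1))) := by
    rw [h.law2]; infer_instance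
  exact Measure.isProbabilityMeasure_of_map (fun w : X × X × X × X × X => (w.1, w.2.2.1, w.2.1))

theorem map_z₁ (h : IsConfig T ν m k Ω) (hν : IsTripleJoining μ T ν) :
    Ω.map (fun w => w.2.1) = μ := by
  rw [← hν.map3, ← h.law1, Measure.map_map (by fun_prop) (by fun_prop)]
  rfl

theorem map_z₂ (h : IsConfig T ν m k Ω) (hν : IsTripleJoining μ T ν) :
    Ω.map (fun w => w.2.2.2.1) = μ := by
  rw [← hν.map3, ← h.law3, Measure.map_map (by fun_prop) (by fun_prop)]
  rfl

theorem map_y (h : IsConfig T ν m k Ω) (hν : IsTripleJoining μ T ν) :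
    Ω.map (fun w => w.2.2.2.2) = μ := by
  rw [← hν.map2, ← h.law1, Measure.map_map (by fun_prop) (by fun_prop)]
  rfl

omit [IsProbabilityMeasure μ] in
theorem map_x_z₂ (h : IsConfig T ν m k Ω) (hν : IsTripleJoining μ T ν)
    [IsProbabilityMeasure μ] : Ω.map (fun w => (w.1, w.2.2.2.1)) = μ.prod μ := by
  have hT := hν.measurePreserving
  have h1 : Ω.map (fun w => (ipow T m w.1, w.2.2.2.1)) = μ.prod μ := by
    rw [← hν.map13]
    conv_rhs => rw [← h.law3]
    rw [Measure.map_map (by fun_prop) (by fun_prop)]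
    rfl
  have h2 : (μ.prod μ).map (Prod.map (ipow T (-m)) id) = μ.prod μ :=
    ((measurePreserving_ipow hT (-m)).prod (MeasurePreserving.id μ)).map_eq
  rw [← h2, ← h1, Measure.map_map (by fun_prop) (by fun_prop)]
  congr 1
  funext w
  simp

theorem map_x_y (h : IsConfig T ν m k Ω) (hν : IsTripleJoining μ T ν) :
    Ω.map (fun w => (w.1, w.2.2.2.2)) = μ.prod μ := by
  have hT := hν.measurePreserving
  have h1 : Ω.map (fun w => (ipow T k w.1, w.2.2.2.2)) = μ.prod μ := by
    rw [← hν.map12]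
    conv_rhs => rw [← h.law1]
    rw [Measure.map_map (by fun_prop) (by fun_prop)]
    rfl
  have h2 : (μ.prod μ).map (Prod.map (ipow T (-k)) id) = μ.prod μ :=
    ((measurePreserving_ipow hT (-k)).prod (MeasurePreserving.id μ)).map_eq
  rw [← h2, ← h1, Measure.map_map (by fun_prop) (by fun_prop)]
  congr 1
  funext w
  simp

variable [StandardBorelSpace X] [Nonempty X] [IsProbabilityMeasure ν]

/-- A bound for the law of `((x, z₁, y₁), z₂)` that does not depend on `k`. -/
theorem map_le (h : IsConfig T ν m k Ω) {c : ENNReal} (h12 : HasFiniteFibres (over12 ν) c) :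
    Ω.map (fun w => ((w.1, w.2.1, w.2.2.1), w.2.2.2.1))
      ≤ c • (ν.map fun p => (p.1, p.2.2, p.2.1)) ⊗ₘ (over12 ν).condKernel.comap
        (fun d : X × X × X => (ipow T m d.1, d.2.2)) (by fun_prop) := by
  have hΩ := h.isProbabilityMeasure
  have hd : Ω.map (fun w => (w.1, w.2.1, w.2.2.1)) = ν.map fun p => (p.1, p.2.2, p.2.1) := by
    conv_rhs => rw [← h.law2]
    rw [Measure.map_map (by fun_prop) (by fun_prop)]
    rfl
  rw [← hd]
  refine h12.map_le (d := fun w : X × X × X × X × X => (w.1, w.2.1, w.2.2.1))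
    (z := fun w => w.2.2.2.1) (by fun_prop) (by fun_prop) (by fun_prop) ?_
  conv_rhs => rw [over12, ← h.law3]
  rw [Measure.map_map (by fun_prop) (by fun_prop)]
  rfl

omit [StandardBorelSpace X] [Nonempty X] [IsProbabilityMeasure ν] in
theorem ergodic_map (h : IsConfig T ν m k Ω) :
    Ergodic (Prod.map (Prod.map T (Prod.map T T)) T)
      (Ω.map (fun w => ((w.1, w.2.1, w.2.2.1), w.2.2.2.1))) :=
  Ergodic.map_of_semiconj h.ergodic (by fun_prop) (by fun_prop) (fun _ => rfl)

end IsConfig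

variable [StandardBorelSpace X] [Nonempty X] [IsProbabilityMeasure ν]

/-- The possible laws of `((x, z₁, y₁), z₂)` in a configuration, for a given `m`. -/
theorem finite_config_laws (m : ℤ) {c : ENNReal} (hc : c ≠ ⊤)
    (h12 : HasFiniteFibres (over12 ν) c) :
    {ζ : Measure ((X × X × X) × X) | ∃ k Ω, IsConfig T ν m k Ω ∧
      Ω.map (fun w => ((w.1, w.2.1, w.2.2.1), w.2.2.2.1)) = ζ}.Finite := by
  set θ := (ν.map fun p => (p.1, p.2.2, p.2.1)) ⊗ₘ (over12 ν).condKernel.comap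
        (fun d : X × X × X => (ipow T m d.1, d.2.2)) (by fun_prop) with hθ
  have i0 : IsProbabilityMeasure (ν.map fun p => (p.1, p.2.2, p.2.1)) :=
    Measure.isProbabilityMeasure_map (by fun_prop)
  have i1 : IsFiniteMeasure (c • θ) := Measure.smul_finite _ hc
  refine (finite_ergodic_le (S := Prod.map (Prod.map T (Prod.map T T)) T) (c • θ)).subset ?_
  rintro ζ ⟨k, Ω, h, rfl⟩
  have := h.isProbabilityMeasure
  exact ⟨Measure.isProbabilityMeasure_map (by fun_prop), h.ergodic_map, h.map_le h12⟩

/-- If `(y, z₂)` is not independent then `z₂ = T ^ s y`, so `(x, z₂, z₁)` has the law of ν shifted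
by `(-k, s, 0)`. That law is determined by the law of `(x, z₁, y₁, z₂)`, which has finitely many
possibilities for all k together. Two values of k sharing it would make ν invariant under a shift
fixing the third coordinate. -/
theorem finite_config_not_prod (hM : HasMinimalPairs μ T) (hν : IsTripleJoining μ T ν)
    (hne : ν ≠ μ.prod (μ.prod μ)) {c : ENNReal} (hc : c ≠ ⊤)
    (h12 : HasFiniteFibres (over12 ν) c) (m : ℤ) :
    {k : ℤ | ∃ Ω, IsConfig T ν m k Ω ∧
      Ω.map (fun w => (w.2.2.2.2, w.2.2.2.1)) ≠ μ.prod μ}.Finite := by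
  by_contra hinf
  have hchoose : ∀ k : {k : ℤ | ∃ Ω, IsConfig T ν m k Ω ∧
      Ω.map (fun w => (w.2.2.2.2, w.2.2.2.1)) ≠ μ.prod μ}, ∃ ζ ∈ {ζ : Measure ((X × X × X) × X) |
      ∃ k Ω, IsConfig T ν m k Ω ∧ Ω.map (fun w => ((w.1, w.2.1, w.2.2.1), w.2.2.2.1)) = ζ},
      ∃ s : ℤ, ζ.map (fun q => (q.1.1, q.2, q.1.2.1)) = ν.map (shift T (-k) s 0) := by
    rintro ⟨k, Ω, h, hy⟩
    refine ⟨_, ⟨k, Ω, h, rfl⟩, ?_⟩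
    rcases hM.map_eq_or h.ergodic (f := fun w => w.2.2.2.2) (g := fun w => w.2.2.2.1)
      (by fun_prop) (by fun_prop) (fun _ => rfl) (fun _ => rfl) (h.map_y hν) (h.map_z₂ hν)
      with h1 | ⟨s, hs⟩
    · exact absurd h1 hy
    refine ⟨s, ?_⟩
    have := eq_map_shift_of_map_shift_eq (T := T) (ν := ν) (a := k) (b := -s) (c := 0)
      (ξ := Ω.map fun w => (w.1, w.2.2.2.1, w.2.1)) (by
        conv_rhs => rw [← h.law1]
        rw [Measure.map_map (by fun_prop) (by fun_prop)]
        refine Measure.map_congr ?_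
        filter_upwards [hs] with w hw
        simp [shift, hw])
    rw [neg_neg, neg_zero] at this
    rw [← this, Measure.map_map (by fun_prop) (by fun_prop)]
    rfl
  choose ζ hζ s hs using hchoose
  have hinf' : Infinite {k : ℤ | ∃ Ω, IsConfig T ν m k Ω ∧
      Ω.map (fun w => (w.2.2.2.2, w.2.2.2.1)) ≠ μ.prod μ} := Set.infinite_coe_iff.2 hinf
  obtain ⟨k, -, k', -, hkk, heq⟩ := Set.infinite_univ.exists_ne_map_eq_of_mapsTo
    (f := ζ) (fun k _ => hζ k) (finite_config_laws m hc h12)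
  have h1 := (hs k).symm
  rw [heq, hs k'] at h1
  refine hne (hν.eq_prod_of_map_shift (by simp) (Or.inl ?_) (map_shift_sub_eq h1))
  intro h0
  exact hkk (Subtype.ext (by linarith))

/-- Configurations with `(T ^ r x, y, z₂)` of law `ν` exist for finitely many `k` only. -/
theorem finite_config_const (hν : IsTripleJoining μ T ν)
    (hne : ν ≠ μ.prod (μ.prod μ)) {c : ENNReal} (hc : c ≠ ⊤)
    (h12 : HasFiniteFibres (over12 ν) c) (h13 : HasFiniteFibres (over13 ν) c) (m r : ℤ) :
    {k : ℤ | ∃ Ω, IsConfig T ν m k Ω ∧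
      Ω.map (fun w => (ipow T r w.1, w.2.2.2.2, w.2.2.2.1)) = ν}.Finite := by
  -- The law of `(x, y, z₂)` is a shift of ν not involving k. Attaching y₁ over `(T ^ m x, z₂)` and
  -- z₁ over `(x, y₁)` costs a factor c each, so all variables together obey a bound free of k.
  set θ1 := (ν.map (shift T (-r) 0 0)) ⊗ₘ (over13 ν).condKernel.comap
    (fun d : X × X × X => (ipow T m d.1, d.2.2)) (by fun_prop) with hθ1
  set θ2 := (c • θ1) ⊗ₘ (over12 ν).condKernel.comap
    (fun d : (X × X × X) × X => (d.1.1, d.2)) (by fun_prop) with hθ2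
  have i0 : IsProbabilityMeasure (ν.map (shift T (-r) 0 0)) :=
    Measure.isProbabilityMeasure_map (by fun_prop)
  have i1 : IsFiniteMeasure (c • θ1) := Measure.smul_finite _ hc
  have i2 : IsFiniteMeasure (c • θ2) := Measure.smul_finite _ hc
  have hfin := finite_ergodic_le
    (S := Prod.map (Prod.map (Prod.map T (Prod.map T T)) T) T) (c • θ2)
  by_contra hinf
  have hchoose : ∀ k : {k : ℤ | ∃ Ω, IsConfig T ν m k Ω ∧
      Ω.map (fun w => (ipow T r w.1, w.2.2.2.2, w.2.2.2.1)) = ν}, ∃ ζ ∈ {P | IsProbabilityMeasure P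
        ∧ Ergodic (Prod.map (Prod.map (Prod.map T (Prod.map T T)) T) T) P ∧ P ≤ c • θ2},
      ζ.map (fun q => (q.1.1.1, q.1.1.2.1, q.2)) = ν.map (shift T (-k) 0 0) := by
    rintro ⟨k, Ω, h, h4⟩
    have hΩ := h.isProbabilityMeasure
    refine ⟨Ω.map (fun w => (((w.1, w.2.2.2.2, w.2.2.2.1), w.2.2.1), w.2.1)),
      ⟨Measure.isProbabilityMeasure_map (by fun_prop),
        Ergodic.map_of_semiconj h.ergodic (by fun_prop) (by fun_prop) (fun _ => rfl), ?_⟩, ?_⟩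
    · have hd : Ω.map (fun w => (w.1, w.2.2.2.2, w.2.2.2.1)) = ν.map (shift T (-r) 0 0) := by
        have := eq_map_shift_of_map_shift_eq (T := T) (ν := ν) (a := r) (b := 0) (c := 0)
          (ξ := Ω.map fun w => (w.1, w.2.2.2.2, w.2.2.2.1)) (by
            conv_rhs => rw [← h4]
            rw [Measure.map_map (by fun_prop) (by fun_prop)]
            rfl)
        simpa using this
      have h1 := h13.map_le (Ω := Ω) (d := fun w => (w.1, w.2.2.2.2, w.2.2.2.1))
        (π := fun d : X × X × X => (ipow T m d.1, d.2.2))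
        (z := fun w => w.2.2.1) (by fun_prop) (by fun_prop) (by fun_prop) (by
          conv_rhs => rw [over13, ← h.law3]
          rw [Measure.map_map (by fun_prop) (by fun_prop)]
          rfl)
      rw [hd] at h1
      have h2 := h12.map_le (Ω := Ω) (d := fun w => ((w.1, w.2.2.2.2, w.2.2.2.1), w.2.2.1))
        (π := fun d : (X × X × X) × X => (d.1.1, d.2))
        (z := fun w => w.2.1) (by fun_prop) (by fun_prop) (by fun_prop) (by
          conv_rhs => rw [over12, ← h.law2]
          rw [Measure.map_map (by fun_prop) (by fun_prop)]
          rfl)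
      refine h2.trans ?_
      have h3 := compProd_mono_left h1 ((over12 ν).condKernel.comap
        (fun d : (X × X × X) × X => (d.1.1, d.2)) (by fun_prop))
      refine Measure.le_iff.2 fun E hE => ?_
      simp only [Measure.smul_apply, smul_eq_mul]
      gcongr
    · have := eq_map_shift_of_map_shift_eq (T := T) (ν := ν) (a := k) (b := 0) (c := 0)
          (ξ := Ω.map fun w => (w.1, w.2.2.2.2, w.2.1)) (by
            conv_rhs => rw [← h.law1]
            rw [Measure.map_map (by fun_prop) (by fun_prop)]
            rfl)
      rw [neg_zero] at this
      rw [← this, Measure.map_map (by fun_prop) (by fun_prop)]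
      rfl
  choose ζ hζ hs using hchoose
  have hinf' : Infinite {k : ℤ | ∃ Ω, IsConfig T ν m k Ω ∧
      Ω.map (fun w => (ipow T r w.1, w.2.2.2.2, w.2.2.2.1)) = ν} := Set.infinite_coe_iff.2 hinf
  obtain ⟨k, -, k', -, hkk, heq⟩ := Set.infinite_univ.exists_ne_map_eq_of_mapsTo
    (f := ζ) (fun k _ => hζ k) hfin
  have h1 := (hs k).symm
  rw [heq, hs k'] at h1
  refine hne (hν.eq_prod_of_map_shift (by simp) (Or.inl ?_) (map_shift_sub_eq h1))
  intro h0
  exact hkk (Subtype.ext (by linarith))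

/-- If `(x, z₁, z₂)` is independent then so is `ν`. -/
theorem IsConfig.eq_prod_of_map_eq_prod (hν : IsTripleJoining μ T ν)
    (h : IsConfig T ν m k Ω) {c : ENNReal} (hc : c ≠ ⊤) (h13 : HasFiniteFibres (over13 ν) c)
    (hξ : Ω.map (fun w => (w.1, w.2.1, w.2.2.2.1)) = μ.prod (μ.prod μ)) :
    ν = μ.prod (μ.prod μ) := by
  have hΩ := h.isProbabilityMeasure
  have hT := hν.measurePreserving
  set θ := (μ.prod (μ.prod μ)) ⊗ₘ (over13 ν).condKernel.comap
    (fun d : X × X × X => (d.1, d.2.1)) (by fun_prop) with hθ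
  have i1 : IsFiniteMeasure (c • θ) := Measure.smul_finite _ hc
  have hfin := finite_ergodic_le (S := Prod.map (Prod.map T (Prod.map T T)) T) (c • θ)
  -- Replacing z₂ by `T ^ j z₂` keeps the three variables independent, while y₁ remains in its
  -- finite fibre over `(x, z₁)`. The bound does not involve j, so two values of j give the same
  -- law, and ν is invariant under a power of its third coordinate.
  have hmem : ∀ j : ℤ, Ω.map (fun w => ((w.1, w.2.1, ipow T j w.2.2.2.1), w.2.2.1)) ∈
      {P | IsProbabilityMeasure P ∧ Ergodic (Prod.map (Prod.map T (Prod.map T T)) T) P ∧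
        P ≤ c • θ} := by
    intro j
    refine ⟨Measure.isProbabilityMeasure_map (by fun_prop),
        Ergodic.map_of_semiconj h.ergodic (by fun_prop) (by fun_prop)
          (fun w => by simp [ipow_apply_comm]), ?_⟩
    have hd : Ω.map (fun w => (w.1, w.2.1, ipow T j w.2.2.2.1)) = μ.prod (μ.prod μ) := by
      have h2 : (μ.prod (μ.prod μ)).map (Prod.map id (Prod.map id (ipow T j)))
          = μ.prod (μ.prod μ) := ((MeasurePreserving.id μ).prod
            ((MeasurePreserving.id μ).prod (measurePreserving_ipow hT j))).map_eq
      rw [← h2, ← hξ, Measure.map_map (by fun_prop) (by fun_prop)]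
      rfl
    rw [hθ, ← hd]
    refine h13.map_le (Ω := Ω) (d := fun w => (w.1, w.2.1, ipow T j w.2.2.2.1))
      (π := fun d : X × X × X => (d.1, d.2.1))
      (z := fun w => w.2.2.1) (by fun_prop) (by fun_prop) (by fun_prop) ?_
    conv_rhs => rw [over13, ← h.law2]
    rw [Measure.map_map (by fun_prop) (by fun_prop)]
    rfl
  obtain ⟨j, -, j', -, hjj, heq⟩ := Set.infinite_univ.exists_ne_map_eq_of_mapsTo
    (fun j _ => hmem j) hfin
  have hs : ∀ j : ℤ, (Ω.map (fun w => ((w.1, w.2.1, ipow T j w.2.2.2.1), w.2.2.1))).map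
      (fun q => (ipow T m q.1.1, q.2, q.1.2.2)) = ν.map (shift T 0 0 j) := by
    intro j
    conv_rhs => rw [← h.law3]
    rw [Measure.map_map (by fun_prop) (by fun_prop), Measure.map_map (by fun_prop) (by fun_prop)]
    rfl
  have h1 := (hs j).symm
  rw [heq, hs j'] at h1
  refine hν.eq_prod_of_map_shift (by simp) (Or.inr (Or.inr ?_)) (map_shift_sub_eq h1)
  exact sub_ne_zero.2 hjj

/-- Configurations with `(T ^ (k + r) x, y, z₂)` of law `ν` exist for finitely many `k` only. -/
theorem finite_config_add (hM : HasMinimalPairs μ T) (hν : IsTripleJoining μ T ν)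
    (hne : ν ≠ μ.prod (μ.prod μ)) {c : ENNReal} (hc : c ≠ ⊤)
    (h12 : HasFiniteFibres (over12 ν) c) (h13 : HasFiniteFibres (over13 ν) c) {m : ℤ}
    (hm : m ≠ 0) (r : ℤ) :
    {k : ℤ | ∃ Ω, IsConfig T ν m k Ω ∧
      Ω.map (fun w => (ipow T (k + r) w.1, w.2.2.2.2, w.2.2.2.1)) = ν}.Finite := by
  -- Relative to `(T ^ k x, y, z₁)`, of law ν, the variable z₂ lies over `(T ^ r (T ^ k x), y)`, so
  -- this bound does not involve k.
  set θ := ν ⊗ₘ (over12 ν).condKernel.comap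
    (fun d : X × X × X => (ipow T r d.1, d.2.1)) (by fun_prop) with hθ
  have i1 : IsFiniteMeasure (c • θ) := Measure.smul_finite _ hc
  have hfin := finite_ergodic_le (S := Prod.map (Prod.map T (Prod.map T T)) T) (c • θ)
  by_contra hinf
  have hinf' : Infinite {k : ℤ | ∃ Ω, IsConfig T ν m k Ω ∧
      Ω.map (fun w => (ipow T (k + r) w.1, w.2.2.2.2, w.2.2.2.1)) = ν} :=
    Set.infinite_coe_iff.2 hinf
  have hchoose : ∀ k : {k : ℤ | ∃ Ω, IsConfig T ν m k Ω ∧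
      Ω.map (fun w => (ipow T (k + r) w.1, w.2.2.2.2, w.2.2.2.1)) = ν}, ∃ Ω, IsConfig T ν m k Ω ∧
      Ω.map (fun w => (ipow T (k + r) w.1, w.2.2.2.2, w.2.2.2.1)) = ν := fun k => k.2
  choose Ω hΩ h4 using hchoose
  have hmaps : ∀ k, (Ω k).map (fun w => ((ipow T k w.1, w.2.2.2.2, w.2.1), w.2.2.2.1)) ∈
      {P | IsProbabilityMeasure P ∧ Ergodic (Prod.map (Prod.map T (Prod.map T T)) T) P ∧
        P ≤ c • θ} := by
    intro k
    have i := (hΩ k).isProbabilityMeasure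
    refine ⟨Measure.isProbabilityMeasure_map (by fun_prop),
        Ergodic.map_of_semiconj (hΩ k).ergodic (by fun_prop) (by fun_prop)
          (fun w => by simp [ipow_apply_comm]), ?_⟩
    have h1 := h12.map_le (Ω := Ω k) (d := fun w => (ipow T k w.1, w.2.2.2.2, w.2.1))
      (π := fun d : X × X × X => (ipow T r d.1, d.2.1))
      (z := fun w => w.2.2.2.1) (by fun_prop) (by fun_prop) (by fun_prop) (by
        conv_rhs => rw [over12, ← h4 k]
        rw [Measure.map_map (by fun_prop) (by fun_prop)]
        congr 1
        funext w
        simp only [Function.comp_apply, add_comm (k : ℤ) r, ipow_add])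
    rw [(hΩ k).law1] at h1
    exact h1
  have hmaps' : ∀ k, (Ω k).map (fun w => ((w.1, w.2.1, w.2.2.1), w.2.2.2.1)) ∈
      {ζ : Measure ((X × X × X) × X) | ∃ k Ω, IsConfig T ν m k Ω ∧
        Ω.map (fun w => ((w.1, w.2.1, w.2.2.1), w.2.2.2.1)) = ζ} :=
    fun k => ⟨k, Ω k, hΩ k, rfl⟩
  -- Two laws are pigeonholed at once: that of `(x, z₁, z₂)` and that of `(T ^ k x, z₁, z₂)`. Their
  -- coincidence for k and k' makes the law ξ invariant under a nonzero power acting on x alone.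
  obtain ⟨k, -, k', -, hkk, heq⟩ := Set.infinite_univ.exists_ne_map_eq_of_mapsTo
    (f := fun k => ((Ω k).map (fun w => ((ipow T k w.1, w.2.2.2.2, w.2.1), w.2.2.2.1)),
      (Ω k).map (fun w => ((w.1, w.2.1, w.2.2.1), w.2.2.2.1))))
    (fun k _ => Set.mk_mem_prod (hmaps k) (hmaps' k))
    (hfin.prod (finite_config_laws m hc h12))
  obtain ⟨heq1, heq2⟩ := Prod.ext_iff.1 heq
  have hk : (k : ℤ) - k' ≠ 0 := fun h0 => hkk (Subtype.ext (by linarith))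
  set ξ := (Ω k).map (fun w => (w.1, w.2.1, w.2.2.2.1)) with hξ
  have hξ' : ξ = (Ω k').map (fun w => (w.1, w.2.1, w.2.2.2.1)) := by
    have := congrArg (fun z => z.map fun q : (X × X × X) × X => (q.1.1, q.1.2.1, q.2)) heq2
    simp only at this
    rwa [Measure.map_map (by fun_prop) (by fun_prop),
      Measure.map_map (by fun_prop) (by fun_prop)] at this
  have hshift : ξ.map (shift T k 0 0) = ξ.map (shift T k' 0 0) := by
    conv_rhs => rw [hξ']
    have := congrArg (fun z => z.map fun q : (X × X × X) × X => (q.1.1, q.1.2.2, q.2)) heq1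
    simp only at this
    rw [Measure.map_map (by fun_prop) (by fun_prop),
      Measure.map_map (by fun_prop) (by fun_prop)] at this
    rw [hξ, Measure.map_map (by fun_prop) (by fun_prop),
      Measure.map_map (by fun_prop) (by fun_prop)]
    exact this
  have hinv := map_shift_sub_eq hshift
  have hprod := eq_prod_of_invariant hν.measurePreserving hν.ergodic_prod (R := X) (ν := ξ)
    (a := k - k') (c := 0) (by
      rw [hξ, Measure.map_map (by fun_prop) (by fun_prop)]
      exact (hΩ k).map_x_z₂ hν) hk (by rw [sub_self] at hinv; exact hinv)
  refine hne ?_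
  -- Now x is independent of `(z₁, z₂)`. If z₁ and z₂ are independent, all three are. Otherwise `z₂
  -- = T ^ s z₁`, and the two copies of ν sharing y₁ differ by the shift `(m, 0, s)`, which is
  -- nontrivial since m is nonzero.
  rcases hM.map_eq_or (hΩ k).ergodic (f := fun w => w.2.1) (g := fun w => w.2.2.2.1)
      (by fun_prop) (by fun_prop) (fun _ => rfl) (fun _ => rfl) ((hΩ k).map_z₁ hν)
      ((hΩ k).map_z₂ hν) with h1 | ⟨s, hs⟩
  · refine (hΩ k).eq_prod_of_map_eq_prod hν hc h13 ?_
    change ξ = _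
    rw [hprod, hξ, Measure.map_map (by fun_prop) (by fun_prop)]
    congr 1
  · refine hν.eq_prod_of_map_shift (a := m) (b := 0) (c := s) (by simp) (Or.inl hm) ?_
    conv_lhs => rw [← (hΩ k).law2]
    conv_rhs => rw [← (hΩ k).law3]
    rw [Measure.map_map (by fun_prop) (by fun_prop)]
    refine Measure.map_congr ?_
    filter_upwards [hs] with w hw
    simp [shift, hw]

end Configurations

end SelfJoining

namespace SelfJoining

/-! ### Domination tested on rectangles, and nearly constant families. -/

section Rectangles

variable {α β : Type*} [MeasurableSpace α] [MeasurableSpace β]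

theorem isSetSemiring_measurable_prod :
    IsSetSemiring (Set.image2 (· ×ˢ ·) {s : Set α | MeasurableSet s}
      {t : Set β | MeasurableSet t}) where
  empty_mem := ⟨∅, .empty, ∅, .empty, by simp⟩
  inter_mem := by
    rintro _ ⟨A, hA, B, hB, rfl⟩ _ ⟨A', hA', B', hB', rfl⟩
    exact ⟨A ∩ A', hA.inter hA', B ∩ B', hB.inter hB', Set.prod_inter_prod.symm⟩
  sdiff_eq_sUnion' := by
    classical
    rintro _ ⟨A, hA, B, hB, rfl⟩ _ ⟨A', hA', B', hB', rfl⟩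
    refine ⟨{(A \ A') ×ˢ B, (A ∩ A') ×ˢ (B \ B')}, ?_, ?_, ?_⟩
    · intro s hs
      simp only [Finset.coe_insert, Finset.coe_singleton, Set.mem_insert_iff,
        Set.mem_singleton_iff] at hs
      rcases hs with rfl | rfl
      · exact ⟨_, hA.diff hA', B, hB, rfl⟩
      · exact ⟨_, hA.inter hA', _, hB.diff hB', rfl⟩
    · intro s hs t ht hst
      have hd : Disjoint ((A \ A') ×ˢ B) ((A ∩ A') ×ˢ (B \ B')) := by
        rw [Set.disjoint_left]
        rintro ⟨a, b⟩ h1 h2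
        exact h1.1.2 h2.1.2
      simp only [Finset.coe_insert, Finset.coe_singleton, Set.mem_insert_iff,
        Set.mem_singleton_iff] at hs ht
      rcases hs with rfl | rfl <;> rcases ht with rfl | rfl
      · exact absurd rfl hst
      · exact hd
      · exact hd.symm
      · exact absurd rfl hst
    · ext ⟨a, b⟩
      simp only [Finset.coe_insert, Finset.coe_singleton, Set.sUnion_insert, Set.sUnion_singleton,
        Set.mem_sdiff, Set.mem_prod, Set.mem_union, Set.mem_inter_iff]
      tauto

/-- A finite union of rectangles splits into disjoint rectangles, so the inequality holds for it;
every measurable set is close to such a union for the sum of the two measures. -/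
theorem measure_le_of_forall_prod_le {ρ θ : Measure (α × β)} [IsFiniteMeasure ρ]
    [IsFiniteMeasure θ]
    (h : ∀ A B, MeasurableSet A → MeasurableSet B → ρ (A ×ˢ B) ≤ θ (A ×ˢ B)) : ρ ≤ θ := by
  have hC := isSetSemiring_measurable_prod (α := α) (β := β)
  refine Measure.le_iff.2 fun E hE => ?_
  refine ENNReal.le_of_forall_pos_le_add fun ε hε _ => ?_
  have hε2 : (0 : ENNReal) < ε / 2 := ENNReal.half_pos (by exact_mod_cast hε.ne')
  obtain ⟨t, ht, hlt⟩ := exists_measure_symmDiff_lt_of_generateFrom_isSetSemiring (μ := ρ + θ) hC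
    ⟨{Set.univ}, by simp, by
      rw [Set.singleton_subset_iff]
      exact ⟨Set.univ, .univ, Set.univ, .univ, Set.univ_prod_univ⟩, by simp⟩
    generateFrom_prod.symm hE hε2
  have htle : ρ t ≤ θ t := by
    obtain ⟨P, hP⟩ := hC.mem_supClosure_iff.1 ht
    have hm : ∀ s ∈ P.parts, MeasurableSet s := fun s hs => by
      obtain ⟨A, hA, B, hB, rfl⟩ := hP hs
      exact hA.prod hB
    have ht' : t = ⋃ s ∈ P.parts, id s := by
      conv_lhs => rw [← P.sup_parts]
      exact Finset.sup_set_eq_biUnion _ _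
    have hd : Set.PairwiseDisjoint (P.parts : Set (Set (α × β))) id := P.disjoint
    rw [ht', measure_biUnion_finset hd hm, measure_biUnion_finset hd hm]
    refine Finset.sum_le_sum fun s hs => ?_
    obtain ⟨A, hA, B, hB, rfl⟩ := hP hs
    exact h A B hA hB
  have h1 : ρ (E \ t) ≤ ε / 2 := (measure_mono (fun x hx => Or.inr hx)).trans
    ((le_add_of_nonneg_right bot_le).trans hlt.le)
  have h2 : θ (t \ E) ≤ ε / 2 := (measure_mono (fun x hx => Or.inl hx)).trans
    ((le_add_of_nonneg_left bot_le).trans hlt.le)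
  calc ρ E ≤ ρ (t ∪ E \ t) := measure_mono (by
        intro x hx; by_cases hxt : x ∈ t
        · exact Or.inl hxt
        · exact Or.inr ⟨hx, hxt⟩)
    _ ≤ ρ t + ρ (E \ t) := measure_union_le _ _
    _ ≤ θ t + ε / 2 := add_le_add htle h1
    _ ≤ θ (E ∪ t \ E) + ε / 2 := by
        gcongr
        intro x hx; by_cases hxt : x ∈ E
        · exact Or.inl hxt
        · exact Or.inr ⟨hx, hxt⟩
    _ ≤ θ E + θ (t \ E) + ε / 2 := by gcongr; exact measure_union_le _ _
    _ ≤ θ E + ε / 2 + ε / 2 := by gcongr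
    _ = θ E + ε := by rw [add_assoc, ENNReal.add_halves]

theorem measure_le_of_forall_prod₃_le {γ : Type*} [MeasurableSpace γ] {ρ θ : Measure (α × β × γ)}
    [IsFiniteMeasure ρ] [IsFiniteMeasure θ]
    (h : ∀ A B C, MeasurableSet A → MeasurableSet B → MeasurableSet C →
      ρ (A ×ˢ B ×ˢ C) ≤ θ (A ×ˢ B ×ˢ C)) : ρ ≤ θ := by
  refine measure_le_of_forall_prod_le fun A E hA hE => ?_
  have hs : ∀ ξ : Measure (α × β × γ), ∀ F : Set (β × γ), MeasurableSet F →
      (ξ.restrict (A ×ˢ Set.univ)).map Prod.snd F = ξ (A ×ˢ F) := fun ξ F hF => by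
    rw [Measure.map_apply measurable_snd hF, Measure.restrict_apply (measurable_snd hF)]
    congr 1
    ext x; simp; tauto
  have := measure_le_of_forall_prod_le (ρ := (ρ.restrict (A ×ˢ Set.univ)).map Prod.snd)
    (θ := (θ.restrict (A ×ˢ Set.univ)).map Prod.snd) (fun B C hB hC => by
      rw [hs _ _ (hB.prod hC), hs _ _ (hB.prod hC)]
      exact h A B C hA hB hC) E
  rwa [hs _ _ hE, hs _ _ hE] at this

/-- Bounded measurable functions form a separable set in `L¹`. -/
theorem exists_seq_dense_L1 (μ : Measure α) [IsProbabilityMeasure μ]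
    [MeasurableSpace.CountablyGenerated α] {C : ℝ} (hC : 0 ≤ C) :
    ∃ h : ℕ → α → ℝ, (∀ j, Measurable (h j)) ∧ (∀ j x, |h j x| ≤ C) ∧
      ∀ f : α → ℝ, Measurable f → (∀ x, |f x| ≤ C) → ∀ ε : ENNReal, ε ≠ 0 →
        ∃ j, ∫⁻ x, ‖f x - h j x‖ₑ ∂μ < ε := by
  have : Fact ((1 : ENNReal) ≠ ⊤) := ⟨by simp⟩
  set g : ℕ → Lp ℝ 1 μ := TopologicalSpace.denseSeq _ with hg
  have hgm : ∀ j, Measurable (g j) := fun j => (Lp.stronglyMeasurable _).measurable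
  -- Truncation to `[-C, C]` is 1-Lipschitz and fixes f, so it preserves the approximation while
  -- providing the uniform bound.
  refine ⟨fun j x => max (-C) (min C (g j x)), fun j => ?_, fun j x => ?_, ?_⟩
  · exact measurable_const.max (measurable_const.min (hgm j))
  · rw [abs_le]
    exact ⟨le_max_left _ _, max_le (by linarith) (min_le_left _ _)⟩
  intro f hf hfC ε hε
  have hfi : MemLp f 1 μ := MemLp.of_bound hf.aestronglyMeasurable C (ae_of_all _ hfC)
  obtain ⟨j, hj⟩ := (TopologicalSpace.denseRange_denseSeq (Lp ℝ 1 μ)).exists_mem_open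
    (Metric.isOpen_eball (x := hfi.toLp f) (ε := ε)) ⟨_, Metric.mem_eball_self (pos_iff_ne_zero.2 hε)⟩
  refine ⟨j, lt_of_le_of_lt ?_ hj⟩
  rw [edist_comm, Lp.edist_def, eLpNorm_one_eq_lintegral_enorm]
  refine lintegral_mono_ae ?_
  filter_upwards [hfi.coeFn_toLp] with x hx
  rw [Pi.sub_apply, hx, Real.enorm_eq_ofReal_abs, Real.enorm_eq_ofReal_abs]
  refine ENNReal.ofReal_le_ofReal ?_
  have hfx := abs_le.1 (hfC x)
  have h1 : f x = max (-C) (min C (f x)) := by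
    rw [min_eq_right hfx.2, max_eq_right hfx.1]
  conv_lhs => rw [h1]
  have h2 := abs_max_sub_max_le_max (-C) (min C (f x)) (-C) (min C (g j x))
  have h3 := abs_min_sub_min_le_max C (f x) C (g j x)
  rw [sub_self, abs_zero, max_eq_right (b := |_|) (abs_nonneg _)] at h2 h3
  exact h2.trans h3

/-- A bounded measurable family of functions is nearly constant in `L¹` on some subset of positive
measure of any given set of positive measure. -/
theorem exists_subset_nearly_const {ρ : Measure β} (μ : Measure α) [IsProbabilityMeasure μ]
    [MeasurableSpace.CountablyGenerated α] {a : β × α → ℝ} (ha : Measurable a) {C : ℝ}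
    (hC : ∀ p, |a p| ≤ C) {A : Set β} (hA : MeasurableSet A) (hA0 : ρ A ≠ 0) {ε : ENNReal}
    (hε : ε ≠ 0) :
    ∃ A' ⊆ A, MeasurableSet A' ∧ ρ A' ≠ 0 ∧
      ∀ x ∈ A', ∀ x' ∈ A', ∫⁻ y, ‖a (x, y) - a (x', y)‖ₑ ∂μ ≤ ε := by
  have hC0 : 0 ≤ C := by
    by_contra hneg
    have hne : A.Nonempty := nonempty_of_measure_ne_zero hA0
    obtain ⟨y⟩ : Nonempty α := μ.nonempty_of_neZero
    exact hneg ((abs_nonneg _).trans (hC (hne.some, y)))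
  obtain ⟨h, hm, hb, hd⟩ := exists_seq_dense_L1 μ hC0
  have hε2 : ε / 2 ≠ 0 := by simpa using hε
  -- Countably many balls of radius `ε / 2` in L¹ contain all slices, so the slices over some subset
  -- of A of positive measure lie in a single ball.
  set E : ℕ → Set β := fun j => {x | ∫⁻ y, ‖a (x, y) - h j y‖ₑ ∂μ < ε / 2} with hE
  have hEm : ∀ j, MeasurableSet (E j) := by
    intro j
    have : Measurable fun x => ∫⁻ y, ‖a (x, y) - h j y‖ₑ ∂μ :=
      Measurable.lintegral_prod_right' (f := fun p : β × α => ‖a p - h j p.2‖ₑ)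
        (ha.sub ((hm j).comp measurable_snd)).enorm
    exact this measurableSet_Iio
  have hcov : A = ⋃ j, A ∩ E j := by
    rw [← Set.inter_iUnion, eq_comm, Set.inter_eq_left]
    intro x _
    obtain ⟨j, hj⟩ := hd (fun y => a (x, y)) (ha.comp measurable_prodMk_left) (fun y => hC _) _ hε2
    exact Set.mem_iUnion.2 ⟨j, hj⟩
  obtain ⟨j, hj⟩ : ∃ j, ρ (A ∩ E j) ≠ 0 := by
    by_contra! hall
    exact hA0 (by rw [hcov]; exact measure_iUnion_null hall)
  refine ⟨A ∩ E j, Set.inter_subset_left, hA.inter (hEm j), hj, fun x hx x' hx' => ?_⟩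
  have hmx : ∀ x, Measurable fun y => ‖a (x, y) - h j y‖ₑ := fun x =>
    ((ha.comp measurable_prodMk_left).sub (hm j)).enorm
  calc ∫⁻ y, ‖a (x, y) - a (x', y)‖ₑ ∂μ
      ≤ ∫⁻ y, (‖a (x, y) - h j y‖ₑ + ‖a (x', y) - h j y‖ₑ) ∂μ := by
        refine lintegral_mono fun y => ?_
        have : a (x, y) - a (x', y) = (a (x, y) - h j y) - (a (x', y) - h j y) := by ring
        rw [this]
        exact enorm_sub_le
    _ = ∫⁻ y, ‖a (x, y) - h j y‖ₑ ∂μ + ∫⁻ y, ‖a (x', y) - h j y‖ₑ ∂μ :=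
        lintegral_add_left (hmx x) _
    _ ≤ ε / 2 + ε / 2 := add_le_add (le_of_lt hx.2) (le_of_lt hx'.2)
    _ = ε := ENNReal.add_halves ε

end Rectangles

/-! ### Uniform form of multiple recurrence. -/

section Recurrence

variable {X : Type u} [MeasurableSpace X] {μ : Measure X} {T : X ≃ᵐ X}

/-- Multiple recurrence is uniform in the return times. -/
theorem IsMultiplyRecurrent.exists_forall (h : IsMultiplyRecurrent μ T) {A : Set X}
    (hA : MeasurableSet A) (hA0 : 0 < μ A) :
    ∃ N : ℕ, ∀ a b : ℕ, N ≤ a → N ≤ b → (N : ℤ) ≤ |(a : ℤ) - b| →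
      0 < μ (T^[a] ⁻¹' A ∩ T^[b] ⁻¹' A ∩ A) := by
  classical
  by_contra! hbad
  obtain ⟨φ, hφ, hP⟩ := extraction_forall_of_frequently
    (P := fun n b => ∃ a : ℕ, n ≤ a ∧ (n : ℤ) ≤ |(a : ℤ) - b| ∧
      μ (T^[a] ⁻¹' A ∩ T^[b] ⁻¹' A ∩ A) ≤ 0) (fun n => by
      rw [frequently_atTop]
      intro N
      obtain ⟨a, b, ha, hb, hab, h0⟩ := hbad (max n N)
      exact ⟨b, le_trans (le_max_right _ _) hb, a, le_trans (le_max_left _ _) ha,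
        le_trans (by exact_mod_cast le_max_left _ _) hab, h0⟩)
  choose a ha1 ha2 ha3 using hP
  -- The bad pairs are strung into one admissible sequence; away from them `2 * m` serves as a
  -- filler for which both k and its distance to m tend to infinity.
  set k : ℕ → ℕ := fun m => if hm : ∃ n, φ n = m then a hm.choose else 2 * m with hk
  have hkφ : ∀ n, k (φ n) = a n := by
    intro n
    have hm : ∃ n', φ n' = φ n := ⟨n, rfl⟩
    rw [hk]
    simp only [dif_pos hm]
    rw [hφ.injective hm.choose_spec]
  have hkn : ∀ m, (¬ ∃ n, φ n = m) → k m = 2 * m := fun m hm => by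
    rw [hk]; simp only [dif_neg hm]
  have hk1 : Tendsto k atTop atTop := by
    refine tendsto_atTop.2 fun M => ?_
    filter_upwards [eventually_ge_atTop (max (φ M) M)] with m hm
    by_cases hex : ∃ n, φ n = m
    · obtain ⟨n, rfl⟩ := hex
      rw [hkφ]
      exact (hφ.le_iff_le.1 ((le_max_left _ _).trans hm)).trans (ha1 n)
    · rw [hkn m hex]
      have := (le_max_right (φ M) M).trans hm
      omega
  have hk2 : Tendsto (fun m : ℕ => |(k m : ℤ) - (m : ℤ)|) atTop atTop := by
    refine tendsto_atTop.2 fun M => ?_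
    filter_upwards [eventually_ge_atTop (max (φ M.toNat) M.toNat)] with m hm
    by_cases hex : ∃ n, φ n = m
    · obtain ⟨n, rfl⟩ := hex
      rw [hkφ]
      have h1 := hφ.le_iff_le.1 ((le_max_left _ _).trans hm)
      have := ha2 n
      omega
    · rw [hkn m hex]
      have := (le_max_right (φ M.toNat) M.toNat).trans hm
      push_cast
      rw [abs_of_nonneg (by omega)]
      omega
  have hev := hφ.tendsto_atTop.eventually (h A hA hA0 k hk1 hk2)
  obtain ⟨n, hn⟩ := hev.exists
  rw [hkφ] at hn
  exact absurd hn (not_lt.2 (ha3 n))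

/-- The exponents met later may be negative. For `p = -q`, translating by `T ^ q` turns the times 0,
k, -q into q, k + q, 0, whose gaps are again large. -/
theorem IsMultiplyRecurrent.exists_forall_int (h : IsMultiplyRecurrent μ T)
    (hT : MeasurePreserving T μ μ) {A : Set X} (hA : MeasurableSet A) (hA0 : 0 < μ A) :
    ∃ N : ℕ, ∀ k p : ℤ, N ≤ k → N ≤ |p| → N ≤ |p - k| →
      0 < μ (A ∩ ipow T k ⁻¹' A ∩ ipow T p ⁻¹' A) := by
  obtain ⟨N, hN⟩ := h.exists_forall hA hA0
  refine ⟨N, fun k p hk hp hpk => ?_⟩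
  obtain ⟨k', rfl⟩ := Int.eq_ofNat_of_zero_le (show 0 ≤ k by omega)
  obtain ⟨q, rfl | rfl⟩ := Int.eq_nat_or_neg p
  · have h1 := hN k' q (by omega) (by simpa using hp) (by rwa [abs_sub_comm])
    refine h1.trans_le (measure_mono ?_)
    rintro x ⟨⟨hx1, hx2⟩, hx3⟩
    refine ⟨⟨hx3, ?_⟩, ?_⟩
    · rwa [Set.mem_preimage, ipow_natCast]
    · rwa [Set.mem_preimage, ipow_natCast]
  · have hq : N ≤ q := by simpa using hp
    have h1 := hN (k' + q) q (by omega) hq (by push_cast; simp; omega)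
    refine h1.trans_le ?_
    have hm : MeasurableSet (A ∩ ipow T k' ⁻¹' A ∩ ipow T (-q) ⁻¹' A) :=
      (hA.inter ((ipow T k').measurable hA)).inter ((ipow T (-q)).measurable hA)
    rw [← (measurePreserving_ipow hT q).measure_preimage hm.nullMeasurableSet]
    refine measure_mono ?_
    rintro x ⟨⟨hx1, hx2⟩, hx3⟩
    refine ⟨⟨?_, ?_⟩, ?_⟩
    · rwa [ipow_natCast]
    · rw [Set.mem_preimage, ← ipow_natCast] at hx1
      change ipow T k' (ipow T q x) ∈ A
      rw [← ipow_add]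
      exact_mod_cast hx1
    · change ipow T (-q) (ipow T q x) ∈ A
      rwa [ipow_neg_ipow]

end Recurrence

/-! ### Completed configurations with distant exponents. -/

section FarConfigurations

variable {X : Type u} [MeasurableSpace X] {μ : Measure X} [IsProbabilityMeasure μ] {T : X ≃ᵐ X}
  {ν : Measure (X × X × X)}

theorem compProd_compProd_comap_apply {P : Type*} [MeasurableSpace P] (M : Measure P) [SFinite M]
    (κ₁ κ₂ : Kernel P X) [IsSFiniteKernel κ₁] [IsSFiniteKernel κ₂] {A : Set P} {C D : Set X}
    (hA : MeasurableSet A) (hC : MeasurableSet C) (hD : MeasurableSet D) :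
    ((M ⊗ₘ κ₁) ⊗ₘ (κ₂.comap (Prod.fst : P × X → P) measurable_fst)) ((A ×ˢ C) ×ˢ D)
      = ∫⁻ p in A, κ₁ p C * κ₂ p D ∂M := by
  rw [Measure.compProd_apply_prod (hA.prod hC) hD,
    Measure.setLIntegral_compProd (Kernel.measurable_coe _ hD) hA hC]
  refine setLIntegral_congr_fun hA fun p _ => ?_
  simp [mul_comm]

variable [StandardBorelSpace X] [Nonempty X] [IsProbabilityMeasure ν]

/-- The law of `(x, z, z')` where `x, y` are independent and `z, z'` are conditionally independent
given `(x, y)`, with both `(x, y, z)` and `(x, y, z')` of law `ν`. -/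
noncomputable def relSquare (μ : Measure X) (ν : Measure (X × X × X)) [IsProbabilityMeasure ν] :
    Measure (X × X × X) :=
  (((μ.prod μ) ⊗ₘ (over12 ν).condKernel) ⊗ₘ ((over12 ν).condKernel.comap
    (Prod.fst : (X × X) × X → X × X) measurable_fst)).map fun q => (q.1.1.1, q.1.2, q.2)

instance : IsProbabilityMeasure (relSquare μ ν) :=
  Measure.isProbabilityMeasure_map (by fun_prop)

omit [StandardBorelSpace X] [Nonempty X] in
theorem setLIntegral_prod_univ {f : X × X → ENNReal} (hf : Measurable f) {A : Set X} :
    ∫⁻ p in A ×ˢ Set.univ, f p ∂μ.prod μ = ∫⁻ x in A, ∫⁻ y, f (x, y) ∂μ ∂μ := by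
  rw [← Measure.prod_restrict, Measure.restrict_univ, lintegral_prod _ hf.aemeasurable]

theorem relSquare_apply {A C D : Set X} (hA : MeasurableSet A) (hC : MeasurableSet C)
    (hD : MeasurableSet D) :
    relSquare μ ν (A ×ˢ C ×ˢ D) = ∫⁻ x in A, ∫⁻ y,
      (over12 ν).condKernel (x, y) C * (over12 ν).condKernel (x, y) D ∂μ ∂μ := by
  rw [relSquare, Measure.map_apply (by fun_prop) (hA.prod (hC.prod hD))]
  have : (fun q : ((X × X) × X) × X => (q.1.1.1, q.1.2, q.2)) ⁻¹' A ×ˢ C ×ˢ D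
      = ((A ×ˢ Set.univ) ×ˢ C) ×ˢ D := by
    ext q; simp; tauto
  rw [this, compProd_compProd_comap_apply _ _ _ (hA.prod .univ) hC hD, setLIntegral_prod_univ]
  exact (Kernel.measurable_coe _ hC).mul (Kernel.measurable_coe _ hD)

/-- The pair `(x, y)` is independent, and z₁ and z₂ lie in the finite fibres over `(T ^ k x, y)` and
`(T ^ p x, y)`. Each costs one factor c; the bound still depends on k and p, which recurrence will
remove. -/
theorem IsConfig.map_apply_le {m k p : ℤ} {Ω : Measure (X × X × X × X × X)}
    (h : IsConfig T ν m k Ω) (hν : IsTripleJoining μ T ν)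
    (h4 : Ω.map (fun w => (ipow T p w.1, w.2.2.2.2, w.2.2.2.1)) = ν) {c : ENNReal}
    (hc : c ≠ ⊤) (h12 : HasFiniteFibres (over12 ν) c) {A C D : Set X} (hA : MeasurableSet A)
    (hC : MeasurableSet C) (hD : MeasurableSet D) :
    Ω.map (fun w => (w.1, w.2.1, w.2.2.2.1)) (A ×ˢ C ×ˢ D) ≤ c * c * ∫⁻ x in A, ∫⁻ y,
      (over12 ν).condKernel (ipow T k x, y) C * (over12 ν).condKernel (ipow T p x, y) D ∂μ ∂μ := by
  have hΩ := h.isProbabilityMeasure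
  set κ₁ := (over12 ν).condKernel.comap (fun d : X × X => (ipow T k d.1, d.2)) (by fun_prop)
    with hκ₁
  set κ₂ := (over12 ν).condKernel.comap (fun d : X × X => (ipow T p d.1, d.2)) (by fun_prop)
    with hκ₂
  have h1 := h12.map_le (Ω := Ω) (d := fun w => (w.1, w.2.2.2.2))
    (π := fun d : X × X => (ipow T k d.1, d.2)) (z := fun w => w.2.1) (by fun_prop) (by fun_prop)
    (by fun_prop) (by
      conv_rhs => rw [over12, ← h.law1]
      rw [Measure.map_map (by fun_prop) (by fun_prop)]
      rfl)
  rw [h.map_x_y hν] at h1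
  have h2 := h12.map_le (Ω := Ω) (d := fun w => ((w.1, w.2.2.2.2), w.2.1))
    (π := fun d : (X × X) × X => (ipow T p d.1.1, d.1.2))
    (z := fun w => w.2.2.2.1) (by fun_prop) (by fun_prop) (by fun_prop) (by
      conv_rhs => rw [over12, ← h4]
      rw [Measure.map_map (by fun_prop) (by fun_prop)]
      rfl)
  have i1 : IsFiniteMeasure (c • (μ.prod μ) ⊗ₘ κ₁) := Measure.smul_finite _ hc
  have h3 := compProd_mono_left h1 (κ₂.comap (Prod.fst : (X × X) × X → X × X) measurable_fst)
  have hE : Ω.map (fun w => (w.1, w.2.1, w.2.2.2.1)) (A ×ˢ C ×ˢ D)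
      = Ω.map (fun w => (((w.1, w.2.2.2.2), w.2.1), w.2.2.2.1)) (((A ×ˢ Set.univ) ×ˢ C) ×ˢ D) := by
    rw [Measure.map_apply (by fun_prop) (hA.prod (hC.prod hD)),
      Measure.map_apply (by fun_prop) (((hA.prod .univ).prod hC).prod hD)]
    congr 1
    ext q; simp; tauto
  rw [hE]
  refine (h2 _).trans ?_
  rw [Measure.smul_apply, smul_eq_mul, mul_assoc]
  gcongr
  refine (h3 _).trans ?_
  rw [Measure.compProd_smul_left, Measure.smul_apply, smul_eq_mul,
    compProd_compProd_comap_apply _ _ _ (hA.prod .univ) hC hD, setLIntegral_prod_univ]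
  · rfl
  · exact (Kernel.measurable_coe _ hC).mul (Kernel.measurable_coe _ hD)

theorem mul_le_mul_add_enorm {a b a' b' : ENNReal} (ha : a ≤ 1) (hb : b ≤ 1) (ha' : a' ≤ 1)
    (hb' : b' ≤ 1) :
    a' * b' ≤ a * b + ‖a'.toReal - a.toReal‖ₑ + ‖b'.toReal - b.toReal‖ₑ := by
  have key : ∀ s t : ENNReal, s ≤ 1 → t ≤ 1 → s ≤ t + ‖s.toReal - t.toReal‖ₑ := by
    intro s t hs ht
    have hs' : s ≠ ⊤ := ne_top_of_le_ne_top (by simp) hs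
    have ht' : t ≠ ⊤ := ne_top_of_le_ne_top (by simp) ht
    conv_lhs => rw [← ENNReal.ofReal_toReal hs']
    conv_rhs => rw [← ENNReal.ofReal_toReal ht']
    rw [Real.enorm_eq_ofReal_abs, ENNReal.toReal_ofReal ENNReal.toReal_nonneg,
      ← ENNReal.ofReal_add ENNReal.toReal_nonneg (abs_nonneg _)]
    refine ENNReal.ofReal_le_ofReal ?_
    linarith [le_abs_self (s.toReal - t.toReal)]
  calc a' * b' ≤ a' * (b + ‖b'.toReal - b.toReal‖ₑ) := by gcongr; exact key _ _ hb' hb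
    _ = a' * b + a' * ‖b'.toReal - b.toReal‖ₑ := mul_add _ _ _
    _ ≤ (a + ‖a'.toReal - a.toReal‖ₑ) * b + 1 * ‖b'.toReal - b.toReal‖ₑ := by
        gcongr; exact key _ _ ha' ha
    _ = a * b + ‖a'.toReal - a.toReal‖ₑ * b + ‖b'.toReal - b.toReal‖ₑ := by rw [add_mul, one_mul]
    _ ≤ a * b + ‖a'.toReal - a.toReal‖ₑ * 1 + ‖b'.toReal - b.toReal‖ₑ := by gcongr
    _ = _ := by rw [mul_one]

/-- If `ξ` is the law of `(x, z₁, z₂)` in configurations with all of `k`, `p` and `p - k`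
arbitrarily large, then multiple recurrence bounds `ξ` by a multiple of `relSquare μ ν`. -/
theorem le_relSquare (hR : IsMultiplyRecurrent μ T) (hν : IsTripleJoining μ T ν) {c : ENNReal}
    (hc : c ≠ ⊤) (h12 : HasFiniteFibres (over12 ν) c) {m : ℤ} {ξ : Measure (X × X × X)}
    (hξ : ∀ N : ℕ, ∃ k p : ℤ, ∃ Ω, IsConfig T ν m k Ω ∧
      Ω.map (fun w => (ipow T p w.1, w.2.2.2.2, w.2.2.2.1)) = ν ∧ N ≤ k ∧ N ≤ |p| ∧ N ≤ |p - k| ∧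
      Ω.map (fun w => (w.1, w.2.1, w.2.2.2.1)) = ξ) :
    ξ ≤ (c * c) • relSquare μ ν := by
  have hT := hν.measurePreserving
  set κ := (over12 ν).condKernel with hκ
  have hcc : c * c ≠ ⊤ := ENNReal.mul_ne_top hc hc
  have hξ1 : ξ.fst = μ ∧ IsProbabilityMeasure ξ := by
    obtain ⟨k, p, Ω, h, -, -, -, -, rfl⟩ := hξ 0
    have := h.isProbabilityMeasure
    refine ⟨?_, Measure.isProbabilityMeasure_map (by fun_prop)⟩
    rw [Measure.fst, Measure.map_map (by fun_prop) (by fun_prop), ← hν.map1, ← h.law2,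
      Measure.map_map (by fun_prop) (by fun_prop)]
    rfl
  obtain ⟨hfst, hξp⟩ := hξ1
  have ifin : IsFiniteMeasure ((c * c) • relSquare μ ν) := Measure.smul_finite _ hcc
  refine measure_le_of_forall_prod₃_le fun A C D hA hC hD => ?_
  set U : X → ENNReal := fun x => ξ.condKernel x (C ×ˢ D) with hU
  set W : X → ENNReal := fun x => ∫⁻ y, κ (x, y) C * κ (x, y) D ∂μ with hW
  have hUm : Measurable U := Kernel.measurable_coe _ (hC.prod hD)
  have hκC : ∀ C : Set X, MeasurableSet C → Measurable fun q => κ q C := fun C hC =>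
    Kernel.measurable_coe _ hC
  have hWm : Measurable W := ((hκC C hC).mul (hκC D hD)).lintegral_prod_right
  have hξA : ∀ A : Set X, MeasurableSet A → ξ (A ×ˢ C ×ˢ D) = ∫⁻ x in A, U x ∂μ := by
    intro A hA
    rw [← hfst, hU]
    exact (Measure.setLIntegral_condKernel_eq_measure_prod hA (hC.prod hD)).symm
  -- Comparison is made fibrewise over x: U and W are the conditional masses of `C ×ˢ D` under ξ and
  -- under the target measure.
  suffices hUW : ∀ᵐ x ∂μ, U x ≤ c * c * W x by
    rw [hξA A hA, Measure.smul_apply, relSquare_apply hA hC hD, smul_eq_mul,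
      ← lintegral_const_mul _ hWm]
    exact setLIntegral_mono_ae (hWm.const_mul _).aemeasurable (hUW.mono fun x hx _ => hx)
  by_contra hnot
  rw [ae_iff] at hnot
  have hcov : {x | ¬ U x ≤ c * c * W x} = ⋃ n : ℕ, {x | c * c * W x + (n : ENNReal)⁻¹ < U x} := by
    ext x
    simp only [Set.mem_ofPred_eq, Set.mem_iUnion, not_le]
    constructor
    · intro hx
      obtain ⟨n, hn⟩ := ENNReal.exists_inv_nat_lt (tsub_pos_of_lt hx).ne'
      exact ⟨n, by rw [add_comm]; exact lt_tsub_iff_right.1 hn⟩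
    · rintro ⟨n, hn⟩
      exact lt_of_le_of_lt (le_add_of_nonneg_right bot_le) hn
  obtain ⟨n, hn⟩ : ∃ n : ℕ, μ {x | c * c * W x + (n : ENNReal)⁻¹ < U x} ≠ 0 := by
    by_contra! hall
    exact hnot (by rw [hcov]; exact measure_iUnion_null hall)
  set δ : ENNReal := (n : ENNReal)⁻¹ with hδ
  have hδ0 : δ ≠ 0 := by simp [hδ]
  have hA0m : MeasurableSet {x | c * c * W x + δ < U x} :=
    measurableSet_lt ((hWm.const_mul _).add_const _) hUm
  -- With this choice two errors of size ε, multiplied by `c * c`, cost at most δ. The added 1 keeps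
  -- the denominator positive.
  set ε : ENNReal := δ / (2 * (c * c + 1)) with hε
  have hden : (2 * (c * c + 1) : ENNReal) ≠ ⊤ :=
    ENNReal.mul_ne_top (by simp) (ENNReal.add_ne_top.2 ⟨hcc, by simp⟩)
  have hε0 : ε ≠ 0 := (ENNReal.div_pos hδ0 hden).ne'
  have hεδ : c * c * (ε + ε) ≤ δ := by
    calc c * c * (ε + ε) ≤ (c * c + 1) * (ε + ε) := by gcongr; exact le_self_add
      _ = (2 * (c * c + 1)) * ε := by ring
      _ ≤ δ := by rw [hε]; exact ENNReal.mul_div_le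
  have hreal : ∀ C : Set X, MeasurableSet C → Measurable fun q => (κ q C).toReal := fun C hC =>
    (hκC C hC).ennreal_toReal
  have hle1 : ∀ q (C : Set X), κ q C ≤ 1 := fun q C => prob_le_one
  have hreal1 : ∀ (C : Set X) q, |(κ q C).toReal| ≤ 1 := fun C q => by
    rw [abs_of_nonneg ENNReal.toReal_nonneg]
    exact ENNReal.toReal_le_of_le_ofReal zero_le_one (by simpa using hle1 q C)
  -- Inside the set where the inequality fails by δ, first the fibre masses of C and then those of D
  -- are made nearly constant as functions of y.
  obtain ⟨A1, hA1, hA1m, hA10, hA1C⟩ := exists_subset_nearly_const (ρ := μ) μ (hreal C hC)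
    (hreal1 C) hA0m hn hε0
  obtain ⟨A2, hA2, hA2m, hA20, hA2D⟩ := exists_subset_nearly_const (ρ := μ) μ (hreal D hD)
    (hreal1 D) hA1m hA10 hε0
  obtain ⟨N, hN⟩ := hR.exists_forall_int hT hA2m (pos_iff_ne_zero.2 hA20)
  obtain ⟨k, p, Ω, hΩ, h4, hk, hp, hpk, hmap⟩ := hξ N
  -- Here x, `T ^ k x` and `T ^ p x` all lie in A2, so the shifted fibre masses may be replaced by
  -- those at x. This bounds U on average over a set where it was assumed strictly larger.
  set A3 := A2 ∩ ipow T k ⁻¹' A2 ∩ ipow T p ⁻¹' A2 with hA3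
  have hA3m : MeasurableSet A3 :=
    (hA2m.inter ((ipow T k).measurable hA2m)).inter ((ipow T p).measurable hA2m)
  have hA30 : μ A3 ≠ 0 := (hN k p hk hp hpk).ne'
  have h1 : ξ (A3 ×ˢ C ×ˢ D) ≤ ∫⁻ x in A3, (c * c * W x + δ) ∂μ := by
    rw [← hmap]
    refine (hΩ.map_apply_le hν h4 hc h12 hA3m hC hD).trans ?_
    have hm : Measurable fun x => ∫⁻ y, κ (ipow T k x, y) C * κ (ipow T p x, y) D ∂μ := by
      refine Measurable.lintegral_prod_right' (f := fun q : X × X =>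
        κ (ipow T k q.1, q.2) C * κ (ipow T p q.1, q.2) D) ?_
      exact ((hκC C hC).comp (by fun_prop)).mul ((hκC D hD).comp (by fun_prop))
    rw [← lintegral_const_mul _ hm]
    refine setLIntegral_mono ((hWm.const_mul _).add_const _) fun x hx => ?_
    refine le_trans ?_ (add_le_add_right hεδ (c * c * W x))
    rw [← mul_add]
    gcongr
    have hmC : ∀ x', Measurable fun y => ‖(κ (x', y) C).toReal - (κ (x, y) C).toReal‖ₑ :=
      fun x' => (((hreal C hC).comp measurable_prodMk_left).sub
        ((hreal C hC).comp measurable_prodMk_left)).enorm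
    have hmP : Measurable fun y => κ (x, y) C * κ (x, y) D :=
      ((hκC C hC).comp measurable_prodMk_left).mul ((hκC D hD).comp measurable_prodMk_left)
    calc ∫⁻ y, κ (ipow T k x, y) C * κ (ipow T p x, y) D ∂μ
        ≤ ∫⁻ y, (κ (x, y) C * κ (x, y) D + ‖(κ (ipow T k x, y) C).toReal - (κ (x, y) C).toReal‖ₑ
          + ‖(κ (ipow T p x, y) D).toReal - (κ (x, y) D).toReal‖ₑ) ∂μ :=
          lintegral_mono fun y => mul_le_mul_add_enorm (hle1 _ _) (hle1 _ _) (hle1 _ _) (hle1 _ _)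
      _ = W x + ∫⁻ y, ‖(κ (ipow T k x, y) C).toReal - (κ (x, y) C).toReal‖ₑ ∂μ
          + ∫⁻ y, ‖(κ (ipow T p x, y) D).toReal - (κ (x, y) D).toReal‖ₑ ∂μ := by
          rw [lintegral_add_left (by exact hmP.add (hmC _)), lintegral_add_left hmP]
      _ ≤ W x + ε + ε := by
          gcongr
          · exact hA1C _ (hA2 hx.1.2) _ (hA2 hx.1.1)
          · exact hA2D _ hx.2 _ hx.1.1
      _ = W x + (ε + ε) := add_assoc _ _ _
  have h2 : ∫⁻ x in A3, (c * c * W x + δ) ∂μ < ∫⁻ x in A3, U x ∂μ := by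
    have hlt : ∀ x ∈ A3, c * c * W x + δ < U x := fun x hx => hA1 (hA2 hx.1.1)
    refine setLIntegral_strict_mono hA3m hA30 hUm ?_ (ae_of_all _ hlt)
    refine ne_top_of_le_ne_top ?_ (setLIntegral_mono hUm fun x hx => (hlt x hx).le)
    rw [← hξA A3 hA3m]
    exact measure_ne_top _ _
  rw [← hξA A3 hA3m] at h2
  exact absurd h1 (not_le.2 h2)

/-- Configurations with the law of `(x, z₁, z₂)` bounded by a multiple of `relSquare μ ν` exist for
finitely many `m` only. -/
theorem finite_config_le_relSquare (hν : IsTripleJoining μ T ν)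
    (hne : ν ≠ μ.prod (μ.prod μ)) {c : ENNReal} (hc : c ≠ ⊤)
    (h13 : HasFiniteFibres (over13 ν) c) :
    {m : ℤ | ∃ k Ω, IsConfig T ν m k Ω ∧
      Ω.map (fun w => (w.1, w.2.1, w.2.2.2.1)) ≤ (c * c) • relSquare μ ν}.Finite := by
  have hcc : c * c ≠ ⊤ := ENNReal.mul_ne_top hc hc
  have ifin : IsFiniteMeasure ((c * c) • relSquare μ ν) := Measure.smul_finite _ hcc
  -- The bound on `(x, z₁, z₂)` does not involve m, and y₁ lies over `(x, z₁)`. Hence the law of all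
  -- four variables repeats for two values of m if there are infinitely many.
  set θ := ((c * c) • relSquare μ ν) ⊗ₘ (over13 ν).condKernel.comap
    (fun d : X × X × X => (d.1, d.2.1)) (by fun_prop) with hθ
  have i1 : IsFiniteMeasure (c • θ) := Measure.smul_finite _ hc
  have hfin := finite_ergodic_le (S := Prod.map (Prod.map T (Prod.map T T)) T) (c • θ)
  by_contra hinf
  have hchoose : ∀ m : {m : ℤ | ∃ k Ω, IsConfig T ν m k Ω ∧
      Ω.map (fun w => (w.1, w.2.1, w.2.2.2.1)) ≤ (c * c) • relSquare μ ν}, ∃ ζ ∈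
      {P | IsProbabilityMeasure P ∧ Ergodic (Prod.map (Prod.map T (Prod.map T T)) T) P ∧
        P ≤ c • θ}, ζ.map (fun q => (q.1.1, q.2, q.1.2.2)) = ν.map (shift T (-m) 0 0) := by
    rintro ⟨m, k, Ω, h, hle⟩
    have hΩ := h.isProbabilityMeasure
    refine ⟨Ω.map (fun w => ((w.1, w.2.1, w.2.2.2.1), w.2.2.1)),
      ⟨Measure.isProbabilityMeasure_map (by fun_prop),
        Ergodic.map_of_semiconj h.ergodic (by fun_prop) (by fun_prop) (fun _ => rfl), ?_⟩, ?_⟩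
    · refine (h13.map_le (Ω := Ω) (d := fun w => (w.1, w.2.1, w.2.2.2.1))
        (π := fun d : X × X × X => (d.1, d.2.1))
        (z := fun w => w.2.2.1) (by fun_prop) (by fun_prop) (by fun_prop) (by
          conv_rhs => rw [over13, ← h.law2]
          rw [Measure.map_map (by fun_prop) (by fun_prop)]
          rfl)).trans ?_
      have h3 := compProd_mono_left hle ((over13 ν).condKernel.comap
        (fun d : X × X × X => (d.1, d.2.1)) (by fun_prop))
      refine Measure.le_iff.2 fun E hE => ?_
      simp only [Measure.smul_apply, smul_eq_mul]
      gcongr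
    · have := eq_map_shift_of_map_shift_eq (T := T) (ν := ν) (a := m) (b := 0) (c := 0)
          (ξ := Ω.map fun w => (w.1, w.2.2.1, w.2.2.2.1)) (by
            conv_rhs => rw [← h.law3]
            rw [Measure.map_map (by fun_prop) (by fun_prop)]
            rfl)
      rw [neg_zero] at this
      rw [← this, Measure.map_map (by fun_prop) (by fun_prop)]
      rfl
  choose ζ hζ hs using hchoose
  have hinf' : Infinite {m : ℤ | ∃ k Ω, IsConfig T ν m k Ω ∧
      Ω.map (fun w => (w.1, w.2.1, w.2.2.2.1)) ≤ (c * c) • relSquare μ ν} :=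
    Set.infinite_coe_iff.2 hinf
  obtain ⟨k, -, k', -, hkk, heq⟩ := Set.infinite_univ.exists_ne_map_eq_of_mapsTo
    (f := ζ) (fun k _ => hζ k) hfin
  have h1 := (hs k).symm
  rw [heq, hs k'] at h1
  refine hne (hν.eq_prod_of_map_shift (by simp) (Or.inl ?_) (map_shift_sub_eq h1))
  intro h0
  exact hkk (Subtype.ext (by linarith))

end FarConfigurations

end SelfJoining

namespace SelfJoining

/-! ### Approximation by sums of products. -/

section Approximation

variable {α β ι : Type*} [MeasurableSpace α] [MeasurableSpace β]

theorem tendsto_of_forall_approx {l : Filter ι} {a : ι → ℝ} {a₀ : ℝ}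
    (h : ∀ ε > 0, ∃ (b : ι → ℝ) (b₀ : ℝ), Tendsto b l (𝓝 b₀) ∧ (∀ᶠ n in l, |a n - b n| ≤ ε) ∧
      |a₀ - b₀| ≤ ε) : Tendsto a l (𝓝 a₀) := by
  rw [Metric.tendsto_nhds]
  intro ε hε
  obtain ⟨b, b₀, hb, hab, h0⟩ := h (ε / 4) (by positivity)
  filter_upwards [Metric.tendsto_nhds.1 hb (ε / 4) (by positivity), hab] with n h1 h2
  rw [Real.dist_eq] at h1 ⊢
  have : a n - a₀ = (a n - b n) + (b n - b₀) - (a₀ - b₀) := by ring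
  rw [this]
  calc |(a n - b n) + (b n - b₀) - (a₀ - b₀)|
      ≤ |(a n - b n) + (b n - b₀)| + |a₀ - b₀| := abs_sub _ _
    _ ≤ |a n - b n| + |b n - b₀| + |a₀ - b₀| := by gcongr; exact abs_add_le _ _
    _ < ε := by linarith

theorem abs_integral_le_of_abs_le {P : Measure α} [IsProbabilityMeasure P] {f : α → ℝ} {C : ℝ}
    (hC : ∀ x, |f x| ≤ C) : |∫ x, f x ∂P| ≤ C := by
  simpa using norm_integral_le_of_norm_le_const (μ := P) (f := f) (ae_of_all _ fun x => by
    simpa using hC x)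

theorem measurable_integral_kernel {κ : Kernel α β} [IsMarkovKernel κ] {f : α × β → ℝ}
    (hf : Measurable f) : Measurable fun a => ∫ y, f (a, y) ∂κ a :=
  (StronglyMeasurable.integral_kernel_prod_right' (κ := κ) hf.stronglyMeasurable).measurable

theorem abs_mul_le_mul {a b C D : ℝ} (ha : |a| ≤ C) (hb : |b| ≤ D) : |a * b| ≤ C * D := by
  rw [abs_mul]
  exact mul_le_mul ha hb (abs_nonneg _) ((abs_nonneg _).trans ha)

/-- A bounded measurable function is a uniform limit of simple functions. -/
theorem exists_simpleFunc_abs_sub_le {f : α → ℝ} (hf : Measurable f) {C : ℝ}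
    (hC : ∀ x, |f x| ≤ C) {ε : ℝ} (hε : 0 < ε) : ∃ s : SimpleFunc α ℝ, ∀ x, |f x - s x| ≤ ε := by
  have hm : Measurable fun x => ε * (⌊f x / ε⌋ : ℝ) :=
    ((measurable_from_top (f := fun n : ℤ => (n : ℝ))).comp
      (Int.measurable_floor.comp (hf.div_const ε))).const_mul ε
  refine ⟨⟨fun x => ε * (⌊f x / ε⌋ : ℝ), fun c => hm (measurableSet_singleton c), ?_⟩, fun x => ?_⟩
  · refine ((Set.finite_Icc ⌊-C / ε⌋ ⌊C / ε⌋).image fun n : ℤ => ε * (n : ℝ)).subset ?_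
    rintro _ ⟨x, rfl⟩
    have h := abs_le.1 (hC x)
    exact ⟨⌊f x / ε⌋, ⟨Int.floor_mono (by gcongr; exact h.1), Int.floor_mono (by gcongr; exact h.2)⟩,
      rfl⟩
  · change |f x - ε * (⌊f x / ε⌋ : ℝ)| ≤ ε
    have h1 := Int.floor_le (f x / ε)
    have h2 := Int.lt_floor_add_one (f x / ε)
    have h3 : f x = ε * (f x / ε) := by field_simp
    have h4 : f x - ε * (⌊f x / ε⌋ : ℝ) = ε * (f x / ε - ⌊f x / ε⌋) := by
      rw [mul_sub, ← h3]
    rw [h4, abs_of_nonneg (mul_nonneg hε.le (by linarith))]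
    nlinarith

/-- Convergence on measurable rectangles implies convergence of the integrals of products of
bounded measurable functions. -/
theorem tendsto_integral_mul_of_forall_prod {l : Filter ι} {lam : ι → Measure (α × β)}
    {η : Measure (α × β)} [∀ i, IsProbabilityMeasure (lam i)] [IsProbabilityMeasure η]
    (h : ∀ A B, MeasurableSet A → MeasurableSet B →
      Tendsto (fun i => (lam i).real (A ×ˢ B)) l (𝓝 (η.real (A ×ˢ B))))
    {u : α → ℝ} {v : β → ℝ} (hu : Measurable u) (hv : Measurable v) {C D : ℝ}
    (hC : ∀ x, |u x| ≤ C) (hD : ∀ y, |v y| ≤ D) :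
    Tendsto (fun i => ∫ p, u p.1 * v p.2 ∂lam i) l (𝓝 (∫ p, u p.1 * v p.2 ∂η)) := by
  have hint : ∀ (P : Measure (α × β)) [IsProbabilityMeasure P] (s : SimpleFunc α ℝ)
      (t : SimpleFunc β ℝ), Integrable (fun p => s p.1 * t p.2) P := by
    intro P _ s t
    obtain ⟨c, hc⟩ := s.exists_forall_norm_le
    obtain ⟨d, hd⟩ := t.exists_forall_norm_le
    exact integrable_of_abs_le ((s.measurable.comp measurable_fst).mul
      (t.measurable.comp measurable_snd)) (C := c * d) fun p => abs_mul_le_mul (hc _) (hd _)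
  have hst : ∀ (s : SimpleFunc α ℝ) (t : SimpleFunc β ℝ),
      Tendsto (fun i => ∫ p, s p.1 * t p.2 ∂lam i) l (𝓝 (∫ p, s p.1 * t p.2 ∂η)) := by
    intro s t
    induction s using SimpleFunc.induction with
    | @add s s' _ h1 h2 =>
      have : ∀ (P : Measure (α × β)) [IsProbabilityMeasure P],
          ∫ p, (s + s') p.1 * t p.2 ∂P = ∫ p, s p.1 * t p.2 ∂P + ∫ p, s' p.1 * t p.2 ∂P := by
        intro P _
        rw [← integral_add (hint P s t) (hint P s' t)]
        refine integral_congr_ae (ae_of_all _ fun p => ?_)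
        simp only [SimpleFunc.coe_add, Pi.add_apply]; ring
      simp only [this]
      exact h1.add h2
    | @const c A hA =>
      induction t using SimpleFunc.induction with
      | @add t t' _ h1 h2 =>
        set s := SimpleFunc.piecewise A hA (SimpleFunc.const α c) (SimpleFunc.const α 0) with hs
        have : ∀ (P : Measure (α × β)) [IsProbabilityMeasure P],
            ∫ p, s p.1 * (t + t') p.2 ∂P = ∫ p, s p.1 * t p.2 ∂P + ∫ p, s p.1 * t' p.2 ∂P := by
          intro P _
          rw [← integral_add (hint P s t) (hint P s t')]
          refine integral_congr_ae (ae_of_all _ fun p => ?_)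
          simp only [SimpleFunc.coe_add, Pi.add_apply]; ring
        simp only [this]
        exact h1.add h2
      | @const d B hB =>
        have : ∀ (P : Measure (α × β)) [IsProbabilityMeasure P],
            ∫ p, (SimpleFunc.piecewise A hA (SimpleFunc.const α c) (SimpleFunc.const α 0)) p.1 *
              (SimpleFunc.piecewise B hB (SimpleFunc.const β d) (SimpleFunc.const β 0)) p.2 ∂P
              = P.real (A ×ˢ B) * (c * d) := by
          intro P _
          rw [← smul_eq_mul (P.real _), ← integral_indicator_const _ (hA.prod hB)]
          refine integral_congr_ae (ae_of_all _ fun p => ?_)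
          by_cases h1 : p.1 ∈ A <;> by_cases h2 : p.2 ∈ B <;>
            simp [h1, h2, Set.indicator]
        simp only [this]
        exact (h A B hA hB).mul_const _
  refine tendsto_of_forall_approx fun ε hε => ?_
  have hC0 : 0 ≤ C ∨ IsEmpty α := by
    by_cases hα : Nonempty α
    · exact Or.inl ((abs_nonneg _).trans (hC hα.some))
    · exact Or.inr (not_nonempty_iff.1 hα)
  -- Replacing both factors costs at most `δ * |C| + δ * |D| + δ ^ 2`, which is at most ε.
  set δ := ε / (|C| + |D| + ε + 1) with hδ
  have hpos : 0 < |C| + |D| + ε + 1 := by positivity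
  have hδ0 : 0 < δ := by positivity
  have hδ1 : δ * (|C| + |D| + δ) ≤ ε := by
    have h1 : δ ≤ ε + 1 := by
      rw [hδ, div_le_iff₀ hpos]
      nlinarith [abs_nonneg C, abs_nonneg D]
    calc δ * (|C| + |D| + δ) ≤ δ * (|C| + |D| + ε + 1) :=
          mul_le_mul_of_nonneg_left (by linarith) hδ0.le
      _ = ε := by rw [hδ]; field_simp
  obtain ⟨s, hs⟩ := exists_simpleFunc_abs_sub_le hu hC hδ0
  obtain ⟨t, ht⟩ := exists_simpleFunc_abs_sub_le hv hD hδ0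
  have key : ∀ (P : Measure (α × β)) [IsProbabilityMeasure P],
      |∫ p, u p.1 * v p.2 ∂P - ∫ p, s p.1 * t p.2 ∂P| ≤ ε := by
    intro P _
    rw [← integral_sub (f := fun p => u p.1 * v p.2) (integrable_of_abs_le ((hu.comp measurable_fst).mul
      (hv.comp measurable_snd)) (C := C * D) fun p => abs_mul_le_mul (hC _) (hD _)) (hint P s t)]
    refine abs_integral_le_of_abs_le fun p => ?_
    have h1 : u p.1 * v p.2 - s p.1 * t p.2
        = u p.1 * (v p.2 - t p.2) + (u p.1 - s p.1) * v p.2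
          - (u p.1 - s p.1) * (v p.2 - t p.2) := by ring
    have h2 := abs_mul_le_mul ((hC p.1).trans (le_abs_self C)) (ht p.2)
    have h3 := abs_mul_le_mul (hs p.1) ((hD p.2).trans (le_abs_self D))
    have h4 := abs_mul_le_mul (hs p.1) (ht p.2)
    rw [h1]
    refine (abs_sub _ _).trans (le_trans (add_le_add (abs_add_le _ _) le_rfl) ?_)
    nlinarith
  exact ⟨_, _, hst s t, Eventually.of_forall fun i => key (lam i), key η⟩

/-- A bounded measurable function on a product is approximated in `L¹` by finite sums of products of
bounded measurable functions. -/
theorem exists_sum_mul_approx (ρ : Measure α) [IsProbabilityMeasure ρ] (μ : Measure β)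
    [IsProbabilityMeasure μ] [MeasurableSpace.CountablyGenerated β] {K : α × β → ℝ}
    (hK : Measurable K) {C : ℝ} (hC : ∀ p, |K p| ≤ C) {ε : ENNReal} (hε : ε ≠ 0) :
    ∃ (n : ℕ) (a : ℕ → α → ℝ) (b : ℕ → β → ℝ), (∀ j, Measurable (a j)) ∧ (∀ j, Measurable (b j)) ∧
      (∀ j x, |a j x| ≤ 1) ∧ (∀ j y, |b j y| ≤ C) ∧
      (∀ p : α × β, |∑ j ∈ Finset.range n, a j p.1 * b j p.2| ≤ C) ∧
      ∫⁻ p, ‖K p - ∑ j ∈ Finset.range n, a j p.1 * b j p.2‖ₑ ∂ρ.prod μ ≤ ε := by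
  have hC0 : 0 ≤ C := by
    obtain ⟨x⟩ : Nonempty α := ρ.nonempty_of_neZero
    obtain ⟨y⟩ : Nonempty β := μ.nonempty_of_neZero
    exact (abs_nonneg _).trans (hC (x, y))
  obtain ⟨h, hm, hb, hd⟩ := exists_seq_dense_L1 μ hC0
  have hε2 : ε / 2 ≠ 0 := by simpa using hε
  -- The first space is partitioned according to the first function of a dense sequence that is
  -- close to the slice of K. The approximant takes that function on each of finitely many pieces
  -- and zero on the tail, which has small measure.
  set E : ℕ → Set α := fun j => {x | ∫⁻ y, ‖K (x, y) - h j y‖ₑ ∂μ < ε / 2} with hE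
  have hEm : ∀ j, MeasurableSet (E j) := by
    intro j
    have : Measurable fun x => ∫⁻ y, ‖K (x, y) - h j y‖ₑ ∂μ :=
      Measurable.lintegral_prod_right' (f := fun p : α × β => ‖K p - h j p.2‖ₑ)
        (hK.sub ((hm j).comp measurable_snd)).enorm
    exact this measurableSet_Iio
  set F := disjointed E with hF
  have hFm : ∀ j, MeasurableSet (F j) := fun j => MeasurableSet.disjointed hEm j
  have hFd : Pairwise (Function.onFun Disjoint F) := disjoint_disjointed E
  have hcov : ⋃ j, F j = Set.univ := by
    rw [hF, iUnion_disjointed, Set.eq_univ_iff_forall]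
    intro x
    obtain ⟨j, hj⟩ := hd (fun y => K (x, y)) (hK.comp measurable_prodMk_left) (fun y => hC _) _ hε2
    exact Set.mem_iUnion.2 ⟨j, hj⟩
  have htail := tendsto_measure_biUnion_Ici_zero_of_pairwise_disjoint (μ := ρ)
    (fun i => (hFm i).nullMeasurableSet) hFd
  have htail2 : Tendsto (fun n => ENNReal.ofReal C * ρ (⋃ i ∈ Set.Ici n, F i)) atTop (𝓝 0) := by
    simpa using ENNReal.Tendsto.const_mul htail (Or.inr (ENNReal.ofReal_ne_top (r := C)))
  obtain ⟨n, hn⟩ := ((tendsto_order.1 htail2).2 _ (pos_iff_ne_zero.2 hε2)).exists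
  set a : ℕ → α → ℝ := fun j => (F j).indicator fun _ => 1 with ha
  have ham : ∀ j, Measurable (a j) := fun j => measurable_const.indicator (hFm j)
  have hsum1 : ∀ j < n, ∀ x ∈ F j, ∀ y, ∑ i ∈ Finset.range n, a i x * h i y = h j y := by
    intro j hj x hx y
    rw [Finset.sum_eq_single j]
    · simp [ha, hx]
    · intro i _ hij
      have : x ∉ F i := fun hxi => (Set.disjoint_left.1 (hFd hij)) hxi hx
      simp [ha, this]
    · intro hj'; exact absurd (Finset.mem_range.2 hj) hj'
  have hsum2 : ∀ x, (∀ j < n, x ∉ F j) → ∀ y, ∑ i ∈ Finset.range n, a i x * h i y = 0 := by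
    intro x hx y
    refine Finset.sum_eq_zero fun i hi => ?_
    simp [ha, hx i (Finset.mem_range.1 hi)]
  refine ⟨n, a, h, ham, hm, fun j x => abs_indicator_one_le _ _, hb, fun p => ?_, ?_⟩
  · by_cases hex : ∃ j < n, p.1 ∈ F j
    · obtain ⟨j, hj, hx⟩ := hex
      rw [hsum1 j hj _ hx]
      exact hb j _
    · push Not at hex
      rw [hsum2 _ hex]
      simpa
  have hmeas : Measurable fun p : α × β =>
      ‖K p - ∑ j ∈ Finset.range n, a j p.1 * h j p.2‖ₑ :=
    (hK.sub (Finset.measurable_fun_sum _ fun j _ => ((ham j).comp measurable_fst).mul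
      ((hm j).comp measurable_snd))).enorm
  rw [lintegral_prod _ hmeas.aemeasurable]
  have hTm : MeasurableSet (⋃ i ∈ Set.Ici n, F i) :=
    MeasurableSet.biUnion (Set.to_countable _) fun i _ => hFm i
  calc ∫⁻ x, ∫⁻ y, ‖K (x, y) - ∑ j ∈ Finset.range n, a j x * h j y‖ₑ ∂μ ∂ρ
      ≤ ∫⁻ x, (ε / 2 + (⋃ i ∈ Set.Ici n, F i).indicator (fun _ => ENNReal.ofReal C) x) ∂ρ := by
        refine lintegral_mono fun x => ?_
        by_cases hex : ∃ j < n, x ∈ F j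
        · obtain ⟨j, hj, hx⟩ := hex
          simp only [hsum1 j hj _ hx]
          have : x ∈ E j := disjointed_subset E j hx
          exact (le_of_lt this).trans le_self_add
        · push Not at hex
          simp only [hsum2 _ hex, sub_zero]
          have hx : x ∈ ⋃ i ∈ Set.Ici n, F i := by
            obtain ⟨i, hi⟩ := Set.mem_iUnion.1 (hcov ▸ Set.mem_univ x)
            refine Set.mem_biUnion (x := i) ?_ hi
            by_contra hlt
            exact hex i (not_le.1 hlt) hi
          rw [Set.indicator_of_mem hx]
          refine le_trans ?_ le_add_self
          calc ∫⁻ y, ‖K (x, y)‖ₑ ∂μ ≤ ∫⁻ _, ENNReal.ofReal C ∂μ := by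
                refine lintegral_mono fun y => ?_
                rw [Real.enorm_eq_ofReal_abs]
                exact ENNReal.ofReal_le_ofReal (hC _)
            _ = _ := by simp
    _ = ε / 2 + ENNReal.ofReal C * ρ (⋃ i ∈ Set.Ici n, F i) := by
        rw [lintegral_add_left measurable_const, lintegral_indicator_const hTm]
        simp
    _ ≤ ε / 2 + ε / 2 := by gcongr
    _ = ε := ENNReal.add_halves ε

end Approximation

/-! ### Mixing for functions and with a parameter. -/

section Mixing

variable {X : Type u} [MeasurableSpace X] {μ : Measure X} [IsProbabilityMeasure μ] {T : X ≃ᵐ X}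

omit [IsProbabilityMeasure μ] in
theorem IsMixing.tendsto_measure (h : IsMixing μ T) (hT : MeasurePreserving T μ μ) {A B : Set X}
    (hA : MeasurableSet A) (hB : MeasurableSet B) {s : ℕ → ℕ} (hs : Tendsto s atTop atTop) :
    Tendsto (fun n => μ (T^[s n] ⁻¹' A ∩ B)) atTop (𝓝 (μ A * μ B)) := by
  have h1 := h ![A, B] (fun i => by fin_cases i <;> assumption) (fun _ => s) (fun _ => hs)
  have hprod : ∏ i, μ ((![A, B] : Fin 2 → Set X) i) = μ A * μ B := by simp [Fin.prod_univ_two]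
  rw [hprod] at h1
  refine h1.congr fun n => ?_
  have hset : (⋂ i : Fin (1 + 1), (⇑T)^[∑ j : Fin 1 with j.castSucc < i, s n] ''
      (![A, B] : Fin 2 → Set X) i) = A ∩ T^[s n] '' B := by
    ext x
    simp [Set.mem_iInter, Fin.forall_fin_two, Finset.filter_singleton]
  rw [hset]
  have hinj : Function.Injective T^[s n] := T.injective.iterate _
  have himg : MeasurableSet (T^[s n] '' B) := by
    have : T^[s n] '' B = (ipow T (s n)) '' B := by
      ext x; simp [ipow_natCast]
    rw [this]
    exact (ipow T (s n)).measurableSet_image.2 hB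
  rw [← (hT.iterate (s n)).measure_preimage (hA.inter himg).nullMeasurableSet, Set.preimage_inter,
    Set.preimage_image_eq _ hinj]

theorem IsMixing.tendsto_integral (h : IsMixing μ T) (hT : MeasurePreserving T μ μ) {f g : X → ℝ}
    (hf : Measurable f) (hg : Measurable g) {C D : ℝ} (hC : ∀ x, |f x| ≤ C) (hD : ∀ x, |g x| ≤ D) :
    Tendsto (fun n : ℕ => ∫ x, f (T^[n] x) * g x ∂μ) atTop (𝓝 ((∫ x, f x ∂μ) * ∫ x, g x ∂μ)) := by
  have hm : ∀ n : ℕ, Measurable fun x => (T^[n] x, x) := fun n =>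
    (T.measurable.iterate n).prodMk measurable_id
  have i : ∀ n : ℕ, IsProbabilityMeasure (μ.map fun x => (T^[n] x, x)) := fun n =>
    Measure.isProbabilityMeasure_map (hm n).aemeasurable
  have := tendsto_integral_mul_of_forall_prod (l := atTop)
    (lam := fun n : ℕ => μ.map fun x => (T^[n] x, x)) (η := μ.prod μ) (fun A B hA hB => by
      have h1 := (ENNReal.tendsto_toReal (by finiteness)).comp
        (h.tendsto_measure hT hA hB tendsto_id)
      rw [Measure.real, Measure.prod_prod]
      refine h1.congr fun n => ?_
      rw [Measure.real, Measure.map_apply (hm n) (hA.prod hB)]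
      rfl) hf hg hC hD
  rw [integral_prod_mul] at this
  refine this.congr fun n => ?_
  rw [integral_map (f := fun p : X × X => f p.1 * g p.2) (hm n).aemeasurable
    ((hf.comp measurable_fst).mul (hg.comp measurable_snd)).aestronglyMeasurable]

theorem integral_prod_swap {B : Type*} [MeasurableSpace B] {ρ : Measure B} [IsProbabilityMeasure ρ]
    {f : X × B → ℝ} (hf : Measurable f) {C : ℝ} (hC : ∀ p, |f p| ≤ C) :
    ∫ p, f p ∂μ.prod ρ = ∫ b, ∫ x, f (x, b) ∂μ ∂ρ :=
  integral_prod_symm _ (integrable_of_abs_le hf hC)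

/-- Mixing with a parameter. -/
theorem IsMixing.tendsto_integral_prod (h : IsMixing μ T) (hT : MeasurePreserving T μ μ)
    {B : Type*} [MeasurableSpace B] {ρ : Measure B} [IsProbabilityMeasure ρ] {f g : X × B → ℝ}
    (hf : Measurable f) (hg : Measurable g) {C D : ℝ} (hC : ∀ x, |f x| ≤ C) (hD : ∀ x, |g x| ≤ D) :
    Tendsto (fun n : ℕ => ∫ p, f (T^[n] p.1, p.2) * g p ∂μ.prod ρ) atTop
      (𝓝 (∫ b, (∫ x, f (x, b) ∂μ) * ∫ x, g (x, b) ∂μ ∂ρ)) := by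
  have hfn : ∀ n : ℕ, Measurable fun p : X × B => f (T^[n] p.1, p.2) := fun n =>
    hf.comp (((T.measurable.iterate n).comp measurable_fst).prodMk measurable_snd)
  have hb : ∀ n : ℕ, ∀ p : X × B, |f (T^[n] p.1, p.2) * g p| ≤ C * D := fun n p =>
    abs_mul_le_mul (hC _) (hD _)
  have h1 : ∀ n : ℕ, ∫ p, f (T^[n] p.1, p.2) * g p ∂μ.prod ρ
      = ∫ b, ∫ x, f (T^[n] x, b) * g (x, b) ∂μ ∂ρ := fun n =>
    integral_prod_swap ((hfn n).mul hg) (hb n)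
  simp only [h1]
  refine tendsto_integral_of_dominated_convergence (fun _ => C * D) (fun n => ?_)
    (integrable_const _) (fun n => ae_of_all _ fun b => ?_) (ae_of_all _ fun b => ?_)
  · exact ((hfn n).mul hg).stronglyMeasurable.integral_prod_left'.aestronglyMeasurable
  · exact abs_integral_le_of_abs_le fun x => hb n (x, b)
  · exact h.tendsto_integral hT (hf.comp measurable_prodMk_right) (hg.comp measurable_prodMk_right)
      (fun _ => hC _) (fun _ => hD _)

end Mixing

end SelfJoining

namespace SelfJoining

/-! ### Conditional expectations along fibres. -/

section FibreAverages

variable {B Z : Type*} [MeasurableSpace B] [MeasurableSpace Z] [StandardBorelSpace Z] [Nonempty Z]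
  {ρ : Measure (B × Z)} [IsProbabilityMeasure ρ]

/-- The conditional expectation of a function of the second coordinate given the first one. -/
noncomputable def fibreAvg (ρ : Measure (B × Z)) [IsFiniteMeasure ρ] (g : Z → ℝ) (b : B) : ℝ :=
  ∫ z, g z ∂ρ.condKernel b

@[fun_prop]
theorem measurable_fibreAvg {g : Z → ℝ} (hg : Measurable g) : Measurable (fibreAvg ρ g) :=
  measurable_integral_kernel (f := fun p : B × Z => g p.2) (hg.comp measurable_snd)

theorem measurable_fibreAvg_param {D : Type*} [MeasurableSpace D] {g : D × Z → ℝ}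
    (hg : Measurable g) {π : D → B} (hπ : Measurable π) :
    Measurable fun d => fibreAvg ρ (fun z => g (d, z)) (π d) :=
  measurable_integral_kernel (κ := ρ.condKernel.comap π hπ) hg

theorem abs_fibreAvg_le {g : Z → ℝ} {C : ℝ} (hC : ∀ z, |g z| ≤ C) (b : B) :
    |fibreAvg ρ g b| ≤ C :=
  abs_integral_le_of_abs_le hC

theorem integral_compProd_of_abs_le {Y : Type*} [MeasurableSpace Y] {Γ : Measure Y}
    [IsProbabilityMeasure Γ] {π : Y → B} (hπ : Measurable π) {F : Y × Z → ℝ} (hF : Measurable F)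
    {C : ℝ} (hC : ∀ p, |F p| ≤ C) :
    ∫ p, F p ∂(Γ ⊗ₘ ρ.condKernel.comap π hπ) = ∫ y, fibreAvg ρ (fun z => F (y, z)) (π y) ∂Γ :=
  Measure.integral_compProd (integrable_of_abs_le hF hC)

theorem integral_eq_integral_fibreAvg {F : B × Z → ℝ} (hF : Measurable F)
    {C : ℝ} (hC : ∀ p, |F p| ≤ C) :
    ∫ p, F p ∂ρ = ∫ b, fibreAvg ρ (fun z => F (b, z)) b ∂ρ.fst := by
  conv_lhs => rw [← ρ.disintegrate ρ.condKernel]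
  exact Measure.integral_compProd (integrable_of_abs_le hF hC)

theorem fibreAvg_const_mul (c : ℝ) (g : Z → ℝ) (b : B) :
    fibreAvg ρ (fun z => c * g z) b = c * fibreAvg ρ g b :=
  integral_const_mul _ _

theorem fibreAvg_mul_const (c : ℝ) (g : Z → ℝ) (b : B) :
    fibreAvg ρ (fun z => g z * c) b = fibreAvg ρ g b * c :=
  integral_mul_const _ _

end FibreAverages

section ErgodicComponents

variable {Y Z : Type*} [MeasurableSpace Y] [MeasurableSpace Z] {S : Y → Y} {Ω : Measure Y}
  {κ : Kernel Y Y} [IsProbabilityMeasure Ω]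

theorem IsErgodicDecomposition.map_eq (hE : IsErgodicDecomposition S Ω κ) {π : Y → Z}
    (hπ : Measurable π) {θ : Measure Z} (h : ∀ᵐ ω ∂Ω, (κ ω).map π = θ) : Ω.map π = θ := by
  ext E hE'
  rw [Measure.map_apply hπ hE']
  refine hE.measure_eq (hπ hE') ?_
  filter_upwards [h] with ω hω
  rw [← hω, Measure.map_apply hπ hE']

end ErgodicComponents

/-! ### Integration over a triple joining through its fibres. -/

section Triple

variable {X : Type u} [MeasurableSpace X] [StandardBorelSpace X] [Nonempty X]
  {μ : Measure X} {T : X ≃ᵐ X} {ν : Measure (X × X × X)} [IsProbabilityMeasure ν]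

namespace IsTripleJoining

variable {F : X × X × X → ℝ} {C : ℝ}

theorem integral_eq_over12 (h : IsTripleJoining μ T ν) (hF : Measurable F) (hC : ∀ p, |F p| ≤ C) :
    ∫ p, F p ∂ν = ∫ q, fibreAvg (over12 ν) (fun z => F (q.1, q.2, z)) q ∂μ.prod μ := by
  rw [← h.over12_fst, ← integral_eq_integral_fibreAvg (ρ := over12 ν)
    (F := fun w => F (w.1.1, w.1.2, w.2)) (by fun_prop) (fun _ => hC _), over12,
    integral_map (by fun_prop) (Measurable.aestronglyMeasurable (by fun_prop))]

theorem integral_eq_over13 (h : IsTripleJoining μ T ν) (hF : Measurable F) (hC : ∀ p, |F p| ≤ C) :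
    ∫ p, F p ∂ν = ∫ q, fibreAvg (over13 ν) (fun y => F (q.1, y, q.2)) q ∂μ.prod μ := by
  rw [← h.over13_fst, ← integral_eq_integral_fibreAvg (ρ := over13 ν)
    (F := fun w => F (w.1.1, w.2, w.1.2)) (by fun_prop) (fun _ => hC _), over13,
    integral_map (by fun_prop) (Measurable.aestronglyMeasurable (by fun_prop))]

theorem integral_eq_over23 (h : IsTripleJoining μ T ν) (hF : Measurable F) (hC : ∀ p, |F p| ≤ C) :
    ∫ p, F p ∂ν = ∫ q, fibreAvg (over23 ν) (fun x => F (x, q.1, q.2)) q ∂μ.prod μ := by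
  rw [← h.over23_fst, ← integral_eq_integral_fibreAvg (ρ := over23 ν)
    (F := fun w => F (w.2, w.1.1, w.1.2)) (by fun_prop) (fun _ => hC _), over23,
    integral_map (by fun_prop) (Measurable.aestronglyMeasurable (by fun_prop))]

variable [IsProbabilityMeasure μ]

/-- A triple joining for which all functions of the first variable have constant conditional
expectation given the other two is a product. -/
theorem eq_prod_of_forall_fibreAvg (h : IsTripleJoining μ T ν)
    (hz : ∀ f : X → ℝ, Measurable f → (∀ x, |f x| ≤ 1) → ∫ x, f x ∂μ = 0 →
      ∀ᵐ q ∂μ.prod μ, fibreAvg (over23 ν) f q = 0) : ν = μ.prod (μ.prod μ) := by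
  refine Measure.ext_prod₃ fun {A B D} hA hB hD => ?_
  have hmA : Measurable (A.indicator (1 : X → ℝ)) := measurable_one.indicator hA
  -- The centred indicator of A has conditional mean zero, so A is independent of every rectangle in
  -- the other two coordinates.
  set f : X → ℝ := fun x => A.indicator 1 x - μ.real A with hf
  have hfm : Measurable f := hmA.sub_const _
  have h01 : 0 ≤ μ.real A ∧ μ.real A ≤ 1 := ⟨measureReal_nonneg, measureReal_le_one⟩
  have hf1 : ∀ x, |f x| ≤ 1 := fun x => by
    by_cases hx : x ∈ A <;> simp [hf, hx, abs_le] <;> linarith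
  have hf0 : ∫ x, f x ∂μ = 0 := by
    rw [hf, integral_sub (f := A.indicator (1 : X → ℝ))
      ((integrable_const (1 : ℝ)).indicator hA) (integrable_const _), integral_indicator_one hA]
    simp
  have hK := hz f hfm hf1 hf0
  set g : X × X × X → ℝ := fun p => B.indicator 1 p.2.1 * D.indicator 1 p.2.2 with hg
  have hmB : Measurable (B.indicator (1 : X → ℝ)) := measurable_one.indicator hB
  have hmD : Measurable (D.indicator (1 : X → ℝ)) := measurable_one.indicator hD
  have e0 : ∫ p, g p * f p.1 ∂ν = 0 := by
    rw [h.integral_eq_over23 (F := fun p => g p * f p.1) (C := 1 * 1 * 1) (by fun_prop)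
      (fun p => abs_mul_le_mul (abs_mul_le_mul (abs_indicator_one_le _ _)
        (abs_indicator_one_le _ _)) (hf1 _))]
    refine integral_eq_zero_of_ae ?_
    filter_upwards [hK] with q hq
    simp only [hg, fibreAvg_const_mul, hq, mul_zero, Pi.zero_apply]
  have e1 : ∫ p, g p * f p.1 ∂ν = ν.real (A ×ˢ B ×ˢ D) - μ.real A * (μ.real B * μ.real D) := by
    have h1 : ∀ p, g p * f p.1 = (A ×ˢ B ×ˢ D).indicator (1 : X × X × X → ℝ) p
        - μ.real A * (B ×ˢ D).indicator (1 : X × X → ℝ) p.2 := by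
      rintro ⟨x, y, z⟩
      by_cases hx : x ∈ A <;> by_cases hy : y ∈ B <;> by_cases hz : z ∈ D <;>
        simp [hg, hf, hx, hy, hz]
    have h2 : ∫ p, (B ×ˢ D).indicator (1 : X × X → ℝ) p.2 ∂ν = μ.real B * μ.real D := by
      have := integral_map (μ := ν) (φ := fun p : X × X × X => p.2)
        (f := (B ×ˢ D).indicator (1 : X × X → ℝ)) (by fun_prop)
        (measurable_one.indicator (hB.prod hD)).aestronglyMeasurable
      rw [← this, integral_indicator_one (hB.prod hD)]
      have h3 : ν.map (fun p : X × X × X => p.2) = μ.prod μ := h.map23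
      rw [h3, measureReal_prod_prod]
    simp only [h1]
    rw [integral_sub (f := (A ×ˢ B ×ˢ D).indicator (1 : X × X × X → ℝ))
      (g := fun p => μ.real A * (B ×ˢ D).indicator (1 : X × X → ℝ) p.2)
      ((integrable_const (1 : ℝ)).indicator (hA.prod (hB.prod hD)))
      (((integrable_const (1 : ℝ)).indicator (hB.prod hD) |>.comp_measurable
        measurable_snd).const_mul _), integral_indicator_one (hA.prod (hB.prod hD)),
        integral_const_mul, h2]
  rw [e0] at e1
  rw [Measure.prod_prod, Measure.prod_prod]
  rw [← ENNReal.toReal_eq_toReal_iff' (by finiteness) (by finiteness)]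
  rw [ENNReal.toReal_mul, ENNReal.toReal_mul]
  simp only [Measure.real] at e1
  linarith

end IsTripleJoining

end Triple

end SelfJoining

namespace SelfJoining

/-! ### Invariant measures whose ergodic components are configurations. -/

section LinkedMeasures

variable {X : Type u} [MeasurableSpace X] [StandardBorelSpace X] [Nonempty X]
  {μ : Measure X} [IsProbabilityMeasure μ] {T : X ≃ᵐ X}
  {ν : Measure (X × X × X)} [IsProbabilityMeasure ν]

/-- The law of `((x, y₁, z₁), z₂)`, with `(x, y₁, z₁)` of law `ν` and `z₂` drawn from the fibre of
`ν` over `(T ^ m x, y₁)`. -/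
noncomputable def linked (T : X ≃ᵐ X) (ν : Measure (X × X × X)) [IsProbabilityMeasure ν] (m : ℤ) :
    Measure ((X × X × X) × X) :=
  ν ⊗ₘ (over12 ν).condKernel.comap (fun p : X × X × X => (ipow T m p.1, p.2.1)) (by fun_prop)

/-- The law of `(((x, y₁, z₁), z₂), y)`, where moreover `y` is drawn from the fibre of `ν` over
`(T ^ k x, z₁)`. -/
noncomputable def linked₂ (T : X ≃ᵐ X) (ν : Measure (X × X × X)) [IsProbabilityMeasure ν]
    (m k : ℤ) : Measure (((X × X × X) × X) × X) :=
  linked T ν m ⊗ₘ (over13 ν).condKernel.comap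
    (fun q : (X × X × X) × X => (ipow T k q.1.1, q.1.2.2)) (by fun_prop)

instance (m : ℤ) : IsProbabilityMeasure (linked T ν m) := by
  unfold linked; infer_instance

instance (m k : ℤ) : IsProbabilityMeasure (linked₂ T ν m k) := by
  unfold linked₂; infer_instance

theorem map_fst_linked (m : ℤ) : (linked T ν m).map Prod.fst = ν :=
  Measure.fst_compProd _ _

theorem map_fst_linked₂ (m k : ℤ) : (linked₂ T ν m k).map Prod.fst = linked T ν m :=
  Measure.fst_compProd _ _

namespace IsTripleJoining

omit [StandardBorelSpace X] [Nonempty X] [IsProbabilityMeasure ν] in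
theorem map_ipow12 (h : IsTripleJoining μ T ν) (m : ℤ) :
    ν.map (fun p => (ipow T m p.1, p.2.1)) = μ.prod μ := by
  have h2 : (μ.prod μ).map (Prod.map (ipow T m) id) = μ.prod μ :=
    ((measurePreserving_ipow h.measurePreserving m).prod (MeasurePreserving.id μ)).map_eq
  rw [← h2, ← h.map12, Measure.map_map (by fun_prop) (by fun_prop)]
  rfl

omit [StandardBorelSpace X] [Nonempty X] [IsProbabilityMeasure ν] in
theorem map_ipow13 (h : IsTripleJoining μ T ν) (m : ℤ) :
    ν.map (fun p => (ipow T m p.1, p.2.2)) = μ.prod μ := by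
  have h2 : (μ.prod μ).map (Prod.map (ipow T m) id) = μ.prod μ :=
    ((measurePreserving_ipow h.measurePreserving m).prod (MeasurePreserving.id μ)).map_eq
  rw [← h2, ← h.map13, Measure.map_map (by fun_prop) (by fun_prop)]
  rfl

theorem map_linked_law3 (h : IsTripleJoining μ T ν) (m : ℤ) :
    (linked T ν m).map (fun q => (ipow T m q.1.1, q.1.2.1, q.2)) = ν := by
  have h1 := map_compProd_condKernel (Γ := ν) (π := fun p : X × X × X => (ipow T m p.1, p.2.1))
    (by fun_prop) (ρ := over12 ν) (by rw [h.over12_fst, h.map_ipow12])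
  have h2 : (over12 ν).map (fun w => (w.1.1, w.1.2, w.2)) = ν := by
    rw [over12, Measure.map_map (by fun_prop) (by fun_prop)]
    exact Measure.map_id
  conv_rhs => rw [← h2, ← h1]
  rw [Measure.map_map (by fun_prop) (by fun_prop)]
  rfl

theorem map_linked_ipow (h : IsTripleJoining μ T ν) (m k : ℤ) :
    (linked T ν m).map (fun q => (ipow T k q.1.1, q.1.2.2)) = μ.prod μ := by
  rw [← h.map_ipow13 k]
  conv_rhs => rw [← map_fst_linked (T := T) (ν := ν) m]
  rw [Measure.map_map (by fun_prop) (by fun_prop)]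
  rfl

theorem map_linked₂_law1 (h : IsTripleJoining μ T ν) (m k : ℤ) :
    (linked₂ T ν m k).map (fun q => (ipow T k q.1.1.1, q.2, q.1.1.2.2)) = ν := by
  have h1 := map_compProd_condKernel (Γ := linked T ν m)
    (π := fun q : (X × X × X) × X => (ipow T k q.1.1, q.1.2.2))
    (by fun_prop) (ρ := over13 ν) (by rw [h.over13_fst, h.map_linked_ipow])
  have h2 : (over13 ν).map (fun w => (w.1.1, w.2, w.1.2)) = ν := by
    rw [over13, Measure.map_map (by fun_prop) (by fun_prop)]
    exact Measure.map_id
  conv_rhs => rw [← h2, ← h1]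
  rw [Measure.map_map (by fun_prop) (by fun_prop)]
  rfl

theorem measurePreserving_linked (h : IsTripleJoining μ T ν) (m : ℤ) :
    MeasurePreserving (Prod.map (Prod.map T (Prod.map T T)) T) (linked T ν m) (linked T ν m) :=
  measurePreserving_compProd_condKernel (β := T.prodCongr T) h.ergodic.toMeasurePreserving _
    (fun p => Prod.ext (ipow_apply_comm _ _ _) rfl) h.ergodic_over12.toMeasurePreserving
    (by rw [h.over12_fst, h.map_ipow12])

theorem measurePreserving_linked₂ (h : IsTripleJoining μ T ν) (m k : ℤ) :
    MeasurePreserving (Prod.map (Prod.map (Prod.map T (Prod.map T T)) T) T) (linked₂ T ν m k)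
      (linked₂ T ν m k) :=
  measurePreserving_compProd_condKernel (β := T.prodCongr T) (h.measurePreserving_linked m) _
    (fun p => Prod.ext (ipow_apply_comm _ _ _) rfl) h.ergodic_over13.toMeasurePreserving
    (by rw [h.over13_fst, h.map_linked_ipow])

theorem map_z₂_linked (h : IsTripleJoining μ T ν) (m : ℤ) : (linked T ν m).map Prod.snd = μ := by
  rw [← h.map3]
  conv_rhs => rw [← h.map_linked_law3 m]
  rw [Measure.map_map (by fun_prop) (by fun_prop)]
  rfl

end IsTripleJoining

/-- The variables of a configuration, in the order `(x, z₁, y₁, z₂, y)`. -/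
def toConfig (q : ((X × X × X) × X) × X) : X × X × X × X × X :=
  (q.1.1.1, q.1.1.2.2, q.1.1.2.1, q.1.2, q.2)

omit [StandardBorelSpace X] [Nonempty X] in
@[fun_prop]
theorem measurable_toConfig : Measurable (toConfig (X := X)) := by
  unfold toConfig; fun_prop

/-- The ergodic components of an extension of `linked₂` are configurations. -/
theorem IsTripleJoining.ae_isConfig (h : IsTripleJoining μ T ν) {m k : ℤ} {Y : Type*}
    [MeasurableSpace Y] {S : Y → Y} {Ω : Measure Y} [IsProbabilityMeasure Ω] {κ : Kernel Y Y}
    (hE : IsErgodicDecomposition S Ω κ) {g : Y → ((X × X × X) × X) × X} (hg : Measurable g)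
    (hgS : ∀ y, g (S y) = Prod.map (Prod.map (Prod.map T (Prod.map T T)) T) T (g y))
    (hΩ : Ω.map g = linked₂ T ν m k) :
    ∀ᵐ ω ∂Ω, IsConfig T ν m k ((κ ω).map fun y => toConfig (g y)) := by
  have l1 : Ω.map (fun y => (ipow T k (g y).1.1.1, (g y).2, (g y).1.1.2.2)) = ν := by
    rw [← h.map_linked₂_law1 m k, ← hΩ, Measure.map_map (by fun_prop) hg]
    rfl
  have l2 : Ω.map (fun y => (g y).1.1) = ν := by
    conv_rhs => rw [← map_fst_linked (T := T) (ν := ν) m, ← map_fst_linked₂ m k, ← hΩ]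
    rw [Measure.map_map (by fun_prop) (by fun_prop), Measure.map_map (by fun_prop) (by fun_prop)]
    rfl
  have l3 : Ω.map (fun y => (ipow T m (g y).1.1.1, (g y).1.1.2.1, (g y).1.2)) = ν := by
    conv_rhs => rw [← h.map_linked_law3 m, ← map_fst_linked₂ m k, ← hΩ]
    rw [Measure.map_map (by fun_prop) (by fun_prop), Measure.map_map (by fun_prop) (by fun_prop)]
    rfl
  -- Each prescribed law is the ergodic measure ν of a factor, so almost every component inherits
  -- it.
  have e : ∀ {π : Y → X × X × X}, Measurable π →
      π ∘ S = Prod.map T (Prod.map T T) ∘ π → Ω.map π = ν → ∀ᵐ ω ∂Ω, (κ ω).map π = ν := by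
    intro π hπ hπS hπν
    have := hE.ae_map_eq hπ hπS (by rw [hπν]; exact h.ergodic)
    rwa [hπν] at this
  have hgS' : g ∘ S = Prod.map (Prod.map (Prod.map T (Prod.map T T)) T) T ∘ g := funext hgS
  filter_upwards [hE.ergodic, e (by fun_prop) (by
      funext y; simp [hgS y, ipow_apply_comm]) l1, e (by fun_prop) (by
      funext y; simp [hgS y]) l2, e (by fun_prop) (by
      funext y; simp [hgS y, ipow_apply_comm]) l3] with ω h0 h1 h2 h3
  refine ⟨Ergodic.map_of_semiconj h0 (by fun_prop) (by fun_prop) (fun y => by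
    simp [hgS y, toConfig]), ?_, ?_, ?_⟩
  · conv_rhs => rw [← h1]
    rw [Measure.map_map (by fun_prop) (by fun_prop)]
    rfl
  · conv_rhs => rw [← h2]
    rw [Measure.map_map (by fun_prop) (by fun_prop)]
    rfl
  · conv_rhs => rw [← h3]
    rw [Measure.map_map (by fun_prop) (by fun_prop)]
    rfl

/-- If `(y, z₂)` is independent in all configurations then it is in `linked₂`. -/
theorem IsTripleJoining.map_linked₂_eq_prod (h : IsTripleJoining μ T ν) {m k : ℤ}
    (hprod : ∀ Ω, IsConfig T ν m k Ω →
      Ω.map (fun w => (w.2.2.2.2, w.2.2.2.1)) = μ.prod μ) :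
    (linked₂ T ν m k).map (fun q => (q.2, q.1.2)) = μ.prod μ := by
  obtain ⟨κ, hE⟩ := exists_ergodic_decomposition (h.measurePreserving_linked₂ m k)
  refine hE.map_eq (by fun_prop) ?_
  filter_upwards [h.ae_isConfig hE measurable_id (fun _ => rfl) Measure.map_id] with ω hω
  rw [← hprod _ hω, Measure.map_map (by fun_prop) (by fun_prop)]
  rfl

/-- If moreover no configuration completes to a fourth copy of `ν`, then the conditional
expectation of a function of mean zero given `(y, z₂)` is orthogonal to functions of `x`. -/
theorem IsTripleJoining.integral_linked₂_eq_zero (hM : HasMinimalPairs μ T)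
    (h : IsTripleJoining μ T ν) {m k : ℤ}
    (hprod : ∀ Ω, IsConfig T ν m k Ω →
      Ω.map (fun w => (w.2.2.2.2, w.2.2.2.1)) = μ.prod μ)
    (hno : ∀ Ω (p : ℤ), IsConfig T ν m k Ω →
      Ω.map (fun w => (ipow T p w.1, w.2.2.2.2, w.2.2.2.1)) ≠ ν)
    {f g : X → ℝ} (hf : Measurable f) (hg : Measurable g) {C D : ℝ} (hC : ∀ x, |f x| ≤ C)
    (hD : ∀ x, |g x| ≤ D) (hf0 : ∫ x, f x ∂μ = 0) :
    ∫ q, g q.1.1.1 * fibreAvg (over23 ν) f (q.2, q.1.2) ∂linked₂ T ν m k = 0 := by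
  have hfst : (linked₂ T ν m k).map (fun q => (q.2, q.1.2)) = (over23 ν).fst := by
    rw [h.map_linked₂_eq_prod hprod, h.over23_fst]
  -- A variable w is drawn from the fibre of ν over `(y, z₂)`, so that the triple `(w, y, z₂)` has
  -- law ν and integrating `f(w)` yields the conditional expectation.
  set M := linked₂ T ν m k ⊗ₘ (over23 ν).condKernel.comap
    (fun q : ((X × X × X) × X) × X => (q.2, q.1.2)) (by fun_prop) with hMdef
  have hMS : MeasurePreserving
      (Prod.map (Prod.map (Prod.map (Prod.map T (Prod.map T T)) T) T) T) M M :=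
    measurePreserving_compProd_condKernel (β := T.prodCongr T) (h.measurePreserving_linked₂ m k) _
      (fun p => rfl) h.ergodic_over23.toMeasurePreserving hfst
  have hlaw : M.map (fun w => (w.2, w.1.2, w.1.1.2)) = ν := by
    have h1 := map_compProd_condKernel (Γ := linked₂ T ν m k)
      (π := fun q : ((X × X × X) × X) × X => (q.2, q.1.2)) (by fun_prop) (ρ := over23 ν) hfst
    have h2 : (over23 ν).map (fun w => (w.2, w.1.1, w.1.2)) = ν := by
      rw [over23, Measure.map_map (by fun_prop) (by fun_prop)]
      exact Measure.map_id
    conv_rhs => rw [← h2, ← h1]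
    rw [Measure.map_map (by fun_prop) (by fun_prop)]
    rfl
  obtain ⟨κ, hE⟩ := exists_ergodic_decomposition hMS
  -- On each component x and w are independent or `w = T ^ p x`; the latter would complete the
  -- configuration to a fourth copy of ν.
  have hind : M.map (fun w => (w.1.1.1.1, w.2)) = μ.prod μ := by
    refine hE.map_eq (by fun_prop) ?_
    have e1 := hE.ae_map_eq (π := fun w => (w.2, w.1.2, w.1.1.2)) (by fun_prop)
      (R := Prod.map T (Prod.map T T)) rfl (by rw [hlaw]; exact h.ergodic)
    rw [hlaw] at e1
    filter_upwards [h.ae_isConfig hE (g := Prod.fst) measurable_fst (fun _ => rfl)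
      (Measure.fst_compProd _ _), hE.ergodic, e1] with ω hω he h4
    have mx : (κ ω).map (fun w => w.1.1.1.1) = μ := by
      rw [← h.map1]
      conv_rhs => rw [← hω.law2]
      rw [Measure.map_map (by fun_prop) (by fun_prop), Measure.map_map (by fun_prop) (by fun_prop)]
      rfl
    have mw : (κ ω).map (fun w => w.2) = μ := by
      rw [← h.map1]
      conv_rhs => rw [← h4]
      rw [Measure.map_map (by fun_prop) (by fun_prop)]
      rfl
    rcases hM.map_eq_or he (f := fun w => w.1.1.1.1) (g := fun w => w.2) (by fun_prop)
      (by fun_prop) (fun _ => rfl) (fun _ => rfl) mx mw with h5 | ⟨p, hp⟩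
    · exact h5
    · refine absurd ?_ (hno _ p hω)
      rw [Measure.map_map (by fun_prop) (by fun_prop)]
      conv_rhs => rw [← h4]
      refine Measure.map_congr ?_
      filter_upwards [hp] with w hw
      simp [toConfig, hw]
  have hint : ∫ w, g w.1.1.1.1 * f w.2 ∂M = 0 := by
    have := integral_map (μ := M) (φ := fun w => (w.1.1.1.1, w.2))
      (f := fun p : X × X => g p.1 * f p.2) (by fun_prop)
      (Measurable.aestronglyMeasurable (by fun_prop))
    rw [← this, hind, integral_prod_mul, hf0, mul_zero]
  rw [← hint, hMdef, integral_compProd_of_abs_le _ (by fun_prop)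
    (fun w => abs_mul_le_mul (hD _) (hC _))]
  simp only [fibreAvg_const_mul]

end LinkedMeasures

end SelfJoining

namespace SelfJoining

theorem abs_integral_mul_sub_le {Y Z : Type*} [MeasurableSpace Y] [MeasurableSpace Z]
    {P : Measure Y} [IsProbabilityMeasure P] {θ : Measure Z} {π : Y → Z} (hπ : Measurable π)
    (hθ : P.map π = θ) {U : Y → ℝ} {H H' : Z → ℝ} (hU : Measurable U) (hH : Measurable H)
    (hH' : Measurable H') {C D D' : ℝ} (hC : ∀ y, |U y| ≤ C) (hD : ∀ z, |H z| ≤ D)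
    (hD' : ∀ z, |H' z| ≤ D') {ε : ℝ} (hε : 0 ≤ ε)
    (hl : ∫⁻ z, ‖H z - H' z‖ₑ ∂θ ≤ ENNReal.ofReal ε) :
    |∫ y, U y * H (π y) ∂P - ∫ y, U y * H' (π y) ∂P| ≤ C * ε := by
  have hC0 : 0 ≤ C := by
    obtain ⟨y⟩ : Nonempty Y := P.nonempty_of_neZero
    exact (abs_nonneg _).trans (hC y)
  have hb : ∀ y, |H (π y) - H' (π y)| ≤ D + D' := fun y =>
    (abs_sub _ _).trans (add_le_add (hD _) (hD' _))
  rw [← integral_sub (f := fun y => U y * H (π y)) (g := fun y => U y * H' (π y))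
    (integrable_of_abs_le (by fun_prop) fun y => abs_mul_le_mul (hC y) (hD _))
    (integrable_of_abs_le (by fun_prop) fun y => abs_mul_le_mul (hC y) (hD' _))]
  calc |∫ y, U y * H (π y) - U y * H' (π y) ∂P|
      ≤ ∫ y, |U y * H (π y) - U y * H' (π y)| ∂P := abs_integral_le_integral_abs
    _ ≤ ∫ y, C * |H (π y) - H' (π y)| ∂P := by
        refine integral_mono_of_nonneg (ae_of_all _ fun _ => abs_nonneg _)
          (integrable_of_abs_le (C := C * (D + D')) (by fun_prop) fun y =>
            abs_mul_le_mul (by rw [abs_of_nonneg hC0]) (by rw [abs_abs]; exact hb y))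
          (ae_of_all _ fun y => ?_)
        simp only
        rw [← mul_sub, abs_mul]
        gcongr
        exact hC y
    _ = C * ∫ y, |H (π y) - H' (π y)| ∂P := integral_const_mul _ _
    _ = C * ∫ z, |H z - H' z| ∂θ := by
        rw [← hθ, integral_map (f := fun z => |H z - H' z|) (by fun_prop)
          (Measurable.aestronglyMeasurable (by fun_prop))]
    _ ≤ C * ε := by
        gcongr
        have := integral_norm_eq_lintegral_enorm (μ := θ) (f := fun z => H z - H' z)
          (Measurable.aestronglyMeasurable (by fun_prop))
        simp only [Real.norm_eq_abs] at this
        rw [this]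
        exact ENNReal.toReal_le_of_le_ofReal hε hl

/-! ### The limits in k and in m. -/

section Limits

variable {X : Type u} [MeasurableSpace X] [StandardBorelSpace X] [Nonempty X]
  {μ : Measure X} [IsProbabilityMeasure μ] {T : X ≃ᵐ X}
  {ν : Measure (X × X × X)} [IsProbabilityMeasure ν]

namespace IsTripleJoining

variable {u f a b : X → ℝ} {Cu C Ca Cb : ℝ}

omit [IsProbabilityMeasure μ] in
-- Integrating out y, z₂ and then y₁ leaves an integral over the independent pair `(x, z₁)` in which
-- k enters only through `T ^ k x`, ready for mixing.
theorem integral_linked₂_mul (h : IsTripleJoining μ T ν) (hu : Measurable u) (hf : Measurable f)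
    (ha : Measurable a) (hb : Measurable b) (hCu : ∀ x, |u x| ≤ Cu) (hC : ∀ x, |f x| ≤ C)
    (hCa : ∀ x, |a x| ≤ Ca) (hCb : ∀ x, |b x| ≤ Cb) (m : ℤ) (k : ℕ) :
    ∫ q, u q.1.1.1 * f (ipow T k q.1.1.1) * (a q.2 * b q.1.2) ∂linked₂ T ν m k
      = ∫ p, (f (T^[k] p.1) * fibreAvg (over13 ν) a (T^[k] p.1, p.2)) *
          (u p.1 * fibreAvg (over13 ν)
            (fun y => fibreAvg (over12 ν) b (ipow T m p.1, y)) p) ∂μ.prod μ := by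
  have e1 : ∀ q : ((X × X × X) × X) × X, u q.1.1.1 * f (ipow T k q.1.1.1) * (a q.2 * b q.1.2)
      = u q.1.1.1 * f (ipow T k q.1.1.1) * b q.1.2 * a q.2 := fun q => by ring
  have b1 : ∀ q : X, |u q * f (ipow T k q)| ≤ Cu * C := fun q => abs_mul_le_mul (hCu _) (hC _)
  simp only [e1]
  rw [linked₂, integral_compProd_of_abs_le _ (by fun_prop)
    (fun w => abs_mul_le_mul (abs_mul_le_mul (b1 _) (hCb _)) (hCa _))]
  simp only [fibreAvg_const_mul]
  have e2 : ∀ q : (X × X × X) × X, u q.1.1 * f (ipow T k q.1.1) * b q.2 *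
      fibreAvg (over13 ν) a (ipow T k q.1.1, q.1.2.2)
      = u q.1.1 * f (ipow T k q.1.1) * fibreAvg (over13 ν) a (ipow T k q.1.1, q.1.2.2) * b q.2 :=
    fun q => by ring
  simp only [e2]
  rw [linked, integral_compProd_of_abs_le _ (by fun_prop)
    (fun w => abs_mul_le_mul (abs_mul_le_mul (b1 _) (abs_fibreAvg_le hCa _)) (hCb _))]
  simp only [fibreAvg_const_mul]
  rw [h.integral_eq_over13 (F := fun p => u p.1 * f (ipow T k p.1) *
    fibreAvg (over13 ν) a (ipow T k p.1, p.2.2) * fibreAvg (over12 ν) b (ipow T m p.1, p.2.1))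
    (by fun_prop) (fun w => abs_mul_le_mul (abs_mul_le_mul (b1 _) (abs_fibreAvg_le hCa _))
      (abs_fibreAvg_le hCb _))]
  simp only [fibreAvg_const_mul, ipow_natCast]
  refine integral_congr_ae (ae_of_all _ fun p => ?_)
  simp only
  ring

theorem integral_linked_prod_mul (h : IsTripleJoining μ T ν) {K : X × X → ℝ} (hu : Measurable u)
    (hK : Measurable K) (ha : Measurable a) (hb : Measurable b) (hCu : ∀ x, |u x| ≤ Cu)
    (hC : ∀ x, |K x| ≤ C) (hCa : ∀ x, |a x| ≤ Ca) (hCb : ∀ x, |b x| ≤ Cb) (m : ℤ) :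
    ∫ w, u w.1.1.1 * K (w.2, w.1.1.2.2) * (a w.2 * b w.1.2) ∂(linked T ν m).prod μ
      = ∫ p, (∫ y, K (y, p.2) * a y ∂μ) *
          (u p.1 * fibreAvg (over13 ν)
            (fun y => fibreAvg (over12 ν) b (ipow T m p.1, y)) p) ∂μ.prod μ := by
  have hk : ∃ k : X → ℝ, ∀ z, ∫ y, K (y, z) * a y ∂μ = k z := ⟨_, fun _ => rfl⟩
  obtain ⟨k, hk⟩ := hk
  have hka : Measurable k := by
    have := measurable_integral_kernel (κ := Kernel.const X μ)
      (f := fun p : X × X => K (p.2, p.1) * a p.2) (by fun_prop)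
    simp only [Kernel.const_apply, hk] at this
    exact this
  have hkb : ∀ z, |k z| ≤ C * Ca := fun z => hk z ▸
    abs_integral_le_of_abs_le fun y => abs_mul_le_mul (hC _) (hCa _)
  have e1 : ∀ w : ((X × X × X) × X) × X, u w.1.1.1 * K (w.2, w.1.1.2.2) * (a w.2 * b w.1.2)
      = u w.1.1.1 * b w.1.2 * (K (w.2, w.1.1.2.2) * a w.2) := fun q => by ring
  simp only [e1]
  rw [integral_prod _ (integrable_of_abs_le (by fun_prop)
    (fun w => abs_mul_le_mul (abs_mul_le_mul (hCu _) (hCb _)) (abs_mul_le_mul (hC _) (hCa _))))]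
  simp only [integral_const_mul, hk]
  have e2 : ∀ q : (X × X × X) × X, u q.1.1 * b q.2 * k q.1.2.2
      = u q.1.1 * k q.1.2.2 * b q.2 := fun q => by ring
  simp only [e2]
  rw [linked, integral_compProd_of_abs_le _ (by fun_prop)
    (fun w => abs_mul_le_mul (abs_mul_le_mul (hCu _) (hkb _)) (hCb _))]
  simp only [fibreAvg_const_mul]
  rw [h.integral_eq_over13 (F := fun p => u p.1 * k p.2.2 *
    fibreAvg (over12 ν) b (ipow T m p.1, p.2.1))
    (by fun_prop) (fun w => abs_mul_le_mul (abs_mul_le_mul (hCu _) (hkb _))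
      (abs_fibreAvg_le hCb _))]
  simp only [fibreAvg_const_mul]
  refine integral_congr_ae (ae_of_all _ fun p => ?_)
  simp only
  ring

/-- Mixing separates `T ^ k x` from x for each z₁. The separated factor pairs `f(x)` with the
conditional expectation of a given `(x, z₁)`; by duality under ν it also pairs `a(y)` with that of f
given `(y, z₁)`. -/
theorem tendsto_integral_linked₂_mul (h : IsTripleJoining μ T ν) (hmix : IsMixing μ T)
    (hu : Measurable u) (hf : Measurable f)
    (ha : Measurable a) (hb : Measurable b) (hCu : ∀ x, |u x| ≤ Cu) (hC : ∀ x, |f x| ≤ C)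
    (hCa : ∀ x, |a x| ≤ Ca) (hCb : ∀ x, |b x| ≤ Cb) (m : ℤ) :
    Tendsto (fun k : ℕ => ∫ q, u q.1.1.1 * f (ipow T k q.1.1.1) * (a q.2 * b q.1.2)
      ∂linked₂ T ν m k) atTop (𝓝 (∫ w, u w.1.1.1 * fibreAvg (over23 ν) f (w.2, w.1.1.2.2) *
        (a w.2 * b w.1.2) ∂(linked T ν m).prod μ)) := by
  have hKC : ∀ p, |fibreAvg (over23 ν) f p| ≤ C := abs_fibreAvg_le hC
  have hK : Measurable (fibreAvg (over23 ν) f) := measurable_fibreAvg hf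
  set B : X × X → ℝ := fun p => fibreAvg (over13 ν)
    (fun y => fibreAvg (over12 ν) b (ipow T m p.1, y)) p with hB
  have hBm : Measurable B := measurable_fibreAvg_param (D := X × X) (π := id)
    (g := fun p => fibreAvg (over12 ν) b (ipow T m p.1.1, p.2)) (by fun_prop) measurable_id
  have hBb : ∀ p, |B p| ≤ Cb := fun p => abs_fibreAvg_le (fun y => abs_fibreAvg_le hCb _) _
  rw [h.integral_linked_prod_mul hu hK ha hb hCu hKC hCa hCb]
  simp only [h.integral_linked₂_mul hu hf ha hb hCu hC hCa hCb]
  have hlim := hmix.tendsto_integral_prod h.measurePreserving (ρ := μ)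
    (f := fun p => f p.1 * fibreAvg (over13 ν) a p) (g := fun p => u p.1 * B p)
    (by fun_prop) (by fun_prop) (fun p => abs_mul_le_mul (hC _) (abs_fibreAvg_le hCa _))
    (fun p => abs_mul_le_mul (hCu _) (hBb _))
  convert hlim using 2
  obtain ⟨k, hk⟩ : ∃ k : X → ℝ, ∀ z, ∫ y, fibreAvg (over23 ν) f (y, z) * a y ∂μ = k z :=
    ⟨_, fun _ => rfl⟩
  have hka : Measurable k := by
    have := measurable_integral_kernel (κ := Kernel.const X μ)
      (f := fun p : X × X => fibreAvg (over23 ν) f (p.2, p.1) * a p.2) (by fun_prop)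
    simp only [Kernel.const_apply, hk] at this
    exact this
  have hkb : ∀ z, |k z| ≤ C * Ca := fun z => hk z ▸
    abs_integral_le_of_abs_le fun y => abs_mul_le_mul (hKC _) (hCa _)
  obtain ⟨r, hr⟩ : ∃ r : X → ℝ, ∀ z, ∫ x, u x * B (x, z) ∂μ = r z := ⟨_, fun _ => rfl⟩
  have hrm : Measurable r := by
    have := measurable_integral_kernel (κ := Kernel.const X μ)
      (f := fun p : X × X => u p.2 * B (p.2, p.1)) (by fun_prop)
    simp only [Kernel.const_apply, hr] at this
    exact this
  have hrb : ∀ z, |r z| ≤ Cu * Cb := fun z => hr z ▸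
    abs_integral_le_of_abs_le fun y => abs_mul_le_mul (hCu _) (hBb _)
  simp only [hk]
  rw [integral_prod_swap (by fun_prop) (fun p => abs_mul_le_mul (hkb _)
    (abs_mul_le_mul (hCu _) (hBb _)))]
  simp only [integral_const_mul, hr]
  -- Both sides are the integral of `r(z) * f(x) * a(y)` under ν, conditioned on `(x, z)` here and
  -- on `(y, z)` next.
  have s1 : ∫ p, r p.2.2 * f p.1 * a p.2.1 ∂ν
      = ∫ z, (∫ x, f x * fibreAvg (over13 ν) a (x, z) ∂μ) * r z ∂μ := by
    rw [h.integral_eq_over13 (F := fun p => r p.2.2 * f p.1 * a p.2.1) (by fun_prop)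
      (fun p => abs_mul_le_mul (abs_mul_le_mul (hrb _) (hC _)) (hCa _))]
    simp only [fibreAvg_const_mul]
    rw [integral_prod_swap (by fun_prop) (fun p => abs_mul_le_mul
      (abs_mul_le_mul (hrb _) (hC _)) (abs_fibreAvg_le hCa _))]
    refine integral_congr_ae (ae_of_all _ fun z => ?_)
    simp only [mul_assoc, integral_const_mul]
    exact mul_comm _ _
  have s2 : ∫ p, r p.2.2 * a p.2.1 * f p.1 ∂ν
      = ∫ z, k z * r z ∂μ := by
    rw [h.integral_eq_over23 (F := fun p => r p.2.2 * a p.2.1 * f p.1) (by fun_prop)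
      (fun p => abs_mul_le_mul (abs_mul_le_mul (hrb _) (hCa _)) (hC _))]
    simp only [fibreAvg_const_mul]
    rw [integral_prod_swap (by fun_prop) (fun p => abs_mul_le_mul
      (abs_mul_le_mul (hrb _) (hCa _)) (abs_fibreAvg_le hC _))]
    refine integral_congr_ae (ae_of_all _ fun z => ?_)
    simp only [mul_assoc, integral_const_mul, ← hk, mul_comm (a _)]
    exact mul_comm _ _
  rw [← s1, ← s2]
  refine integral_congr_ae (ae_of_all _ fun p => ?_)
  simp only
  ring

/-- The limit in `k`. -/
theorem tendsto_integral_linked₂ (h : IsTripleJoining μ T ν) (hmix : IsMixing μ T)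
    (hu : Measurable u) (hf : Measurable f) (hCu : ∀ x, |u x| ≤ Cu) (hC : ∀ x, |f x| ≤ C)
    {H : X × X → ℝ} (hH : Measurable H) {D : ℝ} (hD : ∀ p, |H p| ≤ D) {m : ℤ}
    (hprod : ∀ᶠ k : ℕ in atTop, (linked₂ T ν m k).map (fun q => (q.2, q.1.2)) = μ.prod μ) :
    Tendsto (fun k : ℕ => ∫ q, u q.1.1.1 * f (ipow T k q.1.1.1) * H (q.2, q.1.2)
      ∂linked₂ T ν m k) atTop (𝓝 (∫ w, u w.1.1.1 * fibreAvg (over23 ν) f (w.2, w.1.1.2.2) *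
        H (w.2, w.1.2) ∂(linked T ν m).prod μ)) := by
  refine tendsto_of_forall_approx fun ε hε => ?_
  have hCC : 0 ≤ Cu * C := by
    obtain ⟨x⟩ := ‹Nonempty X›
    exact mul_nonneg ((abs_nonneg _).trans (hCu x)) ((abs_nonneg _).trans (hC x))
  set δ := ε / (Cu * C + 1) with hδ
  have hδ0 : 0 < δ := by positivity
  have hδε : Cu * C * δ ≤ ε := by
    rw [hδ, mul_div_assoc', div_le_iff₀ (by positivity)]
    nlinarith
  -- One approximation of H serves all large k, because `(y, z₂)` then has the fixed law `μ.prod μ`;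
  -- the same holds for the limit measure.
  obtain ⟨n, a, b, ha, hb, ha1, hbD, hsum, hl⟩ := exists_sum_mul_approx μ μ hH hD
    (ε := ENNReal.ofReal δ) (by simpa using hδ0)
  set H' : X × X → ℝ := fun p => ∑ j ∈ Finset.range n, a j p.1 * b j p.2 with hH'
  have hH'm : Measurable H' := by fun_prop
  refine ⟨fun k => ∫ q, u q.1.1.1 * f (ipow T k q.1.1.1) * H' (q.2, q.1.2) ∂linked₂ T ν m k,
    ∫ w, u w.1.1.1 * fibreAvg (over23 ν) f (w.2, w.1.1.2.2) * H' (w.2, w.1.2)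
      ∂(linked T ν m).prod μ, ?_, ?_, ?_⟩
  · simp only [hH', Finset.mul_sum]
    have i1 : ∀ k : ℕ, ∀ j ∈ Finset.range n, Integrable (fun q : ((X × X × X) × X) × X =>
        u q.1.1.1 * f (ipow T k q.1.1.1) * (a j q.2 * b j q.1.2)) (linked₂ T ν m k) :=
      fun k j _ => integrable_of_abs_le (by fun_prop) fun q =>
        abs_mul_le_mul (abs_mul_le_mul (hCu _) (hC _)) (abs_mul_le_mul (ha1 j _) (hbD j _))
    have i2 : ∀ j ∈ Finset.range n, Integrable (fun w : ((X × X × X) × X) × X =>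
        u w.1.1.1 * fibreAvg (over23 ν) f (w.2, w.1.1.2.2) * (a j w.2 * b j w.1.2))
        ((linked T ν m).prod μ) :=
      fun j _ => integrable_of_abs_le (by fun_prop) fun q =>
        abs_mul_le_mul (abs_mul_le_mul (hCu _) (abs_fibreAvg_le hC _))
          (abs_mul_le_mul (ha1 j _) (hbD j _))
    rw [integral_finsetSum _ i2]
    simp only [fun k => integral_finsetSum _ (i1 k)]
    exact tendsto_finsetSum _ fun j _ =>
      h.tendsto_integral_linked₂_mul hmix hu hf (ha j) (hb j) hCu hC (ha1 j) (hbD j) m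
  · filter_upwards [hprod] with k hk
    exact (abs_integral_mul_sub_le (P := linked₂ T ν m k) (π := fun q => (q.2, q.1.2))
      (U := fun q => u q.1.1.1 * f (ipow T k q.1.1.1)) (by fun_prop) hk (by fun_prop) hH hH'm
      (fun q => abs_mul_le_mul (hCu _) (hC _)) hD hsum hδ0.le hl).trans hδε
  · have hk : ((linked T ν m).prod μ).map (fun w => (w.2, w.1.2)) = μ.prod μ := by
      have h1 : ((linked T ν m).prod μ).map (Prod.map Prod.snd id) = μ.prod μ :=
        ((⟨measurable_snd, h.map_z₂_linked m⟩ : MeasurePreserving Prod.snd (linked T ν m) μ).prod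
          (MeasurePreserving.id μ)).map_eq
      have h2 : (μ.prod μ).map Prod.swap = μ.prod μ := Measure.prod_swap
      rw [← h2]
      conv_rhs => rw [← h1]
      rw [Measure.map_map (by fun_prop) (by fun_prop)]
      rfl
    exact (abs_integral_mul_sub_le (P := (linked T ν m).prod μ) (π := fun q => (q.2, q.1.2))
      (U := fun w => u w.1.1.1 * fibreAvg (over23 ν) f (w.2, w.1.1.2.2)) (by fun_prop) hk
      (by fun_prop) hH hH'm
      (fun q => abs_mul_le_mul (hCu _) (abs_fibreAvg_le hC _)) hD hsum hδ0.le hl).trans hδε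

/-- The limit in `m`. -/
theorem tendsto_integral_linked (h : IsTripleJoining μ T ν) (hmix : IsMixing μ T)
    (hf : Measurable f) (hC : ∀ x, |f x| ≤ C)
    {G : X × X → ℝ} (hG : Measurable G) {D : ℝ} (hD : ∀ p, |G p| ≤ D) :
    Tendsto (fun m : ℕ => ∫ w, f w.1.1.1 * f (ipow T m w.1.1.1) * G (w.2, w.1.1.2.2) *
        G (w.2, w.1.2) ∂(linked T ν m).prod μ) atTop
      (𝓝 (∫ q, (∫ x, f x * fibreAvg (over12 ν) (fun z => G (q.2, z)) (x, q.1) ∂μ) *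
        (∫ x, f x * fibreAvg (over12 ν) (fun z => G (q.2, z)) (x, q.1) ∂μ) ∂μ.prod μ)) := by
  -- Integrating z₂ and z₁ over their fibres gives `L (T ^ m x, y₁, y)` and `L (x, y₁, y)`. Mixing
  -- in x, with `(y₁, y)` as parameter, turns their product into a square.
  set L : X × X × X → ℝ := fun p => fibreAvg (over12 ν) (fun z => G (p.2.2, z)) (p.1, p.2.1) with hL
  have hLm : Measurable L := measurable_fibreAvg_param (D := X × X × X)
    (π := fun p => (p.1, p.2.1)) (g := fun p => G (p.1.2.2, p.2)) (by fun_prop) (by fun_prop)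
  have hLD : ∀ p, |L p| ≤ D := fun p => abs_fibreAvg_le (fun z => hD _) _
  have hlim := hmix.tendsto_integral_prod h.measurePreserving (ρ := μ.prod μ)
    (f := fun p => f p.1 * L p) (g := fun p => f p.1 * L p)
    (by fun_prop) (by fun_prop) (fun p => abs_mul_le_mul (hC _) (hLD _))
    (fun p => abs_mul_le_mul (hC _) (hLD _))
  refine hlim.congr fun m => ?_
  have hb : ∀ x, |f x * f (ipow T m x)| ≤ C * C := fun x => abs_mul_le_mul (hC _) (hC _)
  rw [integral_prod_symm _ (integrable_of_abs_le (by fun_prop) fun w =>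
    abs_mul_le_mul (abs_mul_le_mul (hb _) (hD _)) (hD _))]
  have e1 : ∀ y, ∫ q, f q.1.1 * f (ipow T m q.1.1) * G (y, q.1.2.2) * G (y, q.2) ∂linked T ν m
      = ∫ p : X × X, f p.1 * f (ipow T m p.1) * L (ipow T m p.1, p.2, y) * L (p.1, p.2, y)
        ∂μ.prod μ := by
    intro y
    rw [linked, integral_compProd_of_abs_le _ (by fun_prop)
      (fun w => abs_mul_le_mul (abs_mul_le_mul (hb _) (hD _)) (hD _))]
    simp only [fibreAvg_const_mul]
    have e2 : ∀ p : X × X × X, f p.1 * f (ipow T m p.1) * G (y, p.2.2) *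
        fibreAvg (over12 ν) (fun z => G (y, z)) (ipow T m p.1, p.2.1)
        = f p.1 * f (ipow T m p.1) * L (ipow T m p.1, p.2.1, y) * G (y, p.2.2) := fun p => by
      simp only [hL]; ring
    simp only [e2]
    rw [h.integral_eq_over12 (F := fun p => f p.1 * f (ipow T m p.1) *
      L (ipow T m p.1, p.2.1, y) * G (y, p.2.2)) (by fun_prop)
      (fun w => abs_mul_le_mul (abs_mul_le_mul (hb _) (hLD _)) (hD _))]
    simp only [fibreAvg_const_mul, hL]
  simp only [e1]
  have e3 := integral_prod_symm (μ := μ.prod μ) (ν := μ) (fun p : (X × X) × X =>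
    f p.1.1 * f (ipow T m p.1.1) * L (ipow T m p.1.1, p.1.2, p.2) * L (p.1.1, p.1.2, p.2))
    (integrable_of_abs_le (by fun_prop)
      (fun w => abs_mul_le_mul (abs_mul_le_mul (hb _) (hLD _)) (hLD _)))
  rw [← e3]
  have e4 := (measurePreserving_prodAssoc μ μ μ).integral_comp' (fun p : X × X × X =>
    f (T^[m] p.1) * L (T^[m] p.1, p.2) * (f p.1 * L p))
  rw [← e4]
  refine integral_congr_ae (ae_of_all _ fun p => ?_)
  simp only [ipow_natCast, MeasurableEquiv.prodAssoc, MeasurableEquiv.coe_mk,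
    Equiv.prodAssoc_apply]
  ring

/-- Vanishing of the limit in `m` for `G` the conditional expectation of `f`. -/
theorem ae_fibreAvg_eq_zero (h : IsTripleJoining μ T ν) (hf : Measurable f) (hC : ∀ x, |f x| ≤ C)
    (h0 : ∫ q : X × X, (∫ x, f x * fibreAvg (over12 ν)
          (fun z => fibreAvg (over23 ν) f (q.2, z)) (x, q.1) ∂μ) *
        (∫ x, f x * fibreAvg (over12 ν)
          (fun z => fibreAvg (over23 ν) f (q.2, z)) (x, q.1) ∂μ) ∂μ.prod μ = 0) :
    ∀ᵐ q ∂μ.prod μ, fibreAvg (over23 ν) f q = 0 := by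
  set K := fibreAvg (over23 ν) f with hKdef
  have hK : Measurable K := measurable_fibreAvg hf
  have hKC : ∀ p, |K p| ≤ C := abs_fibreAvg_le hC
  set L : X × X × X → ℝ := fun p => fibreAvg (over12 ν) (fun z => K (p.2.2, z)) (p.1, p.2.1) with hL
  have hLm : Measurable L := measurable_fibreAvg_param (D := X × X × X)
    (π := fun p => (p.1, p.2.1)) (g := fun p => K (p.1.2.2, p.2)) (by fun_prop) (by fun_prop)
  have hLC : ∀ p, |L p| ≤ C := fun p => abs_fibreAvg_le (fun z => hKC _) _
  set s : X × X → ℝ := fun q => ∫ x, f x * L (x, q) ∂μ with hs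
  have hsm : Measurable s := measurable_integral_kernel (κ := Kernel.const (X × X) μ)
      (f := fun p : (X × X) × X => f p.2 * L (p.2, p.1)) (by fun_prop)
  have hsC : ∀ q, |s q| ≤ C * C := fun z =>
    abs_integral_le_of_abs_le fun y => abs_mul_le_mul (hC _) (hLC _)
  have hs0 : ∀ᵐ q ∂μ.prod μ, s q = 0 := by
    have h0' : ∫ q, s q * s q ∂μ.prod μ = 0 := h0
    rw [integral_eq_zero_iff_of_nonneg (fun q => mul_self_nonneg _)
      (integrable_of_abs_le (hsm.mul hsm) fun q => abs_mul_le_mul (hsC q) (hsC q))] at h0'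
    filter_upwards [h0'] with q hq
    simpa using hq
  have hka : ∀ A : Set X, MeasurableSet A →
      ∀ᵐ z ∂μ, ∫ y, K (y, z) * A.indicator 1 y ∂μ = 0 := by
    intro A hA
    set a : X → ℝ := A.indicator 1 with ha
    have ham : Measurable a := measurable_one.indicator hA
    have ha1 : ∀ y, |a y| ≤ 1 := fun y => abs_indicator_one_le A y
    set k : X → ℝ := fun z => ∫ y, K (y, z) * a y ∂μ with hk
    have hkm : Measurable k := measurable_integral_kernel (κ := Kernel.const X μ)
      (f := fun p : X × X => K (p.2, p.1) * a p.2) (by fun_prop)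
    have hkb : ∀ z, |k z| ≤ C * 1 := fun z =>
      abs_integral_le_of_abs_le fun y => abs_mul_le_mul (hKC _) (ha1 _)
    -- The square of k is unfolded: one factor becomes f under ν, then the z-fibre over `(x, y)` is
    -- averaged, and integrating in x leaves s tested against `a ⊗ a`, which is zero.
    have e1 : ∫ z, k z * k z ∂μ = ∫ p, k p.2.2 * a p.2.1 * f p.1 ∂ν := by
      rw [h.integral_eq_over23 (F := fun p => k p.2.2 * a p.2.1 * f p.1) (by fun_prop)
        (fun p => abs_mul_le_mul (abs_mul_le_mul (hkb _) (ha1 _)) (hC _))]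
      simp only [fibreAvg_const_mul, ← hKdef]
      rw [integral_prod_swap (by fun_prop) (fun p => abs_mul_le_mul
        (abs_mul_le_mul (hkb _) (ha1 _)) (hKC _))]
      refine integral_congr_ae (ae_of_all _ fun z => ?_)
      simp only [mul_assoc, integral_const_mul, mul_comm (a _)]
      rfl
    have e2 : ∫ p, k p.2.2 * a p.2.1 * f p.1 ∂ν
        = ∫ q : X × X, f q.1 * a q.2 * ∫ y, L (q.1, q.2, y) * a y ∂μ ∂μ.prod μ := by
      have : ∀ p : X × X × X, k p.2.2 * a p.2.1 * f p.1 = f p.1 * a p.2.1 * k p.2.2 :=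
        fun p => by ring
      simp only [this]
      rw [h.integral_eq_over12 (F := fun p => f p.1 * a p.2.1 * k p.2.2) (by fun_prop)
        (fun p => abs_mul_le_mul (abs_mul_le_mul (hC _) (ha1 _)) (hkb _))]
      simp only [fibreAvg_const_mul]
      refine integral_congr_ae (ae_of_all _ fun q => ?_)
      simp only
      congr 1
      simp only [fibreAvg, hk, hL]
      rw [integral_integral_swap (f := fun z y => K (y, z) * a y)
        (integrable_of_abs_le (C := C * 1)
          (f := fun p : X × X => K (p.2, p.1) * a p.2) (by fun_prop)
          fun p => abs_mul_le_mul (hKC _) (ha1 _))]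
      simp only [integral_mul_const]
    have e3 : ∫ q : X × X, f q.1 * a q.2 * ∫ y, L (q.1, q.2, y) * a y ∂μ ∂μ.prod μ
        = ∫ q, a q.1 * a q.2 * s q ∂μ.prod μ := by
      have b1 : ∀ p : X × X × X, |a p.2.1 * a p.2.2 * (f p.1 * L p)| ≤ 1 * 1 * (C * C) :=
        fun p => abs_mul_le_mul (abs_mul_le_mul (ha1 _) (ha1 _)) (abs_mul_le_mul (hC _) (hLC _))
      have e4 := (measurePreserving_prodAssoc μ μ μ).integral_comp' (fun p : X × X × X =>
        a p.2.1 * a p.2.2 * (f p.1 * L p))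
      rw [integral_prod_symm _ (integrable_of_abs_le (by fun_prop) b1)] at e4
      simp only [integral_const_mul] at e4
      rw [← e4, integral_prod _ (integrable_of_abs_le (by fun_prop) (fun p => b1 _))]
      refine integral_congr_ae (ae_of_all _ fun q => ?_)
      simp only [← integral_const_mul]
      refine integral_congr_ae (ae_of_all _ fun y => ?_)
      simp only [MeasurableEquiv.prodAssoc, MeasurableEquiv.coe_mk, Equiv.prodAssoc_apply]
      ring
    have e5 : ∫ q, a q.1 * a q.2 * s q ∂μ.prod μ = 0 := by
      refine integral_eq_zero_of_ae ?_
      filter_upwards [hs0] with q hq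
      simp [hq]
    have e6 : ∫ z, k z * k z ∂μ = 0 := by rw [e1, e2, e3, e5]
    rw [integral_eq_zero_iff_of_nonneg (fun q => mul_self_nonneg _)
      (integrable_of_abs_le (hkm.mul hkm) fun q => abs_mul_le_mul (hkb q) (hkb q))] at e6
    filter_upwards [e6] with z hz
    simpa using hz
  refine ae_eq_zero_of_forall_setIntegral_prod_eq_zero (ρ := μ.prod μ)
    (integrable_of_abs_le hK hKC) fun E F hE hF => ?_
  have hmE : Measurable (E.indicator (1 : X → ℝ)) := measurable_one.indicator hE
  have hmF : Measurable (F.indicator (1 : X → ℝ)) := measurable_one.indicator hF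
  have h1 : ∫ p in E ×ˢ F, K p ∂μ.prod μ
      = ∫ p : X × X, F.indicator 1 p.2 * (K p * E.indicator 1 p.1) ∂μ.prod μ := by
    rw [← integral_indicator (hE.prod hF)]
    refine integral_congr_ae (ae_of_all _ fun p => ?_)
    by_cases h1 : p.1 ∈ E <;> by_cases h2 : p.2 ∈ F <;> simp [Set.indicator, h1, h2]
  have hb : ∀ p : X × X, |F.indicator (1 : X → ℝ) p.2 * (K p * E.indicator (1 : X → ℝ) p.1)|
      ≤ 1 * (C * 1) := fun p => abs_mul_le_mul
    (abs_indicator_one_le F _) (abs_mul_le_mul (hKC _) (abs_indicator_one_le E _))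
  rw [h1, integral_prod_swap (by fun_prop) hb]
  refine integral_eq_zero_of_ae ?_
  filter_upwards [hka E hE] with z hz
  simp only [integral_const_mul, hz, mul_zero, Pi.zero_apply]

end IsTripleJoining

end Limits

end SelfJoining

namespace SelfJoining

/-! ### Triple joinings are products under multiple recurrence. -/

section MainTriples

variable {X : Type u} [MeasurableSpace X] [StandardBorelSpace X] [Nonempty X]
  {μ : Measure X} [IsProbabilityMeasure μ] {T : X ≃ᵐ X}
  {ν : Measure (X × X × X)} [IsProbabilityMeasure ν]

/-- A triple joining other than the product admits, for arbitrarily large `m`, infinitely many `k`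
with configurations that complete to a fourth copy of `ν`. -/
theorem IsTripleJoining.exists_infinite_config (hM : HasMinimalPairs μ T) (hmix : IsMixing μ T)
    (h : IsTripleJoining μ T ν) (hne : ν ≠ μ.prod (μ.prod μ)) {c : ENNReal} (hc : c ≠ ⊤)
    (h12 : HasFiniteFibres (over12 ν) c) (M : ℕ) :
    ∃ m : ℕ, M ≤ m ∧ {k : ℕ | ∃ Ω, ∃ p : ℤ, IsConfig T ν m k Ω ∧
      Ω.map (fun w => (ipow T p w.1, w.2.2.2.2, w.2.2.2.1)) = ν}.Infinite := by
  by_contra! hcon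
  refine hne (h.eq_prod_of_forall_fibreAvg fun f hf hf1 hf0 => ?_)
  refine h.ae_fibreAvg_eq_zero hf hf1 ?_
  have hK : Measurable (fibreAvg (over23 ν) f) := measurable_fibreAvg hf
  have hK1 : ∀ p, |fibreAvg (over23 ν) f p| ≤ 1 := abs_fibreAvg_le hf1
  -- The limits are iterated: for fixed large m the limit in k is shown to be zero, and only then
  -- does m tend to infinity.
  refine tendsto_nhds_unique (h.tendsto_integral_linked hmix hf hf1 hK hK1)
    (tendsto_const_nhds.congr' ?_)
  filter_upwards [eventually_ge_atTop M] with m hm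
  have hfin := hcon m hm
  have hev1 : ∀ᶠ k : ℕ in atTop, ∀ Ω (p : ℤ), IsConfig T ν m k Ω →
      Ω.map (fun w => (ipow T p w.1, w.2.2.2.2, w.2.2.2.1)) ≠ ν := by
    obtain ⟨N, hN⟩ := hfin.bddAbove
    filter_upwards [eventually_gt_atTop N] with k hk Ω p hΩ h4
    exact absurd (hN ⟨Ω, p, hΩ, h4⟩) (not_le.2 hk)
  have hev2 : ∀ᶠ k : ℕ in atTop, ∀ Ω, IsConfig T ν m k Ω →
      Ω.map (fun w => (w.2.2.2.2, w.2.2.2.1)) = μ.prod μ := by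
    obtain ⟨N, hN⟩ := (finite_config_not_prod hM h hne hc h12 m).bddAbove
    filter_upwards [eventually_gt_atTop N.toNat] with k hk Ω hΩ
    by_contra h4
    have : (k : ℤ) ≤ N := hN ⟨Ω, hΩ, h4⟩
    omega
  have hu : ∀ x, |f x * f (ipow T m x)| ≤ 1 * 1 := fun x => abs_mul_le_mul (hf1 _) (hf1 _)
  refine tendsto_nhds_unique (tendsto_const_nhds.congr' ?_)
    (h.tendsto_integral_linked₂ hmix (u := fun x => f x * f (ipow T m x)) (by fun_prop) hf hu hf1
      hK hK1 (hev2.mono fun k hk => h.map_linked₂_eq_prod hk))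
  filter_upwards [hev1, hev2] with k h1 h2
  exact (h.integral_linked₂_eq_zero hM h2 h1 hf
    (g := fun x => f x * f (ipow T m x) * f (ipow T k x)) (by fun_prop) hf1
    (fun x => abs_mul_le_mul (hu x) (hf1 _)) hf0).symm

/-- The configurations of `exists_infinite_config` can be taken with all differences of exponents
large and a given law of `(x, z₁, z₂)`. -/
theorem IsTripleJoining.exists_config_law (hM : HasMinimalPairs μ T)
    (h : IsTripleJoining μ T ν) (hne : ν ≠ μ.prod (μ.prod μ)) {c : ENNReal} (hc : c ≠ ⊤)
    (h12 : HasFiniteFibres (over12 ν) c) (h13 : HasFiniteFibres (over13 ν) c) {m : ℤ} (hm : m ≠ 0)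
    (hinf : {k : ℕ | ∃ Ω, ∃ p : ℤ, IsConfig T ν m k Ω ∧
      Ω.map (fun w => (ipow T p w.1, w.2.2.2.2, w.2.2.2.1)) = ν}.Infinite) :
    ∃ ξ : Measure (X × X × X), ∀ N : ℕ, ∃ (k p : ℤ) (Ω : _), IsConfig T ν m k Ω ∧
      Ω.map (fun w => (ipow T p w.1, w.2.2.2.2, w.2.2.2.1)) = ν ∧
      (N : ℤ) ≤ k ∧ (N : ℤ) ≤ |p| ∧ (N : ℤ) ≤ |p - k| ∧
      Ω.map (fun w => (w.1, w.2.1, w.2.2.2.1)) = ξ := by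
  have hN : ∀ N : ℕ, ∃ (k p : ℤ) (Ω : _), IsConfig T ν m k Ω ∧
      Ω.map (fun w => (ipow T p w.1, w.2.2.2.2, w.2.2.2.1)) = ν ∧
      (N : ℤ) ≤ k ∧ (N : ℤ) ≤ |p| ∧ (N : ℤ) ≤ |p - k| := by
    intro N
    set I := Set.Icc (-(N : ℤ)) N with hI
    -- For each small r, the cases `p = r` and `p = k + r` arise for finitely many k only;
    -- infinitely many k remain once all of them are removed.
    have hfin : (⋃ r ∈ I, {k : ℤ | ∃ Ω, IsConfig T ν m k Ω ∧
          Ω.map (fun w => (ipow T r w.1, w.2.2.2.2, w.2.2.2.1)) = ν} ∪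
        {k : ℤ | ∃ Ω, IsConfig T ν m k Ω ∧
          Ω.map (fun w => (ipow T (k + r) w.1, w.2.2.2.2, w.2.2.2.1)) = ν}).Finite :=
      (Set.finite_Icc _ _).biUnion fun r _ =>
        (finite_config_const h hne hc h12 h13 m r).union
          (finite_config_add hM h hne hc h12 h13 hm r)
    have hfin' := (hfin.preimage (f := fun n : ℕ => (n : ℤ)) Nat.cast_injective.injOn).union
      (Set.finite_Iio N)
    obtain ⟨k, ⟨Ω, p, hΩ, h4⟩, hk⟩ := (hinf.sdiff hfin').nonempty
    simp only [Set.mem_union, Set.mem_preimage, Set.mem_iUnion, not_or, Set.mem_Iio, not_lt,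
      not_exists] at hk
    refine ⟨k, p, Ω, hΩ, h4, by exact_mod_cast hk.2, ?_, ?_⟩
    · by_contra! hlt
      refine (hk.1 p ?_).1 ⟨Ω, hΩ, h4⟩
      exact Set.mem_Icc.2 (abs_le.1 hlt.le)
    · by_contra! hlt
      refine (hk.1 (p - k) ?_).2 ⟨Ω, hΩ, by simpa using h4⟩
      exact Set.mem_Icc.2 (abs_le.1 hlt.le)
  choose k p Ω hΩ h4 hk hp hpk using hN
  -- With m fixed only finitely many laws of `(x, z₁, z₂)` occur, so one of them is attained for
  -- infinitely many N.
  have hfin := (finite_config_laws m hc h12 (T := T)).image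
    fun ζ => ζ.map fun q : (X × X × X) × X => (q.1.1, q.1.2.1, q.2)
  have hmem : ∀ N, (Ω N).map (fun w => (w.1, w.2.1, w.2.2.2.1)) ∈
      (fun ζ : Measure ((X × X × X) × X) => ζ.map fun q => (q.1.1, q.1.2.1, q.2)) ''
      {ζ | ∃ k Ω, IsConfig T ν m k Ω ∧
        Ω.map (fun w => ((w.1, w.2.1, w.2.2.1), w.2.2.2.1)) = ζ} := fun N =>
    ⟨_, ⟨k N, Ω N, hΩ N, rfl⟩, by
      simp only
      rw [Measure.map_map (by fun_prop) (by fun_prop)]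
      rfl⟩
  have := hfin.to_subtype
  obtain ⟨ξ, hξ⟩ := Finite.exists_infinite_fiber fun N =>
    (⟨_, hmem N⟩ : ((fun ζ : Measure ((X × X × X) × X) => ζ.map fun q => (q.1.1, q.1.2.1, q.2)) ''
      {ζ | ∃ k Ω, IsConfig T ν m k Ω ∧
        Ω.map (fun w => ((w.1, w.2.1, w.2.2.1), w.2.2.2.1)) = ζ}))
  refine ⟨ξ, fun N => ?_⟩
  obtain ⟨N', hN', hle⟩ := (Set.infinite_coe_iff.1 hξ).exists_gt N
  have hc' : (N : ℤ) ≤ N' := by exact_mod_cast hle.le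
  refine ⟨k N', p N', Ω N', hΩ N', h4 N', hc'.trans (hk N'), hc'.trans (hp N'),
    hc'.trans (hpk N'), ?_⟩
  exact congrArg Subtype.val (Set.mem_singleton_iff.1 hN')

omit [IsProbabilityMeasure ν] in
/-- Mixing, minimal self-joinings of order two and multiple recurrence exclude pairwise
independent ergodic triple joinings other than the product. -/
theorem HasMinimalPairs.hasProductTriples (hM : HasMinimalPairs μ T) (hmix : IsMixing μ T)
    (hR : IsMultiplyRecurrent μ T) : HasProductTriples μ T := by
  intro ν h
  by_contra hne
  have := h.isProbabilityMeasure
  obtain ⟨c, hc, h12, h13, -⟩ := hM.exists_hasFiniteFibres_over h hne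
  have hfin := finite_config_le_relSquare (T := T) h hne hc h13
  obtain ⟨M, hMb⟩ := hfin.bddAbove
  obtain ⟨m, hm, hinf⟩ := h.exists_infinite_config hM hmix hne hc h12 (M.toNat + 1)
  obtain ⟨ξ, hξ⟩ := h.exists_config_law hM hne hc h12 h13 (m := m) (by omega) hinf
  have hle := le_relSquare hR h hc h12 hξ
  obtain ⟨k, p, Ω, hΩ, -, -, -, -, hlaw⟩ := hξ 0
  have : (m : ℤ) ≤ M := hMb ⟨k, Ω, hΩ, hlaw ▸ hle⟩
  omega

end MainTriples

end SelfJoining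

namespace SelfJoining

/-! ### Limit joinings and orbit laws. -/

section Limits

variable {ι : Type*} [Fintype ι] {X : Type u} [MeasurableSpace X]

theorem Measure.ext_univ_pi {P Q : Measure (ι → X)} [IsProbabilityMeasure P]
    [IsProbabilityMeasure Q]
    (h : ∀ A : ι → Set X, (∀ i, MeasurableSet (A i)) →
      P (Set.univ.pi A) = Q (Set.univ.pi A)) : P = Q := by
  refine ext_of_generate_finite _ generateFrom_pi.symm isPiSystem_pi ?_ (by simp)
  rintro _ ⟨A, hA, rfl⟩
  exact h A fun i => hA i (Set.mem_univ i)

theorem measure_pi_le_add {μ : Measure X} {P : Measure (ι → X)}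
    (hP : ∀ i, P.map (fun x => x i) = μ) {A B : ι → Set X} (hA : ∀ i, MeasurableSet (A i))
    (hB : ∀ i, MeasurableSet (B i)) {ε : ENNReal} (hε : ∀ i, μ (A i \ B i) ≤ ε) :
    P (Set.univ.pi A) ≤ P (Set.univ.pi B) + Fintype.card ι * ε := by
  have hsub : Set.univ.pi A ⊆ Set.univ.pi B ∪ ⋃ i, (fun x : ι → X => x i) ⁻¹' (A i \ B i) := by
    intro x hx
    by_cases hxB : x ∈ Set.univ.pi B
    · exact Or.inl hxB
    · simp only [Set.mem_univ_pi, not_forall] at hxB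
      obtain ⟨i, hi⟩ := hxB
      exact Or.inr (Set.mem_iUnion.2 ⟨i, hx i (Set.mem_univ i), hi⟩)
  refine (measure_mono hsub).trans ((measure_union_le _ _).trans ?_)
  gcongr
  refine (measure_iUnion_fintype_le _ _).trans ?_
  have : ∀ i, P ((fun x : ι → X => x i) ⁻¹' (A i \ B i)) ≤ ε := fun i => by
    rw [← Measure.map_apply (measurable_pi_apply i) ((hA i).diff (hB i)), hP i]
    exact hε i
  refine (Finset.sum_le_sum fun i _ => this i).trans ?_
  simp

variable [StandardBorelSpace X]

/-- Measures on a power with given marginals have limit points for the convergence on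
measurable boxes. -/
theorem exists_limit_of_marginals (μ : Measure X) [IsProbabilityMeasure μ] {τ : Type*}
    (F : Ultrafilter τ) (lam : τ → Measure (ι → X)) (hlam : ∀ t, IsProbabilityMeasure (lam t))
    (hm : ∀ t i, (lam t).map (fun x => x i) = μ) :
    ∃ η : Measure (ι → X), IsProbabilityMeasure η ∧ (∀ i, η.map (fun x => x i) = μ) ∧
      ∀ A : ι → Set X, (∀ i, MeasurableSet (A i)) →
        Tendsto (fun t => lam t (Set.univ.pi A)) F (𝓝 (η (Set.univ.pi A))) := by
  let := upgradeStandardBorel X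
  set P : τ → ProbabilityMeasure (ι → X) := fun t => ⟨lam t, hlam t⟩ with hP
  -- A compact set carrying most of μ gives a compact cube carrying most of every joining, since all
  -- one-dimensional marginals are μ.
  have htight : IsTightMeasureSet {((ρ : ProbabilityMeasure (ι → X)) : Measure (ι → X)) |
      ρ ∈ Set.range P} := by
    rw [isTightMeasureSet_iff_exists_isCompact_measure_compl_le]
    intro ε hε
    have hε' : 0 < ε / (Fintype.card ι + 1) :=
      ENNReal.div_pos hε.ne' (by finiteness)
    obtain ⟨K, hK, hKε⟩ := isTightMeasureSet_iff_exists_isCompact_measure_compl_le.1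
      (isTightMeasureSet_singleton (μ := μ)) _ hε'
    refine ⟨Set.univ.pi fun _ => K, isCompact_univ_pi fun _ => hK, ?_⟩
    rintro _ ⟨_, ⟨t, rfl⟩, rfl⟩
    have hsub : (Set.univ.pi fun _ : ι => K)ᶜ ⊆ ⋃ i, (fun x : ι → X => x i) ⁻¹' Kᶜ := by
      intro x hx
      simpa using hx
    have hm' : ∀ i, lam t ((fun x : ι → X => x i) ⁻¹' Kᶜ) ≤ ε / (Fintype.card ι + 1) := fun i => by
      rw [← Measure.map_apply (measurable_pi_apply i) hK.measurableSet.compl, hm t i]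
      exact hKε μ rfl
    calc lam t (Set.univ.pi fun _ : ι => K)ᶜ
        ≤ ∑ i, lam t ((fun x : ι → X => x i) ⁻¹' Kᶜ) :=
          (measure_mono hsub).trans (measure_iUnion_fintype_le _ _)
      _ ≤ ∑ _i : ι, ε / (Fintype.card ι + 1) := Finset.sum_le_sum fun i _ => hm' i
      _ = Fintype.card ι * (ε / (Fintype.card ι + 1)) := by simp
      _ ≤ (Fintype.card ι + 1) * (ε / (Fintype.card ι + 1)) := by gcongr; exact le_self_add
      _ = ε := ENNReal.mul_div_cancel (by simp) (by finiteness)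
  obtain ⟨η, -, hη⟩ := (isCompact_closure_of_isTightMeasureSet htight).ultrafilter_le_nhds
    (F.map P) (le_principal_iff.2 (mem_map.2 (univ_mem' fun t =>
      subset_closure (Set.mem_range_self t))))
  have hlim : Tendsto P F (𝓝 η) := hη
  have hmarg : ∀ i, (η : Measure (ι → X)).map (fun x => x i) = μ := by
    intro i
    have h1 := ProbabilityMeasure.tendsto_map_of_tendsto_of_continuous P η hlim
      (f := fun x : ι → X => x i) (continuous_apply i)
    have h2 : ∀ t, (P t).map (continuous_apply i).measurable.aemeasurable
        = (⟨μ, inferInstance⟩ : ProbabilityMeasure X) := fun t => Subtype.ext (hm t i)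
    have h3 := tendsto_nhds_unique (X := ProbabilityMeasure X) (h1.congr h2) tendsto_const_nhds
    exact congrArg (fun ρ : ProbabilityMeasure X => (ρ : Measure X)) h3
  refine ⟨η, inferInstance, hmarg, fun A hA => ?_⟩
  have hex : ∀ B : ι → Set X, ∃ l, Tendsto (fun t => lam t (Set.univ.pi B)) F (𝓝 l) := fun B => by
    obtain ⟨l, -, hl⟩ := isCompact_univ.ultrafilter_le_nhds
      (F.map fun t => lam t (Set.univ.pi B)) (by simp)
    exact ⟨l, hl⟩
  obtain ⟨l, hl⟩ := hex A
  suffices l = (η : Measure (ι → X)) (Set.univ.pi A) by rwa [this] at hl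
  have hcard : ∀ ε : NNReal, 0 < ε →
      Fintype.card ι * ((ε : ENNReal) / (Fintype.card ι + 1)) ≤ ε := fun ε _ =>
    calc Fintype.card ι * ((ε : ENNReal) / (Fintype.card ι + 1))
        ≤ (Fintype.card ι + 1) * ((ε : ENNReal) / (Fintype.card ι + 1)) := by
          gcongr; exact le_self_add
      _ = ε := ENNReal.mul_div_cancel (by simp) (by finiteness)
  have hne : ∀ ε : NNReal, 0 < ε → (ε : ENNReal) / (Fintype.card ι + 1) ≠ 0 := fun ε hε =>
    (ENNReal.div_pos (by simpa using hε.ne') (by finiteness)).ne'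
  refine le_antisymm ?_ ?_
  -- Weak convergence only controls closed and open boxes. Fixed marginals make the cost of
  -- replacing a measurable box by one of these uniform in t: closed boxes inside give this
  -- inequality, open boxes outside the other.
  · refine ENNReal.le_of_forall_pos_le_add fun ε hε _ => ?_
    choose D hDA hDc hDε using fun i => (hA i).exists_isClosed_sdiff_lt (μ := μ)
      (measure_ne_top _ _) (hne ε hε)
    obtain ⟨l', hl'⟩ := hex D
    have h1 : l' ≤ (η : Measure (ι → X)) (Set.univ.pi D) := by
      rw [← hl'.limsup_eq]
      exact ProbabilityMeasure.limsup_measure_closed_le_of_tendsto hlim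
        (isClosed_set_pi fun i _ => hDc i)
    have h2 : l ≤ l' + ε := le_of_tendsto_of_tendsto' hl (hl'.add_const _) fun t =>
      (measure_pi_le_add (hm t) hA (fun i => (hDc i).measurableSet) fun i => (hDε i).le).trans
        (by gcongr; exact hcard ε hε)
    refine h2.trans ?_
    gcongr
    exact h1.trans (measure_mono (Set.pi_mono fun i _ => hDA i))
  · refine ENNReal.le_of_forall_pos_le_add fun ε hε _ => ?_
    choose U hUA hUo _ hUε using fun i => (hA i).exists_isOpen_sdiff_lt (μ := μ)
      (measure_ne_top _ _) (hne ε hε)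
    obtain ⟨l', hl'⟩ := hex U
    have h1 : (η : Measure (ι → X)) (Set.univ.pi U) ≤ l' := by
      rw [← hl'.liminf_eq]
      exact ProbabilityMeasure.le_liminf_measure_open_of_tendsto hlim
        (isOpen_set_pi Set.finite_univ fun i _ => hUo i)
    have h2 : l' ≤ l + ε := le_of_tendsto_of_tendsto' hl' (hl.add_const _) fun t =>
      (measure_pi_le_add (hm t) (fun i => (hUo i).measurableSet) hA fun i => (hUε i).le).trans
        (by gcongr; exact hcard ε hε)
    exact ((measure_mono (Set.pi_mono fun i _ => hUA i)).trans h1).trans h2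

/-- The law of `(T ^ (-n₀) x, …, T ^ (-n_k) x)`, where `n_i` is the `i`-th partial sum of `s`. -/
noncomputable def orbitLaw {k : ℕ} (μ : Measure X) (T : X ≃ᵐ X) (s : Fin k → ℕ) :
    Measure (Fin (k + 1) → X) :=
  μ.map fun x i => ipow T (-((∑ j : Fin k with j.castSucc < i, s j : ℕ) : ℤ)) x

omit [StandardBorelSpace X] in
theorem measurable_orbit {k : ℕ} (T : X ≃ᵐ X) (s : Fin k → ℕ) :
    Measurable fun (x : X) (i : Fin (k + 1)) =>
      ipow T (-((∑ j : Fin k with j.castSucc < i, s j : ℕ) : ℤ)) x :=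
  measurable_pi_lambda _ fun _ => (ipow T _).measurable

omit [StandardBorelSpace X] in
theorem orbitLaw_pi {k : ℕ} (μ : Measure X) (T : X ≃ᵐ X) (s : Fin k → ℕ)
    {A : Fin (k + 1) → Set X} (hA : ∀ i, MeasurableSet (A i)) :
    orbitLaw μ T s (Set.univ.pi A)
      = μ (⋂ i : Fin (k + 1), T^[∑ j : Fin k with j.castSucc < i, s j] '' A i) := by
  rw [orbitLaw, Measure.map_apply (measurable_orbit T s) (MeasurableSet.univ_pi hA)]
  congr 1
  ext x
  simp only [Set.mem_preimage, Set.mem_univ_pi, Set.mem_iInter]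
  refine forall_congr' fun i => ?_
  constructor
  · intro h
    refine ⟨_, h, ?_⟩
    rw [← ipow_natCast, ipow_ipow_neg]
  · rintro ⟨y, hy, rfl⟩
    rw [← ipow_natCast, ipow_neg_ipow]
    exact hy

/-- Mixing of multiplicity `k` follows if all limits of the orbit laws are products. -/
theorem isMixingOfMultiplicity_of_forall_limit {k : ℕ} {μ : Measure X} [IsProbabilityMeasure μ]
    {T : X ≃ᵐ X} (hT : MeasurePreserving T μ μ)
    (h : ∀ s : Fin k → ℕ → ℕ, (∀ j, Tendsto (s j) atTop atTop) → ∀ F : Ultrafilter ℕ,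
      (F : Filter ℕ) ≤ atTop → ∀ η : Measure (Fin (k + 1) → X), IsSelfJoining (k + 1) μ T η →
      (∀ A : Fin (k + 1) → Set X, (∀ i, MeasurableSet (A i)) →
        Tendsto (fun t => orbitLaw μ T (fun j => s j t) (Set.univ.pi A)) F
          (𝓝 (η (Set.univ.pi A)))) → η = Measure.pi fun _ => μ) :
    IsMixingOfMultiplicity k μ T := by
  intro A hA s hs
  rw [tendsto_iff_ultrafilter]
  intro F hF
  have hp : ∀ t, IsProbabilityMeasure (orbitLaw μ T fun j => s j t) := fun t =>
    Measure.isProbabilityMeasure_map (measurable_orbit T _).aemeasurable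
  obtain ⟨η, hη, hmarg, hlim⟩ := exists_limit_of_marginals μ F
    (fun t => orbitLaw μ T fun j => s j t) hp (fun t i => by
      rw [orbitLaw, Measure.map_map (by fun_prop) (measurable_orbit T _)]
      exact (measurePreserving_ipow hT _).map_eq)
  have hd : Measurable (diagMap (k + 1) T) :=
    measurable_pi_lambda _ fun i => T.measurable.comp (measurable_pi_apply i)
  have hpre : ∀ B : Fin (k + 1) → Set X,
      diagMap (k + 1) T ⁻¹' Set.univ.pi B = Set.univ.pi fun i => T ⁻¹' B i := fun B => by
    ext x; simp [diagMap]
  have hinv : MeasurePreserving (diagMap (k + 1) T) η η := by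
    refine ⟨hd, ?_⟩
    have := Measure.isProbabilityMeasure_map (μ := η) hd.aemeasurable
    refine Measure.ext_univ_pi fun B hB => ?_
    rw [Measure.map_apply hd (MeasurableSet.univ_pi hB), hpre]
    refine tendsto_nhds_unique (hlim _ fun i => T.measurable (hB i)) ((hlim B hB).congr fun t => ?_)
    rw [← hpre, orbitLaw, Measure.map_apply (measurable_orbit T _) (MeasurableSet.univ_pi hB),
      Measure.map_apply (measurable_orbit T _) (hd (MeasurableSet.univ_pi hB)),
      ← hT.measure_preimage ((measurable_orbit T _ (MeasurableSet.univ_pi hB)).nullMeasurableSet)]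
    congr 1
    ext x
    simp [diagMap, ipow_apply_comm]
  have := h s hs F hF η ⟨hη, hinv, hmarg⟩ hlim
  rw [← Measure.pi_pi, ← this]
  exact (hlim A hA).congr fun t => orbitLaw_pi μ T _ hA

end Limits

end SelfJoining

namespace SelfJoining

section Decomposition

variable {Y : Type*} [MeasurableSpace Y] {S : Y → Y} {Ω : Measure Y} {κ : Kernel Y Y}
  [IsProbabilityMeasure Ω]

theorem IsErgodicDecomposition.integral_eq (hE : IsErgodicDecomposition S Ω κ) {G : Y → ℝ}
    (hG : Measurable G) {C : ℝ} (hC : ∀ y, |G y| ≤ C) :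
    ∫ ω, ∫ y, G y ∂κ ω ∂Ω = ∫ y, G y ∂Ω := by
  have := hE.isMarkovKernel
  have hsnd : (Ω ⊗ₘ κ).map Prod.snd = Ω := by
    ext E hE'
    rw [Measure.map_apply measurable_snd hE', Measure.compProd_apply (measurable_snd hE'),
      ← hE.lintegral_eq E hE']
    rfl
  rw [← Measure.integral_compProd (f := fun p => G p.2)
    (integrable_of_abs_le (by fun_prop) fun p => hC p.2)]
  conv_rhs => rw [← hsnd]
  rw [integral_map (by fun_prop) hG.aestronglyMeasurable]

end Decomposition

/-! ### Systems that are not mixing. -/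

section NotMixing

variable {X : Type u} [MeasurableSpace X] [StandardBorelSpace X]
  {μ : Measure X} [IsProbabilityMeasure μ] {T : X ≃ᵐ X}

/-- Convergence of measures on rectangles, with marginals fixed, extends to relatively
independent correlations. -/
theorem tendsto_integral_correlation {τ : Type*} {l : Filter τ} {lam : τ → Measure (X × X)}
    [∀ t, IsProbabilityMeasure (lam t)] {η : Measure (X × X)} [IsProbabilityMeasure η]
    (hlam1 : ∀ t, (lam t).map Prod.fst = μ) (hlam2 : ∀ t, (lam t).map Prod.snd = μ)
    (hη1 : η.map Prod.fst = μ) (hη2 : η.map Prod.snd = μ)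
    (h : ∀ A B, MeasurableSet A → MeasurableSet B →
      Tendsto (fun t => (lam t).real (A ×ˢ B)) l (𝓝 (η.real (A ×ˢ B))))
    {Φ Ψ : X × X → ℝ} (hΦ : Measurable Φ) (hΨ : Measurable Ψ) {C : ℝ} (hC : ∀ p, |Φ p| ≤ C)
    (hD : ∀ p, |Ψ p| ≤ C) :
    Tendsto (fun t => ∫ w, Φ (w.1.1, w.2) * Ψ (w.1.2, w.2) ∂(lam t).prod μ) l
      (𝓝 (∫ w, Φ (w.1.1, w.2) * Ψ (w.1.2, w.2) ∂η.prod μ)) := by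
  refine tendsto_of_forall_approx fun ε hε => ?_
  have hC0 : 0 ≤ C := by
    obtain ⟨x⟩ : Nonempty X := μ.nonempty_of_neZero
    exact (abs_nonneg _).trans (hC (x, x))
  set δ := ε / (2 * C + 1) with hδ
  have hδ0 : 0 < δ := by positivity
  have hδε : C * δ + C * δ ≤ ε := by
    rw [← add_mul, hδ, mul_div_assoc', div_le_iff₀ (by positivity)]
    nlinarith
  obtain ⟨n, a, b, ha, hb, ha1, hbC, hsum, hl⟩ := exists_sum_mul_approx μ μ hΦ hC
    (ε := ENNReal.ofReal δ) (by simpa using hδ0)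
  obtain ⟨n', a', b', ha', hb', ha1', hbC', hsum', hl'⟩ := exists_sum_mul_approx μ μ hΨ hD
    (ε := ENNReal.ofReal δ) (by simpa using hδ0)
  set Φ' : X × X → ℝ := fun p => ∑ j ∈ Finset.range n, a j p.1 * b j p.2 with hΦ'
  set Ψ' : X × X → ℝ := fun p => ∑ j ∈ Finset.range n', a' j p.1 * b' j p.2 with hΨ'
  have hΦ'm : Measurable Φ' := by fun_prop
  have hΨ'm : Measurable Ψ' := by fun_prop
  have key : ∀ (P : Measure (X × X)) [IsProbabilityMeasure P], P.map Prod.fst = μ →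
      P.map Prod.snd = μ → |∫ w, Φ (w.1.1, w.2) * Ψ (w.1.2, w.2) ∂P.prod μ
        - ∫ w, Φ' (w.1.1, w.2) * Ψ' (w.1.2, w.2) ∂P.prod μ| ≤ ε := by
    intro P _ h1 h2
    have m1 : (P.prod μ).map (fun w => (w.1.1, w.2)) = μ.prod μ :=
      ((⟨measurable_fst, h1⟩ : MeasurePreserving Prod.fst P μ).prod
        (MeasurePreserving.id μ)).map_eq
    have m2 : (P.prod μ).map (fun w => (w.1.2, w.2)) = μ.prod μ :=
      ((⟨measurable_snd, h2⟩ : MeasurePreserving Prod.snd P μ).prod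
        (MeasurePreserving.id μ)).map_eq
    have e1 := abs_integral_mul_sub_le (P := P.prod μ) (π := fun w => (w.1.1, w.2)) (by fun_prop)
      m1 (U := fun w => Ψ (w.1.2, w.2)) (by fun_prop) hΦ hΦ'm (fun w => hD _) hC hsum hδ0.le hl
    have e2 := abs_integral_mul_sub_le (P := P.prod μ) (π := fun w => (w.1.2, w.2)) (by fun_prop)
      m2 (U := fun w => Φ' (w.1.1, w.2)) (by fun_prop) hΨ hΨ'm (fun w => hsum _) hD hsum' hδ0.le
      hl'
    simp only [fun w : (X × X) × X => mul_comm (Ψ (w.1.2, w.2))] at e1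
    exact (abs_sub_le _ _ _).trans ((add_le_add e1 e2).trans hδε)
  refine ⟨fun t => ∫ w, Φ' (w.1.1, w.2) * Ψ' (w.1.2, w.2) ∂(lam t).prod μ,
    ∫ w, Φ' (w.1.1, w.2) * Ψ' (w.1.2, w.2) ∂η.prod μ, ?_, ?_, key η hη1 hη2⟩
  · have e : ∀ (P : Measure (X × X)) [IsProbabilityMeasure P],
        ∫ w, Φ' (w.1.1, w.2) * Ψ' (w.1.2, w.2) ∂P.prod μ
        = ∑ i ∈ Finset.range n, ∑ j ∈ Finset.range n',
          (∫ p, a i p.1 * a' j p.2 ∂P) * ∫ y, b i y * b' j y ∂μ := by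
      intro P _
      have e0 : ∀ w : (X × X) × X, Φ' (w.1.1, w.2) * Ψ' (w.1.2, w.2)
          = ∑ i ∈ Finset.range n, ∑ j ∈ Finset.range n',
            (a i w.1.1 * a' j w.1.2) * (b i w.2 * b' j w.2) := fun w => by
        simp only [hΦ', hΨ', Finset.sum_mul_sum]
        refine Finset.sum_congr rfl fun i _ => Finset.sum_congr rfl fun j _ => ?_
        ring
      simp only [e0]
      have hint : ∀ i j, Integrable (fun w : (X × X) × X =>
          (a i w.1.1 * a' j w.1.2) * (b i w.2 * b' j w.2)) (P.prod μ) := fun i j =>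
        integrable_of_abs_le (by fun_prop) fun w => abs_mul_le_mul
          (abs_mul_le_mul (ha1 _ _) (ha1' _ _)) (abs_mul_le_mul (hbC _ _) (hbC' _ _))
      rw [integral_finsetSum _ fun i _ => integrable_finsetSum _ fun j _ => hint i j]
      refine Finset.sum_congr rfl fun i _ => ?_
      rw [integral_finsetSum _ fun j _ => hint i j]
      refine Finset.sum_congr rfl fun j _ => ?_
      exact integral_prod_mul (fun p : X × X => a i p.1 * a' j p.2) (fun y => b i y * b' j y)
    simp only [e]
    exact tendsto_finsetSum _ fun i _ => tendsto_finsetSum _ fun j _ =>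
      (tendsto_integral_mul_of_forall_prod h (ha i) (ha' j) (ha1 i) (ha1' j)).mul_const _
  · exact Eventually.of_forall fun t => key (lam t) (hlam1 t) (hlam2 t)

variable [Nonempty X] {ν : Measure (X × X × X)} [IsProbabilityMeasure ν]

/-- In a triple joining other than the product the copies of the third variable over distinct
points of an orbit are uncorrelated. -/
theorem IsTripleJoining.integral_fibreAvg_mul_eq_zero (hM : HasMinimalPairs μ T)
    (h : IsTripleJoining μ T ν) (hne : ν ≠ μ.prod (μ.prod μ)) {f : X → ℝ} (hf : Measurable f)
    {C : ℝ} (hC : ∀ x, |f x| ≤ C) (hf0 : ∫ x, f x ∂μ = 0) {n : ℤ} (hn : n ≠ 0) :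
    ∫ q : X × X, fibreAvg (over12 ν) f q * fibreAvg (over12 ν) f (ipow T n q.1, q.2) ∂μ.prod μ
      = 0 := by
  obtain ⟨κ, hE⟩ := exists_ergodic_decomposition (h.measurePreserving_linked n)
  -- Two copies of the third variable over x and `T ^ n x` with common y: a relation by `T ^ s`
  -- would make ν invariant under the shift `(n, 0, s)`.
  have hind : (linked T ν n).map (fun q => (q.1.2.2, q.2)) = μ.prod μ := by
    refine hE.map_eq (by fun_prop) ?_
    have e1 := hE.ae_map_eq (π := Prod.fst) (by fun_prop)
      (R := Prod.map T (Prod.map T T)) rfl (by rw [map_fst_linked]; exact h.ergodic)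
    have e2 := hE.ae_map_eq (π := fun q => (ipow T n q.1.1, q.1.2.1, q.2)) (by fun_prop)
      (R := Prod.map T (Prod.map T T)) (by funext q; simp [ipow_apply_comm])
      (by rw [h.map_linked_law3]; exact h.ergodic)
    rw [map_fst_linked] at e1
    rw [h.map_linked_law3] at e2
    filter_upwards [hE.ergodic, e1, e2] with ω he h1 h2
    have m1 : (κ ω).map (fun q => q.1.2.2) = μ := by
      rw [← h.map3]
      conv_rhs => rw [← h1]
      rw [Measure.map_map (by fun_prop) (by fun_prop)]
      rfl
    have m2 : (κ ω).map (fun q => q.2) = μ := by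
      rw [← h.map3]
      conv_rhs => rw [← h2]
      rw [Measure.map_map (by fun_prop) (by fun_prop)]
      rfl
    rcases hM.map_eq_or he (f := fun q => q.1.2.2) (g := fun q => q.2) (by fun_prop)
      (by fun_prop) (fun _ => rfl) (fun _ => rfl) m1 m2 with h5 | ⟨s, hs⟩
    · exact h5
    · refine absurd ?_ hne
      refine h.eq_prod_of_map_shift (a := n) (b := 0) (c := s) (by simp) (Or.inl hn) ?_
      conv_lhs => rw [← h1]
      conv_rhs => rw [← h2]
      rw [Measure.map_map (by fun_prop) (by fun_prop)]
      refine Measure.map_congr ?_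
      filter_upwards [hs] with w hw
      simp [shift, hw]
  have hzero : ∫ q, f q.1.2.2 * f q.2 ∂linked T ν n = 0 := by
    have := integral_map (μ := linked T ν n) (φ := fun q => (q.1.2.2, q.2))
      (f := fun p : X × X => f p.1 * f p.2) (by fun_prop)
      (Measurable.aestronglyMeasurable (by fun_prop))
    rw [← this, hind, integral_prod_mul, hf0, mul_zero]
  rw [← hzero, linked, integral_compProd_of_abs_le _ (by fun_prop)
    (fun w => abs_mul_le_mul (hC _) (hC _))]
  simp only [fibreAvg_const_mul]
  rw [h.integral_eq_over12 (F := fun p => f p.2.2 * fibreAvg (over12 ν) f (ipow T n p.1, p.2.1))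
    (by fun_prop) (fun w => abs_mul_le_mul (hC _) (abs_fibreAvg_le hC _))]
  simp only [fibreAvg_mul_const]

/-- A limit joining of the orbit that charges an off-diagonal forces all triple joinings to be
products. -/
theorem IsTripleJoining.eq_prod_of_limit (hM : HasMinimalPairs μ T) (h : IsTripleJoining μ T ν)
    {n : ℕ → ℤ} {F : Ultrafilter ℕ} (hn : ∀ p, ∀ᶠ t in F, n t ≠ p)
    {η : Measure (X × X)} [IsProbabilityMeasure η] (hη : MeasurePreserving (Prod.map T T) η η)
    (hη1 : η.map Prod.fst = μ) (hη2 : η.map Prod.snd = μ)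
    (hlim : ∀ A B, MeasurableSet A → MeasurableSet B →
      Tendsto (fun t => (μ.map fun x => (x, ipow T (n t) x)).real (A ×ˢ B)) F
        (𝓝 (η.real (A ×ˢ B)))) (hne : η ≠ μ.prod μ) : ν = μ.prod (μ.prod μ) := by
  by_contra hν
  have hT := h.measurePreserving
  have hTe : Ergodic T μ := by
    have := Ergodic.map_of_semiconj h.ergodic (f := fun p => p.1) T.measurable (by fun_prop)
      (fun _ => rfl)
    rwa [h.map1] at this
  obtain ⟨κ, hE⟩ := exists_ergodic_decomposition hη
  have hMk := hE.isMarkovKernel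
  have e1 := hE.ae_map_eq (π := Prod.fst) measurable_fst (R := T) rfl (by rw [hη1]; exact hTe)
  have e2 := hE.ae_map_eq (π := Prod.snd) measurable_snd (R := T) rfl (by rw [hη2]; exact hTe)
  rw [hη1] at e1
  rw [hη2] at e2
  have hcomp : ∀ᵐ ω ∂η, κ ω = μ.prod μ ∨ ∃ p, κ ω = offDiagonal μ T p := by
    filter_upwards [hE.ergodic, e1, e2] with ω h0 h1 h2
    exact hM _ h0 h1 h2
  -- Since η is not the product, some single off-diagonal has positive weight among its components.
  obtain ⟨p, hp⟩ : ∃ p : ℤ, ∃ᶠ ω in ae η, κ ω = offDiagonal μ T p := by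
    by_contra! hcon
    refine hne ?_
    have h2 : ∀ᵐ ω ∂η, ∀ p : ℤ, κ ω ≠ offDiagonal μ T p :=
      ae_all_iff.2 hcon
    have h3 := hE.map_eq measurable_id (θ := μ.prod μ) (by
      filter_upwards [hcomp, h2] with ω hω hω2
      rw [Measure.map_id]
      rcases hω with hω | ⟨p, hω⟩
      · exact hω
      · exact absurd hω (hω2 p))
    rwa [Measure.map_id] at h3
  have h' := h.swap23.swap12
  have := h'.isProbabilityMeasure
  refine hν (IsTripleJoining.eq_prod_of_swap23 (IsTripleJoining.eq_prod_of_swap12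
    (h'.eq_prod_of_forall_fibreAvg fun f hf hf1 hf0 => ?_)))
  have hover : over23 ((ν.map fun p => (p.1, p.2.2, p.2.1)).map fun p => (p.2.1, p.1, p.2.2))
      = over12 ν := by
    rw [over23, over12, Measure.map_map (by fun_prop) (by fun_prop),
      Measure.map_map (by fun_prop) (by fun_prop)]
    rfl
  have hΦ0 : ∫ q, fibreAvg (over12 ν) f q * fibreAvg (over12 ν) f q ∂μ.prod μ = 0 := by
    set Φ := fibreAvg (over12 ν) f with hΦ
    have hΦm : Measurable Φ := measurable_fibreAvg hf
    have hΦ1 : ∀ q, |Φ q| ≤ 1 := abs_fibreAvg_le hf1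
    -- Translating by `-p` makes the component `Δ_{T ^ p}` contribute exactly the integral of `Φ ^
    -- 2`.
    set Ψ : X × X → ℝ := fun q => Φ (ipow T (-p) q.1, q.2) with hΨ
    have hΨm : Measurable Ψ := by fun_prop
    have hb : ∀ w : (X × X) × X, |Φ (w.1.1, w.2) * Ψ (w.1.2, w.2)| ≤ 1 * 1 := fun w =>
      abs_mul_le_mul (hΦ1 _) (hΦ1 _)
    set G : X × X → ℝ := fun q => ∫ y, Φ (q.1, y) * Ψ (q.2, y) ∂μ with hG
    have hGm : Measurable G := measurable_integral_kernel (κ := Kernel.const (X × X) μ)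
      (f := fun w : (X × X) × X => Φ (w.1.1, w.2) * Ψ (w.1.2, w.2)) (by fun_prop)
    have hG1 : ∀ q, |G q| ≤ 1 * 1 := fun q => abs_integral_le_of_abs_le fun y => hb (q, y)
    have hGint : ∀ (P : Measure (X × X)) [IsProbabilityMeasure P],
        ∫ w, Φ (w.1.1, w.2) * Ψ (w.1.2, w.2) ∂P.prod μ = ∫ q, G q ∂P := fun P _ =>
      integral_prod _ (integrable_of_abs_le (by fun_prop) hb)
    have hoff : ∀ m : ℤ, ∫ q, G q ∂(μ.map fun x => (x, ipow T m x))
        = ∫ q : X × X, Φ q * Φ (ipow T (m - p) q.1, q.2) ∂μ.prod μ := by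
      intro m
      rw [integral_map (by fun_prop) hGm.aestronglyMeasurable,
        integral_prod _ (integrable_of_abs_le (C := 1 * 1) (by fun_prop)
          fun w => abs_mul_le_mul (hΦ1 _) (hΦ1 _))]
      simp only [hG, hΨ, ← ipow_add, sub_eq_neg_add]
    have hmarg : ∀ m : ℤ, (μ.map fun x => (x, ipow T m x)).map Prod.fst = μ ∧
        (μ.map fun x => (x, ipow T m x)).map Prod.snd = μ := fun m => by
      rw [Measure.map_map (by fun_prop) (by fun_prop), Measure.map_map (by fun_prop) (by fun_prop)]
      exact ⟨Measure.map_id, (measurePreserving_ipow hT m).map_eq⟩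
    have hprob : ∀ t : ℕ, IsProbabilityMeasure (μ.map fun x => (x, ipow T (n t) x)) := fun t =>
      Measure.isProbabilityMeasure_map (by fun_prop)
    -- The approximating off-diagonals eventually avoid exponent p, and all their correlations
    -- vanish.
    have hGη : ∫ q, G q ∂η = 0 := by
      have hl := tendsto_integral_correlation (fun t => (hmarg (n t)).1) (fun t => (hmarg (n t)).2)
        hη1 hη2 hlim hΦm hΨm hΦ1 (fun q => hΦ1 _)
      simp only [hGint, hoff] at hl
      refine tendsto_nhds_unique hl (tendsto_const_nhds.congr' ?_)
      filter_upwards [hn p] with t ht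
      exact (h.integral_fibreAvg_mul_eq_zero hM hν hf hf1 hf0 (sub_ne_zero.2 ht)).symm
    have hoff' : ∀ q, offDiagonal μ T q = μ.map fun x => (x, ipow T q x) := fun q => by
      rw [offDiagonal]; simp only [coe_ipow]
    -- On every type of component the contribution is nonnegative: a square for the product, the
    -- integral of `Φ ^ 2` for exponent p, zero for other exponents. A total of zero then
    -- annihilates the one of positive weight.
    have hg0 : ∀ᵐ ω ∂η, 0 ≤ ∫ q, G q ∂κ ω := by
      filter_upwards [hcomp] with ω hω
      rcases hω with hω | ⟨q, hω⟩
      · rw [hω, ← hGint, integral_prod_symm _ (integrable_of_abs_le (by fun_prop) hb)]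
        refine integral_nonneg fun y => ?_
        change 0 ≤ ∫ x : X × X, Φ (x.1, y) * Ψ (x.2, y) ∂μ.prod μ
        rw [integral_prod_mul (fun x => Φ (x, y)) (fun x => Ψ (x, y))]
        simp only [hΨ]
        rw [integral_comp_ipow hT (-p) fun x => Φ (x, y)]
        exact mul_self_nonneg _
      · rw [hω, hoff', hoff]
        by_cases hqp : q = p
        · subst hqp
          refine integral_nonneg fun y => ?_
          simp only [sub_self, ipow_zero]
          exact mul_self_nonneg _
        · rw [h.integral_fibreAvg_mul_eq_zero hM hν hf hf1 hf0 (sub_ne_zero.2 hqp)]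
    have hgm : Measurable fun ω => ∫ q, G q ∂κ ω :=
      measurable_integral_kernel (f := fun w : (X × X) × X × X => G w.2) (by fun_prop)
    have hgz : ∀ᵐ ω ∂η, ∫ q, G q ∂κ ω = 0 := by
      have h1 := hE.integral_eq hGm hG1
      rw [hGη, integral_eq_zero_iff_of_nonneg_ae hg0
        (integrable_of_abs_le hgm fun ω => abs_integral_le_of_abs_le hG1)] at h1
      exact h1
    obtain ⟨ω, hω1, hω2⟩ := (hp.and_eventually hgz).exists
    rw [hω1, hoff', hoff] at hω2
    simpa only [sub_self, ipow_zero, Prod.mk.eta] using hω2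
  have hΦm : Measurable (fibreAvg (over12 ν) f) := measurable_fibreAvg hf
  have hΦ1 : ∀ q, |fibreAvg (over12 ν) f q| ≤ 1 := abs_fibreAvg_le hf1
  rw [integral_eq_zero_iff_of_nonneg (fun q => mul_self_nonneg _)
      (integrable_of_abs_le (hΦm.mul hΦm) fun q => abs_mul_le_mul (hΦ1 q) (hΦ1 q))] at hΦ0
  filter_upwards [hΦ0] with q hq
  simp only [hover]
  simpa using hq

end NotMixing

end SelfJoining

namespace SelfJoining

/-- A measure for which all functions of the second coordinate have constant conditional
expectation given the first one is a product. -/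
theorem eq_prod_of_forall_fibreAvg {B Z : Type*} [MeasurableSpace B] [MeasurableSpace Z]
    [StandardBorelSpace Z] [Nonempty Z] {ρ : Measure (B × Z)} [IsProbabilityMeasure ρ]
    (h : ∀ f : Z → ℝ, Measurable f → (∀ z, |f z| ≤ 1) → ∫ z, f z ∂ρ.snd = 0 →
      ∀ᵐ b ∂ρ.fst, fibreAvg ρ f b = 0) : ρ = ρ.fst.prod ρ.snd := by
  refine (Measure.prod_eq fun E A hE hA => ?_).symm
  have hmA : Measurable (A.indicator (1 : Z → ℝ)) := measurable_one.indicator hA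
  have hmE : Measurable (E.indicator (1 : B → ℝ)) := measurable_one.indicator hE
  have hE1 := abs_indicator_one_le E
  set f : Z → ℝ := fun z => A.indicator 1 z - ρ.snd.real A with hf
  have hfm : Measurable f := hmA.sub_const _
  have h01 : 0 ≤ ρ.snd.real A ∧ ρ.snd.real A ≤ 1 := ⟨measureReal_nonneg, measureReal_le_one⟩
  have hf1 : ∀ x, |f x| ≤ 1 := fun x => by
    by_cases hx : x ∈ A <;> simp [hf, hx, abs_le] <;> linarith
  have hf0 : ∫ x, f x ∂ρ.snd = 0 := by
    rw [hf, integral_sub (f := A.indicator (1 : Z → ℝ))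
      ((integrable_const (1 : ℝ)).indicator hA) (integrable_const _), integral_indicator_one hA]
    simp
  have e0 : ∫ p, E.indicator (1 : B → ℝ) p.1 * f p.2 ∂ρ = 0 := by
    rw [integral_eq_integral_fibreAvg (F := fun p => E.indicator (1 : B → ℝ) p.1 * f p.2)
      (by fun_prop) (fun p => abs_mul_le_mul (hE1 p.1) (hf1 p.2))]
    refine integral_eq_zero_of_ae ?_
    filter_upwards [h f hfm hf1 hf0] with q hq
    simp only [fibreAvg_const_mul, hq, mul_zero, Pi.zero_apply]
  have e1 : ∫ p, E.indicator (1 : B → ℝ) p.1 * f p.2 ∂ρ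
      = ρ.real (E ×ˢ A) - ρ.snd.real A * ρ.fst.real E := by
    have h1 : ∀ p : B × Z, E.indicator (1 : B → ℝ) p.1 * f p.2
        = (E ×ˢ A).indicator (1 : B × Z → ℝ) p
          - ρ.snd.real A * (Prod.fst ⁻¹' E).indicator (1 : B × Z → ℝ) p := by
      rintro ⟨x, y⟩
      by_cases hx : x ∈ E <;> by_cases hy : y ∈ A <;> simp [hf, hx, hy, Set.indicator]
    simp only [h1]
    rw [integral_sub (f := (E ×ˢ A).indicator (1 : B × Z → ℝ))
      (g := fun p => ρ.snd.real A * (Prod.fst ⁻¹' E).indicator (1 : B × Z → ℝ) p)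
      ((integrable_const (1 : ℝ)).indicator (hE.prod hA))
      (((integrable_const (1 : ℝ)).indicator (measurable_fst hE)).const_mul _),
      integral_indicator_one (hE.prod hA), integral_const_mul,
      integral_indicator_one (measurable_fst hE)]
    congr 2
    rw [Measure.real, Measure.real, Measure.fst_apply hE]
  rw [e0] at e1
  rw [← ENNReal.toReal_eq_toReal_iff' (by finiteness) (by finiteness), ENNReal.toReal_mul]
  simp only [Measure.real] at e1
  linarith

/-! ### From triples to joinings with a third system. -/

section Extension

variable {X : Type u} [MeasurableSpace X] [StandardBorelSpace X] [Nonempty X]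
  {μ : Measure X} [IsProbabilityMeasure μ] {T : X ≃ᵐ X}
  {R : Type*} [MeasurableSpace R] [StandardBorelSpace R] {ρ : Measure R} [IsProbabilityMeasure ρ]
  {β : R ≃ᵐ R} {ν : Measure (X × R × X)} [IsProbabilityMeasure ν]

omit [StandardBorelSpace X] [Nonempty X] [StandardBorelSpace R] in
theorem map_ipow_fst_prod (hT : MeasurePreserving T μ μ) {Y : Type*} [MeasurableSpace Y]
    {Ω : Measure Y} {f : Y → X} {g : Y → R} (hf : Measurable f) (hg : Measurable g)
    {θ : Measure R} [SFinite θ] (h : Ω.map (fun y => (f y, g y)) = μ.prod θ) (m : ℤ) :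
    Ω.map (fun y => (ipow T m (f y), g y)) = μ.prod θ := by
  have h2 : (μ.prod θ).map (Prod.map (ipow T m) id) = μ.prod θ :=
    ((measurePreserving_ipow hT m).prod (MeasurePreserving.id θ)).map_eq
  conv_rhs => rw [← h2, ← h]
  rw [Measure.map_map (by fun_prop) (by fun_prop)]
  rfl

/-- The orthogonality relation behind `eq_prod_of_pairs`. -/
theorem integral_fibreAvg_eq_zero_of_pairs (hM : HasMinimalPairs μ T) (hP : HasProductTriples μ T)
    (hT : MeasurePreserving T μ μ)
    (he : Ergodic (Prod.map T (Prod.map β T)) ν)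
    (hxr : ν.map (fun p => (p.1, p.2.1)) = μ.prod ρ) (hrz : ν.map Prod.snd = ρ.prod μ)
    (hxz : ν.map (fun p => (p.1, p.2.2)) = μ.prod μ) (hne : ν ≠ μ.prod (ρ.prod μ))
    [IsProbabilityMeasure (ν.map fun p => ((p.1, p.2.1), p.2.2))]
    {u f : X → ℝ} (hu : Measurable u) (hf : Measurable f) {C D : ℝ} (hD : ∀ x, |u x| ≤ D)
    (hC : ∀ x, |f x| ≤ C) (hf0 : ∫ x, f x ∂μ = 0) {m : ℤ} (hm : m ≠ 0) :
    ∫ q : X × R, u (ipow T m q.1) * fibreAvg (ν.map fun p => ((p.1, p.2.1), p.2.2)) f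
        (ipow T m q.1, q.2) *
      (u q.1 * fibreAvg (ν.map fun p => ((p.1, p.2.1), p.2.2)) f q) ∂μ.prod ρ = 0 := by
  set P := ν.map fun p => ((p.1, p.2.1), p.2.2) with hPdef
  have hfst : P.fst = μ.prod ρ := by
    rw [← hxr, hPdef, Measure.fst, Measure.map_map (by fun_prop) (by fun_prop)]
    rfl
  have heP : Ergodic (Prod.map (T.prodCongr β) T) P :=
    Ergodic.map_of_semiconj he (by fun_prop) (by fun_prop) (fun _ => rfl)
  have hπ : ν.map (fun p => (ipow T m p.1, p.2.1)) = P.fst := by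
    rw [hfst]
    exact map_ipow_fst_prod hT measurable_fst (by fun_prop) hxr m
  set M := ν ⊗ₘ P.condKernel.comap (fun p : X × R × X => (ipow T m p.1, p.2.1)) (by fun_prop)
    with hMdef
  have hMS : MeasurePreserving (Prod.map (Prod.map T (Prod.map β T)) T) M M :=
    measurePreserving_compProd_condKernel (β := T.prodCongr β) he.toMeasurePreserving _
      (fun p => Prod.ext (ipow_apply_comm _ _ _) rfl) heP.toMeasurePreserving hπ
  have hM1 : M.map Prod.fst = ν := Measure.fst_compProd _ _
  have hM2 : M.map (fun q => (ipow T m q.1.1, q.1.2.1, q.2)) = ν := by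
    have h1 := map_compProd_condKernel (Γ := ν)
      (π := fun p : X × R × X => (ipow T m p.1, p.2.1)) (by fun_prop) hπ
    have h2 : P.map (fun w => (w.1.1, w.1.2, w.2)) = ν := by
      rw [hPdef, Measure.map_map (by fun_prop) (by fun_prop)]
      exact Measure.map_id
    conv_rhs => rw [← h2, ← h1]
    rw [Measure.map_map (by fun_prop) (by fun_prop)]
    rfl
  have hTT : Ergodic (Prod.map T T) (μ.prod μ) := by
    rw [← hxz]
    exact Ergodic.map_of_semiconj he (by fun_prop) (by fun_prop) (fun _ => rfl)
  have hz : ν.map (fun p => p.2.2) = μ := by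
    have h1 : (μ.prod μ).map Prod.snd = μ := measurePreserving_snd.map_eq
    rw [← hxz, Measure.map_map (by fun_prop) (by fun_prop)] at h1
    exact h1
  obtain ⟨κ, hE⟩ := exists_ergodic_decomposition hMS
  -- The variable `q.2` is a second copy of z lying over `(T ^ m x, r)`. If it is independent of z,
  -- the triple with x is pairwise independent, hence a product; if it is `T ^ s z`, then ν is
  -- invariant under `T ^ m × id × T ^ s` and is itself the product.
  have hind : M.map (fun q => (q.1.1, q.1.2.2, q.2)) = μ.prod (μ.prod μ) := by
    refine hE.map_eq (by fun_prop) ?_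
    have e1 := hE.ae_map_eq (π := Prod.fst) (by fun_prop)
      (R := Prod.map T (Prod.map β T)) rfl (by rw [hM1]; exact he)
    have e2 := hE.ae_map_eq (π := fun q => (ipow T m q.1.1, q.1.2.1, q.2)) (by fun_prop)
      (R := Prod.map T (Prod.map β T)) (by funext q; simp [ipow_apply_comm])
      (by rw [hM2]; exact he)
    rw [hM1] at e1
    rw [hM2] at e2
    filter_upwards [hE.ergodic, e1, e2] with ω h0 h1 h2
    have m1 : (κ ω).map (fun q => q.1.2.2) = μ := by
      rw [← hz]
      conv_rhs => rw [← h1]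
      rw [Measure.map_map (by fun_prop) (by fun_prop)]
      rfl
    have m2 : (κ ω).map (fun q => q.2) = μ := by
      rw [← hz]
      conv_rhs => rw [← h2]
      rw [Measure.map_map (by fun_prop) (by fun_prop)]
      rfl
    have m12 : (κ ω).map (fun q => (q.1.1, q.1.2.2)) = μ.prod μ := by
      rw [← hxz]
      conv_rhs => rw [← h1]
      rw [Measure.map_map (by fun_prop) (by fun_prop)]
      rfl
    have m13 : (κ ω).map (fun q => (q.1.1, q.2)) = μ.prod μ := by
      have h3 : (κ ω).map (fun q => (ipow T m q.1.1, q.2)) = μ.prod μ := by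
        rw [← hxz]
        conv_rhs => rw [← h2]
        rw [Measure.map_map (by fun_prop) (by fun_prop)]
        rfl
      simpa using map_ipow_fst_prod hT (by fun_prop) (by fun_prop) h3 (-m)
    rcases hM.map_eq_or h0 (f := fun q => q.1.2.2) (g := fun q => q.2) (by fun_prop)
      (by fun_prop) (fun _ => rfl) (fun _ => rfl) m1 m2 with h5 | ⟨s, hs⟩
    · refine hP _ ⟨Ergodic.map_of_semiconj h0 (by fun_prop) (by fun_prop) (fun _ => rfl), ?_, ?_,
        ?_⟩
      · rw [Measure.map_map (by fun_prop) (by fun_prop)]; exact m12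
      · rw [Measure.map_map (by fun_prop) (by fun_prop)]; exact m13
      · rw [Measure.map_map (by fun_prop) (by fun_prop)]; exact h5
    · refine absurd ?_ hne
      have := eq_prod_of_invariant hT hTT hxz hm (c := s) (by
        conv_lhs => rw [← h1]
        conv_rhs => rw [← h2]
        rw [Measure.map_map (by fun_prop) (by fun_prop)]
        refine Measure.map_congr ?_
        filter_upwards [hs] with w hw
        simp [hw])
      rwa [hrz] at this
  have hint : ∫ q, u (ipow T m q.1.1) * u q.1.1 * f q.1.2.2 * f q.2 ∂M = 0 := by
    have := integral_map (μ := M) (φ := fun q => (q.1.1, q.1.2.2, q.2))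
      (f := fun p : X × X × X => u (ipow T m p.1) * u p.1 * (f p.2.1 * f p.2.2)) (by fun_prop)
      (Measurable.aestronglyMeasurable (by fun_prop))
    simp only [mul_assoc] at this ⊢
    rw [← this, hind]
    have h3 := integral_prod_mul (μ := μ) (ν := μ.prod μ) (fun x => u (ipow T m x) * u x)
      (fun p : X × X => f p.1 * f p.2)
    rw [integral_prod_mul, hf0] at h3
    simpa [mul_assoc] using h3
  have b1 : ∀ x, |u (ipow T m x) * u x| ≤ D * D := fun x => abs_mul_le_mul (hD _) (hD _)
  rw [← hint, hMdef, integral_compProd_of_abs_le _ (by fun_prop)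
    (fun w => abs_mul_le_mul (abs_mul_le_mul (b1 _) (hC _)) (hC _))]
  simp only [fibreAvg_const_mul]
  have h4 := integral_eq_integral_fibreAvg (ρ := P) (F := fun w => u (ipow T m w.1.1) * u w.1.1 *
    f w.2 * fibreAvg P f (ipow T m w.1.1, w.1.2)) (by fun_prop)
    (fun w => abs_mul_le_mul (abs_mul_le_mul (b1 _) (hC _)) (abs_fibreAvg_le hC _))
  rw [hfst] at h4
  simp only [fibreAvg_mul_const, fibreAvg_const_mul] at h4
  have hmap : ∀ G : (X × R) × X → ℝ, Measurable G →
      ∫ w, G w ∂P = ∫ p : X × R × X, G ((p.1, p.2.1), p.2.2) ∂ν := fun G hG => by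
    rw [hPdef, integral_map (by fun_prop) hG.aestronglyMeasurable]
  rw [hmap _ (by fun_prop)] at h4
  rw [h4]
  refine integral_congr_ae (ae_of_all _ fun q => ?_)
  simp only
  ring

/-- For a mixing system whose ergodic pairwise independent triple joinings are products, an ergodic
joining of two copies of the system with a third system is a product as soon as its three
two-dimensional marginals are. -/
theorem eq_prod_of_pairs (hM : HasMinimalPairs μ T) (hP : HasProductTriples μ T)
    (hT : MeasurePreserving T μ μ) (hmix : IsMixing μ T)
    (he : Ergodic (Prod.map T (Prod.map β T)) ν)
    (hxr : ν.map (fun p => (p.1, p.2.1)) = μ.prod ρ) (hrz : ν.map Prod.snd = ρ.prod μ)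
    (hxz : ν.map (fun p => (p.1, p.2.2)) = μ.prod μ) : ν = μ.prod (ρ.prod μ) := by
  by_contra hne
  have hPp : IsProbabilityMeasure (ν.map fun p => ((p.1, p.2.1), p.2.2)) :=
    Measure.isProbabilityMeasure_map (by fun_prop)
  have key := fun (u f : X → ℝ) (hu : Measurable u) (hf : Measurable f) (hD : ∀ x, |u x| ≤ 1)
    (hC : ∀ x, |f x| ≤ 1) (hf0 : ∫ x, f x ∂μ = 0) (m : ℤ) (hm : m ≠ 0) =>
    integral_fibreAvg_eq_zero_of_pairs hM hP hT he hxr hrz hxz hne hu hf hD hC hf0 hm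
  set P := ν.map fun p => ((p.1, p.2.1), p.2.2) with hPdef
  have hfst : P.fst = μ.prod ρ := by
    rw [← hxr, hPdef, Measure.fst, Measure.map_map (by fun_prop) (by fun_prop)]
    rfl
  have hsnd : P.snd = μ := by
    have h1 : (ρ.prod μ).map Prod.snd = μ := measurePreserving_snd.map_eq
    rw [← hrz, Measure.map_map (by fun_prop) (by fun_prop)] at h1
    rw [hPdef, Measure.snd, Measure.map_map (by fun_prop) (by fun_prop)]
    exact h1
  have hprod : P = P.fst.prod P.snd := by
    refine eq_prod_of_forall_fibreAvg fun f hf hf1 hf0 => ?_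
    rw [hsnd] at hf0
    rw [hfst]
    set Φ := fibreAvg P f with hΦ
    have hΦm : Measurable Φ := measurable_fibreAvg hf
    have hΦ1 : ∀ q, |Φ q| ≤ 1 := abs_fibreAvg_le hf1
    refine ae_eq_zero_of_forall_setIntegral_prod_eq_zero (ρ := μ.prod ρ)
      (integrable_of_abs_le hΦm hΦ1) fun E F hE hF => ?_
    set u : X → ℝ := E.indicator 1 with hu
    have hum : Measurable u := measurable_one.indicator hE
    have hu1 : ∀ x, |u x| ≤ 1 := abs_indicator_one_le E
    have hvm : Measurable (F.indicator (1 : R → ℝ)) := measurable_one.indicator hF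
    set s : R → ℝ := fun r => ∫ x, u x * Φ (x, r) ∂μ with hs
    have hsm : Measurable s := measurable_integral_kernel (κ := Kernel.const R μ)
      (f := fun p : R × X => u p.2 * Φ (p.2, p.1)) (by fun_prop)
    have hs1 : ∀ r, |s r| ≤ 1 * 1 := fun r =>
      abs_integral_le_of_abs_le fun x => abs_mul_le_mul (hu1 _) (hΦ1 _)
    have hlim := hmix.tendsto_integral_prod hT (ρ := ρ) (f := fun q => u q.1 * Φ q)
      (g := fun q => u q.1 * Φ q) (by fun_prop) (by fun_prop)
      (fun q => abs_mul_le_mul (hu1 _) (hΦ1 _)) (fun q => abs_mul_le_mul (hu1 _) (hΦ1 _))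
    -- Mixing turns correlations at time m into the square of the x-average for fixed r, while every
    -- correlation with m positive vanishes.
    have hs0 : ∫ r, s r * s r ∂ρ = 0 := by
      refine tendsto_nhds_unique hlim (tendsto_const_nhds.congr' ?_)
      filter_upwards [eventually_gt_atTop 0] with m hm
      have := key u f hum hf hu1 hf1 hf0 m (by omega)
      simp only [ipow_natCast] at this
      exact this.symm
    rw [integral_eq_zero_iff_of_nonneg (fun q => mul_self_nonneg _)
      (integrable_of_abs_le (hsm.mul hsm) fun q => abs_mul_le_mul (hs1 q) (hs1 q))] at hs0
    have h1 : ∫ p in E ×ˢ F, Φ p ∂μ.prod ρ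
        = ∫ p : X × R, F.indicator (1 : R → ℝ) p.2 * (u p.1 * Φ p) ∂μ.prod ρ := by
      rw [← integral_indicator (hE.prod hF)]
      refine integral_congr_ae (ae_of_all _ fun p => ?_)
      by_cases h1 : p.1 ∈ E <;> by_cases h2 : p.2 ∈ F <;> simp [hu, Set.indicator, h1, h2]
    have hb : ∀ p : X × R, |F.indicator (1 : R → ℝ) p.2 * (u p.1 * Φ p)| ≤ 1 * (1 * 1) :=
      fun p => abs_mul_le_mul (abs_indicator_one_le F _) (abs_mul_le_mul (hu1 _) (hΦ1 _))
    rw [h1, integral_prod_swap (by fun_prop) hb]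
    refine integral_eq_zero_of_ae ?_
    filter_upwards [hs0] with r hr
    have hr' : s r = 0 := by simpa using hr
    have hr'' : ∫ x, u x * Φ (x, r) ∂μ = 0 := hr'
    simp only [integral_const_mul, hr'', mul_zero, Pi.zero_apply]
  refine hne ?_
  rw [hfst, hsnd] at hprod
  have h2 : P.map (fun w => (w.1.1, w.1.2, w.2)) = ν := by
    rw [hPdef, Measure.map_map (by fun_prop) (by fun_prop)]
    exact Measure.map_id
  rw [← h2, hprod]
  exact (measurePreserving_prodAssoc μ ρ μ).map_eq

end Extension

end SelfJoining

namespace SelfJoining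

/-! ### Marginals of self-joinings and the trivial case. -/

section SelfJoinings

variable {X : Type u} [MeasurableSpace X] {μ : Measure X} {T : X ≃ᵐ X} {n : ℕ}
  {ν : Measure (Fin n → X)}

theorem measurable_diagMap (n : ℕ) (T : X ≃ᵐ X) : Measurable (diagMap n T) :=
  measurable_pi_lambda _ fun i => T.measurable.comp (measurable_pi_apply i)

theorem IsSelfJoining.comp (h : IsSelfJoining n μ T ν) {m : ℕ} (e : Fin m → Fin n) :
    IsSelfJoining m μ T (ν.map fun x i => x (e i)) := by
  have := h.isProbabilityMeasure
  have hm : Measurable fun (x : Fin n → X) (i : Fin m) => x (e i) := by fun_prop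
  refine ⟨Measure.isProbabilityMeasure_map hm.aemeasurable, ⟨measurable_diagMap m T, ?_⟩, fun i => ?_⟩
  · rw [Measure.map_map (measurable_diagMap m T) hm]
    conv_rhs => rw [← h.invariant.map_eq]
    rw [Measure.map_map hm (measurable_diagMap n T)]
    rfl
  · rw [Measure.map_map (by fun_prop) hm]
    exact h.marginal (e i)

theorem ergodic_comp (h : Ergodic (diagMap n T) ν) {m : ℕ} (e : Fin m → Fin n) :
    Ergodic (diagMap m T) (ν.map fun x i => x (e i)) :=
  Ergodic.map_of_semiconj h (measurable_diagMap m T) (by fun_prop) (fun _ => rfl)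

theorem ergodic_pair (h : Ergodic (diagMap n T) ν) (i j : Fin n) :
    Ergodic (Prod.map T T) (ν.map fun x => (x i, x j)) :=
  Ergodic.map_of_semiconj h (by fun_prop) (by fun_prop) (fun _ => rfl)

theorem IsSelfJoining.pair_fst (h : IsSelfJoining n μ T ν) (i j : Fin n) :
    (ν.map fun x => (x i, x j)).map Prod.fst = μ := by
  rw [Measure.map_map (by fun_prop) (by fun_prop)]
  exact h.marginal i

theorem IsSelfJoining.pair_snd (h : IsSelfJoining n μ T ν) (i j : Fin n) :
    (ν.map fun x => (x i, x j)).map Prod.snd = μ := by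
  rw [Measure.map_map (by fun_prop) (by fun_prop)]
  exact h.marginal j

/-- A measure whose values are `0` and `1` has only the product self-joining. -/
theorem IsSelfJoining.eq_pi_of_zero_one (h : IsSelfJoining n μ T ν) [IsProbabilityMeasure μ]
    (h01 : ∀ A, MeasurableSet A → μ A = 0 ∨ μ A = 1) : ν = Measure.pi fun _ => μ := by
  have := h.isProbabilityMeasure
  refine Measure.ext_univ_pi fun A hA => ?_
  rw [Measure.pi_pi]
  have hi : ∀ i, ν ((fun x => x i) ⁻¹' A i) = μ (A i) := fun i => by
    rw [← Measure.map_apply (measurable_pi_apply i) (hA i), h.marginal i]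
  by_cases hex : ∃ i, μ (A i) = 0
  · obtain ⟨i, h0⟩ := hex
    rw [Finset.prod_eq_zero (Finset.mem_univ i) h0]
    refine measure_mono_null (fun x hx => ?_) ((hi i).trans h0)
    exact hx i (Set.mem_univ i)
  · push Not at hex
    have h1 : ∀ i, μ (A i) = 1 := fun i => (h01 _ (hA i)).resolve_left (hex i)
    rw [Finset.prod_congr rfl fun i _ => h1 i, Finset.prod_const_one]
    have h2 : Set.univ.pi A = ⋂ i, (fun x => x i) ⁻¹' A i := by ext; simp
    rw [h2, ← mem_ae_iff_prob_eq_one (MeasurableSet.iInter fun i => measurable_pi_apply i (hA i)),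
      countable_iInter_mem]
    intro i
    rw [mem_ae_iff_prob_eq_one (measurable_pi_apply i (hA i)), hi i, h1 i]

theorem offDiagonal_eq_map' (μ : Measure X) (T : X ≃ᵐ X) (p : ℤ) :
    offDiagonal μ T p = μ.map fun x => (x, ipow T p x) := by
  rw [offDiagonal]; simp only [coe_ipow]

/-- Evaluating both measures on `A × T ^ p A` gives `μ A = μ A * μ A`. This disposes of the
degenerate systems in which an off-diagonal is also the product. -/
theorem zero_one_of_offDiagonal_eq_prod [IsProbabilityMeasure μ] {p : ℤ}
    (h : offDiagonal μ T p = μ.prod μ) (hT : MeasurePreserving T μ μ) {A : Set X}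
    (hA : MeasurableSet A) : μ A = 0 ∨ μ A = 1 := by
  have hm : MeasurableSet (ipow T (-p) ⁻¹' A) := (ipow T (-p)).measurable hA
  have h1 := congrArg (fun ρ : Measure (X × X) => ρ (A ×ˢ (ipow T (-p) ⁻¹' A))) h
  simp only [Measure.prod_prod] at h1
  rw [offDiagonal_eq_map', Measure.map_apply (by fun_prop) (hA.prod hm),
    (measurePreserving_ipow hT (-p)).measure_preimage hA.nullMeasurableSet] at h1
  have h2 : (fun x => (x, ipow T p x)) ⁻¹' A ×ˢ (ipow T (-p) ⁻¹' A) = A := by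
    ext x; simp
  rw [h2] at h1
  by_cases h0 : μ A = 0
  · exact Or.inl h0
  · right
    have h3 : μ A * 1 = μ A * μ A := by rw [mul_one]; exact h1
    exact ((ENNReal.mul_right_inj h0 (by finiteness)).1 h3).symm

end SelfJoinings

/-! ### Order two. -/

section OrderTwo

variable {X : Type u} [MeasurableSpace X] {μ : Measure X} [IsProbabilityMeasure μ] {T : X ≃ᵐ X}

theorem eq_pi_two_iff {ν : Measure (Fin 2 → X)} [IsProbabilityMeasure ν] :
    ν = (Measure.pi fun _ => μ) ↔ ν.map (fun x => (x 0, x 1)) = μ.prod μ := by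
  have hpre : ∀ A : Fin 2 → Set X, (fun x : Fin 2 → X => (x 0, x 1)) ⁻¹' A 0 ×ˢ A 1
      = Set.univ.pi A := fun A => by
    ext x; simp [Fin.forall_fin_two]
  constructor
  · rintro rfl
    refine (Measure.prod_eq fun A B hA hB => ?_).symm
    rw [Measure.map_apply (by fun_prop) (hA.prod hB)]
    have := hpre ![A, B]
    simp only [Matrix.cons_val_zero, Matrix.cons_val_one] at this
    rw [this, Measure.pi_pi]
    simp
  · intro h
    refine Measure.ext_univ_pi fun A hA => ?_
    rw [← hpre A, ← Measure.map_apply (by fun_prop) ((hA 0).prod (hA 1)), h, hpre A,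
      Measure.pi_pi, Measure.prod_prod]
    simp

theorem msj_two_iff : MSJ 2 μ T ↔ HasMinimalPairs μ T := by
  constructor
  · intro h ρ hρ h1 h2
    have hm : Measurable fun p : X × X => ![p.1, p.2] :=
      measurable_pi_lambda _ fun i => by fin_cases i <;> simp <;> fun_prop
    have hρp : IsProbabilityMeasure ρ := by
      have : IsProbabilityMeasure (ρ.map Prod.fst) := by rw [h1]; infer_instance
      exact Measure.isProbabilityMeasure_of_map Prod.fst
    have hback : (ρ.map fun p => ![p.1, p.2]).map (fun x => (x 0, x 1)) = ρ := by
      rw [Measure.map_map (by fun_prop) hm]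
      exact Measure.map_id
    have hp := Measure.isProbabilityMeasure_map (μ := ρ) hm.aemeasurable
    have he : Ergodic (diagMap 2 T) (ρ.map fun p => ![p.1, p.2]) :=
      Ergodic.map_of_semiconj hρ (measurable_diagMap 2 T) hm fun p => by
        ext i; fin_cases i <;> simp [diagMap]
    have hj : IsSelfJoining 2 μ T (ρ.map fun p => ![p.1, p.2]) := by
      refine ⟨hp, he.toMeasurePreserving, fun i => ?_⟩
      rw [Measure.map_map (by fun_prop) hm]
      fin_cases i
      · exact h1
      · exact h2
    by_cases hpi : (ρ.map fun p => ![p.1, p.2]) = Measure.pi fun _ => μ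
    · left
      rw [eq_pi_two_iff, hback] at hpi
      exact hpi
    · right
      obtain ⟨i, j, hij, p, hp⟩ := h _ hj he hpi
      obtain ⟨rfl, rfl⟩ : i = 0 ∧ j = 1 := by omega
      exact ⟨p, by rw [← hp, hback]⟩
  · intro h ν hν he hne
    have := hν.isProbabilityMeasure
    rcases h _ (ergodic_pair he 0 1) (hν.pair_fst 0 1) (hν.pair_snd 0 1) with h1 | ⟨p, hp⟩
    · exact absurd (eq_pi_two_iff.2 h1) hne
    · exact ⟨0, 1, by simp, p, hp⟩

omit [IsProbabilityMeasure μ] in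
/-- Self-joinings with a pair that is not independent satisfy the conclusion of `MSJ`. -/
theorem HasMinimalPairs.exists_pair (h : HasMinimalPairs μ T) {n : ℕ} {ν : Measure (Fin n → X)}
    (hν : IsSelfJoining n μ T ν) (he : Ergodic (diagMap n T) ν)
    (hne : ¬ ∀ i j : Fin n, i < j → ν.map (fun x => (x i, x j)) = μ.prod μ) :
    ∃ i j : Fin n, i < j ∧ ∃ p : ℤ, ν.map (fun x => (x i, x j)) = offDiagonal μ T p := by
  push Not at hne
  obtain ⟨i, j, hij, h1⟩ := hne
  exact ⟨i, j, hij, (h _ (ergodic_pair he i j) (hν.pair_fst i j) (hν.pair_snd i j)).resolve_left h1⟩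

end OrderTwo

/-! ### Order three. -/

section OrderThree

variable {X : Type u} [MeasurableSpace X] {μ : Measure X} [IsProbabilityMeasure μ] {T : X ≃ᵐ X}

theorem eq_pi_three_iff {ν : Measure (Fin 3 → X)} [IsProbabilityMeasure ν] :
    ν = (Measure.pi fun _ => μ) ↔
      ν.map (fun x => (x 0, x 1, x 2)) = μ.prod (μ.prod μ) := by
  have hpre : ∀ A : Fin 3 → Set X, (fun x : Fin 3 → X => (x 0, x 1, x 2)) ⁻¹' A 0 ×ˢ A 1 ×ˢ A 2
      = Set.univ.pi A := fun A => by
    ext x; simp [Fin.forall_fin_succ]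
  constructor
  · rintro rfl
    refine Measure.ext_prod₃ fun {A B C} hA hB hC => ?_
    rw [Measure.map_apply (by fun_prop) (hA.prod (hB.prod hC))]
    have := hpre ![A, B, C]
    simp only [Matrix.cons_val_zero, Matrix.cons_val_one, Matrix.cons_val] at this
    rw [this, Measure.pi_pi]
    simp [Fin.prod_univ_three, mul_assoc]
  · intro h
    refine Measure.ext_univ_pi fun A hA => ?_
    rw [← hpre A, ← Measure.map_apply (by fun_prop) ((hA 0).prod ((hA 1).prod (hA 2))), h, hpre A,
      Measure.pi_pi, Measure.prod_prod, Measure.prod_prod]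
    simp [Fin.prod_univ_three, mul_assoc]

theorem HasProductTriples.msj_three (hP : HasProductTriples μ T) (hM : HasMinimalPairs μ T) :
    MSJ 3 μ T := by
  intro ν hν he hne
  refine hM.exists_pair hν he fun hpairs => hne ?_
  have := hν.isProbabilityMeasure
  refine eq_pi_three_iff.2 (hP _ ⟨Ergodic.map_of_semiconj he (by fun_prop) (by fun_prop)
    (fun _ => rfl), ?_, ?_, ?_⟩)
  all_goals rw [Measure.map_map (by fun_prop) (by fun_prop)]
  · exact hpairs 0 1 (by decide)
  · exact hpairs 0 2 (by decide)
  · exact hpairs 1 2 (by decide)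

/-- A pair marginal that is both off-diagonal and independent makes μ take only the values 0 and 1,
and the product is then the only self-joining. -/
theorem MSJ.hasProductTriples (h : MSJ 3 μ T) : HasProductTriples μ T := by
  intro ν hν
  have hp := hν.isProbabilityMeasure
  have hm : Measurable fun p : X × X × X => ![p.1, p.2.1, p.2.2] :=
    measurable_pi_lambda _ fun i => by fin_cases i <;> simp <;> fun_prop
  have hback : (ν.map fun p => ![p.1, p.2.1, p.2.2]).map (fun x => (x 0, x 1, x 2)) = ν := by
    rw [Measure.map_map (by fun_prop) hm]
    exact Measure.map_id
  have hp' := Measure.isProbabilityMeasure_map (μ := ν) hm.aemeasurable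
  have he : Ergodic (diagMap 3 T) (ν.map fun p => ![p.1, p.2.1, p.2.2]) :=
    Ergodic.map_of_semiconj hν.ergodic (measurable_diagMap 3 T) hm fun p => by
      ext i; fin_cases i <;> simp [diagMap]
  have hj : IsSelfJoining 3 μ T (ν.map fun p => ![p.1, p.2.1, p.2.2]) := by
    refine ⟨hp', he.toMeasurePreserving, fun i => ?_⟩
    rw [Measure.map_map (by fun_prop) hm]
    fin_cases i
    · exact hν.map1
    · exact hν.map2
    · exact hν.map3
  have hpairs : ∀ i j : Fin 3, i < j →
      (ν.map fun p => ![p.1, p.2.1, p.2.2]).map (fun x => (x i, x j)) = μ.prod μ := by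
    intro i j hij
    rw [Measure.map_map (by fun_prop) hm]
    fin_cases i <;> fin_cases j <;> simp at hij
    · exact hν.map12
    · exact hν.map13
    · exact hν.map23
  suffices hpi : (ν.map fun p => ![p.1, p.2.1, p.2.2]) = Measure.pi fun _ => μ by
    rwa [eq_pi_three_iff, hback] at hpi
  by_contra hne
  obtain ⟨i, j, hij, p, hp⟩ := h _ hj he hne
  rw [hpairs i j hij] at hp
  exact hne (hj.eq_pi_of_zero_one fun A hA =>
    zero_one_of_offDiagonal_eq_prod hp.symm hν.measurePreserving hA)

end OrderThree

/-! ### Induction to all orders. -/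

section AllOrders

variable {X : Type u} [MeasurableSpace X] [StandardBorelSpace X]
  {μ : Measure X} [IsProbabilityMeasure μ] {T : X ≃ᵐ X}

/-- Induction on the order: the coordinates other than the first and last form a single system. The
two faces omitting the last or the first coordinate are products by induction, so the three grouped
variables are pairwise independent and hence jointly independent. -/
theorem eq_pi_of_pairs (hM : HasMinimalPairs μ T) (hP : HasProductTriples μ T)
    (hT : MeasurePreserving T μ μ) (hmix : IsMixing μ T) :
    ∀ (n : ℕ) (ν : Measure (Fin n → X)), IsSelfJoining n μ T ν → Ergodic (diagMap n T) ν →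
      (∀ i j : Fin n, i < j → ν.map (fun x => (x i, x j)) = μ.prod μ) →
      ν = Measure.pi fun _ => μ
  | 0, ν, hν, _, _ => by
    have := hν.isProbabilityMeasure
    refine Measure.ext_univ_pi fun A _ => ?_
    have : Set.univ.pi A = Set.univ := by ext x; simp
    rw [this]; simp
  | 1, ν, hν, _, _ => by
    have := hν.isProbabilityMeasure
    refine Measure.ext_univ_pi fun A hA => ?_
    have h1 : Set.univ.pi A = (fun x => x 0) ⁻¹' A 0 := by ext x; simp
    rw [Measure.pi_pi, h1, ← Measure.map_apply (measurable_pi_apply 0) (hA 0), hν.marginal]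
    simp
  | n + 2, ν, hν, he, hpairs => by
    have hp := hν.isProbabilityMeasure
    have : Nonempty X := μ.nonempty_of_neZero
    have ih1 := eq_pi_of_pairs hM hP hT hmix (n + 1) _ (hν.comp Fin.castSucc)
      (ergodic_comp he Fin.castSucc) (fun i j hij => by
        rw [Measure.map_map (by fun_prop) (by fun_prop)]
        exact hpairs _ _ (Fin.castSucc_lt_castSucc_iff.2 hij))
    have ih2 := eq_pi_of_pairs hM hP hT hmix (n + 1) _ (hν.comp Fin.succ)
      (ergodic_comp he Fin.succ) (fun i j hij => by
        rw [Measure.map_map (by fun_prop) (by fun_prop)]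
        exact hpairs _ _ (Fin.succ_lt_succ_iff.2 hij))
    set g : (Fin (n + 2) → X) → X × (Fin n → X) × X := fun w =>
      (w 0, fun i => w i.succ.castSucc, w (Fin.last (n + 1))) with hg
    have hgm : Measurable g := by fun_prop
    have hgp := Measure.isProbabilityMeasure_map (μ := ν) hgm.aemeasurable
    have hmap : ν.map g = μ.prod ((Measure.pi fun _ => μ).prod μ) := by
      refine eq_prod_of_pairs (β := MeasurableEquiv.piCongrRight fun _ => T) hM hP hT hmix
        (Ergodic.map_of_semiconj he (by fun_prop) hgm (fun _ => rfl)) ?_ ?_ ?_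
      · rw [Measure.map_map (by fun_prop) hgm,
          ← (measurePreserving_piFinSuccAbove (fun _ : Fin (n + 1) => μ) 0).map_eq, ← ih1,
          Measure.map_map (MeasurableEquiv.measurable _) (by fun_prop)]
        rfl
      · rw [Measure.map_map (by fun_prop) hgm, ← Measure.prod_swap,
          ← (measurePreserving_piFinSuccAbove (fun _ : Fin (n + 1) => μ) (Fin.last n)).map_eq,
          ← ih2, Measure.map_map (MeasurableEquiv.measurable _) (by fun_prop),
          Measure.map_map (by fun_prop)
            ((MeasurableEquiv.measurable _).comp (by fun_prop))]
        congr 1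
        funext w
        refine Prod.ext (funext fun i => ?_) rfl
        simp [hg, MeasurableEquiv.piFinSuccAbove, Fin.init]
      · rw [Measure.map_map (by fun_prop) hgm]
        exact hpairs 0 (Fin.last (n + 1)) (Fin.last_pos)
    refine Measure.ext_univ_pi fun A hA => ?_
    have hpre : Set.univ.pi A = g ⁻¹' (A 0 ×ˢ (Set.univ.pi fun i : Fin n => A i.succ.castSucc) ×ˢ
        A (Fin.last (n + 1))) := by
      ext w
      simp only [Set.mem_univ_pi, Set.mem_preimage, Set.mem_prod, hg]
      rw [Fin.forall_fin_succ', Fin.forall_fin_succ]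
      simp [and_assoc]
    rw [Measure.pi_pi, hpre, ← Measure.map_apply hgm ((hA _).prod
      ((MeasurableSet.univ_pi fun i => hA _).prod (hA _))), hmap, Measure.prod_prod,
      Measure.prod_prod, Measure.pi_pi, Fin.prod_univ_castSucc, Fin.prod_univ_succ, mul_assoc]
    rfl

theorem HasProductTriples.msj (hP : HasProductTriples μ T) (hM : HasMinimalPairs μ T)
    (hT : MeasurePreserving T μ μ) (hmix : IsMixing μ T) (n : ℕ) : MSJ n μ T :=
  fun ν hν he hne => hM.exists_pair hν he fun hpairs =>
    hne (eq_pi_of_pairs hM hP hT hmix n ν hν he hpairs)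

end AllOrders

end SelfJoining

namespace SelfJoining

/-! ### Mixing of all orders, and the case without mixing. -/

section AllOrders

variable {X : Type u} [MeasurableSpace X] [StandardBorelSpace X]
  {μ : Measure X} [IsProbabilityMeasure μ] {T : X ≃ᵐ X}

/-- Let φ be the indicator of an invariant set. Its integral against `a ⊗ b` does not change when a
and b are moved by `T ^ n`. Approximating φ by sums of products and mixing in each coordinate
factors out the integrals of a and b, so φ is constant. -/
theorem ergodic_prod_of_isMixing (hT : MeasurePreserving T μ μ) (hmix : IsMixing μ T) :
    Ergodic (Prod.map T T) (μ.prod μ) := by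
  refine ⟨hT.prod hT, ⟨fun {s} hs hinv => ?_⟩⟩
  set φ : X × X → ℝ := s.indicator 1 with hφ
  have hφm : Measurable φ := measurable_one.indicator hs
  have hφ1 : ∀ p, |φ p| ≤ 1 := abs_indicator_one_le s
  have hinvn : ∀ (n : ℕ) (x y : X), φ (T^[n] x, T^[n] y) = φ (x, y) := by
    intro n
    induction n with
    | zero => intro x y; rfl
    | succ n ih =>
      intro x y
      rw [Function.iterate_succ_apply, Function.iterate_succ_apply, ih]
      have : (T x, T y) ∈ s ↔ (x, y) ∈ s := by
        conv_rhs => rw [← hinv]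
        rfl
      by_cases hxy : (x, y) ∈ s
      · simp [hφ, hxy, this.2 hxy]
      · simp [hφ, hxy, mt this.1 hxy]
  have key : ∀ a b : X → ℝ, Measurable a → Measurable b → (∀ x, |a x| ≤ 1) → (∀ x, |b x| ≤ 1) →
      ∫ p, a p.1 * b p.2 * φ p ∂μ.prod μ
        = (∫ p, φ p ∂μ.prod μ) * ((∫ x, a x ∂μ) * ∫ x, b x ∂μ) := by
    intro a b ha hb ha1 hb1
    have hconst : ∀ n : ℕ, ∫ p, a (T^[n] p.1) * b (T^[n] p.2) * φ p ∂μ.prod μ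
        = ∫ p, a p.1 * b p.2 * φ p ∂μ.prod μ := by
      intro n
      have h1 := ((measurePreserving_ipow hT n).prod (measurePreserving_ipow hT n)).integral_comp'
        (f := (ipow T n).prodCongr (ipow T n)) (fun p => a p.1 * b p.2 * φ p)
      rw [← h1]
      refine integral_congr_ae (ae_of_all _ fun p => ?_)
      change _ = a (ipow T n p.1) * b (ipow T n p.2) * φ (ipow T n p.1, ipow T n p.2)
      simp only [ipow_natCast, hinvn, Prod.mk.eta]
    have hTn : ∀ n : ℕ, Measurable (T^[n]) := fun n => T.measurable.iterate n
    have hlim : Tendsto (fun n : ℕ => ∫ p, a (T^[n] p.1) * b (T^[n] p.2) * φ p ∂μ.prod μ) atTop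
        (𝓝 (∫ p : X × X, ((∫ x, a x ∂μ) * ∫ x, b x ∂μ) * φ p ∂μ.prod μ)) := by
      refine tendsto_of_forall_approx fun ε hε => ?_
      obtain ⟨N, u, v, hu, hv, hu1, hv1, hsum, hl⟩ := exists_sum_mul_approx μ μ hφm hφ1
        (ε := ENNReal.ofReal ε) (by simpa using hε)
      set φ' : X × X → ℝ := fun p => ∑ j ∈ Finset.range N, u j p.1 * v j p.2 with hφ'
      have hφ'm : Measurable φ' := by fun_prop
      have hab : |(∫ x, a x ∂μ) * ∫ x, b x ∂μ| ≤ 1 * 1 :=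
        abs_mul_le_mul (abs_integral_le_of_abs_le ha1) (abs_integral_le_of_abs_le hb1)
      refine ⟨fun n => ∫ p, a (T^[n] p.1) * b (T^[n] p.2) * φ' p ∂μ.prod μ,
        ∫ p, ((∫ x, a x ∂μ) * ∫ x, b x ∂μ) * φ' p ∂μ.prod μ, ?_, ?_, ?_⟩
      · have e : ∀ (c d : X → ℝ), Measurable c → Measurable d → (∀ x, |c x| ≤ 1) →
            (∀ x, |d x| ≤ 1) → ∫ p, c p.1 * d p.2 * φ' p ∂μ.prod μ
            = ∑ j ∈ Finset.range N, (∫ x, c x * u j x ∂μ) * ∫ y, d y * v j y ∂μ := by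
          intro c d hc hd hc1 hd1
          simp only [hφ', Finset.mul_sum]
          rw [integral_finsetSum _ fun j _ => integrable_of_abs_le (C := 1 * 1 * (1 * 1))
            (by fun_prop) fun p => abs_mul_le_mul (abs_mul_le_mul (hc1 _) (hd1 _))
              (abs_mul_le_mul (hu1 j _) (hv1 j _))]
          refine Finset.sum_congr rfl fun j _ => ?_
          rw [← integral_prod_mul (fun x => c x * u j x) (fun y => d y * v j y)]
          refine integral_congr_ae (ae_of_all _ fun p => ?_)
          simp only
          ring
        have e1 : ∀ n : ℕ, ∫ p, a (T^[n] p.1) * b (T^[n] p.2) * φ' p ∂μ.prod μ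
            = ∑ j ∈ Finset.range N, (∫ x, a (T^[n] x) * u j x ∂μ) * ∫ y, b (T^[n] y) * v j y ∂μ :=
          fun n => e (fun x => a (T^[n] x)) (fun x => b (T^[n] x)) (ha.comp (hTn n))
            (hb.comp (hTn n)) (fun x => ha1 _) (fun x => hb1 _)
        have e2 : ∫ p, ((∫ x, a x ∂μ) * ∫ x, b x ∂μ) * φ' p ∂μ.prod μ
            = ∑ j ∈ Finset.range N, ((∫ x, a x ∂μ) * ∫ x, u j x ∂μ) *
              ((∫ x, b x ∂μ) * ∫ y, v j y ∂μ) := by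
          rw [e (fun _ => ∫ x, a x ∂μ) (fun _ => ∫ x, b x ∂μ) measurable_const measurable_const
            (fun _ => abs_integral_le_of_abs_le ha1) (fun _ => abs_integral_le_of_abs_le hb1)]
          simp only [integral_const_mul]
        rw [e2]
        simp only [e1]
        exact tendsto_finsetSum _ fun j _ =>
          (hmix.tendsto_integral hT ha (hu j) ha1 (hu1 j)).mul
            (hmix.tendsto_integral hT hb (hv j) hb1 (hv1 j))
      · refine Eventually.of_forall fun n => ?_
        have hTn' := hTn n
        have := abs_integral_mul_sub_le (P := μ.prod μ) (π := id) measurable_id Measure.map_id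
          (U := fun p => a (T^[n] p.1) * b (T^[n] p.2)) (by fun_prop) hφm hφ'm
          (fun p => abs_mul_le_mul (ha1 _) (hb1 _)) hφ1 hsum hε.le hl
        simpa using this
      · have := abs_integral_mul_sub_le (P := μ.prod μ) (π := id) measurable_id Measure.map_id
          (U := fun _ => (∫ x, a x ∂μ) * ∫ x, b x ∂μ) (by fun_prop) hφm hφ'm
          (fun p => hab) hφ1 hsum hε.le hl
        simpa using this
    simp only [hconst] at hlim
    rw [tendsto_nhds_unique tendsto_const_nhds hlim, integral_const_mul, mul_comm]
  have hae := ae_eq_zero_of_forall_setIntegral_prod_eq_zero (ρ := μ.prod μ)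
    (g := fun p => φ p - ∫ p, φ p ∂μ.prod μ)
    (integrable_of_abs_le (C := 1 + 1) (by fun_prop) fun p => (abs_sub _ _).trans
      (add_le_add (hφ1 p) (abs_integral_le_of_abs_le hφ1))) fun E F hE hF => by
    have h1 : ∫ p in E ×ˢ F, φ p ∂μ.prod μ
        = ∫ p : X × X, E.indicator (1 : X → ℝ) p.1 * F.indicator (1 : X → ℝ) p.2 * φ p
          ∂μ.prod μ := by
      rw [← integral_indicator (hE.prod hF)]
      refine integral_congr_ae (ae_of_all _ fun p => ?_)
      by_cases h1 : p.1 ∈ E <;> by_cases h2 : p.2 ∈ F <;> simp [Set.indicator, h1, h2]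
    rw [integral_sub (f := φ) (integrable_of_abs_le hφm hφ1).integrableOn (integrable_const _), h1,
      key _ _ (measurable_one.indicator hE) (measurable_one.indicator hF)
        (abs_indicator_one_le E) (abs_indicator_one_le F), integral_indicator_one hE,
      integral_indicator_one hF]
    simp [mul_comm]
  rw [eventuallyConst_set]
  by_cases hc : ∫ p, φ p ∂μ.prod μ = 1
  · left
    filter_upwards [hae] with p hp
    by_contra hps
    simp [hφ, hps] at hp
    simp [hφ] at hc
    linarith
  · right
    filter_upwards [hae] with p hp hps
    refine hc ?_
    simp only [hφ, Set.indicator_of_mem hps, Pi.one_apply, Pi.zero_apply] at hp ⊢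
    linarith

omit [StandardBorelSpace X] in
/-- In a mixing system, the limits of the orbit laws are pairwise independent. -/
theorem map_pair_eq_prod_of_limit {k : ℕ} (hT : MeasurePreserving T μ μ) (hmix : IsMixing μ T)
    {s : Fin k → ℕ → ℕ} (hs : ∀ j, Tendsto (s j) atTop atTop) {F : Ultrafilter ℕ}
    (hF : (F : Filter ℕ) ≤ atTop) {η : Measure (Fin (k + 1) → X)} (hη : IsSelfJoining (k + 1) μ T η)
    (hlim : ∀ A : Fin (k + 1) → Set X, (∀ i, MeasurableSet (A i)) →
        Tendsto (fun t => orbitLaw μ T (fun j => s j t) (Set.univ.pi A)) F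
          (𝓝 (η (Set.univ.pi A)))) {i j : Fin (k + 1)} (hij : i < j) :
    η.map (fun x => (x i, x j)) = μ.prod μ := by
  have := hη.isProbabilityMeasure
  refine (Measure.prod_eq fun A B hA hB => ?_).symm
  set N : Fin (k + 1) → ℕ → ℕ := fun i t => ∑ l : Fin k with l.castSucc < i, s l t with hN
  -- The increment with index i is counted in the j-th partial sum but not in the i-th, so the gap
  -- between the two times tends to infinity.
  set l : Fin k := ⟨i, by omega⟩ with hl
  have hle : ∀ t, N i t + s l t ≤ N j t := by
    intro t
    have hsub : insert l (Finset.univ.filter fun l : Fin k => l.castSucc < i)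
        ⊆ Finset.univ.filter fun l : Fin k => l.castSucc < j := by
      intro a ha
      simp only [Finset.mem_insert, Finset.mem_filter, Finset.mem_univ, true_and] at ha ⊢
      rcases ha with rfl | ha
      · exact hij
      · exact ha.trans hij
    have := Finset.sum_le_sum_of_subset (f := fun l => s l t) hsub
    rw [Finset.sum_insert (by simp [hl, Fin.lt_def])] at this
    simp only [hN]
    omega
  have hd : Tendsto (fun t => N j t - N i t) atTop atTop :=
    tendsto_atTop_mono (fun t => by have := hle t; omega) (hs l)
  have hlaw : ∀ t, orbitLaw μ T (fun j => s j t)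
      (Set.univ.pi fun a => if a = i then A else if a = j then B else Set.univ)
      = μ (T^[N j t - N i t] ⁻¹' A ∩ B) := by
    intro t
    have hset : (Set.univ.pi fun a => if a = i then A else if a = j then B else Set.univ)
        = (fun x : Fin (k + 1) → X => (x i, x j)) ⁻¹' A ×ˢ B := by
      ext x
      simp only [Set.mem_univ_pi, Set.mem_preimage, Set.mem_prod]
      constructor
      · intro h
        exact ⟨by simpa using h i, by simpa [hij.ne'] using h j⟩
      · rintro ⟨h1, h2⟩ a
        by_cases ha : a = i
        · subst ha; simpa using h1
        · by_cases hb : a = j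
          · subst hb; simpa [ha] using h2
          · simp [ha, hb]
    have hm1 : Measurable (T^[N j t - N i t]) := T.measurable.iterate _
    rw [hset, orbitLaw, Measure.map_apply (measurable_orbit T _)
      ((by fun_prop : Measurable fun x : Fin (k + 1) → X => (x i, x j)) (hA.prod hB)),
      ← (measurePreserving_ipow hT (N j t)).measure_preimage
        ((measurable_orbit T _ ((by fun_prop : Measurable fun x : Fin (k + 1) → X =>
          (x i, x j)) (hA.prod hB))).nullMeasurableSet)]
    congr 1
    ext x
    have e1 : (ipow T (-(N i t : ℤ))) (ipow T (N j t) x) = T^[N j t - N i t] x := by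
      rw [← ipow_natCast, ← ipow_add]
      congr 2
      have := hle t
      omega
    have e2 : (ipow T (-(N j t : ℤ))) (ipow T (N j t) x) = x := ipow_neg_ipow _ _ _
    simp only [Set.mem_preimage, Set.mem_prod, Set.mem_inter_iff]
    rw [e1, e2]
  have h1 := hlim (fun a => if a = i then A else if a = j then B else Set.univ) (fun a => by
    split_ifs <;> simp [hA, hB])
  simp only [hlaw] at h1
  have h2 := tendsto_nhds_unique h1 ((hmix.tendsto_measure hT hA hB hd).mono_left hF)
  rw [← h2, Measure.map_apply (by fun_prop) (hA.prod hB)]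
  congr 1
  ext x
  simp only [Set.mem_univ_pi, Set.mem_preimage, Set.mem_prod]
  constructor
  · rintro ⟨h1, h2⟩ a
    by_cases ha : a = i
    · subst ha; simpa using h1
    · by_cases hb : a = j
      · subst hb; simpa [ha] using h2
      · simp [ha, hb]
  · intro h
    exact ⟨by simpa using h i, by simpa [hij.ne'] using h j⟩

/-- A limit of orbit laws need not be ergodic, but its pairs have the ergodic law `μ.prod μ`, which
passes to almost every component. Minimality makes those components products, hence also the limit.
-/
theorem isMixingOfAllOrders_of_msj (hT : MeasurePreserving T μ μ) (hmix : IsMixing μ T)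
    (h : ∀ n, MSJ n μ T) : IsMixingOfAllOrders μ T := by
  intro k
  refine isMixingOfMultiplicity_of_forall_limit hT fun s hs F hF η hη hlim => ?_
  have hp := hη.isProbabilityMeasure
  have hTT := ergodic_prod_of_isMixing hT hmix
  have hTe : Ergodic T μ := by
    have := Ergodic.map_of_semiconj hTT (f := Prod.fst) T.measurable (by fun_prop) (fun _ => rfl)
    rwa [measurePreserving_fst.map_eq] at this
  obtain ⟨κ, hE⟩ := exists_ergodic_decomposition hη.invariant
  have hMk := hE.isMarkovKernel
  have hpairs : ∀ i j : Fin (k + 1), i < j → ∀ᵐ ω ∂η,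
      (κ ω).map (fun x => (x i, x j)) = μ.prod μ := by
    intro i j hij
    have hη2 := map_pair_eq_prod_of_limit hT hmix hs hF hη hlim hij
    have := hE.ae_map_eq (π := fun x => (x i, x j)) (by fun_prop) (R := Prod.map T T) rfl
      (by rw [hη2]; exact hTT)
    rwa [hη2] at this
  have hmarg : ∀ i : Fin (k + 1), ∀ᵐ ω ∂η, (κ ω).map (fun x => x i) = μ := by
    intro i
    have := hE.ae_map_eq (π := fun x => x i) (by fun_prop) (R := T) rfl
      (by rw [hη.marginal]; exact hTe)
    rwa [hη.marginal] at this
  have hpi := hE.map_eq measurable_id (θ := Measure.pi fun _ => μ) (by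
    filter_upwards [hE.ergodic, ae_all_iff.2 hmarg, ae_all_iff.2 fun i => ae_all_iff.2 fun j =>
      eventually_imp_distrib_left.2 (hpairs i j)] with ω h0 h1 h2
    rw [Measure.map_id]
    have hj : IsSelfJoining (k + 1) μ T (κ ω) := ⟨inferInstance, h0.toMeasurePreserving, h1⟩
    by_contra hne
    obtain ⟨i, j, hij, p, hp⟩ := h _ _ hj h0 hne
    rw [h2 i j hij] at hp
    exact hne (hj.eq_pi_of_zero_one fun A hA => zero_one_of_offDiagonal_eq_prod hp.symm hT hA))
  rwa [Measure.map_id] at hpi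

/-- A system with minimal pairs that is not mixing has only trivial triple joinings. -/
theorem HasMinimalPairs.hasProductTriples_of_not_isMixing (hM : HasMinimalPairs μ T)
    (hT : MeasurePreserving T μ μ) (hmix : ¬ IsMixing μ T) : HasProductTriples μ T := by
  intro ν hν
  by_contra hne
  have := hν.isProbabilityMeasure
  have : Nonempty X := μ.nonempty_of_neZero
  refine hmix (isMixingOfMultiplicity_of_forall_limit hT fun s hs F hF η hη hlim => ?_)
  have hp := hη.isProbabilityMeasure
  refine eq_pi_two_iff.2 ?_
  by_contra hη2
  have hp2 : IsProbabilityMeasure (η.map fun x => (x 0, x 1)) :=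
    Measure.isProbabilityMeasure_map (by fun_prop)
  have hsum1 : ∀ t, (∑ j : Fin 1 with j.castSucc < (1 : Fin 2), s j t) = s 0 t := fun t => by
    rw [Finset.filter_true_of_mem (by simp)]; simp
  have hsum0 : ∀ t, (∑ j : Fin 1 with j.castSucc < (0 : Fin 2), s j t) = 0 := fun t => by
    simp
  -- The exponents are negative because the orbit law applies inverse powers of T; they still leave
  -- every fixed p.
  refine hne (hν.eq_prod_of_limit hM (n := fun t => -(s 0 t : ℤ)) (F := F) (fun p => ?_) ⟨by fun_prop, ?_⟩
    (hη.pair_fst 0 1) (hη.pair_snd 0 1) (fun A B hA hB => ?_) hη2)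
  · filter_upwards [hF ((hs 0).eventually_gt_atTop (-p).toNat)] with t ht
    omega
  · conv_rhs => rw [← hη.invariant.map_eq]
    rw [Measure.map_map (by fun_prop) (by fun_prop),
      Measure.map_map (by fun_prop) (measurable_diagMap _ T)]
    rfl
  · have hpre : (fun x : Fin 2 → X => (x 0, x 1)) ⁻¹' A ×ˢ B = Set.univ.pi ![A, B] := by
      ext x; simp [Fin.forall_fin_two]
    have h1 := hlim ![A, B] (fun i => by fin_cases i <;> simp [hA, hB])
    rw [← hpre] at h1
    have h2 := (ENNReal.tendsto_toReal (by finiteness)).comp h1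
    rw [Measure.real, Measure.map_apply (by fun_prop) (hA.prod hB)]
    refine h2.congr fun t => ?_
    rw [Measure.real, Measure.map_apply (by fun_prop) (hA.prod hB), Function.comp_apply, orbitLaw,
      Measure.map_apply (measurable_orbit T _)
        ((by fun_prop : Measurable fun x : Fin 2 → X => (x 0, x 1)) (hA.prod hB))]
    congr 2

end AllOrders

end SelfJoining

namespace SelfJoining

/-! ### Mixing of multiplicity two gives multiple recurrence. -/

section DoubleMixing

variable {X : Type u} [MeasurableSpace X] {μ : Measure X} [IsProbabilityMeasure μ] {T : X ≃ᵐ X}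

omit [IsProbabilityMeasure μ] in
theorem IsMixingOfMultiplicity.tendsto_triple (h : IsMixingOfMultiplicity 2 μ T) {A B C : Set X}
    (hA : MeasurableSet A) (hB : MeasurableSet B) (hC : MeasurableSet C) {a b : ℕ → ℕ}
    (ha : Tendsto a atTop atTop) (hb : Tendsto b atTop atTop) :
    Tendsto (fun t => μ (A ∩ T^[a t] '' B ∩ T^[a t + b t] '' C)) atTop (𝓝 (μ A * μ B * μ C)) := by
  have h1 := h ![A, B, C] (fun i => by fin_cases i <;> assumption) ![a, b]
    (fun j => by fin_cases j <;> assumption)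
  have hprod : ∏ i, μ ((![A, B, C] : Fin 3 → Set X) i) = μ A * μ B * μ C := by
    simp [Fin.prod_univ_three]
  rw [hprod] at h1
  refine h1.congr fun t => ?_
  have e0 : (∑ j : Fin 2 with j.castSucc < (0 : Fin 3), (![a, b] : Fin 2 → ℕ → ℕ) j t) = 0 := by
    simp
  have e1 : (∑ j : Fin 2 with j.castSucc < (1 : Fin 3), (![a, b] : Fin 2 → ℕ → ℕ) j t) = a t := by
    simp [Finset.sum_filter, Fin.lt_def]
  have e2 : (∑ j : Fin 2 with j.castSucc < (2 : Fin 3), (![a, b] : Fin 2 → ℕ → ℕ) j t)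
      = a t + b t := by
    simp [Finset.sum_filter, Fin.sum_univ_two, Fin.lt_def]
  congr 1
  ext x
  simp only [Set.mem_iInter, Fin.forall_fin_succ, Set.mem_inter_iff]
  change (x ∈ T^[∑ j : Fin 2 with j.castSucc < (0 : Fin 3), (![a, b] : Fin 2 → ℕ → ℕ) j t] '' A ∧
    x ∈ T^[∑ j : Fin 2 with j.castSucc < (1 : Fin 3), (![a, b] : Fin 2 → ℕ → ℕ) j t] '' B ∧
    x ∈ T^[∑ j : Fin 2 with j.castSucc < (2 : Fin 3), (![a, b] : Fin 2 → ℕ → ℕ) j t] '' C ∧ _) ↔ _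
  rw [e0, e1, e2]
  simp [and_assoc]

theorem IsMixingOfMultiplicity.isMixing (h : IsMixingOfMultiplicity 2 μ T) : IsMixing μ T := by
  intro A hA s hs
  have h1 := h.tendsto_triple (hA 0) (hA 1) MeasurableSet.univ (hs 0) tendsto_id
  have hprod : ∏ i, μ (A i) = μ (A 0) * μ (A 1) * μ Set.univ := by
    simp [Fin.prod_univ_two]
  rw [hprod]
  refine h1.congr fun t => ?_
  have e0 : (∑ j : Fin 1 with j.castSucc < (0 : Fin 2), s j t) = 0 := by simp
  have e1 : (∑ j : Fin 1 with j.castSucc < (1 : Fin 2), s j t) = s 0 t := by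
    rw [Finset.filter_true_of_mem (by simp)]; simp
  have hsurj : ∀ m : ℕ, T^[m] '' Set.univ = Set.univ := fun m =>
    Set.image_univ_of_surjective (T.surjective.iterate m)
  congr 1
  ext x
  simp only [Set.mem_iInter, hsurj, Set.inter_univ, Set.mem_inter_iff]
  change _ ↔ ∀ i : Fin 2, x ∈ T^[∑ j : Fin 1 with j.castSucc < i, s j t] '' A i
  rw [Fin.forall_fin_two, e0, e1]
  simp

omit [IsProbabilityMeasure μ] in
-- Double mixing needs increments tending to infinity, so the two times are sorted: the increments
-- are `|k(m) - m|` and `min`, with sum `max`. Pulling back by the larger time turns images of A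
-- into the required preimages.
theorem IsMixingOfMultiplicity.isMultiplyRecurrent (h : IsMixingOfMultiplicity 2 μ T)
    (hT : MeasurePreserving T μ μ) : IsMultiplyRecurrent μ T := by
  intro A hA hpos k hk hkm
  have ha : Tendsto (fun m : ℕ => ((k m : ℤ) - m).natAbs) atTop atTop := by
    refine tendsto_atTop.2 fun N => ?_
    filter_upwards [hkm.eventually_ge_atTop (N : ℤ)] with m hm
    rw [Int.abs_eq_natAbs] at hm
    exact_mod_cast hm
  have hb : Tendsto (fun m : ℕ => min (k m) m) atTop atTop := by
    refine tendsto_atTop.2 fun N => ?_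
    filter_upwards [hk.eventually_ge_atTop N, eventually_ge_atTop N] with m h1 h2
    exact le_min h1 h2
  have hlim := h.tendsto_triple hA hA hA ha hb
  have hpos' : 0 < μ A * μ A * μ A := by
    have := hpos.ne'
    exact pos_iff_ne_zero.2 (by simp [this])
  filter_upwards [(tendsto_order.1 hlim).1 0 hpos'] with m hm
  have hmax : ((k m : ℤ) - m).natAbs + min (k m) m = max (k m) m := by omega
  rw [hmax] at hm
  have hinj : ∀ n : ℕ, Function.Injective (T^[n]) := fun n => T.injective.iterate n
  have himg : ∀ n : ℕ, MeasurableSet (T^[n] '' A) := fun n => by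
    have : T^[n] '' A = ipow T (-n) ⁻¹' A := by
      ext x
      constructor
      · rintro ⟨y, hy, rfl⟩
        rw [← ipow_natCast]
        simpa using hy
      · intro hx
        exact ⟨_, hx, by rw [← ipow_natCast]; simp⟩
    rw [this]
    exact (ipow T (-n)).measurable hA
  have hpre := (hT.iterate (max (k m) m)).measure_preimage
    (((hA.inter (himg ((k m : ℤ) - m).natAbs)).inter (himg (max (k m) m))).nullMeasurableSet)
  rw [← hpre] at hm
  refine hm.trans_le (measure_mono ?_)
  rintro x ⟨⟨h1, y, hy, hyx⟩, z, hz, hzx⟩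
  have hzx' : z = x := hinj _ hzx
  have hyx' : y = T^[min (k m) m] x := by
    refine hinj (((k m : ℤ) - m).natAbs) ?_
    rw [hyx, ← hmax, Function.iterate_add_apply]
  subst hzx'
  subst hyx'
  rcases le_total (k m) m with hle | hle
  · rw [min_eq_left hle] at hy
    have h1' : T^[m] z ∈ A := by rwa [max_eq_right hle] at h1
    exact ⟨⟨hy, h1'⟩, hz⟩
  · rw [min_eq_right hle] at hy
    have h1' : T^[k m] z ∈ A := by rwa [max_eq_left hle] at h1
    exact ⟨⟨h1', hy⟩, hz⟩

end DoubleMixing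

/-! ### Order three implies order two. -/

section LowerOrder

variable {X : Type u} [MeasurableSpace X] [StandardBorelSpace X]
  {μ : Measure X} [IsProbabilityMeasure μ] {T : X ≃ᵐ X}

theorem measurableSet_orbit_rel {Y : Type*} [MeasurableSpace Y] {f g : Y → X} (hf : Measurable f)
    (hg : Measurable g) : MeasurableSet {y | ∃ p : ℤ, g y = ipow T p (f y)} := by
  have : {y | ∃ p : ℤ, g y = ipow T p (f y)}
      = ⋃ p : ℤ, (fun y => (f y, g y)) ⁻¹' {q : X × X | q.2 = ipow T p q.1} := by
    ext y; simp
  rw [this]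
  exact MeasurableSet.iUnion fun p => (hf.prodMk hg) (measurableSet_graph_ipow T p)

omit [IsProbabilityMeasure μ] in
/-- An ergodic joining supported by the orbit equivalence relation is an off-diagonal. -/
theorem exists_eq_offDiagonal {ρ : Measure (X × X)} (he : Ergodic (Prod.map T T) ρ)
    (hρ : ρ ≠ 0) (h1 : ρ.map Prod.fst = μ) (h : ∀ᵐ q ∂ρ, ∃ p : ℤ, q.2 = ipow T p q.1) :
    ∃ p : ℤ, ρ = offDiagonal μ T p := by
  obtain ⟨p, hp⟩ : ∃ p : ℤ, ρ {q : X × X | q.2 = ipow T p q.1} ≠ 0 := by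
    by_contra! hcon
    have h2 : ∀ᵐ q ∂ρ, ∀ p : ℤ, ¬ q.2 = ipow T p q.1 :=
      ae_all_iff.2 fun p => measure_eq_zero_iff_ae_notMem.1 (hcon p)
    have h3 : ∀ᵐ q ∂ρ, False := by
      filter_upwards [h, h2] with q ⟨p, hq⟩ hq2
      exact hq2 p hq
    refine hρ ?_
    simpa using h3
  refine ⟨p, ?_⟩
  have hinv : Prod.map T T ⁻¹' {q : X × X | q.2 = ipow T p q.1} = {q | q.2 = ipow T p q.1} := by
    ext q
    change T q.2 = ipow T p (T q.1) ↔ q.2 = ipow T p q.1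
    rw [ipow_apply_comm, T.injective.eq_iff]
  have hae : ∀ᵐ q ∂ρ, q.2 = ipow T p q.1 := by
    rcases he.toPreErgodic.ae_empty_or_univ (measurableSet_graph_ipow T p) hinv with h2 | h2
    · exact absurd (ae_eq_empty.1 h2) hp
    · exact eventuallyEq_univ.1 h2
  rw [offDiagonal_eq_map', ← h1, Measure.map_map (by fun_prop) measurable_fst]
  conv_lhs => rw [← Measure.map_id (μ := ρ)]
  refine Measure.map_congr ?_
  filter_upwards [hae] with q hq
  exact Prod.ext rfl hq

/-- Minimal self-joinings of order three imply those of order two. -/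
theorem MSJ.hasMinimalPairs (h : MSJ 3 μ T) : HasMinimalPairs μ T := by
  intro ρ hρ h1 h2
  by_contra! hcon
  obtain ⟨hne, hoff⟩ := hcon
  have hρp : IsProbabilityMeasure ρ := by
    have : IsProbabilityMeasure (ρ.map Prod.fst) := by rw [h1]; infer_instance
    exact Measure.isProbabilityMeasure_of_map Prod.fst
  have hTe : Ergodic T μ := by
    have := Ergodic.map_of_semiconj hρ (f := Prod.fst) T.measurable (by fun_prop) (fun _ => rfl)
    rwa [h1] at this
  have hT := hTe.toMeasurePreserving
  -- An independent third coordinate is adjoined to ρ. Components of this joining are not products,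
  -- since their first pair is ρ, and that pair is not off-diagonal; so the third coordinate must
  -- lie in the orbit of the first or the second.
  obtain ⟨κ, hE⟩ := exists_ergodic_decomposition (hρ.toMeasurePreserving.prod hT)
  have hMk := hE.isMarkovKernel
  have m12 : (ρ.prod μ).map Prod.fst = ρ := measurePreserving_fst.map_eq
  have m3 : (ρ.prod μ).map Prod.snd = μ := measurePreserving_snd.map_eq
  have e12 := hE.ae_map_eq (π := Prod.fst) measurable_fst (R := Prod.map T T) rfl
    (by rw [m12]; exact hρ)
  have e3 := hE.ae_map_eq (π := Prod.snd) measurable_snd (R := T) rfl (by rw [m3]; exact hTe)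
  rw [m12] at e12
  rw [m3] at e3
  set E : Set ((X × X) × X) := {w | ∃ p : ℤ, w.2 = ipow T p w.1.1} ∪
    {w | ∃ p : ℤ, w.2 = ipow T p w.1.2} with hEdef
  have hEm : MeasurableSet E := (measurableSet_orbit_rel (by fun_prop) (by fun_prop)).union
    (measurableSet_orbit_rel (by fun_prop) (by fun_prop))
  have hEκ : ∀ᵐ ω ∂ρ.prod μ, κ ω E = 1 := by
    filter_upwards [hE.ergodic, e12, e3] with ω h0 h12 h3
    set g : (X × X) × X → Fin 3 → X := fun w => ![w.1.1, w.1.2, w.2] with hg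
    have hgm : Measurable g :=
      measurable_pi_lambda _ fun i => by fin_cases i <;> simp [hg] <;> fun_prop
    have hp := Measure.isProbabilityMeasure_map (μ := κ ω) hgm.aemeasurable
    have he : Ergodic (diagMap 3 T) ((κ ω).map g) :=
      Ergodic.map_of_semiconj h0 (measurable_diagMap 3 T) hgm fun p => by
        ext i; fin_cases i <;> simp [diagMap, hg]
    have n1 : (κ ω).map (fun w => w.1.1) = μ := by
      rw [← h1, ← h12, Measure.map_map (by fun_prop) (by fun_prop)]
      rfl
    have n2 : (κ ω).map (fun w => w.1.2) = μ := by
      rw [← h2, ← h12, Measure.map_map (by fun_prop) (by fun_prop)]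
      rfl
    have hj : IsSelfJoining 3 μ T ((κ ω).map g) := by
      refine ⟨hp, he.toMeasurePreserving, fun i => ?_⟩
      rw [Measure.map_map (by fun_prop) hgm]
      fin_cases i
      · exact n1
      · exact n2
      · exact h3
    have hpi : (κ ω).map g ≠ Measure.pi fun _ => μ := by
      intro hpi
      rw [eq_pi_three_iff, Measure.map_map (by fun_prop) hgm] at hpi
      refine hne ?_
      have h4 : (μ.prod (μ.prod μ)).map (fun p => (p.1, p.2.1)) = μ.prod μ :=
        ((MeasurePreserving.id μ).prod (measurePreserving_fst (μ := μ) (ν := μ))).map_eq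
      rw [← h4, ← hpi, ← h12, Measure.map_map (by fun_prop) (by fun_prop)]
      rfl
    obtain ⟨i, j, hij, p, hp⟩ := h _ hj he hpi
    rw [Measure.map_map (by fun_prop) hgm, offDiagonal_eq_map'] at hp
    have hgraph : ∀ᵐ w ∂κ ω, g w j = ipow T p (g w i) := by
      have h5 : ∀ᵐ q ∂(μ.map fun x => (x, ipow T p x)), q.2 = ipow T p q.1 := by
        rw [ae_map_iff (by fun_prop) (measurableSet_graph_ipow T p)]
        simp
      rw [← hp, ae_map_iff (by fun_prop) (measurableSet_graph_ipow T p)] at h5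
      exact h5
    rw [← mem_ae_iff_prob_eq_one hEm]
    fin_cases i <;> fin_cases j <;> simp at hij
    · refine absurd ?_ (hoff p)
      rw [offDiagonal_eq_map', ← hp, ← h12]
      rfl
    · filter_upwards [hgraph] with w hw
      exact Or.inl ⟨p, hw⟩
    · filter_upwards [hgraph] with w hw
      exact Or.inr ⟨p, hw⟩
  have hE1 : (ρ.prod μ) E = 1 := hE.measure_eq hEm hEκ
  rw [← mem_ae_iff_prob_eq_one hEm] at hE1
  -- By Fubini one pair `(a, b)` works for almost every third coordinate, so μ is carried by two
  -- orbits. By ergodicity one of them has full measure, which puts both coordinates of ρ on the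
  -- same orbit.
  obtain ⟨⟨a, b⟩, hab⟩ := (Measure.ae_ae_of_ae_prod hE1).exists
  have horb : ∀ c : X, ∃ O : Set X, MeasurableSet O ∧ O = {w | ∃ p : ℤ, w = ipow T p c} ∧
      (μ O = 0 ∨ ∀ᵐ w ∂μ, w ∈ O) := by
    intro c
    have hOm : MeasurableSet {w | ∃ p : ℤ, w = ipow T p c} :=
      measurableSet_orbit_rel measurable_const measurable_id
    have hinv : T ⁻¹' {w | ∃ p : ℤ, w = ipow T p c} = {w | ∃ p : ℤ, w = ipow T p c} := by
      ext w
      constructor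
      · rintro ⟨p, hp⟩
        refine ⟨-1 + p, ?_⟩
        rw [ipow_add, ← hp]
        conv_lhs => rw [← ipow_neg_ipow T 1 w, ipow_one]
      · rintro ⟨p, rfl⟩
        exact ⟨1 + p, by rw [ipow_add, ipow_one]⟩
    refine ⟨_, hOm, rfl, ?_⟩
    rcases hTe.toPreErgodic.ae_empty_or_univ hOm hinv with h5 | h5
    · exact Or.inl (ae_eq_empty.1 h5)
    · exact Or.inr (eventuallyEq_univ.1 h5)
  have hc : ∃ c : X, ∀ᵐ w ∂μ, ∃ p : ℤ, w = ipow T p c := by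
    obtain ⟨O, -, rfl, ha⟩ := horb a
    obtain ⟨O, -, rfl, hb⟩ := horb b
    rcases ha with ha | ha
    · rcases hb with hb | hb
      · have h6 : ∀ᵐ w ∂μ, False := by
          filter_upwards [hab, measure_eq_zero_iff_ae_notMem.1 ha,
            measure_eq_zero_iff_ae_notMem.1 hb] with w hw h7 h8
          exact hw.elim h7 h8
        exact absurd h6.exists (by simp)
      · exact ⟨b, hb⟩
    · exact ⟨a, ha⟩
  obtain ⟨c, hc⟩ := hc
  have hc1 : ∀ᵐ q ∂ρ, ∃ p : ℤ, q.1 = ipow T p c := by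
    rw [← h1] at hc
    exact ae_of_ae_map (p := fun w => ∃ p : ℤ, w = ipow T p c) (by fun_prop) hc
  have hc2 : ∀ᵐ q ∂ρ, ∃ p : ℤ, q.2 = ipow T p c := by
    rw [← h2] at hc
    exact ae_of_ae_map (p := fun w => ∃ p : ℤ, w = ipow T p c) (by fun_prop) hc
  obtain ⟨p, hp⟩ := exists_eq_offDiagonal hρ (IsProbabilityMeasure.ne_zero ρ) h1 (by
    filter_upwards [hc1, hc2] with q ⟨p1, hq1⟩ ⟨p2, hq2⟩
    exact ⟨p2 - p1, by rw [hq1, hq2, ← ipow_add, sub_add_cancel]⟩)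
  exact hoff p hp

end LowerOrder

end SelfJoining

/-! ### Assembly of the three statements. -/

theorem mainTheorem4 :
    -- multiple recurrence
    (∀ (X : Type u) [MeasurableSpace X] [StandardBorelSpace X]
        (μ : Measure X) [IsProbabilityMeasure μ] (T : X ≃ᵐ X), MeasurePreserving T μ μ →
        SelfJoining.IsMixing μ T → SelfJoining.MSJ 2 μ T →
        SelfJoining.IsMultiplyRecurrent μ T →
          SelfJoining.MSJ 3 μ T ∧ (∀ n : ℕ, SelfJoining.MSJ n μ T) ∧
            SelfJoining.IsMixingOfAllOrders μ T) ∧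
    -- mixing of multiplicity two
    (∀ (X : Type u) [MeasurableSpace X] [StandardBorelSpace X]
        (μ : Measure X) [IsProbabilityMeasure μ] (T : X ≃ᵐ X), MeasurePreserving T μ μ →
        SelfJoining.MSJ 2 μ T → SelfJoining.IsMixingOfMultiplicity 2 μ T →
          (∀ n : ℕ, SelfJoining.MSJ n μ T) ∧ SelfJoining.IsMixingOfAllOrders μ T) ∧
    -- `MSJ(2) = MSJ(3)` is equivalent to a positive answer to Rokhlin's problem in `MSJ(2)`
    List.TFAE [
      (∀ (X : Type u) [MeasurableSpace X] [StandardBorelSpace X]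
        (μ : Measure X) [IsProbabilityMeasure μ] (T : X ≃ᵐ X), MeasurePreserving T μ μ →
        (SelfJoining.MSJ 2 μ T ↔ SelfJoining.MSJ 3 μ T)),
      (∀ (X : Type u) [MeasurableSpace X] [StandardBorelSpace X]
        (μ : Measure X) [IsProbabilityMeasure μ] (T : X ≃ᵐ X), MeasurePreserving T μ μ →
        SelfJoining.MSJ 2 μ T → SelfJoining.IsMixing μ T →
          SelfJoining.IsMixingOfMultiplicity 2 μ T),
      (∀ (X : Type u) [MeasurableSpace X] [StandardBorelSpace X]
        (μ : Measure X) [IsProbabilityMeasure μ] (T : X ≃ᵐ X), MeasurePreserving T μ μ →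
        SelfJoining.MSJ 2 μ T → SelfJoining.IsMixing μ T →
          SelfJoining.IsMixingOfAllOrders μ T)] := by
  have part1 : ∀ (X : Type u) [MeasurableSpace X] [StandardBorelSpace X]
      (μ : Measure X) [IsProbabilityMeasure μ] (T : X ≃ᵐ X), MeasurePreserving T μ μ →
      SelfJoining.IsMixing μ T → SelfJoining.MSJ 2 μ T →
      SelfJoining.IsMultiplyRecurrent μ T →
        SelfJoining.MSJ 3 μ T ∧ (∀ n : ℕ, SelfJoining.MSJ n μ T) ∧
          SelfJoining.IsMixingOfAllOrders μ T := by
    intro X _ _ μ _ T hT hmix h2 hR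
    have : Nonempty X := μ.nonempty_of_neZero
    have hM := SelfJoining.msj_two_iff.1 h2
    have hP := hM.hasProductTriples hmix hR
    have hall := hP.msj hM hT hmix
    exact ⟨hall 3, hall, SelfJoining.isMixingOfAllOrders_of_msj hT hmix hall⟩
  have part2 : ∀ (X : Type u) [MeasurableSpace X] [StandardBorelSpace X]
      (μ : Measure X) [IsProbabilityMeasure μ] (T : X ≃ᵐ X), MeasurePreserving T μ μ →
      SelfJoining.MSJ 2 μ T → SelfJoining.IsMixingOfMultiplicity 2 μ T →
        (∀ n : ℕ, SelfJoining.MSJ n μ T) ∧ SelfJoining.IsMixingOfAllOrders μ T := by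
    intro X _ _ μ _ T hT h2 hmix
    exact (part1 X μ T hT hmix.isMixing h2 (hmix.isMultiplyRecurrent hT)).2
  refine ⟨part1, part2, ?_⟩
  tfae_have 1 → 3 := by
    intro h X _ _ μ _ T hT h2 hmix
    have hM := SelfJoining.msj_two_iff.1 h2
    have hP := ((h X μ T hT).1 h2).hasProductTriples
    exact SelfJoining.isMixingOfAllOrders_of_msj hT hmix (hP.msj hM hT hmix)
  tfae_have 3 → 2 := fun h X _ _ μ _ T hT h2 hmix => h X μ T hT h2 hmix 2
  tfae_have 2 → 1 := by
    intro h X _ _ μ _ T hT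
    refine ⟨fun h2 => ?_, fun h3 => SelfJoining.msj_two_iff.2 h3.hasMinimalPairs⟩
    -- The hypothesis speaks of mixing systems only; without mixing, triple joinings are products by
    -- the off-diagonal limit argument.
    by_cases hmix : SelfJoining.IsMixing μ T
    · exact (part2 X μ T hT h2 (h X μ T hT h2 hmix)).1 3
    · have hM := SelfJoining.msj_two_iff.1 h2
      exact (hM.hasProductTriples_of_not_isMixing hT hmix).msj_three hM
  tfae_finish
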